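/- Let $K_n\subset\mathbb{R}^2$ be the $n$-th prefractal Koch snowflake: the closed polygonal curve with $3\cdot4^n$ sides obtained from an equilateral triangle of side $1$ by $n$ times replacing each side with four segments of one third of its length, erecting an outward equilateral triangle on its middle third. Let $\Omega$ be the bounded open domain with $\partial\Omega=K_n$. Write $dx$ for Lebesgue measure on $\Omega$, $ds$ for arc length on $K_n$, and $dm=dx+ds$. Let $b$ be a positive continuous function on $\overline\Omega$. Let $\gamma_0u(x)=\lim_{r\to0}|B_r(x)\cap\Omega|^{-1}\int_{B_r(x)\cap\Omega}u\,dy$ be the trace on $K_n$. Let $H^1(K_n)$ be the space of continuous functions on $K_n$ that belong to $H^1$ on each side, with tangential derivative $\nabla_s$. Let $H^{1/2}(K_n)$ be the space of $v\in L^2(K_n)$ with $$\|v\|^2=\int_{K_n}|v|^2\,ds+\iint_{K_n\times K_n}\frac{|v(x)-v(y)|^2}{|x-y|^2}\,ds(x)\,ds(y)<\infty ,$$ and let $H^{-1/2}(K_n)$ be its dual, in which a function $h\in L^2(K_n)$ is identified with $v\mapsto\int_{K_n}hv\,ds$. Define $\theta_2:H^{1/2}(K_n)\to H^{-1/2}(K_n)$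 by $$\langle\theta_2(u),v\rangle=\iint_{K_n\times K_n}\frac{(u(x)-u(y))(v(x)-v(y))}{|x-y|^2}\,ds(x)\,ds(y).$$ Let $V(\Omega,K_n)=\{u\in H^1(\Omega):\gamma_0u\in H^1(K_n)\}$, regarded as a subspace of $L^2(\Omega,m)$ through $u\mapsto(u|_\Omega,\gamma_0u|_{K_n})$, and let $$E(u,v)=\int_\Omega\nabla u\cdot\nabla v\,dx+\int_{K_n}\nabla_su\,\nabla_sv\,ds+\int_{K_n}b\,u\,v\,ds+\langle\theta_2(u),v\rangle ,\qquad u,v\in V(\Omega,K_n).$$ Let $A$ be the operator on $L^2(\Omega,m)$ associated with $E$: $u\in D(A)$ if and only if $u\in V(\Omega,K_n)$ and there is an element $Au\in L^2(\Omega,m)$ such that $E(u,v)=(-Au,v)_{L^2(\Omega,m)}$ for all $v\in V(\Omega,K_n)$. For $u\in H^1(\Omega)$ with distributional Laplacian $\Delta u\in L^2(\Omega)$, the normal derivative $\frac{\partial u}{\partial\nu}\in H^{-1/2}(K_n)$ is defined by $$\Big\langle\frac{\partial u}{\partial\nu},\gamma_0w\Big\rangle=\int_\Omega\nabla u\cdot\nabla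 w\,dx+\int_\Omega\Delta u\,w\,dx\quad\text{for all }w\in H^1(\Omega).$$ For $z\in H^1(K_n)$, the functional $\Delta_{K_n}z$ on $H^1(K_n)$ is defined by $\langle\Delta_{K_n}z,w\rangle=-\int_{K_n}\nabla_sz\,\nabla_sw\,ds$; it is said to belong to $H^{-1/2}(K_n)$ if it extends to a continuous functional on $H^{1/2}(K_n)$. **Theorem.** Let $T>0$, $\alpha\in(0,1)$, $f\in C^{0,\alpha}([0,T];L^2(\Omega,m))$ and $u_0\in D(A)$. Let $u\in C^1([0,T];L^2(\Omega,m))\cap C^0([0,T];D(A))$ be the strict solution of $u'(t)=Au(t)+f(t)$ for $t\in[0,T]$, $u(0)=u_0$. Then for every $t\in[0,T]$: 1. the distributional Laplacian $\Delta u(t)$ belongs to $L^2(\Omega)$, and $\frac{du}{dt}(t,x)=\Delta u(t,x)+f(t,x)$ for a.e. $x\in\Omega$; 2. $\frac{\partial u(t)}{\partial\nu}$ and $\Delta_{K_n}u(t)$ belong to $H^{-1/2}(K_n)$, and $$\frac{du}{dt}=-\frac{\partial u}{\partial\nu}+\Delta_{K_n}u-bu-\theta_2(u)+f\qquad\text{in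 }H^{-1/2}(K_n).$$ Moreover $u(0,x)=u_0(x)$ for $m$-a.e. $x\in\overline\Omega$. -/

import Mathlib

open MeasureTheory Set Filter Topology
open scoped NNReal ENNReal ContDiff

noncomputable section

namespace KochVenttsel

/-- The Euclidean plane. -/
abbrev Plane : Type := EuclideanSpace ℝ (Fin 2)

/-! ### The prefractal Koch snowflake and its interior -/

/-- The apex of the equilateral triangle erected on the middle third of the oriented segment
`PQ`, on the right-hand side of `PQ`. -/
def apex (P Q : Plane) : Plane :=
  !₂[P 0 + (Q 0 - P 0) / 2 + Real.sqrt 3 / 6 * (Q 1 - P 1),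
     P 1 + (Q 1 - P 1) / 2 - Real.sqrt 3 / 6 * (Q 0 - P 0)]

/-- First third point of the segment `PQ`. -/
def third₁ (P Q : Plane) : Plane := AffineMap.lineMap P Q (1 / 3 : ℝ)

/-- Second third point of the segment `PQ`. -/
def third₂ (P Q : Plane) : Plane := AffineMap.lineMap P Q (2 / 3 : ℝ)

/-- The Koch generator: an oriented segment is replaced by four oriented segments of one third of
its length (its images under the four contractions of ratio `1/3` of the Koch curve on it). -/
def kochStep (e : Plane × Plane) : List (Plane × Plane) :=
  [(e.1, third₁ e.1 e.2), (third₁ e.1 e.2, apex e.1 e.2),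
   (apex e.1 e.2, third₂ e.1 e.2), (third₂ e.1 e.2, e.2)]

/-- The vertices of the initial triangle, which is equilateral of side one. -/
def A₁ : Plane := !₂[0, 0]
/-- Second vertex of the initial triangle. -/
def A₃ : Plane := !₂[1, 0]
/-- Third vertex of the initial triangle. -/
def A₅ : Plane := !₂[1 / 2, Real.sqrt 3 / 2]

/-- The `3 * 4 ^ n` sides of the `n`-th prefractal snowflake, oriented counterclockwise
(so that `apex` always points outwards). -/
def kochSides : ℕ → List (Plane × Plane)
  | 0 => [(A₁, A₃), (A₃, A₅), (A₅, A₁)]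
  | n + 1 => (kochSides n).flatMap kochStep

/-- The closed polygonal curve `K_n`. -/
def kochCurve (n : ℕ) : Set Plane := ⋃ e ∈ kochSides n, segment ℝ e.1 e.2

/-- The closed polygonal region bounded by `K_n`: at each step an equilateral triangle is added
on the middle third of every side. -/
def kochRegion : ℕ → Set Plane
  | 0 => convexHull ℝ {A₁, A₃, A₅}
  | n + 1 => kochRegion n ∪
      ⋃ e ∈ kochSides n, convexHull ℝ {third₁ e.1 e.2, apex e.1 e.2, third₂ e.1 e.2}

/-- The open polygonal domain `Ω_n` with boundary `K_n`. -/
def kochDomain (n : ℕ) : Set Plane := interior (kochRegion n)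

/-- Arc length measure of an oriented segment. -/
def sideMeasure (e : Plane × Plane) : Measure Plane :=
  ENNReal.ofReal (dist e.1 e.2) •
    (volume.restrict (Icc (0 : ℝ) 1)).map (fun τ : ℝ => AffineMap.lineMap e.1 e.2 τ)

/-- The arc length measure `ds` on `K_n`. -/
def arcLength (n : ℕ) : Measure Plane := ((kochSides n).map sideMeasure).sum

/-- The Lebesgue measure `dx` on `Ω_n`. -/
def bulk (n : ℕ) : Measure Plane := volume.restrict (kochDomain n)

/-- The measure `dm = dx + ds`. -/
def mMeasure (n : ℕ) : Measure Plane := bulk n + arcLength n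

instance sideMeasure_finite (e : Plane × Plane) : IsFiniteMeasure (sideMeasure e) := by
  unfold sideMeasure
  have : IsFiniteMeasure ((volume.restrict (Icc (0 : ℝ) 1)).map
      (fun τ : ℝ => (AffineMap.lineMap e.1 e.2 τ : Plane))) := inferInstance
  exact Measure.smul_finite _ ENNReal.ofReal_ne_top

instance arcLength_finite (n : ℕ) : IsFiniteMeasure (arcLength n) := by
  unfold arcLength
  induction kochSides n with
  | nil => simpa using (inferInstance : IsFiniteMeasure (0 : Measure Plane))
  | cons a l ih =>
    simp only [List.map_cons, List.sum_cons]
    infer_instance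

/-- The Hilbert space `L²(Ω, m)`. -/
abbrev L2m (n : ℕ) : Type := Lp ℝ 2 (mMeasure n)

/-! ### Weak derivatives in `Ω_n` -/

/-- Test functions: smooth and compactly supported in `Ω_n`. -/
def IsTest (n : ℕ) (φ : Plane → ℝ) : Prop :=
  ContDiff ℝ ∞ φ ∧ HasCompactSupport φ ∧ tsupport φ ⊆ kochDomain n

/-- `G` is the weak gradient of `u` in `Ω_n`. -/
def HasWeakGrad (n : ℕ) (u : Plane → ℝ) (G : Plane → Plane) : Prop :=
  ∀ φ, IsTest n φ → ∀ y : Plane,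
    ∫ x, u x * fderiv ℝ φ x y ∂bulk n = -∫ x, inner ℝ (G x) y * φ x ∂bulk n

/-- `L` is the distributional Laplacian of `u` in `Ω_n`. -/
def HasWeakLaplacian (n : ℕ) (u L : Plane → ℝ) : Prop :=
  ∀ φ, IsTest n φ → ∫ x, u x * Laplacian.laplacian φ x ∂bulk n = ∫ x, L x * φ x ∂bulk n

/-- The Sobolev space `H¹(Ω)`. -/
def MemH1 (n : ℕ) (u : Plane → ℝ) : Prop :=
  MemLp u 2 (bulk n) ∧ ∃ G : Plane → Plane, MemLp G 2 (bulk n) ∧ HasWeakGrad n u G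

open Classical in
/-- The weak gradient `∇u` (unique almost everywhere in `Ω_n` if `u ∈ H¹(Ω)`). -/
def weakGrad (n : ℕ) (u : Plane → ℝ) : Plane → Plane :=
  if h : ∃ G : Plane → Plane, MemLp G 2 (bulk n) ∧ HasWeakGrad n u G then h.choose else 0

/-- `g` is the trace of `u` on `K_n`: at `ds`-almost every point `x` of `K_n`, the averages of `u`
over `B_r(x) ∩ Ω` converge to `g x` as `r → 0`. -/
def HasTrace (n : ℕ) (u g : Plane → ℝ) : Prop :=
  ∀ᵐ x ∂arcLength n,
    Tendsto (fun r : ℝ => ⨍ y in Metric.ball x r ∩ kochDomain n, u y ∂volume) (𝓝[>] 0) (𝓝 (g x))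

/-! ### Sobolev spaces on `K_n` -/

/-- On every side of `K_n` the function `g` is the weak derivative of `u` with respect to arc
length. A side `e` is parametrized by `τ ∈ (0, 1)`, whence the factor `dist e.1 e.2`. -/
def HasTangentialDeriv (n : ℕ) (u g : Plane → ℝ) : Prop :=
  ∀ e ∈ kochSides n, ∀ φ : ℝ → ℝ, ContDiff ℝ ∞ φ → HasCompactSupport φ → tsupport φ ⊆ Ioo 0 1 →
    ∫ τ in Icc (0 : ℝ) 1, u (AffineMap.lineMap e.1 e.2 τ) * deriv φ τ =
      -(dist e.1 e.2 * ∫ τ in Icc (0 : ℝ) 1, g (AffineMap.lineMap e.1 e.2 τ) * φ τ)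

/-- The Sobolev space `H¹(K_n)`: (classes of) continuous functions on `K_n` which are in `H¹` on
every side. -/
def MemH1K (n : ℕ) (u : Plane → ℝ) : Prop :=
  (∃ w : Plane → ℝ, ContinuousOn w (kochCurve n) ∧ u =ᵐ[arcLength n] w) ∧
    ∃ g : Plane → ℝ, MemLp g 2 (arcLength n) ∧ HasTangentialDeriv n u g

open Classical in
/-- The tangential derivative `∇_s u` (unique `ds`-almost everywhere if `u ∈ H¹(K_n)`). -/
def tangentialDeriv (n : ℕ) (u : Plane → ℝ) : Plane → ℝ :=
  if h : ∃ g : Plane → ℝ, MemLp g 2 (arcLength n) ∧ HasTangentialDeriv n u g then h.choose else 0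

/-- The difference quotient of the Gagliardo seminorm of `H^{1/2}(K_n)`. -/
def diffQuot (u : Plane → ℝ) (p : Plane × Plane) : ℝ := (u p.1 - u p.2) / dist p.1 p.2

theorem diffQuot_congr {n : ℕ} {u v : Plane → ℝ} (h : u =ᵐ[arcLength n] v) :
    diffQuot u =ᵐ[(arcLength n).prod (arcLength n)] diffQuot v := by
  filter_upwards [Measure.quasiMeasurePreserving_fst.ae h,
    Measure.quasiMeasurePreserving_snd.ae h] with p h1 h2
  simp [diffQuot, h1, h2]

theorem diffQuot_add (u v : Plane → ℝ) : diffQuot (u + v) = diffQuot u + diffQuot v := by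
  ext p; simp only [diffQuot, Pi.add_apply]; ring

theorem diffQuot_smul (c : ℝ) (u : Plane → ℝ) : diffQuot (c • u) = c • diffQuot u := by
  ext p; simp only [diffQuot, Pi.smul_apply, smul_eq_mul]; ring

/-- `H^{1/2}(K_n)` as a subspace of `L²(K_n)`: finite Gagliardo seminorm. -/
def hHalfSubmodule (n : ℕ) : Submodule ℝ (Lp ℝ 2 (arcLength n)) where
  carrier := {g | MemLp (diffQuot g) 2 ((arcLength n).prod (arcLength n))}
  zero_mem' := by
    have h := diffQuot_congr (Lp.coeFn_zero ℝ 2 (arcLength n))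
    refine (memLp_congr_ae h).2 ?_
    have : diffQuot (0 : Plane → ℝ) = 0 := by ext p; simp [diffQuot]
    rw [this]; exact MemLp.zero
  add_mem' := by
    intro a b ha hb
    refine (memLp_congr_ae (diffQuot_congr (Lp.coeFn_add a b))).2 ?_
    rw [diffQuot_add]; exact MemLp.add ha hb
  smul_mem' := by
    intro c a ha
    refine (memLp_congr_ae (diffQuot_congr (Lp.coeFn_smul c a))).2 ?_
    rw [diffQuot_smul]; exact MemLp.const_smul ha c

theorem mem_hHalfSubmodule {n : ℕ} {g : Lp ℝ 2 (arcLength n)} :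
    g ∈ hHalfSubmodule n ↔ MemLp (diffQuot g) 2 ((arcLength n).prod (arcLength n)) := Iff.rfl

/-- The Sobolev space `H^{1/2}(K_n)`; its norm is given below. -/
def HHalf (n : ℕ) : Type := hHalfSubmodule n

instance (n : ℕ) : AddCommGroup (HHalf n) := inferInstanceAs (AddCommGroup (hHalfSubmodule n))
instance (n : ℕ) : Module ℝ (HHalf n) := inferInstanceAs (Module ℝ (hHalfSubmodule n))

/-- The identification of `H^{1/2}(K_n)` with a subspace of `L²(K_n)`. -/
def HHalf.toSub (n : ℕ) : HHalf n ≃ₗ[ℝ] hHalfSubmodule n := LinearEquiv.refl ℝ (hHalfSubmodule n)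

/-- An element of `H^{1/2}(K_n)` as a function, defined `ds`-almost everywhere. -/
instance (n : ℕ) : CoeFun (HHalf n) (fun _ => Plane → ℝ) :=
  ⟨fun g => ((HHalf.toSub n g : Lp ℝ 2 (arcLength n)) : Plane → ℝ)⟩

/-- The difference quotient as an element of `L²(K_n × K_n)`. -/
def quotSub (n : ℕ) : hHalfSubmodule n →ₗ[ℝ] Lp ℝ 2 ((arcLength n).prod (arcLength n)) where
  toFun g := MemLp.toLp (diffQuot g) (mem_hHalfSubmodule.1 g.2)
  map_add' a b := by
    rw [← MemLp.toLp_add, MemLp.toLp_eq_toLp_iff, ← diffQuot_add]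
    exact diffQuot_congr (Lp.coeFn_add a.1 b.1)
  map_smul' c a := by
    rw [RingHom.id_apply, ← MemLp.toLp_const_smul, MemLp.toLp_eq_toLp_iff, ← diffQuot_smul]
    exact diffQuot_congr (Lp.coeFn_smul c a.1)

/-- The difference quotient as a linear map on `H^{1/2}(K_n)`. -/
def HHalf.quot (n : ℕ) : HHalf n →ₗ[ℝ] Lp ℝ 2 ((arcLength n).prod (arcLength n)) :=
  quotSub n ∘ₗ (HHalf.toSub n).toLinearMap

theorem HHalf.coeFn_quot (n : ℕ) (g : HHalf n) :
    HHalf.quot n g =ᵐ[(arcLength n).prod (arcLength n)] diffQuot g :=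
  MemLp.coeFn_toLp (mem_hHalfSubmodule.1 (HHalf.toSub n g).2)

/-- `g ↦ (g, difference quotient of g)`. -/
def HHalf.embed (n : ℕ) : HHalf n →ₗ[ℝ]
    WithLp 2 (Lp ℝ 2 (arcLength n) × Lp ℝ 2 ((arcLength n).prod (arcLength n))) :=
  (WithLp.linearEquiv 2 ℝ _).symm.toLinearMap ∘ₗ
    (((hHalfSubmodule n).subtype ∘ₗ (HHalf.toSub n).toLinearMap).prod (HHalf.quot n))

theorem HHalf.embed_injective (n : ℕ) : Function.Injective (HHalf.embed n) := by
  intro a b h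
  have h1 : (HHalf.toSub n a : Lp ℝ 2 (arcLength n)) = HHalf.toSub n b :=
    congrArg (fun z => (WithLp.linearEquiv 2 ℝ _ z).1) h
  exact (HHalf.toSub n).injective (Subtype.ext h1)

/-- The norm of `H^{1/2}(K_n)`:
`‖g‖² = ∫ |g|² ds + ∬ |g(x) - g(y)|² / |x - y|² ds ds`. -/
instance (n : ℕ) : NormedAddCommGroup (HHalf n) :=
  NormedAddCommGroup.induced (HHalf n) _ (HHalf.embed n) (HHalf.embed_injective n)

instance (n : ℕ) : NormedSpace ℝ (HHalf n) := NormedSpace.induced ℝ (HHalf n) _ (HHalf.embed n)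

/-- `H^{-1/2}(K_n)`, the dual space of `H^{1/2}(K_n)`. -/
abbrev HNegHalf (n : ℕ) : Type := StrongDual ℝ (HHalf n)

/-- The form `∬ (u(x) - u(y)) (v(x) - v(y)) / |x - y|² ds(x) ds(y)`. -/
def nonlocalForm (n : ℕ) (u v : Plane → ℝ) : ℝ :=
  ∫ p : Plane × Plane, (u p.1 - u p.2) * (v p.1 - v p.2) / dist p.1 p.2 ^ 2
    ∂(arcLength n).prod (arcLength n)

theorem nonlocalForm_eq_inner (n : ℕ) (u v : HHalf n) :
    nonlocalForm n u v = inner ℝ (HHalf.quot n u) (HHalf.quot n v) := by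
  rw [L2.inner_def, nonlocalForm]
  refine integral_congr_ae ?_
  filter_upwards [HHalf.coeFn_quot n u, HHalf.coeFn_quot n v] with p hu hv
  simp only [hu, hv, diffQuot, RCLike.inner_apply, conj_trivial]
  ring

theorem HHalf.norm_sq (n : ℕ) (g : HHalf n) :
    ‖g‖ ^ 2 = ∫ x, g x ^ 2 ∂arcLength n + nonlocalForm n g g := by
  have h : ‖g‖ ^ 2 = ‖(HHalf.toSub n g : Lp ℝ 2 (arcLength n))‖ ^ 2 + ‖HHalf.quot n g‖ ^ 2 :=
    WithLp.prod_norm_sq_eq_of_L2 (HHalf.embed n g)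
  rw [h, nonlocalForm_eq_inner, real_inner_self_eq_norm_sq, ← real_inner_self_eq_norm_sq,
    L2.inner_def]
  simp [pow_two]

theorem HHalf.norm_quot_le (n : ℕ) (g : HHalf n) : ‖HHalf.quot n g‖ ≤ ‖g‖ := by
  have h : ‖g‖ ^ 2 = ‖(HHalf.toSub n g : Lp ℝ 2 (arcLength n))‖ ^ 2 + ‖HHalf.quot n g‖ ^ 2 :=
    WithLp.prod_norm_sq_eq_of_L2 (HHalf.embed n g)
  exact le_of_sq_le_sq (by nlinarith [sq_nonneg ‖(HHalf.toSub n g : Lp ℝ 2 (arcLength n))‖]) (norm_nonneg g)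

/-- The nonlocal operator `θ₂ : H^{1/2}(K_n) → H^{-1/2}(K_n)`,
`⟨θ₂ u, v⟩ = ∬ (u(x) - u(y)) (v(x) - v(y)) / |x - y|² ds(x) ds(y)`. -/
def theta₂ (n : ℕ) : HHalf n →L[ℝ] HNegHalf n :=
  LinearMap.mkContinuous₂
    (LinearMap.mk₂ ℝ (fun u v : HHalf n => nonlocalForm n u v)
      (fun u u' v => by
        rw [nonlocalForm_eq_inner, nonlocalForm_eq_inner, nonlocalForm_eq_inner, map_add,
          inner_add_left])
      (fun c u v => by
        rw [nonlocalForm_eq_inner, nonlocalForm_eq_inner, map_smul, real_inner_smul_left,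
          smul_eq_mul])
      (fun u v v' => by
        rw [nonlocalForm_eq_inner, nonlocalForm_eq_inner, nonlocalForm_eq_inner, map_add,
          inner_add_right])
      (fun c u v => by
        rw [nonlocalForm_eq_inner, nonlocalForm_eq_inner, map_smul, real_inner_smul_right,
          smul_eq_mul]))
    1 (fun u v => by
      simp only [LinearMap.mk₂_apply, nonlocalForm_eq_inner, one_mul]
      exact (norm_inner_le_norm _ _).trans (mul_le_mul (HHalf.norm_quot_le n u)
        (HHalf.norm_quot_le n v) (norm_nonneg _) (norm_nonneg _)))

theorem theta₂_apply (n : ℕ) (u v : HHalf n) : theta₂ n u v = nonlocalForm n u v := rfl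

/-! ### The energy form and its operator -/

/-- The space `V(Ω, K_n)` of the `u ∈ H¹(Ω)` with trace in `H¹(K_n)`, as a subspace of `L²(Ω, m)`:
the restriction of an element to `K_n` is the trace of its restriction to `Ω`. -/
def MemV (n : ℕ) (u : Plane → ℝ) : Prop := MemH1 n u ∧ HasTrace n u u ∧ MemH1K n u

/-- The bilinear energy form `E(u, v)`. -/
def energy (n : ℕ) (b u v : Plane → ℝ) : ℝ :=
  ∫ x, inner ℝ (weakGrad n u x) (weakGrad n v x) ∂bulk n
    + ∫ x, tangentialDeriv n u x * tangentialDeriv n v x ∂arcLength n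
    + ∫ x, b x * u x * v x ∂arcLength n
    + nonlocalForm n u v

/-- `u ∈ D(A)`, where `A` is the operator on `L²(Ω, m)` associated with the form `E`. -/
def MemDomA (n : ℕ) (b : Plane → ℝ) (u : L2m n) : Prop :=
  MemV n u ∧ ∃ w : L2m n, ∀ v : L2m n, MemV n v → energy n b u v = inner ℝ (-w) v

open Classical in
/-- The operator `A` on `D(A)`: `E(u, v) = (-A u, v)` for all `v ∈ V(Ω, K_n)`.
(As `V(Ω, K_n)` is dense in `L²(Ω, m)`, this determines `A u`.) -/
def opA (n : ℕ) (b : Plane → ℝ) (u : L2m n) : L2m n :=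
  if h : ∃ w : L2m n, ∀ v : L2m n, MemV n v → energy n b u v = inner ℝ (-w) v
    then h.choose else 0

/-- `u` is a strict solution of `u' = A u + f` on `[0, T]`, `u(0) = u₀`:
`u ∈ C¹([0, T]; L²(Ω, m)) ∩ C⁰([0, T]; D(A))`, with the graph norm on `D(A)`. -/
structure IsStrictSolution (n : ℕ) (b : Plane → ℝ) (T : ℝ) (f : ℝ → L2m n) (u₀ : L2m n)
    (u : ℝ → L2m n) : Prop where
  contDiffOn : ContDiffOn ℝ 1 u (Icc 0 T)
  mem_domA : ∀ t ∈ Icc 0 T, MemDomA n b (u t)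
  continuousOn_opA : ContinuousOn (fun t => opA n b (u t)) (Icc 0 T)
  equation : ∀ t ∈ Icc 0 T, derivWithin u (Icc 0 T) t = opA n b (u t) + f t
  initial : u 0 = u₀

/-! ### Normal derivative and Laplacian on `K_n` -/

/-- For `u ∈ H¹(Ω)` with distributional Laplacian `L ∈ L²(Ω)`, the functional `N` is the outward
normal derivative `∂u/∂ν ∈ H^{-1/2}(K_n)`, in the sense of the Green formula
`⟨∂u/∂ν, w⟩ = ∫ ∇u · ∇w dx + ∫ Δu w dx` for all `w ∈ H¹(Ω)`. -/
def IsNormalDeriv (n : ℕ) (u : Plane → ℝ) (N : HNegHalf n) : Prop :=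
  MemH1 n u ∧ ∃ L : Plane → ℝ, MemLp L 2 (bulk n) ∧ HasWeakLaplacian n u L ∧
    ∀ (w : Plane → ℝ) (g : HHalf n), MemH1 n w → HasTrace n w g →
      N g = ∫ x, inner ℝ (weakGrad n u x) (weakGrad n w x) ∂bulk n + ∫ x, L x * w x ∂bulk n

/-- For `z ∈ H¹(K_n)`, the functional `Δ_{K_n} z ∈ H^{-1}(K_n)`, that is
`w ↦ -∫ ∇_s z ∇_s w ds` on `H¹(K_n)`, belongs to `H^{-1/2}(K_n)`, its (unique) continuous extension
to `H^{1/2}(K_n)` being `D`. -/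
def IsCurveLaplacian (n : ℕ) (z : Plane → ℝ) (D : HNegHalf n) : Prop :=
  MemH1K n z ∧ ∀ w : HHalf n, MemH1K n w →
    D w = -∫ x, tangentialDeriv n z x * tangentialDeriv n w x ∂arcLength n

end KochVenttsel

end

open MeasureTheory Set Filter Topology
open scoped NNReal ENNReal ContDiff

noncomputable section

namespace KochVenttsel

/-! ### Geometry of the prefractal snowflake -/

/-! Time plays no role: at a fixed `t` the evolution equation says that `U = u(t)` lies in the
domain of the operator with `A U = u' - f`, so the theorem reduces to the stationary statement
`exists_normalDeriv_curveLaplacian` for `a = A U`. That statement comes from inserting test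
functions in `E(U, v) = -(a, v)`. Functions supported in the open domain kill every term on the
curve and give `ΔU = a` (`hasWeakDiv_of_energy`, `hasWeakLaplacian_of_hasWeakDiv`). Once `∂U/∂ν` is
known to be a bounded functional on `H^{1/2}(K_n)`, the functional `a + ∂U/∂ν + bU + θ₂U` is also
bounded. Testing the form with an extension of `w ∈ H¹(K_n)` shows that it acts on `w` as
`Δ_{K_n}U`, and this is the boundary condition. That `U` itself has a trace in `H^{1/2}(K_n)` is the
embedding `memLp_diffQuot_of_memH1K`.

The normal derivative (`exists_normalTrace`) needs two facts. The first is a bounded right inverse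
of the trace. `ext` averages a boundary function with weights proportional to `|x - y|^{-4}`; these
concentrate at the scale of the distance to the curve, and the decay is fast enough for the
Gagliardo seminorm to control the gradient (`lintegral_fderiv_ext_sq_le`) and for the trace to be
recovered (`hasTrace_ext`). The second is that `∫ ∇U·∇w + ∫ a w` depends only on the trace of `w`,
that is, it vanishes when the trace does (`integral_inner_add_eq_zero_of_trace`).

The second fact is the hard one, because the trace is only a limit of averages over balls at almost
every boundary point. The main step is that extension by zero preserves `H¹`: the `defect` in the
integration by parts formula vanishes against all smooth functions of the plane. Vertices are
removable since points have zero capacity, so it suffices to work near one side. In the tangential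
direction a cut-off depending only on the normal coordinate does no harm. In the normal direction,
let `z` be the position relative to a point `p` of the line through the side. The field `z / (2(s² +
|z|²))` has zero normal component on that line, and its divergence is an approximate delta at `p`.
Zero trace makes the delta term vanish as `s → 0` for almost every `p`. Integrating the resulting
identity over `p` turns the kernel `z / |z|²` into `-π` times the normal direction, which is the
claim (`defect_sideNormal_eq_zero`).

For the zero extension `W`, translations satisfy `‖W(· + h) - W‖ ≤ |h| ‖∇W‖`. A strip of width `δ`
along the curve leaves the domain under translations of length `O(δ)`, so `w` has `L²` norm `O(δ)`
on it. This cancels the `1/δ` in the gradient of a cut-off vanishing near the curve, and the Green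
formula passes to the limit.

All geometry is local to rhombi. Around each side there is an open rhombus with angles `60°` at the
endpoints. The rhombi are nested along the construction, those of different sides of one generation
are disjoint, and in each of them the region is exactly the inner half (`mem_kochRegion_iff`). In
coordinates adapted to a side these are finite checks of linear inequalities. -/

/-- The squared length of a side. -/
def sqLen (e : Plane × Plane) : ℝ := (e.2 0 - e.1 0) ^ 2 + (e.2 1 - e.1 1) ^ 2

/-- Tangential coordinate with respect to a side, equal to `0` and `1` at its endpoints. -/
def tanCoord (e : Plane × Plane) (x : Plane) : ℝ :=
  ((x 0 - e.1 0) * (e.2 0 - e.1 0) + (x 1 - e.1 1) * (e.2 1 - e.1 1)) / sqLen e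

/-- Normal coordinate with respect to a side, positive on its outer (right-hand) side. It is scaled
so that lines of slope `30°` are `|norCoord| = tanCoord`. -/
def norCoord (e : Plane × Plane) (x : Plane) : ℝ :=
  Real.sqrt 3 * ((x 0 - e.1 0) * (e.2 1 - e.1 1) - (x 1 - e.1 1) * (e.2 0 - e.1 0)) / sqLen e

/-- The open rhombus with diagonal `e` and angles `60°` at the endpoints of `e`. -/
def rhombus (e : Plane × Plane) : Set Plane :=
  {x | |norCoord e x| < tanCoord e x ∧ |norCoord e x| < 1 - tanCoord e x}

/-- The closed triangle erected on the middle third of `e`. -/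
def midTriangle (e : Plane × Plane) : Set Plane :=
  convexHull ℝ {third₁ e.1 e.2, apex e.1 e.2, third₂ e.1 e.2}

theorem sqLen_pos {e : Plane × Plane} (he : e.1 ≠ e.2) : 0 < sqLen e := by
  unfold sqLen
  by_contra h
  apply he
  have h0 : e.2 0 - e.1 0 = 0 := by nlinarith [sq_nonneg (e.2 0 - e.1 0), sq_nonneg (e.2 1 - e.1 1)]
  have h1 : e.2 1 - e.1 1 = 0 := by nlinarith [sq_nonneg (e.2 0 - e.1 0), sq_nonneg (e.2 1 - e.1 1)]
  ext i
  fin_cases i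
  · simp; linarith
  · simp; linarith

theorem sqLen_eq (e : Plane × Plane) : sqLen e = dist e.1 e.2 ^ 2 := by
  rw [EuclideanSpace.dist_eq, Real.sq_sqrt (by positivity)]
  simp [sqLen, Fin.sum_univ_two, Real.dist_eq]
  ring

theorem lineMap_zero_coord (P Q : Plane) (a : ℝ) :
    (AffineMap.lineMap P Q a : Plane) 0 = P 0 + a * (Q 0 - P 0) := by
  simp [AffineMap.lineMap_apply]; ring

theorem lineMap_one_coord (P Q : Plane) (a : ℝ) :
    (AffineMap.lineMap P Q a : Plane) 1 = P 1 + a * (Q 1 - P 1) := by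
  simp [AffineMap.lineMap_apply]; ring

theorem continuous_tanCoord (e : Plane × Plane) : Continuous (tanCoord e) := by
  unfold tanCoord; fun_prop

theorem continuous_norCoord (e : Plane × Plane) : Continuous (norCoord e) := by
  unfold norCoord; fun_prop

theorem isOpen_rhombus (e : Plane × Plane) : IsOpen (rhombus e) :=
  (isOpen_lt (continuous_norCoord e).abs (continuous_tanCoord e)).inter
    (isOpen_lt (continuous_norCoord e).abs (continuous_const.sub (continuous_tanCoord e)))

theorem tanCoord_lineMap (e : Plane × Plane) (x y : Plane) (a : ℝ) :
    tanCoord e (AffineMap.lineMap x y a) = (1 - a) * tanCoord e x + a * tanCoord e y := by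
  simp only [tanCoord, lineMap_zero_coord, lineMap_one_coord]; ring

theorem norCoord_lineMap (e : Plane × Plane) (x y : Plane) (a : ℝ) :
    norCoord e (AffineMap.lineMap x y a) = (1 - a) * norCoord e x + a * norCoord e y := by
  simp only [norCoord, lineMap_zero_coord, lineMap_one_coord]; ring

@[simp] theorem tanCoord_fst (e : Plane × Plane) : tanCoord e e.1 = 0 := by simp [tanCoord]

theorem tanCoord_snd {e : Plane × Plane} (he : e.1 ≠ e.2) : tanCoord e e.2 = 1 := by
  have := sqLen_pos he
  unfold tanCoord
  rw [div_eq_one_iff_eq this.ne']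
  unfold sqLen; ring

@[simp] theorem norCoord_fst (e : Plane × Plane) : norCoord e e.1 = 0 := by simp [norCoord]

@[simp] theorem norCoord_snd (e : Plane × Plane) : norCoord e e.2 = 0 := by
  unfold norCoord; ring

theorem tanCoord_side {e : Plane × Plane} (he : e.1 ≠ e.2) (a : ℝ) :
    tanCoord e (AffineMap.lineMap e.1 e.2 a) = a := by
  rw [tanCoord_lineMap, tanCoord_fst, tanCoord_snd he]; ring

@[simp] theorem norCoord_side (e : Plane × Plane) (a : ℝ) :
    norCoord e (AffineMap.lineMap e.1 e.2 a) = 0 := by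
  rw [norCoord_lineMap, norCoord_fst, norCoord_snd]; ring

/-- Recovering a point from its coordinates. -/
theorem coord_zero {e : Plane × Plane} (he : e.1 ≠ e.2) (x : Plane) :
    x 0 = e.1 0 + tanCoord e x * (e.2 0 - e.1 0)
      + norCoord e x / Real.sqrt 3 * (e.2 1 - e.1 1) := by
  have h := sqLen_pos he
  have h3 : Real.sqrt 3 ≠ 0 := by positivity
  unfold tanCoord norCoord
  field_simp
  unfold sqLen; ring

theorem coord_one {e : Plane × Plane} (he : e.1 ≠ e.2) (x : Plane) :
    x 1 = e.1 1 + tanCoord e x * (e.2 1 - e.1 1)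
      - norCoord e x / Real.sqrt 3 * (e.2 0 - e.1 0) := by
  have h := sqLen_pos he
  have h3 : Real.sqrt 3 ≠ 0 := by positivity
  unfold tanCoord norCoord
  field_simp
  unfold sqLen; ring

theorem eq_of_coord_eq {e : Plane × Plane} (he : e.1 ≠ e.2) {x y : Plane}
    (h1 : tanCoord e x = tanCoord e y) (h2 : norCoord e x = norCoord e y) : x = y := by
  ext i
  fin_cases i
  · change x 0 = y 0
    rw [coord_zero he x, coord_zero he y, h1, h2]
  · change x 1 = y 1
    rw [coord_one he x, coord_one he y, h1, h2]

theorem eq_lineMap_of_norCoord_eq_zero {e : Plane × Plane} (he : e.1 ≠ e.2) {x : Plane}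
    (h : norCoord e x = 0) : x = AffineMap.lineMap e.1 e.2 (tanCoord e x) :=
  eq_of_coord_eq he (tanCoord_side he _).symm (by rw [h, norCoord_side])

theorem mem_segment_iff_coord {e : Plane × Plane} (he : e.1 ≠ e.2) (x : Plane) :
    x ∈ segment ℝ e.1 e.2 ↔ norCoord e x = 0 ∧ 0 ≤ tanCoord e x ∧ tanCoord e x ≤ 1 := by
  rw [segment_eq_image_lineMap]
  constructor
  · rintro ⟨a, ha, rfl⟩
    rw [norCoord_side, tanCoord_side he]
    exact ⟨rfl, ha⟩
  · rintro ⟨h1, h2⟩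
    exact ⟨tanCoord e x, h2, (eq_lineMap_of_norCoord_eq_zero he h1).symm⟩

/-- Coordinates with respect to a side of one third of the length. -/
theorem coord_subside {e c : Plane × Plane} (he : e.1 ≠ e.2) {p q a b : ℝ}
    (hab : a ^ 2 + b ^ 2 = 1 / 9)
    (h10 : c.1 0 = e.1 0 + p * (e.2 0 - e.1 0) + q * (e.2 1 - e.1 1))
    (h11 : c.1 1 = e.1 1 + p * (e.2 1 - e.1 1) - q * (e.2 0 - e.1 0))
    (h20 : c.2 0 = c.1 0 + a * (e.2 0 - e.1 0) + b * (e.2 1 - e.1 1))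
    (h21 : c.2 1 = c.1 1 + a * (e.2 1 - e.1 1) - b * (e.2 0 - e.1 0)) :
    sqLen c = sqLen e / 9 ∧ (∀ x, tanCoord c x
        = 9 * ((tanCoord e x - p) * a + (norCoord e x / Real.sqrt 3 - q) * b)) ∧
      ∀ x, norCoord c x
        = 9 * (-((tanCoord e x - p) * b) * Real.sqrt 3 + (norCoord e x - q * Real.sqrt 3) * a) := by
  have h := sqLen_pos he
  have h3 : Real.sqrt 3 ≠ 0 := by positivity
  have h33 : Real.sqrt 3 ^ 2 = 3 := Real.sq_sqrt (by norm_num)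
  have hl : sqLen c = sqLen e / 9 := by
    unfold sqLen
    rw [h20, h21]
    linear_combination ((e.2 0 - e.1 0) ^ 2 + (e.2 1 - e.1 1) ^ 2) * hab
  have hl' : sqLen e = (e.2 0 - e.1 0) ^ 2 + (e.2 1 - e.1 1) ^ 2 := rfl
  refine ⟨hl, fun x => ?_, fun x => ?_⟩
  · have e1 : tanCoord c x = ((x 0 - c.1 0) * (c.2 0 - c.1 0)
        + (x 1 - c.1 1) * (c.2 1 - c.1 1)) / (sqLen e / 9) := by rw [← hl]; rfl
    rw [e1, h20, h21, h10, h11]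
    unfold tanCoord norCoord
    field_simp
    rw [hl']; ring
  · have e1 : norCoord c x = Real.sqrt 3 * ((x 0 - c.1 0) * (c.2 1 - c.1 1)
        - (x 1 - c.1 1) * (c.2 0 - c.1 0)) / (sqLen e / 9) := by rw [← hl]; rfl
    rw [e1, h20, h21, h10, h11]
    unfold tanCoord norCoord
    field_simp
    rw [hl']; ring

/-- The four sides replacing `e`. -/
theorem mem_kochStep {e c : Plane × Plane} (he : e.1 ≠ e.2) (hc : c ∈ kochStep e) :
    sqLen c = sqLen e / 9 ∧
    ((∀ x, tanCoord c x = 3 * tanCoord e x ∧ norCoord c x = 3 * norCoord e x) ∨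
    (∀ x, tanCoord c x = 3 / 2 * (tanCoord e x + norCoord e x) - 1 / 2 ∧
      norCoord c x = 3 / 2 * (norCoord e x - 3 * tanCoord e x + 1)) ∨
    (∀ x, tanCoord c x = 3 / 2 * (tanCoord e x - norCoord e x) ∧
      norCoord c x = 3 / 2 * (3 * tanCoord e x + norCoord e x - 2)) ∨
    (∀ x, tanCoord c x = 3 * tanCoord e x - 2 ∧ norCoord c x = 3 * norCoord e x)) := by
  have h3 : Real.sqrt 3 ≠ 0 := by positivity
  have h33 : Real.sqrt 3 ^ 2 = 3 := Real.sq_sqrt (by norm_num)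
  simp only [kochStep, List.mem_cons, List.not_mem_nil, or_false] at hc
  rcases hc with rfl | rfl | rfl | rfl
  · obtain ⟨h1, h2, h4⟩ := coord_subside (c := (e.1, third₁ e.1 e.2)) he
      (p := 0) (q := 0) (a := 1 / 3) (b := 0) (by norm_num)
      (by ring) (by ring) (by simp only [third₁, lineMap_zero_coord]; ring)
      (by simp only [third₁, lineMap_one_coord]; ring)
    refine ⟨h1, Or.inl fun x => ⟨?_, ?_⟩⟩
    · rw [h2]; ring
    · rw [h4]; ring
  · obtain ⟨h1, h2, h4⟩ := coord_subside (c := (third₁ e.1 e.2, apex e.1 e.2)) he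
      (p := 1 / 3) (q := 0) (a := 1 / 6) (b := Real.sqrt 3 / 6) (by linear_combination (1 / 36 : ℝ) * h33)
      (by simp only [third₁, lineMap_zero_coord]; ring)
      (by simp only [third₁, lineMap_one_coord]; ring)
      (by simp only [third₁, lineMap_zero_coord, apex]; simp; ring)
      (by simp only [third₁, lineMap_one_coord, apex]; simp; ring)
    refine ⟨h1, Or.inr (Or.inl fun x => ⟨?_, ?_⟩)⟩
    · rw [h2]; field_simp; ring
    · rw [h4]; linear_combination (-(3 / 2) * (tanCoord e x - 1 / 3)) * h33
  · obtain ⟨h1, h2, h4⟩ := coord_subside (c := (apex e.1 e.2, third₂ e.1 e.2)) he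
      (p := 1 / 2) (q := Real.sqrt 3 / 6) (a := 1 / 6) (b := -(Real.sqrt 3 / 6))
      (by linear_combination (1 / 36 : ℝ) * h33)
      (by simp only [apex]; simp; ring)
      (by simp only [apex]; simp; ring)
      (by simp only [third₂, lineMap_zero_coord, apex]; simp; ring)
      (by simp only [third₂, lineMap_one_coord, apex]; simp; ring)
    refine ⟨h1, Or.inr (Or.inr (Or.inl fun x => ⟨?_, ?_⟩))⟩
    · rw [h2]; field_simp; linear_combination (18 : ℝ) * h33
    · rw [h4]; linear_combination (3 / 2 * (tanCoord e x - 1 / 2) - 1 / 4) * h33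
  · obtain ⟨h1, h2, h4⟩ := coord_subside (c := (third₂ e.1 e.2, e.2)) he
      (p := 2 / 3) (q := 0) (a := 1 / 3) (b := 0) (by norm_num)
      (by simp only [third₂, lineMap_zero_coord]; ring)
      (by simp only [third₂, lineMap_one_coord]; ring)
      (by simp only [third₂, lineMap_zero_coord]; ring)
      (by simp only [third₂, lineMap_one_coord]; ring)
    refine ⟨h1, Or.inr (Or.inr (Or.inr fun x => ⟨?_, ?_⟩))⟩
    · rw [h2]; ring
    · rw [h4]; ring

theorem ne_of_mem_kochStep {e c : Plane × Plane} (he : e.1 ≠ e.2) (hc : c ∈ kochStep e) :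
    c.1 ≠ c.2 := by
  intro h
  have h1 := (mem_kochStep he hc).1
  have h2 := sqLen_pos he
  have : sqLen c = 0 := by simp [sqLen, h]
  linarith

/-- In the affine coordinates of `e` both rhombi are cut out by linear inequalities, so the
inclusion is a check over the four children. This nesting allows every induction on `n` to be
localised to one parent side. -/
theorem rhombus_subset_of_mem_kochStep {e c : Plane × Plane} (he : e.1 ≠ e.2)
    (hc : c ∈ kochStep e) : rhombus c ⊆ rhombus e := by
  rintro x ⟨h1, h2⟩
  simp only [rhombus, mem_ofPred_eq, abs_lt] at h1 h2 ⊢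
  rcases (mem_kochStep he hc).2 with h | h | h | h <;>
  · obtain ⟨ha, hb⟩ := h x
    rw [ha, hb] at h1 h2
    refine ⟨⟨?_, ?_⟩, ?_, ?_⟩ <;> linarith [h1.1, h1.2, h2.1, h2.2]

/-- The three inequalities are the half-planes of the base and of the two slanted edges. -/
theorem mem_midTriangle {e : Plane × Plane} (he : e.1 ≠ e.2) (x : Plane) :
    x ∈ midTriangle e ↔ 0 ≤ norCoord e x ∧ norCoord e x - 3 * tanCoord e x + 1 ≤ 0 ∧
      3 * tanCoord e x + norCoord e x - 2 ≤ 0 := by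
  have h := sqLen_pos he
  have h3 : Real.sqrt 3 ≠ 0 := by positivity
  have h33 : Real.sqrt 3 ^ 2 = 3 := Real.sq_sqrt (by norm_num)
  have ha1 : tanCoord e (apex e.1 e.2) = 1 / 2 := by
    unfold tanCoord; rw [div_eq_iff h.ne']; simp [apex, sqLen]; ring
  have ha2 : norCoord e (apex e.1 e.2) = 1 / 2 := by
    unfold norCoord; rw [div_eq_iff h.ne']; simp [apex, sqLen]
    linear_combination (1 / 6 * ((e.2 0 - e.1 0) ^ 2 + (e.2 1 - e.1 1) ^ 2)) * h33
  have hb1 : tanCoord e (third₁ e.1 e.2) = 1 / 3 := tanCoord_side he _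
  have hb2 : norCoord e (third₁ e.1 e.2) = 0 := norCoord_side e _
  have hc1 : tanCoord e (third₂ e.1 e.2) = 2 / 3 := tanCoord_side he _
  have hc2 : norCoord e (third₂ e.1 e.2) = 0 := norCoord_side e _
  constructor
  · intro hx
    have hconv : Convex ℝ {x | 0 ≤ norCoord e x ∧ norCoord e x - 3 * tanCoord e x + 1 ≤ 0 ∧
        3 * tanCoord e x + norCoord e x - 2 ≤ 0} := by
      rw [convex_iff_segment_subset]
      intro y hy z hz w hw
      rw [segment_eq_image_lineMap] at hw
      obtain ⟨a, ⟨ha0, ha1⟩, rfl⟩ := hw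
      simp only [mem_ofPred_eq, norCoord_lineMap, tanCoord_lineMap] at hy hz ⊢
      refine ⟨?_, ?_, ?_⟩
      · nlinarith
      · nlinarith
      · nlinarith
    refine convexHull_min ?_ hconv hx
    rintro y (rfl | rfl | rfl)
    · simp only [mem_ofPred_eq, hb1, hb2]; norm_num
    · simp only [mem_ofPred_eq, ha1, ha2]; norm_num
    · simp only [mem_ofPred_eq, hc1, hc2]; norm_num
  · rintro ⟨h1, h2, h4⟩
    -- Barycentric coordinates: each weight is the slack in the inequality of the opposite edge
    -- (twice the slack for the apex).
    have hx : x = (3 * (2 / 3 - tanCoord e x - norCoord e x / 3)) • third₁ e.1 e.2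
        + ((2 * norCoord e x) • apex e.1 e.2
        + (3 * (tanCoord e x - 1 / 3 - norCoord e x / 3)) • third₂ e.1 e.2) := by
      have h30 : norCoord e x / Real.sqrt 3 = norCoord e x * Real.sqrt 3 / 3 := by
        field_simp; rw [h33]
      ext i
      fin_cases i
      · change x 0 = _
        rw [coord_zero he x, h30]
        simp [third₁, third₂, apex, AffineMap.lineMap_apply]
        ring
      · change x 1 = _
        rw [coord_one he x, h30]
        simp [third₁, third₂, apex, AffineMap.lineMap_apply]
        ring
    have hT : Convex ℝ (midTriangle e) := convex_convexHull _ _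
    have m1 : third₁ e.1 e.2 ∈ midTriangle e := subset_convexHull _ _ (by simp)
    have m2 : apex e.1 e.2 ∈ midTriangle e := subset_convexHull _ _ (by simp)
    have m3 : third₂ e.1 e.2 ∈ midTriangle e := subset_convexHull _ _ (by simp)
    rw [hx]
    have := hT.sum_mem (t := Finset.univ) (w := ![3 * (2 / 3 - tanCoord e x - norCoord e x / 3),
      2 * norCoord e x, 3 * (tanCoord e x - 1 / 3 - norCoord e x / 3)])
      (z := ![third₁ e.1 e.2, apex e.1 e.2, third₂ e.1 e.2]) ?_ ?_ ?_
    · simpa [Fin.sum_univ_three, add_assoc] using this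
    · intro i _
      fin_cases i
      · simp; linarith
      · simp; linarith
      · simp; linarith
    · simp [Fin.sum_univ_three]; ring
    · intro i _
      fin_cases i <;> simp [m1, m2, m3]


/-- The apex lies on the boundary of the rhombus, so only the closure can contain the triangle.
Moving any point of it slightly towards the midpoint of `e` enters the open rhombus. -/
theorem midTriangle_subset_closure_rhombus {e : Plane × Plane} (he : e.1 ≠ e.2) :
    midTriangle e ⊆ closure (rhombus e) := by
  intro x hx
  obtain ⟨h1, h2, h3⟩ := (mem_midTriangle he x).1 hx
  have hlim : Tendsto (fun a : ℝ => (AffineMap.lineMap x (AffineMap.lineMap e.1 e.2 (1 / 2 : ℝ)) a : Plane))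
      (𝓝[>] 0) (𝓝 x) := by
    have : Continuous
      (fun a : ℝ => (AffineMap.lineMap x (AffineMap.lineMap e.1 e.2 (1 / 2 : ℝ)) a : Plane)) :=
      AffineMap.lineMap_continuous
    simpa using (this.tendsto 0).mono_left nhdsWithin_le_nhds
  refine mem_closure_of_tendsto hlim ?_
  filter_upwards [Ioo_mem_nhdsGT (show (0 : ℝ) < 1 by norm_num)] with a ha
  have e1 := tanCoord_lineMap e x (AffineMap.lineMap e.1 e.2 (1 / 2 : ℝ)) a
  have e2 := norCoord_lineMap e x (AffineMap.lineMap e.1 e.2 (1 / 2 : ℝ)) a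
  rw [tanCoord_side he] at e1
  rw [norCoord_side] at e2
  simp only [rhombus, mem_ofPred_eq, abs_lt]
  rw [e1, e2]
  obtain ⟨ha0, ha1⟩ := ha
  refine ⟨⟨?_, ?_⟩, ?_, ?_⟩ <;> nlinarith

/-- The rhombi attached to different new sides of `e` are disjoint. -/
theorem disjoint_rhombus_of_mem_kochStep {e c c' : Plane × Plane} (he : e.1 ≠ e.2)
    (hc : c ∈ kochStep e) (hc' : c' ∈ kochStep e) (hne : c ≠ c') :
    Disjoint (rhombus c) (rhombus c') := by
  -- Disposes of the diagonal cases below, where the case distinction only yields equal coordinate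
  -- functions. A side is recovered from them as the points with coordinates `(0, 0)` and `(1, 0)`.
  have key : ∀ x y : Plane × Plane, x ∈ kochStep e → y ∈ kochStep e →
      (∀ z, tanCoord x z = tanCoord y z ∧ norCoord x z = norCoord y z) → x = y := by
    intro x y hx hy h
    have hx0 := ne_of_mem_kochStep he hx
    have hy0 := ne_of_mem_kochStep he hy
    refine Prod.ext ?_ ?_
    · refine eq_of_coord_eq hx0 ?_ ?_
      · rw [(h y.1).1]; simp
      · rw [(h y.1).2]; simp
    · refine eq_of_coord_eq hx0 ?_ ?_
      · rw [(h y.2).1, tanCoord_snd hx0, tanCoord_snd hy0]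
      · rw [(h y.2).2]; simp
  rw [Set.disjoint_left]
  rintro x ⟨h1, h2⟩ ⟨h3, h4⟩
  rw [abs_lt] at h1 h2 h3 h4
  rcases (mem_kochStep he hc).2 with h | h | h | h <;>
  rcases (mem_kochStep he hc').2 with h' | h' | h' | h' <;>
  first
  | exact hne (key c c' hc hc' fun z => ⟨(h z).1.trans (h' z).1.symm, (h z).2.trans (h' z).2.symm⟩)
  | · obtain ⟨ha, hb⟩ := h x
      obtain ⟨ha', hb'⟩ := h' x
      rw [ha, hb] at h1 h2
      rw [ha', hb'] at h3 h4
      linarith [h1.1, h1.2, h2.1, h2.2, h3.1, h3.2, h4.1, h4.2]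

theorem mem_kochSides_succ {n : ℕ} {c : Plane × Plane} :
    c ∈ kochSides (n + 1) ↔ ∃ e ∈ kochSides n, c ∈ kochStep e := by
  simp [kochSides, List.mem_flatMap]

/-- The initial triangle in the same form as `mem_kochStep`, so that base cases are again finite
checks of linear inequalities. -/
theorem kochSides_zero_coord {e : Plane × Plane} (he : e ∈ kochSides 0) :
    sqLen e = 1 ∧
    ((∀ x, tanCoord e x = x 0 ∧ norCoord e x = -(Real.sqrt 3 * x 1)) ∨
    (∀ x, tanCoord e x = -(x 0 - 1) / 2 + Real.sqrt 3 * x 1 / 2 ∧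
      norCoord e x = 3 / 2 * (x 0 - 1) + Real.sqrt 3 * x 1 / 2) ∨
    (∀ x, tanCoord e x = 1 - x 0 / 2 - Real.sqrt 3 * x 1 / 2 ∧
      norCoord e x = -(3 / 2) * x 0 + Real.sqrt 3 * x 1 / 2)) := by
  have h33 : Real.sqrt 3 ^ 2 = 3 := Real.sq_sqrt (by norm_num)
  simp only [kochSides, List.mem_cons, List.not_mem_nil, or_false] at he
  rcases he with rfl | rfl | rfl
  · have hl : sqLen (A₁, A₃) = 1 := by simp [sqLen, A₁, A₃]
    refine ⟨hl, Or.inl fun x => ⟨?_, ?_⟩⟩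
    · unfold tanCoord; rw [hl]; simp [A₁, A₃]
    · unfold norCoord; rw [hl]; simp [A₁, A₃]
  · have hl : sqLen (A₃, A₅) = 1 := by
      simp [sqLen, A₃, A₅]; linear_combination (1 / 4 : ℝ) * h33
    refine ⟨hl, Or.inr (Or.inl fun x => ⟨?_, ?_⟩)⟩
    · unfold tanCoord; rw [hl]; simp [A₃, A₅]; ring
    · unfold norCoord; rw [hl]; simp [A₃, A₅]
      linear_combination ((x 0 - 1) / 2) * h33
  · have hl : sqLen (A₅, A₁) = 1 := by
      simp [sqLen, A₁, A₅]; linear_combination (1 / 4 : ℝ) * h33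
    refine ⟨hl, Or.inr (Or.inr fun x => ⟨?_, ?_⟩)⟩
    · unfold tanCoord; rw [hl]; simp [A₁, A₅]
      linear_combination (1 / 4 : ℝ) * h33
    · unfold norCoord; rw [hl]; simp [A₁, A₅]
      linear_combination (-(x 0) / 2) * h33

theorem ne_of_mem_kochSides {n : ℕ} : ∀ {e : Plane × Plane}, e ∈ kochSides n → e.1 ≠ e.2 := by
  induction n with
  | zero =>
    intro e he h
    have h1 := (kochSides_zero_coord he).1
    have : sqLen e = 0 := by simp [sqLen, h]
    linarith
  | succ n ih =>
    intro c hc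
    obtain ⟨e, he, hce⟩ := mem_kochSides_succ.1 hc
    exact ne_of_mem_kochStep (ih he) hce

/-- The rhombi attached to different sides are disjoint. -/
theorem disjoint_rhombus {n : ℕ} : ∀ {e e' : Plane × Plane}, e ∈ kochSides n → e' ∈ kochSides n →
    e ≠ e' → Disjoint (rhombus e) (rhombus e') := by
  induction n with
  | zero =>
    intro c c' hc hc' hne
    have hx0 := ne_of_mem_kochSides hc
    have hy0 := ne_of_mem_kochSides hc'
    have key : (∀ z, tanCoord c z = tanCoord c' z ∧ norCoord c z = norCoord c' z) → c = c' := by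
      intro h
      refine Prod.ext ?_ ?_
      · refine eq_of_coord_eq hx0 ?_ ?_
        · rw [(h c'.1).1]; simp
        · rw [(h c'.1).2]; simp
      · refine eq_of_coord_eq hx0 ?_ ?_
        · rw [(h c'.2).1, tanCoord_snd hx0, tanCoord_snd hy0]
        · rw [(h c'.2).2]; simp
    rw [Set.disjoint_left]
    rintro x ⟨h1, h2⟩ ⟨h3, h4⟩
    rw [abs_lt] at h1 h2 h3 h4
    rcases (kochSides_zero_coord hc).2 with h | h | h <;>
    rcases (kochSides_zero_coord hc').2 with h' | h' | h' <;>
    first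
    | exact hne (key fun z => ⟨(h z).1.trans (h' z).1.symm, (h z).2.trans (h' z).2.symm⟩)
    | · obtain ⟨ha, hb⟩ := h x
        obtain ⟨ha', hb'⟩ := h' x
        rw [ha, hb] at h1 h2
        rw [ha', hb'] at h3 h4
        linarith [h1.1, h1.2, h2.1, h2.2, h3.1, h3.2, h4.1, h4.2]
  | succ n ih =>
    intro c c' hc hc' hne
    obtain ⟨e, he, hce⟩ := mem_kochSides_succ.1 hc
    obtain ⟨e', he', hce'⟩ := mem_kochSides_succ.1 hc'
    -- Siblings are handled by the generator; sides with different parents lie in the disjoint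
    -- rhombi of the parents.
    by_cases h : e = e'
    · subst h
      exact disjoint_rhombus_of_mem_kochStep (ne_of_mem_kochSides he) hce hce' hne
    · exact (ih he he' h).mono
        (rhombus_subset_of_mem_kochStep (ne_of_mem_kochSides he) hce)
        (rhombus_subset_of_mem_kochStep (ne_of_mem_kochSides he') hce')

theorem mem_kochRegion_zero (x : Plane) : x ∈ kochRegion 0 ↔
    0 ≤ Real.sqrt 3 * x 1 ∧ 3 * (x 0 - 1) + Real.sqrt 3 * x 1 ≤ 0 ∧
      -3 * x 0 + Real.sqrt 3 * x 1 ≤ 0 := by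
  have h3 : Real.sqrt 3 ≠ 0 := by positivity
  have h33 : Real.sqrt 3 ^ 2 = 3 := Real.sq_sqrt (by norm_num)
  constructor
  · intro hx
    have hconv : Convex ℝ {x : Plane | 0 ≤ Real.sqrt 3 * x 1 ∧
        3 * (x 0 - 1) + Real.sqrt 3 * x 1 ≤ 0 ∧ -3 * x 0 + Real.sqrt 3 * x 1 ≤ 0} := by
      rw [convex_iff_segment_subset]
      intro y hy z hz w hw
      rw [segment_eq_image_lineMap] at hw
      obtain ⟨a, ⟨ha0, ha1⟩, rfl⟩ := hw
      simp only [mem_ofPred_eq, lineMap_zero_coord, lineMap_one_coord] at hy hz ⊢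
      refine ⟨?_, ?_, ?_⟩
      · nlinarith
      · nlinarith
      · nlinarith
    refine convexHull_min ?_ hconv hx
    rintro y (rfl | rfl | rfl)
    · simp [A₁]
    · simp [A₃]
    · simp only [A₅, mem_ofPred_eq]
      simp
      refine ⟨by positivity, ?_, ?_⟩ <;> nlinarith
  · rintro ⟨h1, h2, h4⟩
    have hx : x = (1 - x 0 - Real.sqrt 3 * x 1 / 3) • A₁
        + ((x 0 - Real.sqrt 3 * x 1 / 3) • A₃ + (2 * (Real.sqrt 3 * x 1) / 3) • A₅) := by
      ext i
      fin_cases i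
      · simp [A₁, A₃, A₅]; ring
      · simp [A₁, A₃, A₅]; linear_combination (-(x 1) / 3) * h33
    have hT : Convex ℝ (kochRegion 0) := convex_convexHull _ _
    have m1 : A₁ ∈ kochRegion 0 := subset_convexHull _ _ (by simp)
    have m2 : A₃ ∈ kochRegion 0 := subset_convexHull _ _ (by simp)
    have m3 : A₅ ∈ kochRegion 0 := subset_convexHull _ _ (by simp)
    rw [hx]
    have := hT.sum_mem (t := Finset.univ) (w := ![1 - x 0 - Real.sqrt 3 * x 1 / 3,
      x 0 - Real.sqrt 3 * x 1 / 3, 2 * (Real.sqrt 3 * x 1) / 3])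
      (z := ![A₁, A₃, A₅]) ?_ ?_ ?_
    · simpa [Fin.sum_univ_three, add_assoc] using this
    · intro i _
      fin_cases i
      · simp; linarith
      · simp; linarith
      · simp; linarith
    · simp [Fin.sum_univ_three]; ring
    · intro i _
      fin_cases i <;> simp [m1, m2, m3]

theorem mem_kochRegion_succ {n : ℕ} {x : Plane} : x ∈ kochRegion (n + 1) ↔
    x ∈ kochRegion n ∨ ∃ e ∈ kochSides n, x ∈ midTriangle e := by
  simp only [kochRegion, mem_union, mem_iUnion, exists_prop]; rfl

theorem isCompact_kochRegion (n : ℕ) : IsCompact (kochRegion n) := by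
  induction n with
  | zero => exact (Set.toFinite _).isCompact_convexHull ℝ
  | succ n ih =>
    refine ih.union ?_
    have : {e | e ∈ kochSides n}.Finite := List.finite_toSet _
    exact this.isCompact_biUnion fun e _ => (Set.toFinite _).isCompact_convexHull ℝ

/-- Inside the rhombus of a side, the region is the inner half. -/
theorem mem_kochRegion_iff {n : ℕ} : ∀ {e : Plane × Plane}, e ∈ kochSides n → ∀ {x : Plane},
    x ∈ rhombus e → (x ∈ kochRegion n ↔ norCoord e x ≤ 0) := by
  induction n with
  | zero =>
    rintro e he x ⟨h1, h2⟩
    rw [abs_lt] at h1 h2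
    rw [mem_kochRegion_zero]
    rcases (kochSides_zero_coord he).2 with h | h | h <;>
    · obtain ⟨ha, hb⟩ := h x
      rw [ha, hb] at h1 h2
      rw [hb]
      constructor
      · rintro ⟨h3, h4, h5⟩; linarith
      · intro h3
        refine ⟨?_, ?_, ?_⟩ <;> linarith [h1.1, h1.2, h2.1, h2.2]
  | succ n ih =>
    intro c hc x hx
    obtain ⟨e, he, hce⟩ := mem_kochSides_succ.1 hc
    have hne := ne_of_mem_kochSides he
    have hxe : x ∈ rhombus e := rhombus_subset_of_mem_kochStep hne hce hx
    rw [mem_kochRegion_succ, ih he hxe]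
    -- Only the triangle erected on the parent can meet the rhombus of `c`. Any other one lies in
    -- the closure of a rhombus disjoint from the open rhombus of the parent.
    have hmid : (∃ e' ∈ kochSides n, x ∈ midTriangle e') ↔ x ∈ midTriangle e := by
      refine ⟨?_, fun h => ⟨e, he, h⟩⟩
      rintro ⟨e', he', hx'⟩
      by_cases h : e' = e
      · rwa [h] at hx'
      · have h1 := midTriangle_subset_closure_rhombus (ne_of_mem_kochSides he') hx'
        obtain ⟨y, hy1, hy2⟩ := mem_closure_iff.1 h1 _ (isOpen_rhombus e) hxe
        exact absurd hy1 (Set.disjoint_left.1 (disjoint_rhombus he' he h) hy2)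
    rw [hmid, mem_midTriangle hne]
    obtain ⟨h1, h2⟩ := hx
    rw [abs_lt] at h1 h2
    -- The rhombi of the two outer thirds miss the new triangle, and those of the two slanted edges
    -- lie strictly outside the old region. In each case only one of the two alternatives survives.
    rcases (mem_kochStep hne hce).2 with h | h | h | h
    · obtain ⟨ha, hb⟩ := h x
      rw [ha, hb] at h1 h2
      rw [hb]
      constructor
      · rintro (h | h) <;> linarith
      · intro h; left; linarith
    · obtain ⟨ha, hb⟩ := h x
      rw [ha, hb] at h1 h2
      rw [hb]
      constructor
      · rintro (h | h)
        · linarith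
        · linarith
      · intro h; right
        refine ⟨?_, ?_, ?_⟩ <;> linarith
    · obtain ⟨ha, hb⟩ := h x
      rw [ha, hb] at h1 h2
      rw [hb]
      constructor
      · rintro (h | h)
        · linarith
        · linarith
      · intro h; right
        refine ⟨?_, ?_, ?_⟩ <;> linarith
    · obtain ⟨ha, hb⟩ := h x
      rw [ha, hb] at h1 h2
      rw [hb]
      constructor
      · rintro (h | h) <;> linarith
      · intro h; left; linarith

theorem mem_kochCurve_iff {n : ℕ} {x : Plane} : x ∈ kochCurve n ↔
    ∃ e ∈ kochSides n, norCoord e x = 0 ∧ 0 ≤ tanCoord e x ∧ tanCoord e x ≤ 1 := by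
  simp only [kochCurve, mem_iUnion, exists_prop]
  constructor
  · rintro ⟨e, he, h⟩
    exact ⟨e, he, (mem_segment_iff_coord (ne_of_mem_kochSides he) x).1 h⟩
  · rintro ⟨e, he, h⟩
    exact ⟨e, he, (mem_segment_iff_coord (ne_of_mem_kochSides he) x).2 h⟩

theorem side_mem_kochCurve {n : ℕ} {e : Plane × Plane} (he : e ∈ kochSides n) {a : ℝ}
    (ha : a ∈ Icc (0 : ℝ) 1) : (AffineMap.lineMap e.1 e.2 a : Plane) ∈ kochCurve n :=
  mem_kochCurve_iff.2 ⟨e, he, by simp, by rw [tanCoord_side (ne_of_mem_kochSides he)]; exact ha.1,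
    by rw [tanCoord_side (ne_of_mem_kochSides he)]; exact ha.2⟩

/-- The frontier of the region is contained in the curve. -/
theorem mem_kochDomain_of_notMem_kochCurve {n : ℕ} : ∀ {x : Plane}, x ∈ kochRegion n →
    x ∉ kochCurve n → x ∈ kochDomain n := by
  induction n with
  | zero =>
    intro x hx hxK
    rw [mem_kochRegion_zero] at hx
    obtain ⟨h1, h2, h3⟩ := hx
    have key : ∀ e ∈ kochSides 0, norCoord e x = 0 → ¬ (0 ≤ tanCoord e x ∧ tanCoord e x ≤ 1) :=
      fun e he h0 h => hxK (mem_kochCurve_iff.2 ⟨e, he, h0, h⟩)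
    have hs : ∀ e ∈ kochSides 0, norCoord e x ≠ 0 := by
      intro e he h0
      apply key e he h0
      rcases (kochSides_zero_coord he).2 with h | h | h <;>
      · obtain ⟨ha, hb⟩ := h x
        rw [hb] at h0
        rw [ha]
        constructor <;> linarith
    have hopen : IsOpen {y : Plane | 0 < Real.sqrt 3 * y 1 ∧ 3 * (y 0 - 1) + Real.sqrt 3 * y 1 < 0 ∧
        -3 * y 0 + Real.sqrt 3 * y 1 < 0} := by
      refine IsOpen.and (isOpen_lt ?_ ?_) (IsOpen.and (isOpen_lt ?_ ?_) (isOpen_lt ?_ ?_)) <;> fun_prop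
    refine mem_interior.2 ⟨_, fun y hy => (mem_kochRegion_zero y).2 ⟨hy.1.le, hy.2.1.le, hy.2.2.le⟩,
      hopen, ?_⟩
    have hm1 : (A₁, A₃) ∈ kochSides 0 := by simp [kochSides]
    have hm2 : (A₃, A₅) ∈ kochSides 0 := by simp [kochSides]
    have hm3 : (A₅, A₁) ∈ kochSides 0 := by simp [kochSides]
    have h33 : Real.sqrt 3 ^ 2 = 3 := Real.sq_sqrt (by norm_num)
    have g1 : norCoord (A₁, A₃) x = -(Real.sqrt 3 * x 1) := by
      simp [norCoord, sqLen, A₁, A₃]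
    have g2 : norCoord (A₃, A₅) x = 3 / 2 * (x 0 - 1) + Real.sqrt 3 * x 1 / 2 := by
      unfold norCoord; rw [(kochSides_zero_coord hm2).1]; simp [A₃, A₅]
      linear_combination ((x 0 - 1) / 2) * h33
    have g3 : norCoord (A₅, A₁) x = -(3 / 2) * x 0 + Real.sqrt 3 * x 1 / 2 := by
      unfold norCoord; rw [(kochSides_zero_coord hm3).1]; simp [A₁, A₅]
      linear_combination (-(x 0) / 2) * h33
    have n1 := hs _ hm1
    have n2 := hs _ hm2
    have n3 := hs _ hm3
    rw [g1] at n1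
    rw [g2] at n2
    rw [g3] at n3
    refine ⟨lt_of_le_of_ne h1 fun h => n1 (by linarith), lt_of_le_of_ne h2 fun h => n2 (by linarith),
      lt_of_le_of_ne h3 fun h => n3 (by linarith)⟩
  | succ n ih =>
    intro x hx hxK
    have hmono : kochDomain n ⊆ kochDomain (n + 1) :=
      interior_mono fun y hy => mem_kochRegion_succ.2 (Or.inl hy)
    -- points of the open middle third of a side are interior
    have hmid : ∀ e ∈ kochSides n, norCoord e x = 0 → 1 / 3 < tanCoord e x → tanCoord e x < 2 / 3 →
        x ∈ kochDomain (n + 1) := by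
      intro e he h0 h1 h2
      have hne := ne_of_mem_kochSides he
      have hopen : IsOpen (rhombus e ∩ ({y | norCoord e y - 3 * tanCoord e y + 1 < 0} ∩
          {y | 3 * tanCoord e y + norCoord e y - 2 < 0})) := by
        have c1 := continuous_norCoord e
        have c2 := continuous_tanCoord e
        refine (isOpen_rhombus e).inter ((isOpen_lt ?_ ?_).inter (isOpen_lt ?_ ?_)) <;> fun_prop
      refine mem_interior.2 ⟨_, ?_, hopen, ?_⟩
      · rintro y ⟨hy, hy1, hy2⟩
        rw [mem_kochRegion_succ]
        rcases le_total (norCoord e y) 0 with h | h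
        · exact Or.inl ((mem_kochRegion_iff he hy).2 h)
        · exact Or.inr ⟨e, he, (mem_midTriangle hne y).2 ⟨h, hy1.le, hy2.le⟩⟩
      · refine ⟨⟨?_, ?_⟩, ?_, ?_⟩
        · rw [h0, abs_zero]; linarith
        · rw [h0, abs_zero]; linarith
        · simp only [mem_ofPred_eq]; linarith
        · simp only [mem_ofPred_eq]; linarith
    have hside : ∀ e ∈ kochSides n, ∀ c ∈ kochStep e, norCoord c x = 0 → 0 ≤ tanCoord c x →
        tanCoord c x ≤ 1 → False := fun e he c hc h0 h1 h2 =>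
      hxK (mem_kochCurve_iff.2 ⟨c, mem_kochSides_succ.2 ⟨e, he, hc⟩, h0, h1, h2⟩)
    -- On an old side, the outer thirds still belong to the new curve, which is excluded; only the
    -- open middle third remains.
    have hbase : ∀ e ∈ kochSides n, norCoord e x = 0 → 0 ≤ tanCoord e x → tanCoord e x ≤ 1 →
        x ∈ kochDomain (n + 1) := by
      intro e he h0 h1 h2
      have hne := ne_of_mem_kochSides he
      by_cases h3 : tanCoord e x ≤ 1 / 3
      · exfalso
        obtain ⟨-, hc, hc'⟩ := coord_subside (c := (e.1, third₁ e.1 e.2)) hne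
          (p := 0) (q := 0) (a := 1 / 3) (b := 0) (by norm_num)
          (by ring) (by ring) (by simp only [third₁, lineMap_zero_coord]; ring)
          (by simp only [third₁, lineMap_one_coord]; ring)
        refine hside e he (e.1, third₁ e.1 e.2) (by simp [kochStep]) ?_ ?_ ?_
        · rw [hc', h0]; ring
        · rw [hc]; linarith
        · rw [hc]; linarith
      · by_cases h4 : 2 / 3 ≤ tanCoord e x
        · exfalso
          obtain ⟨-, hc, hc'⟩ := coord_subside (c := (third₂ e.1 e.2, e.2)) hne
            (p := 2 / 3) (q := 0) (a := 1 / 3) (b := 0) (by norm_num)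
            (by simp only [third₂, lineMap_zero_coord]; ring)
            (by simp only [third₂, lineMap_one_coord]; ring)
            (by simp only [third₂, lineMap_zero_coord]; ring)
            (by simp only [third₂, lineMap_one_coord]; ring)
          refine hside e he (third₂ e.1 e.2, e.2) (by simp [kochStep]) ?_ ?_ ?_
          · rw [hc', h0]; ring
          · rw [hc]; linarith
          · rw [hc]; linarith
        · exact hmid e he h0 (not_le.1 h3) (not_le.1 h4)
    rcases mem_kochRegion_succ.1 hx with hx | ⟨e, he, hx⟩
    · by_cases hK : x ∈ kochCurve n
      · obtain ⟨e, he, h0, h1, h2⟩ := mem_kochCurve_iff.1 hK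
        exact hbase e he h0 h1 h2
      · exact hmono (ih hx hK)
    -- A point of a new triangle lies on its base, treated above, or on a slanted edge, which is a
    -- side of the new curve, or in its interior.
    · have hne := ne_of_mem_kochSides he
      obtain ⟨h1, h2, h3⟩ := (mem_midTriangle hne x).1 hx
      rcases h1.eq_or_lt with h1' | h1'
      · exact hbase e he h1'.symm (by linarith) (by linarith)
      have h33 : Real.sqrt 3 ^ 2 = 3 := Real.sq_sqrt (by norm_num)
      rcases h2.eq_or_lt with h2' | h2'
      · exfalso
        have hcm : (third₁ e.1 e.2, apex e.1 e.2) ∈ kochStep e := by simp [kochStep]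
        obtain ⟨-, hc, hc'⟩ := coord_subside (c := (third₁ e.1 e.2, apex e.1 e.2)) hne
          (p := 1 / 3) (q := 0) (a := 1 / 6) (b := Real.sqrt 3 / 6)
          (by linear_combination (1 / 36 : ℝ) * h33)
          (by simp only [third₁, lineMap_zero_coord]; ring)
          (by simp only [third₁, lineMap_one_coord]; ring)
          (by simp only [third₁, lineMap_zero_coord, apex]; simp; ring)
          (by simp only [third₁, lineMap_one_coord, apex]; simp; ring)
        have e1 : tanCoord (third₁ e.1 e.2, apex e.1 e.2) x
            = 3 / 2 * (tanCoord e x + norCoord e x) - 1 / 2 := by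
          rw [hc]; field_simp; ring
        have e2 : norCoord (third₁ e.1 e.2, apex e.1 e.2) x
            = 3 / 2 * (norCoord e x - 3 * tanCoord e x + 1) := by
          rw [hc']; linear_combination (-(3 / 2) * (tanCoord e x - 1 / 3)) * h33
        exact hside e he _ hcm (by rw [e2, h2']; ring) (by rw [e1]; linarith) (by rw [e1]; linarith)
      rcases h3.eq_or_lt with h3' | h3'
      · exfalso
        have hcm : (apex e.1 e.2, third₂ e.1 e.2) ∈ kochStep e := by simp [kochStep]
        obtain ⟨-, hc, hc'⟩ := coord_subside (c := (apex e.1 e.2, third₂ e.1 e.2)) hne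
          (p := 1 / 2) (q := Real.sqrt 3 / 6) (a := 1 / 6) (b := -(Real.sqrt 3 / 6))
          (by linear_combination (1 / 36 : ℝ) * h33)
          (by simp only [apex]; simp; ring)
          (by simp only [apex]; simp; ring)
          (by simp only [third₂, lineMap_zero_coord, apex]; simp; ring)
          (by simp only [third₂, lineMap_one_coord, apex]; simp; ring)
        have e1 : tanCoord (apex e.1 e.2, third₂ e.1 e.2) x
            = 3 / 2 * (tanCoord e x - norCoord e x) := by
          rw [hc]; field_simp; linear_combination (18 : ℝ) * h33
        have e2 : norCoord (apex e.1 e.2, third₂ e.1 e.2) x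
            = 3 / 2 * (3 * tanCoord e x + norCoord e x - 2) := by
          rw [hc']; linear_combination (3 / 2 * (tanCoord e x - 1 / 2) - 1 / 4) * h33
        exact hside e he _ hcm (by rw [e2, h3']; ring) (by rw [e1]; linarith) (by rw [e1]; linarith)
      have hopen : IsOpen ({y | 0 < norCoord e y} ∩ ({y | norCoord e y - 3 * tanCoord e y + 1 < 0} ∩
          {y | 3 * tanCoord e y + norCoord e y - 2 < 0})) := by
        have c1 := continuous_norCoord e
        have c2 := continuous_tanCoord e
        refine (isOpen_lt ?_ ?_).inter ((isOpen_lt ?_ ?_).inter (isOpen_lt ?_ ?_)) <;> fun_prop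
      refine mem_interior.2 ⟨_, ?_, hopen, h1', h2', h3'⟩
      rintro y ⟨hy1, hy2, hy3⟩
      exact mem_kochRegion_succ.2 (Or.inr ⟨e, he,
        (mem_midTriangle hne y).2 ⟨(show 0 < norCoord e y from hy1).le,
          (show _ < _ from hy2).le, (show _ < _ from hy3).le⟩⟩)


/-! ### Metric estimates in the coordinates of a side -/

/-- The coordinate frame is orthogonal; the `1/3` undoes the factor `√3` built into `norCoord`. -/
theorem dist_sq_coord {e : Plane × Plane} (he : e.1 ≠ e.2) (x y : Plane) :
    dist x y ^ 2 = sqLen e * ((tanCoord e x - tanCoord e y) ^ 2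
      + (norCoord e x - norCoord e y) ^ 2 / 3) := by
  have h33 : Real.sqrt 3 ^ 2 = 3 := Real.sq_sqrt (by norm_num)
  have h3 : Real.sqrt 3 ≠ 0 := by positivity
  rw [EuclideanSpace.dist_eq, Real.sq_sqrt (by positivity)]
  simp only [Fin.sum_univ_two, Real.dist_eq, sq_abs]
  have e0 : x 0 - y 0 = (tanCoord e x - tanCoord e y) * (e.2 0 - e.1 0)
      + (norCoord e x - norCoord e y) / Real.sqrt 3 * (e.2 1 - e.1 1) := by
    rw [coord_zero he x, coord_zero he y]; ring
  have e1 : x 1 - y 1 = (tanCoord e x - tanCoord e y) * (e.2 1 - e.1 1)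
      - (norCoord e x - norCoord e y) / Real.sqrt 3 * (e.2 0 - e.1 0) := by
    rw [coord_one he x, coord_one he y]; ring
  have h4 : ((norCoord e x - norCoord e y) / Real.sqrt 3) ^ 2
      = (norCoord e x - norCoord e y) ^ 2 / 3 := by rw [div_pow, h33]
  rw [e0, e1, ← h4]
  unfold sqLen; ring

theorem side_length_pos {n : ℕ} {e : Plane × Plane} (he : e ∈ kochSides n) : 0 < dist e.1 e.2 :=
  dist_pos.2 (ne_of_mem_kochSides he)

theorem abs_tanCoord_sub_le {e : Plane × Plane} (he : e.1 ≠ e.2) (x y : Plane) :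
    |tanCoord e x - tanCoord e y| ≤ dist x y / dist e.1 e.2 := by
  have hl := dist_pos.2 he
  rw [le_div_iff₀ hl]
  refine (sq_le_sq₀ (by positivity) dist_nonneg).1 ?_
  rw [dist_sq_coord he x y, sqLen_eq, mul_pow, sq_abs]
  nlinarith [mul_nonneg (sq_nonneg (dist e.1 e.2)) (sq_nonneg (norCoord e x - norCoord e y))]

/-- The sharp constant is `√3`; `2` avoids the root. -/
theorem abs_norCoord_sub_le {e : Plane × Plane} (he : e.1 ≠ e.2) (x y : Plane) :
    |norCoord e x - norCoord e y| ≤ 2 * dist x y / dist e.1 e.2 := by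
  have hl := dist_pos.2 he
  rw [le_div_iff₀ hl]
  refine (sq_le_sq₀ (by positivity) (by positivity)).1 ?_
  rw [mul_pow, mul_pow, dist_sq_coord he x y, sqLen_eq, sq_abs]
  nlinarith [mul_nonneg (sq_nonneg (dist e.1 e.2)) (sq_nonneg (norCoord e x - norCoord e y)),
    mul_nonneg (sq_nonneg (dist e.1 e.2)) (sq_nonneg (tanCoord e x - tanCoord e y))]

theorem tanCoord_apex {e : Plane × Plane} (he : e.1 ≠ e.2) :
    tanCoord e (apex e.1 e.2) = 1 / 2 := by
  have h := sqLen_pos he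
  unfold tanCoord; rw [div_eq_iff h.ne']; simp [apex, sqLen]; ring

theorem norCoord_apex {e : Plane × Plane} (he : e.1 ≠ e.2) :
    norCoord e (apex e.1 e.2) = 1 / 2 := by
  have h := sqLen_pos he
  have h33 : Real.sqrt 3 ^ 2 = 3 := Real.sq_sqrt (by norm_num)
  unfold norCoord; rw [div_eq_iff h.ne']; simp [apex, sqLen]
  linear_combination (1 / 6 * ((e.2 0 - e.1 0) ^ 2 + (e.2 1 - e.1 1) ^ 2)) * h33

/-- Every pair of coordinates is attained. -/
theorem exists_coord {e : Plane × Plane} (he : e.1 ≠ e.2) (a b : ℝ) :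
    ∃ x, tanCoord e x = a ∧ norCoord e x = b := by
  refine ⟨AffineMap.lineMap (AffineMap.lineMap e.1 e.2 (2 * a - 1 / 2 : ℝ))
    (AffineMap.lineMap (AffineMap.lineMap e.1 e.2 (1 / 2 : ℝ)) (apex e.1 e.2) (4 * b)) (1 / 2 : ℝ),
    ?_, ?_⟩
  · simp only [tanCoord_lineMap, tanCoord_fst, tanCoord_snd he, tanCoord_apex he]; ring
  · simp only [norCoord_lineMap, norCoord_fst, norCoord_snd, norCoord_apex he]; ring

/-- Approaching a point of a side from within its rhombus, on a prescribed side. -/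
theorem mem_closure_rhombus_inter {e : Plane × Plane} (he : e.1 ≠ e.2) {x : Plane}
    (hx : norCoord e x = 0 ∧ 0 ≤ tanCoord e x ∧ tanCoord e x ≤ 1) {c : ℝ} (hc : |c| < 1 / 2) :
    x ∈ closure (rhombus e ∩ {y | ∃ a > 0, norCoord e y = a * c}) := by
  -- Since `|c| < 1/2`, this point is in the open rhombus, and so is every point strictly between
  -- `x` and it. Along this segment the normal coordinate is `a * c`.
  obtain ⟨q, hq1, hq2⟩ := exists_coord he (1 / 2) c
  have hlim : Tendsto (fun a : ℝ => (AffineMap.lineMap x q a : Plane)) (𝓝[>] 0) (𝓝 x) := by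
    have : Continuous (fun a : ℝ => (AffineMap.lineMap x q a : Plane)) :=
      AffineMap.lineMap_continuous
    simpa using (this.tendsto 0).mono_left nhdsWithin_le_nhds
  refine mem_closure_of_tendsto hlim ?_
  filter_upwards [Ioo_mem_nhdsGT (show (0 : ℝ) < 1 by norm_num)] with a ha
  obtain ⟨h0, h1, h2⟩ := hx
  have e1 := tanCoord_lineMap e x q a
  have e2 := norCoord_lineMap e x q a
  rw [hq1] at e1
  rw [hq2, h0, mul_zero, zero_add] at e2
  obtain ⟨ha0, ha1⟩ := ha
  have habs : |norCoord e (AffineMap.lineMap x q a)| < a / 2 := by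
    rw [e2, abs_mul, abs_of_pos ha0]; nlinarith
  refine ⟨⟨?_, ?_⟩, a, ha0, e2⟩
  · rw [e1]; nlinarith
  · rw [e1]; nlinarith

/-! ### The open domain, its frontier and the vertices -/

theorem isOpen_kochDomain (n : ℕ) : IsOpen (kochDomain n) := isOpen_interior

theorem measurableSet_kochDomain (n : ℕ) : MeasurableSet (kochDomain n) :=
  (isOpen_kochDomain n).measurableSet

theorem kochDomain_subset_kochRegion (n : ℕ) : kochDomain n ⊆ kochRegion n := interior_subset

theorem isBounded_kochDomain (n : ℕ) : Bornology.IsBounded (kochDomain n) :=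
  (isCompact_kochRegion n).isBounded.subset (kochDomain_subset_kochRegion n)

/-- Every point of the curve is a limit of points in the outer half of a rhombus, which are not in
the region. -/
theorem notMem_kochDomain_of_mem_kochCurve {n : ℕ} {x : Plane} (hx : x ∈ kochCurve n) :
    x ∉ kochDomain n := by
  intro hxD
  obtain ⟨e, he, h⟩ := mem_kochCurve_iff.1 hx
  have h1 := mem_closure_rhombus_inter (ne_of_mem_kochSides he) h (c := 1 / 4)
    (by rw [abs_of_pos] <;> norm_num)
  obtain ⟨y, hy1, hy2, a, ha, hy3⟩ := mem_closure_iff.1 h1 _ (isOpen_kochDomain n) hxD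
  have := (mem_kochRegion_iff he hy2).1 (kochDomain_subset_kochRegion n hy1)
  rw [hy3] at this
  linarith

/-- Equality is excluded because such points are on the curve. This is the local half-plane picture
behind all boundary arguments. -/
theorem mem_kochDomain_iff {n : ℕ} {e : Plane × Plane} (he : e ∈ kochSides n) {x : Plane}
    (hx : x ∈ rhombus e) : x ∈ kochDomain n ↔ norCoord e x < 0 := by
  constructor
  · intro h
    refine lt_of_le_of_ne ((mem_kochRegion_iff he hx).1 (kochDomain_subset_kochRegion n h)) ?_
    intro h0
    have hx1 := hx.1
    have hx2 := hx.2
    rw [h0, abs_zero] at hx1 hx2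
    exact notMem_kochDomain_of_mem_kochCurve
      (mem_kochCurve_iff.2 ⟨e, he, h0, hx1.le, by linarith⟩) h
  · intro h
    refine mem_interior.2 ⟨rhombus e ∩ {y | norCoord e y < 0}, ?_,
      (isOpen_rhombus e).inter (isOpen_lt (continuous_norCoord e) continuous_const), hx, h⟩
    rintro y ⟨hy, hy1⟩
    exact (mem_kochRegion_iff he hy).2 (le_of_lt hy1)

theorem kochCurve_subset_closure (n : ℕ) : kochCurve n ⊆ closure (kochDomain n) := by
  intro x hx
  obtain ⟨e, he, h⟩ := mem_kochCurve_iff.1 hx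
  have h1 := mem_closure_rhombus_inter (ne_of_mem_kochSides he) h (c := -(1 / 4))
    (by rw [abs_neg, abs_of_pos] <;> norm_num)
  refine closure_mono ?_ h1
  rintro y ⟨hy1, a, ha, hy2⟩
  refine (mem_kochDomain_iff he hy1).2 ?_
  rw [hy2]; linarith

theorem isCompact_kochCurve (n : ℕ) : IsCompact (kochCurve n) := by
  have : {e | e ∈ kochSides n}.Finite := List.finite_toSet _
  refine this.isCompact_biUnion fun e _ => ?_
  rw [segment_eq_image_lineMap]
  exact isCompact_Icc.image AffineMap.lineMap_continuous

theorem kochSides_ne_nil (n : ℕ) : ∃ e, e ∈ kochSides n := by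
  induction n with
  | zero => exact ⟨(A₁, A₃), by simp [kochSides]⟩
  | succ n ih =>
    obtain ⟨e, he⟩ := ih
    exact ⟨(e.1, third₁ e.1 e.2), mem_kochSides_succ.2 ⟨e, he, by simp [kochStep]⟩⟩

theorem kochCurve_nonempty (n : ℕ) : (kochCurve n).Nonempty := by
  obtain ⟨e, he⟩ := kochSides_ne_nil n
  exact ⟨_, side_mem_kochCurve he (left_mem_Icc.2 zero_le_one)⟩

theorem frontier_kochDomain_subset {n : ℕ} {x : Plane} (hx : x ∈ closure (kochDomain n))
    (hx' : x ∉ kochDomain n) : x ∈ kochCurve n := by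
  by_contra h
  exact hx' (mem_kochDomain_of_notMem_kochCurve
    ((isCompact_kochRegion n).isClosed.closure_subset_iff.2 (kochDomain_subset_kochRegion n) hx) h)

/-- The vertices of the curve. -/
def vertices (n : ℕ) : Set Plane := {p | ∃ e ∈ kochSides n, p = e.1 ∨ p = e.2}

theorem finite_vertices (n : ℕ) : (vertices n).Finite := by
  have h : {e | e ∈ kochSides n}.Finite := List.finite_toSet _
  refine ((h.image Prod.fst).union (h.image Prod.snd)).subset ?_
  rintro p ⟨e, he, rfl | rfl⟩
  · exact Or.inl ⟨e, he, rfl⟩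
  · exact Or.inr ⟨e, he, rfl⟩

theorem side_mem_rhombus {e : Plane × Plane} (he : e.1 ≠ e.2) {a : ℝ} (ha : a ∈ Ioo (0 : ℝ) 1) :
    (AffineMap.lineMap e.1 e.2 a : Plane) ∈ rhombus e := by
  refine ⟨?_, ?_⟩ <;> rw [norCoord_side, tanCoord_side he, abs_zero] <;> linarith [ha.1, ha.2]

/-- The plane without the vertices is covered by the rhombi, the domain, and its exterior. -/
theorem cover_plane {n : ℕ} {x : Plane} (hx : x ∉ vertices n) :
    (∃ e ∈ kochSides n, x ∈ rhombus e) ∨ x ∈ kochDomain n ∨ x ∈ (kochRegion n)ᶜ := by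
  by_cases hK : x ∈ kochCurve n
  · left
    obtain ⟨e, he, h0, h1, h2⟩ := mem_kochCurve_iff.1 hK
    have hne := ne_of_mem_kochSides he
    have hxe := eq_lineMap_of_norCoord_eq_zero hne h0
    refine ⟨e, he, ?_⟩
    rw [hxe]
    refine side_mem_rhombus hne ⟨lt_of_le_of_ne h1 ?_, lt_of_le_of_ne h2 ?_⟩
    · intro h
      rw [← h, AffineMap.lineMap_apply_zero] at hxe
      exact hx ⟨e, he, Or.inl hxe⟩
    · intro h
      rw [h, AffineMap.lineMap_apply_one] at hxe
      exact hx ⟨e, he, Or.inr hxe⟩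
  · right
    by_cases hR : x ∈ kochRegion n
    · exact Or.inl (mem_kochDomain_of_notMem_kochCurve hR hK)
    · exact Or.inr hR

/-- A ball around a point of a side that is contained in the rhombus of that side. -/
theorem ball_subset_rhombus {e : Plane × Plane} (he : e.1 ≠ e.2) {a : ℝ} {y : Plane}
    (h : dist (AffineMap.lineMap e.1 e.2 a) y < dist e.1 e.2 * min a (1 - a) / 2) :
    y ∈ rhombus e := by
  have hl := dist_pos.2 he
  set m := min a (1 - a) with hm
  have hm0 : 0 < m := by
    by_contra h0
    have : dist e.1 e.2 * m / 2 ≤ 0 := by nlinarith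
    exact absurd (lt_of_lt_of_le h this) (not_lt.2 dist_nonneg)
  have h1 := dist_sq_coord he (AffineMap.lineMap e.1 e.2 a) y
  rw [norCoord_side, tanCoord_side he, sqLen_eq] at h1
  have h2 : dist (AffineMap.lineMap e.1 e.2 a) y ^ 2 < (dist e.1 e.2 * m / 2) ^ 2 :=
    pow_lt_pow_left₀ h dist_nonneg (by norm_num)
  rw [h1, mul_div_assoc, mul_pow] at h2
  have h3 := lt_of_mul_lt_mul_left h2 (sq_nonneg _)
  have ha1 : m ≤ a := min_le_left _ _
  have ha2 : m ≤ 1 - a := min_le_right _ _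
  set s := tanCoord e y
  set t := norCoord e y
  -- Cauchy-Schwarz in the form `(|t| + |a - s|)² ≤ 4 ((a - s)² + t²/3)`; this is where the factor
  -- `1/2` in the radius comes from.
  have key : |t| + |a - s| < m := by
    refine lt_of_pow_lt_pow_left₀ 2 hm0.le ?_
    nlinarith [sq_nonneg (|t| - 3 * |a - s|), sq_abs t, sq_abs (a - s)]
  have := le_abs_self (a - s)
  have := neg_abs_le (a - s)
  exact ⟨by linarith, by linarith⟩

/-- A closer point would lie in the rhombus of `e`, although it lies in the disjoint rhombus of
`e'`. The bound is linear in the distance to the nearer endpoint, which makes the Gagliardo integral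
over adjacent sides converge. -/
theorem le_dist_side {n : ℕ} {e e' : Plane × Plane} (he : e ∈ kochSides n) (he' : e' ∈ kochSides n)
    (hne : e ≠ e') {a b : ℝ} (hb : b ∈ Ioo (0 : ℝ) 1) :
    dist e.1 e.2 * min a (1 - a) / 2
      ≤ dist (AffineMap.lineMap e.1 e.2 a : Plane) (AffineMap.lineMap e'.1 e'.2 b) := by
  by_contra h
  exact Set.disjoint_left.1 (disjoint_rhombus he he' hne)
    (ball_subset_rhombus (ne_of_mem_kochSides he) (not_le.1 h))
    (side_mem_rhombus (ne_of_mem_kochSides he') hb)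


/-! ### The measures -/

theorem measurableEmbedding_side {e : Plane × Plane} (he : e.1 ≠ e.2) :
    MeasurableEmbedding (fun τ : ℝ => (AffineMap.lineMap e.1 e.2 τ : Plane)) := by
  have hcont : Continuous (fun τ : ℝ => (AffineMap.lineMap e.1 e.2 τ : Plane)) :=
    AffineMap.lineMap_continuous
  refine hcont.measurableEmbedding fun a b h => ?_
  have := congrArg (tanCoord e) h
  simpa [tanCoord_side he] using this

theorem lintegral_sideMeasure {e : Plane × Plane} (he : e.1 ≠ e.2) (f : Plane → ℝ≥0∞) :
    ∫⁻ x, f x ∂sideMeasure e = ENNReal.ofReal (dist e.1 e.2) *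
      ∫⁻ τ in Icc (0 : ℝ) 1, f (AffineMap.lineMap e.1 e.2 τ) := by
  rw [sideMeasure, lintegral_smul_measure, (measurableEmbedding_side he).lintegral_map, smul_eq_mul]

theorem ae_sideMeasure {e : Plane × Plane} (he : e.1 ≠ e.2) {p : Plane → Prop} :
    (∀ᵐ x ∂sideMeasure e, p x) ↔
      ∀ᵐ τ ∂volume.restrict (Icc (0 : ℝ) 1), p (AffineMap.lineMap e.1 e.2 τ) := by
  have h : ENNReal.ofReal (dist e.1 e.2) ≠ 0 := by
    simpa using he
  rw [sideMeasure, Measure.ae_ennreal_smul_measure_eq h, (measurableEmbedding_side he).ae_map_iff]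

theorem sideMeasure_le_arcLength {n : ℕ} {e : Plane × Plane} (he : e ∈ kochSides n) :
    sideMeasure e ≤ arcLength n := by
  unfold arcLength
  generalize kochSides n = l at he
  induction l with
  | nil => simp at he
  | cons a l ih =>
    simp only [List.map_cons, List.sum_cons]
    rcases List.mem_cons.1 he with rfl | h
    · exact Measure.le_add_right le_rfl
    · exact Measure.le_add_left (ih h)

theorem ae_list_sum {α : Type*} [MeasurableSpace α] (l : List (Measure α)) {p : α → Prop} :
    (∀ᵐ x ∂l.sum, p x) ↔ ∀ μ ∈ l, ∀ᵐ x ∂μ, p x := by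
  induction l with
  | nil => simp
  | cons a l ih => simp [ae_add_measure_iff, ih]

theorem ae_arcLength {n : ℕ} {p : Plane → Prop} :
    (∀ᵐ x ∂arcLength n, p x) ↔ ∀ e ∈ kochSides n, ∀ᵐ x ∂sideMeasure e, p x := by
  rw [arcLength, ae_list_sum]; simp only [List.mem_map, forall_exists_index, and_imp,
    forall_apply_eq_imp_iff₂]

theorem ae_arcLength_iff {n : ℕ} {p : Plane → Prop} :
    (∀ᵐ x ∂arcLength n, p x) ↔ ∀ e ∈ kochSides n,
      ∀ᵐ τ ∂volume.restrict (Icc (0 : ℝ) 1), p (AffineMap.lineMap e.1 e.2 τ) := by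
  rw [ae_arcLength]
  exact forall₂_congr fun e he => ae_sideMeasure (ne_of_mem_kochSides he)

theorem ae_mem_kochCurve (n : ℕ) : ∀ᵐ x ∂arcLength n, x ∈ kochCurve n := by
  rw [ae_arcLength_iff]
  intro e he
  filter_upwards [ae_restrict_mem measurableSet_Icc] with τ hτ
  exact side_mem_kochCurve he hτ

theorem ae_bulk_mem (n : ℕ) : ∀ᵐ x ∂bulk n, x ∈ kochDomain n :=
  ae_restrict_mem (measurableSet_kochDomain n)

theorem ae_mMeasure {n : ℕ} {p : Plane → Prop} :
    (∀ᵐ x ∂mMeasure n, p x) ↔ (∀ᵐ x ∂bulk n, p x) ∧ ∀ᵐ x ∂arcLength n, p x :=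
  ae_add_measure_iff

theorem bulk_le (n : ℕ) : bulk n ≤ mMeasure n := Measure.le_add_right le_rfl

theorem arcLength_le (n : ℕ) : arcLength n ≤ mMeasure n := Measure.le_add_left le_rfl

instance bulk_finite (n : ℕ) : IsFiniteMeasure (bulk n) :=
  ⟨by rw [bulk, Measure.restrict_apply_univ]; exact (isBounded_kochDomain n).measure_lt_top⟩

/-! ### Cauchy-Schwarz inequalities and square integrability -/

/-- Cauchy-Schwarz inequality for lower integrals. -/
theorem lintegral_mul_sq_le {α : Type*} [MeasurableSpace α] {μ : Measure α} {f g : α → ℝ≥0∞}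
    (hf : AEMeasurable f μ) (hg : AEMeasurable g μ) :
    (∫⁻ x, f x * g x ∂μ) ^ 2 ≤ (∫⁻ x, f x ^ 2 ∂μ) * ∫⁻ x, g x ^ 2 ∂μ := by
  have h := ENNReal.lintegral_mul_le_Lp_mul_Lq μ Real.HolderConjugate.two_two hf hg
  have h2 : ∀ a : ℝ≥0∞, (a ^ (1 / 2 : ℝ)) ^ 2 = a := fun a => by
    rw [← ENNReal.rpow_natCast, ← ENNReal.rpow_mul]; norm_num
  have h3 : ∀ a : ℝ≥0∞, a ^ (2 : ℝ) = a ^ 2 := fun a => by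
    rw [← ENNReal.rpow_natCast]; norm_num
  calc (∫⁻ x, f x * g x ∂μ) ^ 2
      ≤ ((∫⁻ x, f x ^ (2 : ℝ) ∂μ) ^ (1 / 2 : ℝ) * (∫⁻ x, g x ^ (2 : ℝ) ∂μ) ^ (1 / 2 : ℝ)) ^ 2 := by
        gcongr; exact h
    _ = _ := by rw [mul_pow, h2, h2]; simp only [h3]

/-- Cauchy-Schwarz inequality with a weight. -/
theorem lintegral_mul_weight_sq_le {α : Type*} [MeasurableSpace α] {μ : Measure α}
    {f k : α → ℝ≥0∞} (hf : AEMeasurable f μ) (hk : AEMeasurable k μ) :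
    (∫⁻ x, f x * k x ∂μ) ^ 2 ≤ (∫⁻ x, k x ∂μ) * ∫⁻ x, f x ^ 2 * k x ∂μ := by
  have h2 : ∀ a : ℝ≥0∞, (a ^ (1 / 2 : ℝ)) ^ 2 = a := fun a => by
    rw [← ENNReal.rpow_natCast, ← ENNReal.rpow_mul]; norm_num
  -- The weight is split as `k = k^{1/2} k^{1/2}`.
  have h := lintegral_mul_sq_le (μ := μ) (f := fun x => k x ^ (1 / 2 : ℝ))
    (g := fun x => f x * k x ^ (1 / 2 : ℝ)) (hk.pow_const _) (hf.mul (hk.pow_const _))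
  simp only [mul_pow, h2] at h
  refine le_trans (le_of_eq ?_) h
  congr 1
  refine lintegral_congr fun x => ?_
  rw [mul_left_comm, ← sq, h2]

theorem integrable_mul_of_memLp {α : Type*} [MeasurableSpace α] {μ : Measure α}
    {f g : α → ℝ} (hf : MemLp f 2 μ) (hg : MemLp g 2 μ) : Integrable (fun x => f x * g x) μ :=
  hf.integrable_mul hg

theorem integrable_inner_of_memLp {α : Type*} [MeasurableSpace α] {μ : Measure α}
    {f g : α → Plane} (hf : MemLp f 2 μ) (hg : MemLp g 2 μ) :
    Integrable (fun x => inner ℝ (f x) (g x)) μ :=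
  (hf.norm.integrable_mul hg.norm).mono (hf.1.inner hg.1)
    (.of_forall fun x => by
      simpa using norm_inner_le_norm (𝕜 := ℝ) (f x) (g x))

/-- Cauchy-Schwarz inequality for integrals of functions. -/
theorem abs_integral_le_eLpNorm_mul {α : Type*} [MeasurableSpace α] {μ : Measure α}
    {f g h : α → ℝ} (hf : MemLp f 2 μ) (hg : MemLp g 2 μ) (hle : ∀ᵐ x ∂μ, |h x| ≤ |f x| * |g x|) :
    |∫ x, h x ∂μ| ≤ (eLpNorm f 2 μ).toReal * (eLpNorm g 2 μ).toReal := by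
  have h1 : |∫ x, h x ∂μ| ≤ ∫ x, |f x| * |g x| ∂μ := by
    refine (abs_integral_le_integral_abs).trans ?_
    by_cases hi : Integrable (fun x => |h x|) μ
    · exact integral_mono_ae hi (hf.norm.integrable_mul hg.norm) hle
    · rw [integral_undef hi]; positivity
  refine h1.trans ?_
  have h3 := real_inner_le_norm (hf.norm.toLp _) (hg.norm.toLp _)
  rw [L2.inner_def, Lp.norm_toLp, Lp.norm_toLp, eLpNorm_norm, eLpNorm_norm] at h3
  refine le_trans (le_of_eq ?_) h3
  refine integral_congr_ae ?_
  filter_upwards [hf.norm.coeFn_toLp, hg.norm.coeFn_toLp] with x hx hy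
  rw [hx, hy]; simp [mul_comm]

theorem eLpNorm_two_sq {α E : Type*} [MeasurableSpace α] [NormedAddCommGroup E]
    {μ : Measure α} (f : α → E) :
    eLpNorm f 2 μ ^ 2 = ∫⁻ x, ‖f x‖ₑ ^ 2 ∂μ := by
  rw [eLpNorm_eq_lintegral_rpow_enorm_toReal (by norm_num) (by norm_num)]
  have h2 : ∀ a : ℝ≥0∞, (a ^ (1 / 2 : ℝ)) ^ 2 = a := fun a => by
    rw [← ENNReal.rpow_natCast, ← ENNReal.rpow_mul]; norm_num
  simp only [ENNReal.toReal_ofNat]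
  rw [h2]
  refine lintegral_congr fun x => ?_
  rw [← ENNReal.rpow_natCast]; norm_num

theorem memLp_two_iff_lintegral {α E : Type*} [MeasurableSpace α] [NormedAddCommGroup E]
    {μ : Measure α} {f : α → E} (hf : AEStronglyMeasurable f μ) :
    MemLp f 2 μ ↔ ∫⁻ x, ‖f x‖ₑ ^ 2 ∂μ < ⊤ := by
  rw [← eLpNorm_two_sq]
  constructor
  · intro h
    exact ENNReal.pow_lt_top h.2
  · intro h
    refine ⟨hf, ?_⟩
    by_contra h'
    rw [not_lt, top_le_iff] at h'
    rw [h'] at h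
    simp at h

/-! ### Weak derivatives -/

theorem IsTest.memLp {n : ℕ} {φ : Plane → ℝ} (h : IsTest n φ) {μ : Measure Plane}
    [IsFiniteMeasureOnCompacts μ] : MemLp φ 2 μ :=
  h.1.continuous.memLp_of_hasCompactSupport h.2.1

theorem memLp_fderiv_apply {φ : Plane → ℝ} (h : ContDiff ℝ ∞ φ) (hc : HasCompactSupport φ)
    {μ : Measure Plane} [IsFiniteMeasureOnCompacts μ] (y : Plane) :
    MemLp (fun x => fderiv ℝ φ x y) 2 μ := by
  refine Continuous.memLp_of_hasCompactSupport
    ((h.continuous_fderiv (by simp)).clm_apply continuous_const) ?_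
  exact hc.fderiv_apply ℝ y

theorem hasWeakGrad_weakGrad {n : ℕ} {u : Plane → ℝ} (hu : MemH1 n u) :
    MemLp (weakGrad n u) 2 (bulk n) ∧ HasWeakGrad n u (weakGrad n u) := by
  have h := hu.2
  rw [weakGrad, dif_pos h]
  exact h.choose_spec

theorem HasWeakGrad.congr {n : ℕ} {u u' : Plane → ℝ} {G : Plane → Plane}
    (h : HasWeakGrad n u G) (hu : u =ᵐ[bulk n] u') : HasWeakGrad n u' G := by
  intro φ hφ y
  rw [← h φ hφ y]
  refine integral_congr_ae ?_
  filter_upwards [hu] with x hx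
  rw [hx]

theorem MemH1.congr {n : ℕ} {u u' : Plane → ℝ} (h : MemH1 n u) (hu : u =ᵐ[bulk n] u') :
    MemH1 n u' :=
  ⟨(memLp_congr_ae hu).1 h.1, h.2.choose, h.2.choose_spec.1, h.2.choose_spec.2.congr hu⟩

theorem locallyIntegrable_of_memLp {n : ℕ} {f : Plane → ℝ} (hf : MemLp f 2 (bulk n)) :
    LocallyIntegrableOn f (kochDomain n) volume :=
  (show IntegrableOn f (kochDomain n) volume from hf.integrable (by norm_num)).locallyIntegrableOn

theorem ae_eq_zero_of_test {n : ℕ} {f : Plane → ℝ} (hf : MemLp f 2 (bulk n))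
    (h : ∀ φ, IsTest n φ → ∫ x, f x * φ x ∂bulk n = 0) : f =ᵐ[bulk n] 0 := by
  have := (isOpen_kochDomain n).ae_eq_zero_of_integral_contDiff_smul_eq_zero
    (locallyIntegrable_of_memLp hf) (fun φ h1 h2 h3 => ?_)
  · exact (ae_restrict_iff' (measurableSet_kochDomain n)).2 this
  · have h4 := h φ ⟨h1, h2, h3⟩
    rw [bulk, setIntegral_eq_integral_of_forall_compl_eq_zero] at h4
    · simpa [mul_comm] using h4
    · intro x hx
      rw [image_eq_zero_of_notMem_tsupport (fun h => hx (h3 h)), mul_zero]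

/-- Uniqueness of the weak gradient. -/
theorem HasWeakGrad.unique {n : ℕ} {u : Plane → ℝ} {G G' : Plane → Plane}
    (h : HasWeakGrad n u G) (h' : HasWeakGrad n u G') (hG : MemLp G 2 (bulk n))
    (hG' : MemLp G' 2 (bulk n)) : G =ᵐ[bulk n] G' := by
  have key : ∀ y : Plane, ∀ᵐ x ∂bulk n, inner ℝ (G x) y - inner ℝ (G' x) y = 0 := by
    intro y
    have m1 := hG.inner_const (𝕜 := ℝ) y
    have m2 := hG'.inner_const (𝕜 := ℝ) y
    refine ae_eq_zero_of_test (m1.sub m2) fun φ hφ => ?_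
    have e2 : MemLp φ 2 (bulk n) := hφ.memLp
    have h1 := h φ hφ y
    have h2 := h' φ hφ y
    simp only [sub_mul]
    rw [integral_sub (integrable_mul_of_memLp m1 e2) (integrable_mul_of_memLp m2 e2)]
    linarith
  filter_upwards [key (EuclideanSpace.single 0 1), key (EuclideanSpace.single 1 1)] with x h0 h1
  ext i
  fin_cases i
  · simpa [EuclideanSpace.inner_single_right, sub_eq_zero] using h0
  · simpa [EuclideanSpace.inner_single_right, sub_eq_zero] using h1

theorem hasTangentialDeriv_tangentialDeriv {n : ℕ} {u : Plane → ℝ} (hu : MemH1K n u) :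
    MemLp (tangentialDeriv n u) 2 (arcLength n) ∧ HasTangentialDeriv n u (tangentialDeriv n u) := by
  have h := hu.2
  rw [tangentialDeriv, dif_pos h]
  exact h.choose_spec

theorem HasTangentialDeriv.congr {n : ℕ} {u u' g : Plane → ℝ}
    (h : HasTangentialDeriv n u g) (hu : u =ᵐ[arcLength n] u') : HasTangentialDeriv n u' g := by
  intro e he φ h1 h2 h3
  rw [← h e he φ h1 h2 h3]
  refine integral_congr_ae ?_
  filter_upwards [ae_arcLength_iff.1 hu e he] with τ hτ
  rw [hτ]

theorem MemH1K.congr {n : ℕ} {u u' : Plane → ℝ} (h : MemH1K n u) (hu : u =ᵐ[arcLength n] u') :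
    MemH1K n u' :=
  ⟨⟨h.1.choose, h.1.choose_spec.1, hu.symm.trans h.1.choose_spec.2⟩,
    h.2.choose, h.2.choose_spec.1, h.2.choose_spec.2.congr hu⟩

theorem memLp_side {n : ℕ} {g : Plane → ℝ} (hg : MemLp g 2 (arcLength n)) {e : Plane × Plane}
    (he : e ∈ kochSides n) :
    MemLp (fun τ : ℝ => g (AffineMap.lineMap e.1 e.2 τ)) 2 (volume.restrict (Icc (0 : ℝ) 1)) := by
  have hne := ne_of_mem_kochSides he
  have h1 := hg.mono_measure (sideMeasure_le_arcLength he)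
  have hc : ENNReal.ofReal (dist e.1 e.2) ≠ 0 := by simpa using hne
  have h2 : MemLp g 2 ((volume.restrict (Icc (0 : ℝ) 1)).map
      (fun τ : ℝ => (AffineMap.lineMap e.1 e.2 τ : Plane))) := by
    have := h1.smul_measure (c := (ENNReal.ofReal (dist e.1 e.2))⁻¹) (by simpa using hc)
    rwa [sideMeasure, smul_smul, ENNReal.inv_mul_cancel hc ENNReal.ofReal_ne_top, one_smul] at this
  exact ((measurableEmbedding_side hne).memLp_map_measure_iff).1 h2

/-- Uniqueness of the tangential derivative. -/
theorem HasTangentialDeriv.unique {n : ℕ} {u g g' : Plane → ℝ}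
    (h : HasTangentialDeriv n u g) (h' : HasTangentialDeriv n u g') (hg : MemLp g 2 (arcLength n))
    (hg' : MemLp g' 2 (arcLength n)) : g =ᵐ[arcLength n] g' := by
  rw [EventuallyEq, ae_arcLength_iff]
  intro e he
  have m1 := (memLp_side hg he).integrable (by norm_num)
  have m2 := (memLp_side hg' he).integrable (by norm_num)
  have hl := side_length_pos he
  set γ : ℝ → ℝ := fun τ => g (AffineMap.lineMap e.1 e.2 τ) - g' (AffineMap.lineMap e.1 e.2 τ)
    with hγ
  have hi : IntegrableOn γ (Icc 0 1) volume := m1.sub m2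
  have key := (isOpen_Ioo (a := (0 : ℝ)) (b := 1)).ae_eq_zero_of_integral_contDiff_smul_eq_zero
    (f := γ) (μ := volume) (hi.mono_set Ioo_subset_Icc_self).locallyIntegrableOn
    (fun φ h1 h2 h3 => ?_)
  · rw [← Measure.restrict_congr_set Ioo_ae_eq_Icc]
    filter_upwards [(ae_restrict_iff' measurableSet_Ioo).2 key] with τ hτ
    simp only [hγ] at hτ
    linarith
  · have e1 := h e he φ h1 h2 h3
    have e2 := h' e he φ h1 h2 h3
    rw [e1] at e2
    have e3 : ∫ τ in Icc (0 : ℝ) 1, g (AffineMap.lineMap e.1 e.2 τ) * φ τ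
        = ∫ τ in Icc (0 : ℝ) 1, g' (AffineMap.lineMap e.1 e.2 τ) * φ τ := by
      have := neg_injective e2
      exact mul_left_cancel₀ hl.ne' this
    have b1 : MemLp φ 2 (volume.restrict (Icc (0 : ℝ) 1)) :=
      h1.continuous.memLp_of_hasCompactSupport h2
    have e4 : ∫ τ in Icc (0 : ℝ) 1, γ τ * φ τ = 0 := by
      simp only [hγ, sub_mul]
      rw [integral_sub (integrable_mul_of_memLp (memLp_side hg he) b1)
        (integrable_mul_of_memLp (memLp_side hg' he) b1), e3, sub_self]
    rw [setIntegral_eq_integral_of_forall_compl_eq_zero] at e4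
    · simpa [mul_comm] using e4
    · intro x hx
      rw [image_eq_zero_of_notMem_tsupport (fun h => hx (Ioo_subset_Icc_self (h3 h))), mul_zero]


/-! ### Weak derivatives in one variable -/

/-- A test function on `(0, 1)` with zero mean is the derivative of a test function. -/
theorem exists_test_deriv_eq {ψ : ℝ → ℝ} (h1 : ContDiff ℝ ∞ ψ) (h2 : HasCompactSupport ψ)
    (h3 : tsupport ψ ⊆ Ioo 0 1) (h4 : ∫ τ in (0 : ℝ)..1, ψ τ = 0) :
    ∃ φ : ℝ → ℝ, ContDiff ℝ ∞ φ ∧ HasCompactSupport φ ∧ tsupport φ ⊆ Ioo 0 1 ∧ deriv φ = ψ := by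
  have hc : Continuous ψ := h1.continuous
  have hd : ∀ x, HasDerivAt (fun x => ∫ τ in (0 : ℝ)..x, ψ τ) (ψ x) x := fun x =>
    intervalIntegral.integral_hasDerivAt_right (hc.intervalIntegrable _ _)
      hc.aestronglyMeasurable.stronglyMeasurableAtFilter hc.continuousAt
  have hder : deriv (fun x => ∫ τ in (0 : ℝ)..x, ψ τ) = ψ := funext fun x => (hd x).deriv
  obtain ⟨a, b, ha, hb, hab⟩ : ∃ a b : ℝ, 0 < a ∧ b < 1 ∧ tsupport ψ ⊆ Icc a b := by
    rcases (tsupport ψ).eq_empty_or_nonempty with h0 | h0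
    · exact ⟨1 / 2, 1 / 2, by norm_num, by norm_num, by simp [h0]⟩
    · have hK : IsCompact (tsupport ψ) := h2
      exact ⟨sInf (tsupport ψ), sSup (tsupport ψ), (h3 (hK.sInf_mem h0)).1,
        (h3 (hK.sSup_mem h0)).2, fun x hx => ⟨csInf_le hK.bddBelow hx, le_csSup hK.bddAbove hx⟩⟩
  have hz : ∀ x, x ∉ Icc a b → ψ x = 0 := fun x hx =>
    image_eq_zero_of_notMem_tsupport fun h => hx (hab h)
  have hs : tsupport (fun x => ∫ τ in (0 : ℝ)..x, ψ τ) ⊆ Icc a b := by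
    refine closure_minimal ?_ isClosed_Icc
    intro x hx
    by_contra hx'
    apply hx
    rw [mem_Icc, not_and_or, not_le, not_le] at hx'
    rcases hx' with h | h
    · refine (intervalIntegral.integral_congr (g := fun _ => 0) fun y hy => ?_).trans (by simp)
      refine hz y fun hy' => ?_
      have : y ≤ max 0 x := (uIcc_subset_Icc (a₂ := min 0 x) (b₂ := max 0 x)
        ⟨min_le_left _ _, le_max_left _ _⟩ ⟨min_le_right _ _, le_max_right _ _⟩ hy).2
      have : max 0 x < a := max_lt ha h
      linarith [hy'.1]
    -- To the right of the support the primitive equals the total integral, which is zero by `h4`.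
    · have e1 := intervalIntegral.integral_add_adjacent_intervals
        (hc.intervalIntegrable 0 x) (hc.intervalIntegrable (μ := volume) x 1)
      have e2 : ∫ τ in x..1, ψ τ = 0 := by
        refine (intervalIntegral.integral_congr (g := fun _ => 0) fun y hy => ?_).trans (by simp)
        refine hz y fun hy' => ?_
        have : min x 1 ≤ y := (uIcc_subset_Icc (a₂ := min x 1) (b₂ := max x 1)
          ⟨min_le_left _ _, le_max_left _ _⟩ ⟨min_le_right _ _, le_max_right _ _⟩ hy).1
        have : b < min x 1 := lt_min h hb
        linarith [hy'.2]
      change ∫ τ in (0 : ℝ)..x, ψ τ = 0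
      linarith
  refine ⟨_, ?_, ?_, hs.trans fun x hx => ⟨ha.trans_le hx.1, hx.2.trans_lt hb⟩, hder⟩
  · rw [contDiff_infty_iff_deriv, hder]
    exact ⟨fun x => (hd x).differentiableAt, h1⟩
  · exact HasCompactSupport.of_support_subset_isCompact isCompact_Icc
      ((subset_tsupport _).trans hs)

/-- A continuous function with vanishing weak derivative is constant. -/
theorem constant_of_weak_deriv_zero {H : ℝ → ℝ} (hH : ContinuousOn H (Icc 0 1))
    (h : ∀ φ : ℝ → ℝ, ContDiff ℝ ∞ φ → HasCompactSupport φ → tsupport φ ⊆ Ioo 0 1 →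
      ∫ τ in Icc (0 : ℝ) 1, H τ * deriv φ τ = 0) :
    ∃ c, ∀ x ∈ Icc (0 : ℝ) 1, H x = c := by
  let β : ContDiffBump (1 / 2 : ℝ) := ⟨1 / 8, 1 / 4, by norm_num, by norm_num⟩
  set ψ₀ : ℝ → ℝ := β.normed volume with hψ₀
  have b1 : ContDiff ℝ ∞ ψ₀ := β.contDiff_normed
  have b2 : HasCompactSupport ψ₀ := β.hasCompactSupport_normed
  have b3 : tsupport ψ₀ ⊆ Ioo 0 1 := by
    rw [hψ₀, β.tsupport_normed_eq, Real.closedBall_eq_Icc]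
    intro x hx
    simp only [β, mem_Icc] at hx
    constructor <;> linarith [hx.1, hx.2]
  have hint : ∀ φ : ℝ → ℝ, tsupport φ ⊆ Ioo 0 1 →
      ∫ τ in (0 : ℝ)..1, φ τ = ∫ τ, φ τ := by
    intro φ hφ
    rw [intervalIntegral.integral_of_le zero_le_one, setIntegral_eq_integral_of_forall_compl_eq_zero]
    intro x hx
    exact image_eq_zero_of_notMem_tsupport fun h' => hx (Ioo_subset_Ioc_self (hφ h'))
  have b4 : ∫ τ in (0 : ℝ)..1, ψ₀ τ = 1 := by rw [hint _ b3]; exact β.integral_normed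
  have hHi : ∀ φ : ℝ → ℝ, Continuous φ → IntegrableOn (fun τ => H τ * φ τ) (Icc 0 1) := fun φ hφ =>
    (hH.mul hφ.continuousOn).integrableOn_Icc
  set k := ∫ τ in Icc (0 : ℝ) 1, H τ * ψ₀ τ with hk
  have key : ∀ φ : ℝ → ℝ, ContDiff ℝ ∞ φ → HasCompactSupport φ → tsupport φ ⊆ Ioo 0 1 →
      ∫ τ in Icc (0 : ℝ) 1, H τ * φ τ = k * ∫ τ, φ τ := by
    intro φ h1 h2 h3
    set c := ∫ τ, φ τ with hc
    -- Du Bois-Reymond: subtracting the multiple `c ψ₀` of a normalised bump makes the mean zero, so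
    -- the difference is a derivative and `H` annihilates it.
    obtain ⟨Φ, g1, g2, g3, g4⟩ := exists_test_deriv_eq (ψ := fun x => φ x - c * ψ₀ x)
      (h1.sub (contDiff_const.mul b1)) (h2.sub (b2.mul_left))
      ((tsupport_sub _ _).trans (union_subset h3 ((tsupport_mul_subset_right).trans b3)))
      (by
        have i2 : IntervalIntegrable (fun τ => c * ψ₀ τ) volume 0 1 :=
          (continuous_const.mul b1.continuous).intervalIntegrable _ _
        rw [intervalIntegral.integral_sub (h1.continuous.intervalIntegrable _ _) i2,
          intervalIntegral.integral_const_mul, b4, hint _ h3]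
        ring)
    have e1 := h Φ g1 g2 g3
    rw [g4] at e1
    have e2 : ∀ τ, H τ * (φ τ - c * ψ₀ τ) = H τ * φ τ - c * (H τ * ψ₀ τ) := fun τ => by ring
    simp only [e2] at e1
    rw [integral_sub (hHi _ h1.continuous) ((hHi _ b1.continuous).const_mul c),
      integral_const_mul] at e1
    linarith
  have hae := (isOpen_Ioo (a := (0 : ℝ)) (b := 1)).ae_eq_zero_of_integral_contDiff_smul_eq_zero
    (f := fun x => H x - k) (μ := volume)
    ((hH.sub continuousOn_const).integrableOn_Icc.mono_set Ioo_subset_Icc_self).locallyIntegrableOn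
    (fun φ h1 h2 h3 => ?_)
  · refine ⟨k, ?_⟩
    have hd : EqOn H (fun _ => k) (Ioo 0 1) := by
      refine Measure.eqOn_open_of_ae_eq (μ := volume) ?_ isOpen_Ioo
        (hH.mono Ioo_subset_Icc_self) continuousOn_const
      filter_upwards [(ae_restrict_iff' measurableSet_Ioo).2 hae] with x hx
      linarith
    have : EqOn H (fun _ => k) (Icc 0 1) := by
      refine hd.of_subset_closure hH continuousOn_const Ioo_subset_Icc_self ?_
      rw [closure_Ioo (by norm_num)]
    exact fun x hx => this hx
  · have e1 := key φ h1 h2 h3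
    have e2 : ∀ x, x ∉ Icc (0 : ℝ) 1 → φ x • (H x - k) = 0 := fun x hx => by
      rw [image_eq_zero_of_notMem_tsupport fun h' => hx (Ioo_subset_Icc_self (h3 h')), zero_smul]
    rw [← setIntegral_eq_integral_of_forall_compl_eq_zero e2]
    have e3 : ∀ x, φ x • (H x - k) = H x * φ x - k * φ x := fun x => by
      rw [smul_eq_mul]; ring
    simp only [e3]
    rw [integral_sub (hHi _ h1.continuous) (h1.continuous.continuousOn.integrableOn_Icc.const_mul k),
      integral_const_mul, e1, integral_Icc_eq_integral_Ioc, ← intervalIntegral.integral_of_le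
        zero_le_one, hint _ h3, sub_self]

/-- A continuous function on `[0, 1]` is the integral of its weak derivative. -/
theorem sub_eq_integral_of_weak_deriv {h γ : ℝ → ℝ} (hh : ContinuousOn h (Icc 0 1))
    (hγ : IntegrableOn γ (Icc 0 1))
    (hw : ∀ φ : ℝ → ℝ, ContDiff ℝ ∞ φ → HasCompactSupport φ → tsupport φ ⊆ Ioo 0 1 →
      ∫ τ in Icc (0 : ℝ) 1, h τ * deriv φ τ = -∫ τ in Icc (0 : ℝ) 1, γ τ * φ τ)
    {a b : ℝ} (ha : a ∈ Icc (0 : ℝ) 1) (hb : b ∈ Icc (0 : ℝ) 1) :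
    h b - h a = ∫ τ in a..b, γ τ := by
  have hγi : IntervalIntegrable γ volume 0 1 := by
    rwa [intervalIntegrable_iff_integrableOn_Icc_of_le zero_le_one]
  have hac := hγi.absolutelyContinuousOnInterval_intervalIntegral (c := 0) (by simp)
  have hIc : ContinuousOn (fun x => ∫ v in (0 : ℝ)..x, γ v) (Icc 0 1) := by
    have := hac.continuousOn
    rwa [uIcc_of_le zero_le_one] at this
  have hder : ∀ᵐ x, x ∈ uIcc (0 : ℝ) 1 → deriv (fun x => ∫ v in (0 : ℝ)..x, γ v) x = γ x := by
    filter_upwards [hγi.ae_hasDerivAt_integral] with x hx hx'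
    exact (hx hx' 0 (by simp)).deriv
  -- The primitive of `γ` is absolutely continuous, so integration by parts shows that it has weak
  -- derivative `γ`; hence `h` minus it has weak derivative zero.
  obtain ⟨c, hc⟩ := constant_of_weak_deriv_zero (H := fun x => h x - ∫ v in (0 : ℝ)..x, γ v)
    (hh.sub hIc) (fun φ h1 h2 h3 => by
      have e1 := hw φ h1 h2 h3
      have hdφ : Continuous (deriv φ) := h1.continuous_deriv (by simp)
      have hφac : AbsolutelyContinuousOnInterval φ 0 1 :=
        ContDiffOn.absolutelyContinuousOnInterval ((h1.of_le (by simp)).contDiffOn)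
      have e2 := hac.integral_mul_deriv_eq_deriv_mul hφac
      have z0 : φ 0 = 0 := image_eq_zero_of_notMem_tsupport fun h' => (h3 h').1.false
      have z1 : φ 1 = 0 := image_eq_zero_of_notMem_tsupport fun h' => (h3 h').2.false
      rw [z0, z1, mul_zero, mul_zero, sub_zero, zero_sub] at e2
      have e3 : ∫ x in (0 : ℝ)..1, deriv (fun x => ∫ v in (0 : ℝ)..x, γ v) x * φ x
          = ∫ x in (0 : ℝ)..1, γ x * φ x := by
        refine intervalIntegral.integral_congr_ae ?_
        filter_upwards [hder] with x hx hx'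
        rw [hx (uIoc_subset_uIcc hx')]
      rw [e3, intervalIntegral.integral_of_le zero_le_one, intervalIntegral.integral_of_le
        zero_le_one, ← integral_Icc_eq_integral_Ioc, ← integral_Icc_eq_integral_Ioc] at e2
      have i1 : IntegrableOn (fun τ => h τ * deriv φ τ) (Icc 0 1) :=
        (hh.mul hdφ.continuousOn).integrableOn_Icc
      have i2 : IntegrableOn (fun τ => (∫ v in (0 : ℝ)..τ, γ v) * deriv φ τ) (Icc 0 1) :=
        (hIc.mul hdφ.continuousOn).integrableOn_Icc
      simp only [sub_mul]
      rw [integral_sub i1 i2, e1, e2, sub_self])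
  have ea : h a - _ = c := hc a ha
  have eb : h b - _ = c := hc b hb
  have e : (∫ v in (0 : ℝ)..a, γ v) + ∫ v in a..b, γ v = ∫ v in (0 : ℝ)..b, γ v := by
    refine intervalIntegral.integral_add_adjacent_intervals ?_ ?_
    · exact hγi.mono_set (by rw [uIcc_of_le ha.1, uIcc_of_le zero_le_one]; exact Icc_subset_Icc_right ha.2)
    · refine hγi.mono_set ?_
      rw [uIcc_of_le zero_le_one]
      exact uIcc_subset_Icc ha hb
  linarith


/-! ### `H¹(K_n)` is contained in `H^{1/2}(K_n)` -/

/-- The integrable kernel `|x|^{-1/2}` on the line. -/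
def invSqrt (x : ℝ) : ℝ≥0∞ := ENNReal.ofReal (|x| ^ (-(1 / 2) : ℝ))

theorem measurable_invSqrt : Measurable invSqrt := by unfold invSqrt; fun_prop

theorem invSqrt_neg (x : ℝ) : invSqrt (-x) = invSqrt x := by simp [invSqrt]

theorem lintegral_invSqrt_lt_top (R : ℝ) : ∫⁻ x in Icc (-R) R, invSqrt x < ⊤ := by
  have h : IntegrableOn (fun x : ℝ => |x| ^ (-(1 / 2) : ℝ)) (Icc (-R) R) := by
    rcases lt_or_ge R 0 with hR | hR
    · rw [Icc_eq_empty (by linarith)]; exact integrableOn_empty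
    rw [← intervalIntegrable_iff_integrableOn_Icc_of_le (f := fun x : ℝ => |x| ^ (-(1 / 2) : ℝ))
      (by linarith)]
    have h1 : IntervalIntegrable (fun x : ℝ => |x| ^ (-(1 / 2) : ℝ)) volume 0 R := by
      have := intervalIntegral.intervalIntegrable_rpow' (a := 0) (b := R) (r := (-(1 / 2) : ℝ))
        (by norm_num)
      refine this.congr ?_
      intro x hx
      rw [uIoc_of_le hR] at hx
      simp only [abs_of_pos hx.1]
    have h2 : IntervalIntegrable (fun x : ℝ => |x| ^ (-(1 / 2) : ℝ)) volume 0 (-R) := by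
      rw [IntervalIntegrable.iff_comp_neg]
      simpa using h1
    exact h2.symm.trans h1
  exact h.lintegral_lt_top

theorem lintegral_invSqrt_sub_le {c : ℝ} (hc : c ∈ Icc (0 : ℝ) 1) :
    ∫⁻ a in Icc (0 : ℝ) 1, invSqrt (a - c) ≤ ∫⁻ x in Icc (-1 : ℝ) 1, invSqrt x := by
  rw [← lintegral_indicator measurableSet_Icc, ← lintegral_indicator measurableSet_Icc,
    ← lintegral_sub_right_eq_self ((Icc (-1 : ℝ) 1).indicator invSqrt) c]
  refine lintegral_mono fun a => ?_
  by_cases ha : a ∈ Icc (0 : ℝ) 1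
  · rw [indicator_of_mem ha, indicator_of_mem]
    exact ⟨by linarith [ha.1, hc.2], by linarith [ha.2, hc.1]⟩
  · rw [indicator_of_notMem ha]; exact zero_le

theorem invSqrt_of_pos {x : ℝ} (hx : 0 < x) : invSqrt x = ENNReal.ofReal (1 / √x) := by
  rw [invSqrt, abs_of_pos hx, Real.rpow_neg hx.le, Real.sqrt_eq_rpow]; simp only [one_div]

/-- Cauchy-Schwarz applied to `∫ γ`. The energy is kept on `(a, b)` only, which is essential for the
double integral below. -/
theorem enorm_sub_sq_le {h γ : ℝ → ℝ} (hγ : IntegrableOn γ (Icc 0 1)) {a b : ℝ}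
    (ha : 0 ≤ a) (hab : a ≤ b) (hb : b ≤ 1) (hd : h b - h a = ∫ τ in a..b, γ τ) :
    ‖h a - h b‖ₑ ^ 2 ≤ ENNReal.ofReal (b - a) * ∫⁻ τ in Ioo a b, ‖γ τ‖ₑ ^ 2 := by
  have hm : AEMeasurable γ (volume.restrict (Ioo a b)) :=
    (hγ.mono_set (Ioo_subset_Icc_self.trans (Icc_subset_Icc ha hb))).aemeasurable
  have h1 : ‖h a - h b‖ₑ ≤ ∫⁻ τ in Ioo a b, ‖γ τ‖ₑ := by
    rw [← enorm_neg, neg_sub, hd, intervalIntegral.integral_of_le hab, integral_Ioc_eq_integral_Ioo]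
    exact enorm_integral_le_lintegral_enorm _
  have h2 := lintegral_mul_sq_le (μ := volume.restrict (Ioo a b)) (f := fun _ => 1)
    (g := fun τ => ‖γ τ‖ₑ) aemeasurable_const hm.enorm
  simp only [one_mul, one_pow, lintegral_const, Measure.restrict_apply MeasurableSet.univ,
    univ_inter, Real.volume_Ioo] at h2
  exact (pow_le_pow_left' h1 2).trans h2

/-- The Gagliardo integral over one side. -/
theorem lintegral_quotient_lt_top {h γ : ℝ → ℝ} (hγ : MemLp γ 2 (volume.restrict (Icc 0 1)))
    (hd : ∀ a ∈ Icc (0 : ℝ) 1, ∀ b ∈ Icc (0 : ℝ) 1, h b - h a = ∫ τ in a..b, γ τ) :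
    ∫⁻ a in Icc (0 : ℝ) 1, ∫⁻ b in Icc (0 : ℝ) 1, ‖(h a - h b) / (a - b)‖ₑ ^ 2 < ⊤ := by
  have hγi : IntegrableOn γ (Icc 0 1) := hγ.integrable (by norm_num)
  have hγ2 := (memLp_two_iff_lintegral hγ.1).1 hγ
  set M := ∫⁻ x in Icc (-1 : ℝ) 1, invSqrt x with hM
  have hMt : M < ⊤ := lintegral_invSqrt_lt_top 1
  -- The squared quotient is at most `(b - a)⁻¹ ∫_a^b |γ|²`, and for `c` between `a` and `b` the
  -- factor `(b - a)⁻¹` is dominated by `|a - c|^{-1/2} |b - c|^{-1/2}`. This separates the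
  -- variables into integrable singularities.
  have key : ∀ a b : ℝ, 0 ≤ a → a < b → b ≤ 1 → ‖(h a - h b) / (a - b)‖ₑ ^ 2 ≤
      ∫⁻ c in Icc (0 : ℝ) 1, ‖γ c‖ₑ ^ 2 * (invSqrt (a - c) * invSqrt (b - c)) := by
    intro a b ha hab hb
    have hba : 0 < b - a := by linarith
    have h1 := enorm_sub_sq_le hγi ha hab.le hb (hd a ⟨ha, by linarith⟩ b ⟨by linarith, hb⟩)
    have h2 : ‖(h a - h b) / (a - b)‖ₑ ^ 2
        ≤ ENNReal.ofReal ((b - a)⁻¹) * ∫⁻ τ in Ioo a b, ‖γ τ‖ₑ ^ 2 := by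
      rw [div_eq_mul_inv, enorm_mul, mul_pow]
      calc ‖h a - h b‖ₑ ^ 2 * ‖(a - b)⁻¹‖ₑ ^ 2
          ≤ (ENNReal.ofReal (b - a) * ∫⁻ τ in Ioo a b, ‖γ τ‖ₑ ^ 2) * ‖(a - b)⁻¹‖ₑ ^ 2 := by
            gcongr
        _ = (ENNReal.ofReal (b - a) * ‖(a - b)⁻¹‖ₑ ^ 2) * ∫⁻ τ in Ioo a b, ‖γ τ‖ₑ ^ 2 := by ring
        _ = _ := by
          congr 1
          rw [Real.enorm_eq_ofReal_abs, ← ENNReal.ofReal_pow (abs_nonneg _), sq_abs,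
            ← ENNReal.ofReal_mul hba.le]
          congr 1
          have : a - b ≠ 0 := by linarith
          field_simp
          ring
    refine h2.trans ?_
    rw [← lintegral_const_mul' _ _ ENNReal.ofReal_ne_top]
    refine le_trans ?_ (lintegral_mono_set
      (show Ioo a b ⊆ Icc 0 1 from Ioo_subset_Icc_self.trans (Icc_subset_Icc ha hb)))
    refine setLIntegral_mono' measurableSet_Ioo fun c hc => ?_
    rw [mul_comm]
    gcongr
    have hc1 : 0 < c - a := by linarith [hc.1]
    have hc2 : 0 < b - c := by linarith [hc.2]
    rw [← invSqrt_neg, neg_sub, invSqrt_of_pos hc1, invSqrt_of_pos hc2,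
      ← ENNReal.ofReal_mul (by positivity)]
    refine ENNReal.ofReal_le_ofReal ?_
    -- Arithmetic-geometric mean: the two lengths add up to `b - a`.
    have s1 : √(c - a) * √(b - c) ≤ b - a := by
      nlinarith [sq_nonneg (√(c - a) - √(b - c)), Real.sq_sqrt hc1.le, Real.sq_sqrt hc2.le]
    rw [div_mul_div_comm, one_mul, inv_eq_one_div]
    exact one_div_le_one_div_of_le (by positivity) s1
  have key' : ∀ a ∈ Icc (0 : ℝ) 1, ∀ b ∈ Icc (0 : ℝ) 1, ‖(h a - h b) / (a - b)‖ₑ ^ 2 ≤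
      ∫⁻ c in Icc (0 : ℝ) 1, ‖γ c‖ₑ ^ 2 * (invSqrt (a - c) * invSqrt (b - c)) := by
    intro a ha b hb
    rcases lt_trichotomy a b with hab | hab | hab
    · exact key a b ha.1 hab hb.2
    · subst hab; simp
    · have := key b a hb.1 hab ha.2
      rw [← neg_sub (h a), ← neg_sub a, neg_div_neg_eq] at this
      refine this.trans (le_of_eq ?_)
      refine lintegral_congr fun c => ?_
      rw [mul_comm (invSqrt (b - c))]
  have hmk : AEMeasurable (fun c => ‖γ c‖ₑ ^ 2) (volume.restrict (Icc (0 : ℝ) 1)) :=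
    hγ.1.aemeasurable.enorm.pow_const 2
  have hms : ∀ c : ℝ, Measurable fun a : ℝ => invSqrt (a - c) := fun c =>
    measurable_invSqrt.comp (measurable_id.sub measurable_const)
  have hk1 : Measurable fun p : ℝ × ℝ => invSqrt (p.1 - p.2) :=
    measurable_invSqrt.comp (measurable_fst.sub measurable_snd)
  -- The dominating kernel is a product in `a` and `b`: by Tonelli, each of these integrations costs
  -- a factor `M` and what remains is `∫ |γ|²`.
  calc ∫⁻ a in Icc (0 : ℝ) 1, ∫⁻ b in Icc (0 : ℝ) 1, ‖(h a - h b) / (a - b)‖ₑ ^ 2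
      ≤ ∫⁻ a in Icc (0 : ℝ) 1, ∫⁻ b in Icc (0 : ℝ) 1, ∫⁻ c in Icc (0 : ℝ) 1,
          ‖γ c‖ₑ ^ 2 * (invSqrt (a - c) * invSqrt (b - c)) := by
        refine setLIntegral_mono' measurableSet_Icc fun a ha => ?_
        exact setLIntegral_mono' measurableSet_Icc fun b hb => key' a ha b hb
    _ = ∫⁻ a in Icc (0 : ℝ) 1, ∫⁻ c in Icc (0 : ℝ) 1, ∫⁻ b in Icc (0 : ℝ) 1,
          ‖γ c‖ₑ ^ 2 * (invSqrt (a - c) * invSqrt (b - c)) := by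
        refine lintegral_congr fun a => ?_
        refine lintegral_lintegral_swap ?_
        refine (hmk.comp_snd).mul (AEMeasurable.mul ?_ hk1.aemeasurable)
        exact ((measurable_invSqrt.comp (measurable_const.sub measurable_id)).comp
          measurable_snd).aemeasurable
    _ ≤ ∫⁻ a in Icc (0 : ℝ) 1, ∫⁻ c in Icc (0 : ℝ) 1, M * (‖γ c‖ₑ ^ 2 * invSqrt (a - c)) := by
        refine lintegral_mono fun a => ?_
        refine setLIntegral_mono' measurableSet_Icc fun c hc => ?_
        simp only [← mul_assoc]
        rw [lintegral_const_mul _ (hms c),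
          mul_assoc M, mul_comm M]
        gcongr
        exact lintegral_invSqrt_sub_le hc
    _ = ∫⁻ c in Icc (0 : ℝ) 1, ∫⁻ a in Icc (0 : ℝ) 1, M * (‖γ c‖ₑ ^ 2 * invSqrt (a - c)) := by
        refine lintegral_lintegral_swap ?_
        exact ((hmk.comp_snd).mul hk1.aemeasurable).const_mul M
    _ ≤ ∫⁻ c in Icc (0 : ℝ) 1, M * M * ‖γ c‖ₑ ^ 2 := by
        refine setLIntegral_mono' measurableSet_Icc fun c hc => ?_
        simp only [← mul_assoc]
        rw [lintegral_const_mul _ (hms c),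
          mul_right_comm]
        gcongr
        exact lintegral_invSqrt_sub_le hc
    _ = M * M * ∫⁻ c in Icc (0 : ℝ) 1, ‖γ c‖ₑ ^ 2 :=
        lintegral_const_mul' _ _ (ENNReal.mul_lt_top hMt hMt).ne
    _ < ⊤ := ENNReal.mul_lt_top (ENNReal.mul_lt_top hMt hMt) hγ2

theorem exists_pos_le_dist_of_finite {S : Set Plane} (hS : S.Finite) :
    ∃ δ > 0, ∀ p ∈ S, ∀ q ∈ S, p ≠ q → δ ≤ dist p q := by
  rcases (S.offDiag).eq_empty_or_nonempty with h | h
  · refine ⟨1, one_pos, fun p hp q hq hpq => ?_⟩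
    have : (p, q) ∈ S.offDiag := ⟨hp, hq, hpq⟩
    rw [h] at this; exact this.elim
  · obtain ⟨z, hz, hmin⟩ := Set.exists_min_image S.offDiag (fun z => dist z.1 z.2) hS.offDiag h
    exact ⟨dist z.1 z.2, dist_pos.2 hz.2.2, fun p hp q hq hpq => hmin (p, q) ⟨hp, hq, hpq⟩⟩

theorem exists_nearest_endpoint (e : Plane × Plane) {a : ℝ} :
    ∃ c : ℝ, (c = 0 ∨ c = 1) ∧ |a - c| ≤ |min a (1 - a)| ∧
      ((AffineMap.lineMap e.1 e.2 c : Plane) = e.1 ∨ (AffineMap.lineMap e.1 e.2 c : Plane) = e.2) := by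
  rcases le_total a (1 - a) with h | h
  · exact ⟨0, Or.inl rfl, by rw [min_eq_left h, sub_zero], Or.inl (by simp)⟩
  · exact ⟨1, Or.inr rfl, by rw [min_eq_right h, abs_sub_comm], Or.inr (by simp)⟩

/-- Two different sides: the difference quotient has an integrable singularity at a common
vertex. -/
theorem exists_diffQuot_sq_le {n : ℕ} {w : Plane → ℝ} {B S : ℝ}
    (hB : ∀ e ∈ kochSides n, ∀ a ∈ Icc (0 : ℝ) 1, ∀ b ∈ Icc (0 : ℝ) 1,
      (w (AffineMap.lineMap e.1 e.2 a) - w (AffineMap.lineMap e.1 e.2 b)) ^ 2 ≤ B * |a - b|)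
    (hS : ∀ x ∈ kochCurve n, |w x| ≤ S)
    {e e' : Plane × Plane} (he : e ∈ kochSides n) (he' : e' ∈ kochSides n) (hne : e ≠ e') :
    ∃ C, 0 ≤ C ∧ ∀ a ∈ Ioo (0 : ℝ) 1, ∀ b ∈ Ioo (0 : ℝ) 1,
      diffQuot w (AffineMap.lineMap e.1 e.2 a, AffineMap.lineMap e'.1 e'.2 b) ^ 2
        ≤ C * (1 / √(min a (1 - a)) * (1 / √(min b (1 - b)))) := by
  obtain ⟨δ, hδ, hsep⟩ := exists_pos_le_dist_of_finite (finite_vertices n)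
  have hl := side_length_pos he
  have hl' := side_length_pos he'
  set l := dist e.1 e.2
  set l' := dist e'.1 e'.2
  have hB0 : 0 ≤ B := by
    have := (sq_nonneg _).trans (hB e he 0 (by simp) 1 (by simp))
    simpa using this
  set κ := min l l' / 2 with hκ
  have hκ0 : 0 < κ := by positivity
  have hS0 : 0 ≤ S := (abs_nonneg _).trans (hS _ (side_mem_kochCurve he (left_mem_Icc.2 zero_le_one)))
  -- The first term serves pairs whose nearest endpoints coincide, the second pairs whose nearest
  -- endpoints are different vertices.
  refine ⟨4 * B / κ ^ 2 + 100 * S ^ 2 / δ ^ 2, by positivity, fun a ha b hb => ?_⟩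
  set x : Plane := AffineMap.lineMap e.1 e.2 a with hx
  set y : Plane := AffineMap.lineMap e'.1 e'.2 b with hy
  set m := min a (1 - a) with hm
  set m' := min b (1 - b) with hm'
  have hm0 : 0 < m := lt_min ha.1 (by linarith [ha.2])
  have hm0' : 0 < m' := lt_min hb.1 (by linarith [hb.2])
  have hm1 : m ≤ 1 := (min_le_left _ _).trans ha.2.le
  have hm1' : m' ≤ 1 := (min_le_left _ _).trans hb.2.le
  have d1 : l * m / 2 ≤ dist x y := le_dist_side he he' hne hb
  have d2 : l' * m' / 2 ≤ dist x y := by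
    rw [dist_comm]; exact le_dist_side he' he hne.symm ha
  have hxy : 0 < dist x y := lt_of_lt_of_le (by positivity) d1
  have hP : 0 < √m * √m' := by positivity
  have hPm : √m * √m' ≤ max m m' := by
    have : √m * √m' ≤ √(max m m') * √(max m m') := by gcongr <;> simp
    rwa [Real.mul_self_sqrt (by positivity)] at this
  have hP1 : √m * √m' ≤ 1 := hPm.trans (max_le hm1 hm1')
  rw [diffQuot, div_pow, div_mul_div_comm, one_mul, mul_one_div]
  rw [div_le_div_iff₀ (by positivity) hP]
  obtain ⟨c, hc, hac, hce⟩ := exists_nearest_endpoint e (a := a)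
  obtain ⟨c', hc', hac', hce'⟩ := exists_nearest_endpoint e' (a := b)
  rw [← hm, abs_of_pos hm0] at hac
  rw [← hm', abs_of_pos hm0'] at hac'
  have hcI : c ∈ Icc (0 : ℝ) 1 := by rcases hc with rfl | rfl <;> simp
  have hcI' : c' ∈ Icc (0 : ℝ) 1 := by rcases hc' with rfl | rfl <;> simp
  set p : Plane := AffineMap.lineMap e.1 e.2 c with hp
  set p' : Plane := AffineMap.lineMap e'.1 e'.2 c' with hp'
  have hpv : p ∈ vertices n := ⟨e, he, hce⟩
  have hpv' : p' ∈ vertices n := ⟨e', he', hce'⟩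
  by_cases hpp : p = p'
  -- Common vertex: going through it, the Hölder bound gives a numerator at most `4 B max(m, m')`.
  -- The separation of the sides gives distance at least `κ max(m, m')`, and `√m √m' ≤ max(m, m')`.
  · have q1 := hB e he a (Ioo_subset_Icc_self ha) c hcI
    have q2 := hB e' he' b (Ioo_subset_Icc_self hb) c' hcI'
    rw [← hp, ← hx] at q1
    rw [← hp', ← hpp, ← hy] at q2
    have q3 : (w x - w y) ^ 2 ≤ 4 * B * max m m' := by
      have r1 : B * |a - c| ≤ B * max m m' :=
        mul_le_mul_of_nonneg_left (hac.trans (le_max_left _ _)) hB0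
      have r2 : B * |b - c'| ≤ B * max m m' :=
        mul_le_mul_of_nonneg_left (hac'.trans (le_max_right _ _)) hB0
      nlinarith [sq_nonneg ((w x - w p) + (w y - w p))]
    have q4 : κ * max m m' ≤ dist x y := by
      rcases max_choice m m' with h | h <;> rw [h]
      · refine le_trans ?_ d1
        have : min l l' ≤ l := min_le_left _ _
        rw [hκ]; nlinarith
      · refine le_trans ?_ d2
        have : min l l' ≤ l' := min_le_right _ _
        rw [hκ]; nlinarith
    have hmm : 0 < max m m' := lt_max_of_lt_left hm0
    calc (w x - w y) ^ 2 * (√m * √m') ≤ (4 * B * max m m') * max m m' := by gcongr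
      _ = 4 * B / κ ^ 2 * (κ * max m m') ^ 2 := by field_simp
      _ ≤ 4 * B / κ ^ 2 * dist x y ^ 2 := by gcongr
      _ ≤ _ := by
        gcongr
        have : 0 ≤ 100 * S ^ 2 / δ ^ 2 := by positivity
        linarith
  -- Each point is within twice `dist x y` of its nearest endpoint, whence `2 + 1 + 2`. Since
  -- different vertices are `δ` apart, `x` and `y` stay apart and boundedness of `w` suffices.
  · have q1 : dist p p' ≤ 5 * dist x y := by
      have t1 : dist p x = |c - a| * l := by rw [hp, hx, dist_lineMap_lineMap, Real.dist_eq]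
      have t2 : dist y p' = |b - c'| * l' := by rw [hp', hy, dist_lineMap_lineMap, Real.dist_eq]
      have t3 : dist p p' ≤ dist p x + dist x y + dist y p' := dist_triangle4 _ _ _ _
      rw [abs_sub_comm] at t1
      nlinarith
    have q2 := hsep p hpv p' hpv' hpp
    have s1 := hS x (side_mem_kochCurve he (Ioo_subset_Icc_self ha))
    have s2 := hS y (side_mem_kochCurve he' (Ioo_subset_Icc_self hb))
    have q3 : (w x - w y) ^ 2 ≤ 4 * S ^ 2 := by
      have : |w x - w y| ≤ 2 * S := (abs_sub _ _).trans (by linarith)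
      calc (w x - w y) ^ 2 = |w x - w y| ^ 2 := (sq_abs _).symm
        _ ≤ (2 * S) ^ 2 := by gcongr
        _ = _ := by ring
    calc (w x - w y) ^ 2 * (√m * √m') ≤ 4 * S ^ 2 * 1 := by gcongr
      _ = 4 * S ^ 2 / δ ^ 2 * δ ^ 2 := by field_simp
      _ ≤ 4 * S ^ 2 / δ ^ 2 * (5 * dist x y) ^ 2 := by gcongr; linarith
      _ = 100 * S ^ 2 / δ ^ 2 * dist x y ^ 2 := by ring
      _ ≤ _ := by
        gcongr
        have : 0 ≤ 4 * B / κ ^ 2 := by positivity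
        linarith

theorem lintegral_inv_sqrt_min_lt_top :
    ∫⁻ a in Ioo (0 : ℝ) 1, ENNReal.ofReal (1 / √(min a (1 - a))) < ⊤ := by
  have h : ∀ a ∈ Ioo (0 : ℝ) 1, ENNReal.ofReal (1 / √(min a (1 - a)))
      ≤ invSqrt (a - 0) + invSqrt (a - 1) := by
    intro a ha
    have h1 : 0 < 1 - a := by linarith [ha.2]
    rcases min_choice a (1 - a) with h | h
    · rw [h, sub_zero, invSqrt_of_pos ha.1]; exact le_self_add
    · rw [h, ← invSqrt_neg (a - 1), neg_sub, invSqrt_of_pos h1]; exact le_add_self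
  calc ∫⁻ a in Ioo (0 : ℝ) 1, ENNReal.ofReal (1 / √(min a (1 - a)))
      ≤ ∫⁻ a in Ioo (0 : ℝ) 1, (invSqrt (a - 0) + invSqrt (a - 1)) :=
        setLIntegral_mono' measurableSet_Ioo h
    _ ≤ ∫⁻ a in Icc (0 : ℝ) 1, (invSqrt (a - 0) + invSqrt (a - 1)) :=
        lintegral_mono_set Ioo_subset_Icc_self
    _ = (∫⁻ a in Icc (0 : ℝ) 1, invSqrt (a - 0)) + ∫⁻ a in Icc (0 : ℝ) 1, invSqrt (a - 1) :=
        lintegral_add_left (measurable_invSqrt.comp (measurable_id.sub measurable_const)) _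
    _ < ⊤ := ENNReal.add_lt_top.2
        ⟨(lintegral_invSqrt_sub_le (by simp)).trans_lt (lintegral_invSqrt_lt_top 1),
          (lintegral_invSqrt_sub_le (by simp)).trans_lt (lintegral_invSqrt_lt_top 1)⟩

theorem memLp_arcLength_of_memH1K {n : ℕ} {u : Plane → ℝ} (hu : MemH1K n u) :
    MemLp u 2 (arcLength n) := by
  obtain ⟨⟨w, hw, huw⟩, -⟩ := hu
  obtain ⟨S, hS⟩ := (isCompact_kochCurve n).exists_bound_of_continuousOn hw
  have hres : arcLength n = (arcLength n).restrict (kochCurve n) :=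
    (Measure.restrict_eq_self_of_ae_mem (ae_mem_kochCurve n)).symm
  have hm : AEStronglyMeasurable w (arcLength n) := by
    rw [hres]
    exact hw.aestronglyMeasurable (isCompact_kochCurve n).isClosed.measurableSet
  refine (memLp_congr_ae huw).2 (MemLp.of_bound hm S ?_)
  filter_upwards [ae_mem_kochCurve n] with x hx using hS x hx

instance finite_sum_sideMeasure (l : List (Plane × Plane)) :
    IsFiniteMeasure (l.map sideMeasure).sum := by
  induction l with
  | nil => simpa using (inferInstance : IsFiniteMeasure (0 : Measure Plane))
  | cons a l ih =>
    simp only [List.map_cons, List.sum_cons]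
    infer_instance

theorem lintegral_arcLength_prod_ne_top {n : ℕ} {f : Plane × Plane → ℝ≥0∞}
    (h : ∀ e ∈ kochSides n, ∀ e' ∈ kochSides n,
      ∫⁻ p, f p ∂(sideMeasure e).prod (sideMeasure e') ≠ ⊤) :
    ∫⁻ p, f p ∂(arcLength n).prod (arcLength n) ≠ ⊤ := by
  have h1 : ∀ l : List (Plane × Plane), ∀ e : Plane × Plane,
      (∀ e' ∈ l, ∫⁻ p, f p ∂(sideMeasure e).prod (sideMeasure e') ≠ ⊤) →
      ∫⁻ p, f p ∂(sideMeasure e).prod (l.map sideMeasure).sum ≠ ⊤ := by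
    intro l e
    induction l with
    | nil => simp
    | cons a l ih =>
      intro hl
      simp only [List.map_cons, List.sum_cons]
      rw [Measure.prod_add, lintegral_add_measure]
      exact ENNReal.add_ne_top.2 ⟨hl a (by simp), ih fun e' he' => hl e' (by simp [he'])⟩
  have h2 : ∀ l l' : List (Plane × Plane),
      (∀ e ∈ l, ∀ e' ∈ l', ∫⁻ p, f p ∂(sideMeasure e).prod (sideMeasure e') ≠ ⊤) →
      ∫⁻ p, f p ∂(l.map sideMeasure).sum.prod (l'.map sideMeasure).sum ≠ ⊤ := by
    intro l l'
    induction l with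
    | nil => simp
    | cons a l ih =>
      intro hl
      simp only [List.map_cons, List.sum_cons]
      rw [Measure.add_prod, lintegral_add_measure]
      exact ENNReal.add_ne_top.2 ⟨h1 l' a (hl a (by simp)), ih fun e he => hl e (by simp [he])⟩
  exact h2 _ _ h

/-- The double integral splits over pairs of sides. On a single side it is bounded by the energy of
the tangential derivative (`lintegral_quotient_lt_top`). For two different sides, continuity at a
common vertex together with Hölder continuity of exponent `1/2` leaves a product of integrable
singularities (`exists_diffQuot_sq_le`). -/
theorem memLp_diffQuot_of_memH1K {n : ℕ} {u : Plane → ℝ} (hu : MemH1K n u) :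
    MemLp (diffQuot u) 2 ((arcLength n).prod (arcLength n)) := by
  have hu2 := memLp_arcLength_of_memH1K hu
  have hmeas : AEStronglyMeasurable (diffQuot u) ((arcLength n).prod (arcLength n)) := by
    unfold diffQuot
    have h1 : AEStronglyMeasurable (fun p : Plane × Plane => u p.1)
        ((arcLength n).prod (arcLength n)) := hu2.1.comp_fst
    have h2 : AEStronglyMeasurable (fun p : Plane × Plane => u p.2)
        ((arcLength n).prod (arcLength n)) := hu2.1.comp_snd
    have h3 : Measurable fun p : Plane × Plane => dist p.1 p.2 := continuous_dist.measurable
    exact ((h1.sub h2).aemeasurable.div h3.aemeasurable).aestronglyMeasurable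
  obtain ⟨⟨w, hw, huw⟩, g, hg, hgw⟩ := hu
  have hgw := hgw.congr huw
  refine (memLp_two_iff_lintegral hmeas).2 ?_
  rw [lintegral_congr_ae (g := fun p => ‖diffQuot w p‖ₑ ^ 2) (by
    filter_upwards [diffQuot_congr huw] with p hp
    rw [hp])]
  -- one side
  have hcont : ∀ e ∈ kochSides n,
      ContinuousOn (fun a : ℝ => w (AffineMap.lineMap e.1 e.2 a)) (Icc 0 1) := by
    intro e he
    exact hw.comp (AffineMap.lineMap_continuous).continuousOn fun a ha => side_mem_kochCurve he ha
  have hγ : ∀ e ∈ kochSides n, MemLp (fun τ : ℝ => dist e.1 e.2 * g (AffineMap.lineMap e.1 e.2 τ)) 2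
      (volume.restrict (Icc (0 : ℝ) 1)) := fun e he => (memLp_side hg he).const_mul _
  have hd : ∀ e ∈ kochSides n, ∀ a ∈ Icc (0 : ℝ) 1, ∀ b ∈ Icc (0 : ℝ) 1,
      w (AffineMap.lineMap e.1 e.2 b) - w (AffineMap.lineMap e.1 e.2 a)
        = ∫ τ in a..b, dist e.1 e.2 * g (AffineMap.lineMap e.1 e.2 τ) := by
    intro e he a ha b hb
    refine sub_eq_integral_of_weak_deriv (h := fun a : ℝ => w (AffineMap.lineMap e.1 e.2 a))
      (hcont e he) ((hγ e he).integrable (by norm_num)) (fun φ h1 h2 h3 => ?_) ha hb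
    rw [hgw e he φ h1 h2 h3, ← integral_const_mul]
    simp only [mul_assoc]
  obtain ⟨S, hS⟩ := (isCompact_kochCurve n).exists_bound_of_continuousOn hw
  -- Hölder continuity of exponent `1/2` on each side; as there are finitely many sides, one
  -- constant `B` serves all.
  have hBe : ∀ e ∈ kochSides n, ∃ B : ℝ, 0 ≤ B ∧ ∀ a ∈ Icc (0 : ℝ) 1, ∀ b ∈ Icc (0 : ℝ) 1,
      (w (AffineMap.lineMap e.1 e.2 a) - w (AffineMap.lineMap e.1 e.2 b)) ^ 2 ≤ B * |a - b| := by
    intro e he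
    have hfin := (memLp_two_iff_lintegral (hγ e he).1).1 (hγ e he)
    set I := ∫⁻ τ in Icc (0 : ℝ) 1, ‖dist e.1 e.2 * g (AffineMap.lineMap e.1 e.2 τ)‖ₑ ^ 2
    have key : ∀ a b : ℝ, 0 ≤ a → a ≤ b → b ≤ 1 →
        (w (AffineMap.lineMap e.1 e.2 a) - w (AffineMap.lineMap e.1 e.2 b)) ^ 2
          ≤ I.toReal * |a - b| := by
      intro a b ha hab hb
      have h1 := enorm_sub_sq_le (h := fun a : ℝ => w (AffineMap.lineMap e.1 e.2 a))
        ((hγ e he).integrable (by norm_num)) ha hab hb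
        (hd e he a ⟨ha, hab.trans hb⟩ b ⟨ha.trans hab, hb⟩)
      have h2 : ‖w (AffineMap.lineMap e.1 e.2 a) - w (AffineMap.lineMap e.1 e.2 b)‖ₑ ^ 2
          ≤ ENNReal.ofReal (b - a) * I :=
        h1.trans (mul_le_mul_right (lintegral_mono_set
          (Ioo_subset_Icc_self.trans (Icc_subset_Icc ha hb))) _)
      have h3 := ENNReal.toReal_mono (ENNReal.mul_lt_top ENNReal.ofReal_lt_top hfin).ne h2
      rw [ENNReal.toReal_pow, toReal_enorm, ENNReal.toReal_mul,
        ENNReal.toReal_ofReal (by linarith), Real.norm_eq_abs, sq_abs] at h3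
      rw [abs_sub_comm, abs_of_nonneg (by linarith), mul_comm]
      exact h3
    refine ⟨I.toReal, ENNReal.toReal_nonneg, fun a ha b hb => ?_⟩
    rcases le_total a b with hab | hab
    · exact key a b ha.1 hab hb.2
    · have := key b a hb.1 hab ha.2
      rw [abs_sub_comm, ← neg_sq, neg_sub] at this
      exact this
  choose! Bf hBf0 hBf using hBe
  have hB : ∃ B : ℝ, ∀ e ∈ kochSides n, Bf e ≤ B := by
    have hfin : ({e | e ∈ kochSides n}).Finite := List.finite_toSet _
    obtain ⟨B, hB⟩ := (hfin.image Bf).bddAbove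
    exact ⟨B, fun e he => hB ⟨e, he, rfl⟩⟩
  obtain ⟨B, hB⟩ := hB
  refine lt_top_iff_ne_top.2 (lintegral_arcLength_prod_ne_top fun e he e' he' => ?_)
  have hne := ne_of_mem_kochSides he
  have hne' := ne_of_mem_kochSides he'
  refine ((lintegral_prod_le _).trans_lt ?_).ne
  rw [lintegral_sideMeasure hne]
  simp_rw [lintegral_sideMeasure hne']
  refine ENNReal.mul_lt_top ENNReal.ofReal_lt_top ?_
  rw [lintegral_const_mul' _ _ ENNReal.ofReal_ne_top]
  refine ENNReal.mul_lt_top ENNReal.ofReal_lt_top ?_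
  by_cases hee : e = e'
  · subst hee
    have h1 := lintegral_quotient_lt_top (h := fun a : ℝ => w (AffineMap.lineMap e.1 e.2 a))
      (hγ e he) (hd e he)
    have h2 : ∀ a b : ℝ, ‖diffQuot w (AffineMap.lineMap e.1 e.2 a, AffineMap.lineMap e.1 e.2 b)‖ₑ ^ 2
        = ENNReal.ofReal (1 / dist e.1 e.2 ^ 2) *
          ‖(w (AffineMap.lineMap e.1 e.2 a) - w (AffineMap.lineMap e.1 e.2 b)) / (a - b)‖ₑ ^ 2 := by
      intro a b
      rw [Real.enorm_eq_ofReal_abs, Real.enorm_eq_ofReal_abs, ← ENNReal.ofReal_pow (abs_nonneg _),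
        ← ENNReal.ofReal_pow (abs_nonneg _), ← ENNReal.ofReal_mul (by positivity), sq_abs, sq_abs]
      simp only [diffQuot, dist_lineMap_lineMap, div_pow, mul_pow, Real.dist_eq, sq_abs]
      congr 1
      rw [div_mul_div_comm, one_mul, mul_comm (dist e.1 e.2 ^ 2)]
    simp_rw [h2]
    rw [show (∫⁻ a in Icc (0 : ℝ) 1, ∫⁻ b in Icc (0 : ℝ) 1, ENNReal.ofReal (1 / dist e.1 e.2 ^ 2) *
        ‖(w (AffineMap.lineMap e.1 e.2 a) - w (AffineMap.lineMap e.1 e.2 b)) / (a - b)‖ₑ ^ 2)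
        = ENNReal.ofReal (1 / dist e.1 e.2 ^ 2) * ∫⁻ a in Icc (0 : ℝ) 1, ∫⁻ b in Icc (0 : ℝ) 1,
        ‖(w (AffineMap.lineMap e.1 e.2 a) - w (AffineMap.lineMap e.1 e.2 b)) / (a - b)‖ₑ ^ 2 by
      simp_rw [lintegral_const_mul' _ _ ENNReal.ofReal_ne_top]]
    exact ENNReal.mul_lt_top ENNReal.ofReal_lt_top h1
  · obtain ⟨C, hC0, hC⟩ := exists_diffQuot_sq_le (w := w) (B := B) (S := S)
      (fun e he a ha b hb => (hBf e he a ha b hb).trans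
        (mul_le_mul_of_nonneg_right (hB e he) (abs_nonneg _)))
      (fun x hx => by simpa using hS x hx) he he' hee
    have hle : ∀ a ∈ Ioo (0 : ℝ) 1, ∀ b ∈ Ioo (0 : ℝ) 1,
        ‖diffQuot w (AffineMap.lineMap e.1 e.2 a, AffineMap.lineMap e'.1 e'.2 b)‖ₑ ^ 2
          ≤ ENNReal.ofReal C * ENNReal.ofReal (1 / √(min a (1 - a))) *
            ENNReal.ofReal (1 / √(min b (1 - b))) := by
      intro a ha b hb
      rw [Real.enorm_eq_ofReal_abs, ← ENNReal.ofReal_pow (abs_nonneg _), sq_abs,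
        ← ENNReal.ofReal_mul hC0, ← ENNReal.ofReal_mul (by positivity)]
      refine ENNReal.ofReal_le_ofReal ((hC a ha b hb).trans (le_of_eq ?_))
      ring
    have hMt := lintegral_inv_sqrt_min_lt_top
    set M := ∫⁻ a in Ioo (0 : ℝ) 1, ENNReal.ofReal (1 / √(min a (1 - a)))
    have hmeas1 : Measurable fun a : ℝ => ENNReal.ofReal (1 / √(min a (1 - a))) := by fun_prop
    simp_rw [← restrict_Ioo_eq_restrict_Icc]
    calc ∫⁻ a in Ioo (0 : ℝ) 1, ∫⁻ b in Ioo (0 : ℝ) 1,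
          ‖diffQuot w (AffineMap.lineMap e.1 e.2 a, AffineMap.lineMap e'.1 e'.2 b)‖ₑ ^ 2
        ≤ ∫⁻ a in Ioo (0 : ℝ) 1, ∫⁻ b in Ioo (0 : ℝ) 1,
          ENNReal.ofReal C * ENNReal.ofReal (1 / √(min a (1 - a))) *
            ENNReal.ofReal (1 / √(min b (1 - b))) := by
          refine setLIntegral_mono' measurableSet_Ioo fun a ha => ?_
          exact setLIntegral_mono' measurableSet_Ioo fun b hb => hle a ha b hb
      _ = ∫⁻ a in Ioo (0 : ℝ) 1, ENNReal.ofReal C * ENNReal.ofReal (1 / √(min a (1 - a))) * M := by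
          refine lintegral_congr fun a => ?_
          rw [lintegral_const_mul _ hmeas1]
      _ = ENNReal.ofReal C * M * M := by
          rw [lintegral_mul_const _ (hmeas1.const_mul _), lintegral_const_mul _ hmeas1]
      _ < ⊤ := ENNReal.mul_lt_top (ENNReal.mul_lt_top ENNReal.ofReal_lt_top hMt) hMt


/-! ### Integrals of powers of the distance in the plane -/

theorem lintegral_comp_smul_plane {r : ℝ} (hr : 0 < r) {f : Plane → ℝ≥0∞} (hf : Measurable f) :
    ∫⁻ z, f z = ENNReal.ofReal (r ^ 2) * ∫⁻ z, f (r • z) := by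
  have h := Measure.map_addHaar_smul (volume : Measure Plane) hr.ne'
  have h1 : ∫⁻ z, f (r • z) = ∫⁻ z, f z ∂(volume.map (fun z : Plane => r • z)) :=
    (lintegral_map hf (measurable_const_smul r)).symm
  rw [h1, h, lintegral_smul_measure, smul_eq_mul, ← mul_assoc, ← ENNReal.ofReal_mul (by positivity)]
  have h2 : Module.finrank ℝ Plane = 2 := by simp
  rw [h2, abs_of_pos (by positivity), mul_inv_cancel₀ (by positivity)]
  simp

theorem integrableOn_norm_rpow_ball {α : ℝ} (hα : α < 2) (R : ℝ) :
    IntegrableOn (fun z : Plane => ‖z‖ ^ (-α)) (Metric.ball 0 R) := by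
  have h2 : Module.finrank ℝ Plane = 2 := by simp
  refine integrableOn_ball_of_norm_le_rpow (C := 1) (α := α) (by rw [h2]; norm_num)
    (by rw [h2]; exact_mod_cast hα) (.of_forall fun x => ?_) ?_
  · rw [one_mul, Real.norm_of_nonneg (by positivity)]
  · exact (Measurable.pow_const measurable_norm _).aestronglyMeasurable

/-- The total mass of `1 / |z|` on the unit ball. -/
def invNormMass : ℝ≥0∞ := ∫⁻ z in Metric.ball (0 : Plane) 1, ENNReal.ofReal (‖z‖⁻¹)

theorem invNormMass_lt_top : invNormMass < ⊤ := by
  have h := (integrableOn_norm_rpow_ball (α := 1) (by norm_num) 1).lintegral_lt_top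
  rw [invNormMass]
  simpa only [Real.rpow_neg_one] using h

theorem measurable_inv_norm : Measurable fun z : Plane => ENNReal.ofReal (‖z‖⁻¹) := by fun_prop

theorem lintegral_inv_norm_ball {r : ℝ} (hr : 0 < r) (q : Plane) :
    ∫⁻ x in Metric.ball q r, ENNReal.ofReal ((dist x q)⁻¹) = ENNReal.ofReal r * invNormMass := by
  have e1 : ∫⁻ x in Metric.ball q r, ENNReal.ofReal ((dist x q)⁻¹)
      = ∫⁻ x, (Metric.ball (0 : Plane) r).indicator (fun z => ENNReal.ofReal (‖z‖⁻¹)) (x - q) := by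
    rw [← lintegral_indicator measurableSet_ball]
    refine lintegral_congr fun x => ?_
    simp only [indicator, Metric.mem_ball, dist_eq_norm, sub_zero]
  rw [e1, lintegral_sub_right_eq_self
    ((Metric.ball (0 : Plane) r).indicator (fun z => ENNReal.ofReal (‖z‖⁻¹))) q,
    lintegral_comp_smul_plane hr (measurable_inv_norm.indicator measurableSet_ball)]
  have e2 : ∀ z : Plane, (Metric.ball (0 : Plane) r).indicator
      (fun z => ENNReal.ofReal (‖z‖⁻¹)) (r • z) = ENNReal.ofReal (r⁻¹) *
        (Metric.ball (0 : Plane) 1).indicator (fun z => ENNReal.ofReal (‖z‖⁻¹)) z := by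
    intro z
    have : r * ‖z‖ < r ↔ ‖z‖ < 1 := by rw [mul_lt_iff_lt_one_right hr]
    simp only [indicator, Metric.mem_ball, dist_zero_right, norm_smul, Real.norm_of_nonneg hr.le,
      this]
    split_ifs
    · rw [mul_inv, ENNReal.ofReal_mul (by positivity)]
    · simp
  simp_rw [e2]
  rw [lintegral_const_mul _ (measurable_inv_norm.indicator measurableSet_ball),
    lintegral_indicator measurableSet_ball, ← mul_assoc, ← ENNReal.ofReal_mul (by positivity),
    invNormMass]
  congr 2
  field_simp

theorem volume_ball_plane {r : ℝ} (hr : 0 ≤ r) (p : Plane) :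
    volume (Metric.ball p r) = ENNReal.ofReal (r ^ 2) * volume (Metric.ball (0 : Plane) 1) := by
  have h2 : Module.finrank ℝ Plane = 2 := by simp
  rw [Measure.addHaar_ball _ _ hr, h2]

/-- The constant in `∫_{B_r(p)} dx / |x - q| ≤ C r`. -/
def ballConst : ℝ≥0∞ := invNormMass + volume (Metric.ball (0 : Plane) 1)

theorem ballConst_lt_top : ballConst < ⊤ :=
  ENNReal.add_lt_top.2 ⟨invNormMass_lt_top, measure_ball_lt_top⟩

/-- Uniform in the pole `q`: inside the ball of radius `r` around `q` this is the centred integral,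
outside it the integrand is at most `1/r` on a set of area `O(r²)`. -/
theorem lintegral_inv_dist_le {r : ℝ} (hr : 0 < r) (p q : Plane) :
    ∫⁻ x in Metric.ball p r, ENNReal.ofReal ((dist x q)⁻¹) ≤ ENNReal.ofReal r * ballConst := by
  have hm : Measurable fun x : Plane => ENNReal.ofReal ((dist x q)⁻¹) := by fun_prop
  calc ∫⁻ x in Metric.ball p r, ENNReal.ofReal ((dist x q)⁻¹)
      ≤ ∫⁻ x in Metric.ball q r ∪ (Metric.ball p r ∩ (Metric.ball q r)ᶜ),
          ENNReal.ofReal ((dist x q)⁻¹) := by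
        refine lintegral_mono_set fun x hx => ?_
        by_cases h : x ∈ Metric.ball q r
        · exact Or.inl h
        · exact Or.inr ⟨hx, h⟩
    _ ≤ (∫⁻ x in Metric.ball q r, ENNReal.ofReal ((dist x q)⁻¹)) +
          ∫⁻ x in Metric.ball p r ∩ (Metric.ball q r)ᶜ, ENNReal.ofReal ((dist x q)⁻¹) :=
        lintegral_union_le _ _ _
    _ ≤ ENNReal.ofReal r * invNormMass + ENNReal.ofReal r * volume (Metric.ball (0 : Plane) 1) := by
        gcongr
        · exact (lintegral_inv_norm_ball hr q).le
        · calc ∫⁻ x in Metric.ball p r ∩ (Metric.ball q r)ᶜ, ENNReal.ofReal ((dist x q)⁻¹)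
              ≤ ∫⁻ x in Metric.ball p r ∩ (Metric.ball q r)ᶜ, ENNReal.ofReal (r⁻¹) := by
                refine setLIntegral_mono' (measurableSet_ball.inter measurableSet_ball.compl)
                  fun x hx => ENNReal.ofReal_le_ofReal ?_
                have : r ≤ dist x q := not_lt.1 hx.2
                gcongr
            _ ≤ ENNReal.ofReal (r⁻¹) * volume (Metric.ball p r) := by
                rw [setLIntegral_const]
                gcongr
                exact inter_subset_left
            _ = _ := by
                rw [volume_ball_plane hr.le, ← mul_assoc, ← ENNReal.ofReal_mul (by positivity)]
                congr 2
                field_simp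
    _ = _ := by rw [ballConst, mul_add]

/-- The total mass of `1 / |z|^4` outside the unit ball. -/
def tailMass : ℝ≥0∞ := ∫⁻ z in {z : Plane | 1 ≤ ‖z‖}, ENNReal.ofReal ((‖z‖ ^ 4)⁻¹)

theorem tailMass_lt_top : tailMass < ⊤ := by
  have h2 : Module.finrank ℝ Plane = 2 := by simp
  have h := finite_integral_one_add_norm (E := Plane) (μ := volume) (r := 4)
    (by rw [h2]; norm_num)
  have hm : MeasurableSet {z : Plane | 1 ≤ ‖z‖} := measurableSet_le measurable_const measurable_norm
  calc tailMass ≤ ∫⁻ z in {z : Plane | 1 ≤ ‖z‖},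
        ENNReal.ofReal 16 * ENNReal.ofReal ((1 + ‖z‖) ^ (-4 : ℝ)) := by
        refine setLIntegral_mono' hm fun z hz => ?_
        have hz : 1 ≤ ‖z‖ := hz
        rw [← ENNReal.ofReal_mul (by norm_num)]
        refine ENNReal.ofReal_le_ofReal ?_
        have e : (1 + ‖z‖) ^ (-4 : ℝ) = ((1 + ‖z‖) ^ 4)⁻¹ := by
          rw [Real.rpow_neg (by positivity)]; norm_cast
        rw [e, ← div_eq_mul_inv, inv_eq_one_div, div_le_div_iff₀ (by positivity) (by positivity)]
        have : (1 + ‖z‖) ^ 4 ≤ (2 * ‖z‖) ^ 4 := by gcongr; linarith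
        nlinarith
    _ ≤ ∫⁻ z : Plane, ENNReal.ofReal 16 * ENNReal.ofReal ((1 + ‖z‖) ^ (-4 : ℝ)) :=
        setLIntegral_le_lintegral _ _
    _ = ENNReal.ofReal 16 * ∫⁻ z : Plane, ENNReal.ofReal ((1 + ‖z‖) ^ (-4 : ℝ)) :=
        lintegral_const_mul' _ _ ENNReal.ofReal_ne_top
    _ < ⊤ := ENNReal.mul_lt_top ENNReal.ofReal_lt_top h

/-- Scaling: the degree `-4` against the planar volume leaves `ρ^{-2}`, the weight of the Gagliardo
seminorm. -/
theorem lintegral_tail {ρ : ℝ} (hρ : 0 < ρ) (q : Plane) :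
    ∫⁻ x in {x | ρ ≤ dist x q}, ENNReal.ofReal ((dist x q ^ 4)⁻¹)
      = ENNReal.ofReal ((ρ ^ 2)⁻¹) * tailMass := by
  have hm : MeasurableSet {z : Plane | ρ ≤ ‖z‖} := measurableSet_le measurable_const measurable_norm
  have hm' : MeasurableSet {z : Plane | 1 ≤ ‖z‖} := measurableSet_le measurable_const measurable_norm
  have hmq : MeasurableSet {z : Plane | ρ ≤ dist z q} :=
    measurableSet_le measurable_const (measurable_id.dist measurable_const)
  have hmf : Measurable fun z : Plane => ENNReal.ofReal ((‖z‖ ^ 4)⁻¹) := by fun_prop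
  have e1 : ∫⁻ x in {x | ρ ≤ dist x q}, ENNReal.ofReal ((dist x q ^ 4)⁻¹)
      = ∫⁻ x, {z : Plane | ρ ≤ ‖z‖}.indicator (fun z => ENNReal.ofReal ((‖z‖ ^ 4)⁻¹)) (x - q) := by
    rw [← lintegral_indicator hmq]
    refine lintegral_congr fun x => ?_
    simp only [indicator, mem_ofPred_eq, dist_eq_norm]
  rw [e1, lintegral_sub_right_eq_self
    ({z : Plane | ρ ≤ ‖z‖}.indicator (fun z => ENNReal.ofReal ((‖z‖ ^ 4)⁻¹))) q,
    lintegral_comp_smul_plane hρ (hmf.indicator hm)]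
  have e2 : ∀ z : Plane, {z : Plane | ρ ≤ ‖z‖}.indicator
      (fun z => ENNReal.ofReal ((‖z‖ ^ 4)⁻¹)) (ρ • z) = ENNReal.ofReal ((ρ ^ 4)⁻¹) *
        {z : Plane | 1 ≤ ‖z‖}.indicator (fun z => ENNReal.ofReal ((‖z‖ ^ 4)⁻¹)) z := by
    intro z
    have : ρ ≤ ρ * ‖z‖ ↔ 1 ≤ ‖z‖ := by rw [le_mul_iff_one_le_right hρ]
    simp only [indicator, mem_ofPred_eq, norm_smul, Real.norm_of_nonneg hρ.le, this]
    split_ifs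
    · rw [mul_pow, mul_inv, ENNReal.ofReal_mul (by positivity)]
    · simp
  simp_rw [e2]
  rw [lintegral_const_mul _ (hmf.indicator hm'),
    lintegral_indicator hm', ← mul_assoc, ← ENNReal.ofReal_mul (by positivity), tailMass]
  congr 2
  field_simp

/-! ### The extension operator -/

/-- The distance to the curve. -/
def curveDist (n : ℕ) (x : Plane) : ℝ := Metric.infDist x (kochCurve n)

theorem curveDist_pos {n : ℕ} {x : Plane} (hx : x ∉ kochCurve n) : 0 < curveDist n x :=
  ((isCompact_kochCurve n).isClosed.notMem_iff_infDist_pos (kochCurve_nonempty n)).1 hx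

theorem curveDist_pos_of_mem {n : ℕ} {x : Plane} (hx : x ∈ kochDomain n) : 0 < curveDist n x :=
  curveDist_pos fun h => notMem_kochDomain_of_mem_kochCurve h hx

theorem curveDist_le {n : ℕ} (x : Plane) {y : Plane} (hy : y ∈ kochCurve n) :
    curveDist n x ≤ dist x y := Metric.infDist_le_dist_of_mem hy

theorem exists_curveDist_eq (n : ℕ) (x : Plane) : ∃ y ∈ kochCurve n, curveDist n x = dist x y :=
  (isCompact_kochCurve n).exists_infDist_eq_dist (kochCurve_nonempty n) x

/-- The kernel `|x - y|^{-4}`. -/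
def invFour (x y : Plane) : ℝ := (dist x y ^ 4)⁻¹

theorem invFour_nonneg (x y : Plane) : 0 ≤ invFour x y := by unfold invFour; positivity

theorem measurable_invFour : Measurable fun p : Plane × Plane => invFour p.1 p.2 := by
  unfold invFour; fun_prop

theorem measurable_invFour_right (x : Plane) : Measurable (invFour x) := by
  unfold invFour; fun_prop

theorem invFour_le {n : ℕ} {x y : Plane} (hx : x ∉ kochCurve n) (hy : y ∈ kochCurve n) :
    invFour x y ≤ (curveDist n x ^ 4)⁻¹ := by
  have h1 := curveDist_pos hx
  have h2 := curveDist_le x hy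
  unfold invFour
  gcongr

theorem integrable_invFour {n : ℕ} {x : Plane} (hx : x ∉ kochCurve n) :
    Integrable (invFour x) (arcLength n) := by
  refine Integrable.of_bound (measurable_invFour_right x).aestronglyMeasurable
    ((curveDist n x ^ 4)⁻¹) ?_
  filter_upwards [ae_mem_kochCurve n] with y hy
  rw [Real.norm_of_nonneg (invFour_nonneg x y)]
  exact invFour_le hx hy

theorem integrable_mul_invFour {n : ℕ} {g : Plane → ℝ} (hg : Integrable g (arcLength n)) {x : Plane}
    (hx : x ∉ kochCurve n) : Integrable (fun y => g y * invFour x y) (arcLength n) := by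
  refine hg.mul_bdd (c := (curveDist n x ^ 4)⁻¹) (measurable_invFour_right x).aestronglyMeasurable ?_
  filter_upwards [ae_mem_kochCurve n] with y hy
  rw [Real.norm_of_nonneg (invFour_nonneg x y)]
  exact invFour_le hx hy

/-- The total mass of the kernel. -/
def kernelMass (n : ℕ) (x : Plane) : ℝ := ∫ y, invFour x y ∂arcLength n

/-- Lower Ahlfors regularity of the curve, in the form of a bound for the mass of the kernel. -/
theorem exists_le_kernelMass (n : ℕ) : ∃ c > 0, ∀ x ∈ kochDomain n,
    c ≤ curveDist n x ^ 3 * kernelMass n x := by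
  obtain ⟨y₁, hy₁⟩ := kochCurve_nonempty n
  obtain ⟨D, hD⟩ := (isBounded_kochDomain n).subset_ball y₁
  have hlist : {e | e ∈ kochSides n}.Finite := List.finite_toSet _
  obtain ⟨e₁, he₁, hmax⟩ := Set.exists_min_image {e | e ∈ kochSides n}
    (fun e => dist e.1 e.2) hlist (kochSides_ne_nil n)
  set l₀ := dist e₁.1 e₁.2
  have hl₀ : 0 < l₀ := side_length_pos he₁
  -- `l₀` is the shortest side and `D` bounds the distance to the curve. The `16` is `2⁴`: the
  -- kernel is at least `(2d)^{-4}` at points within distance `2d`.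
  refine ⟨min 1 (l₀ / (2 * (max D 1))) / 16, by positivity, fun x hx => ?_⟩
  have hxK : x ∉ kochCurve n := fun h => notMem_kochDomain_of_mem_kochCurve h hx
  set d := curveDist n x with hd
  have hd0 : 0 < d := curveDist_pos hxK
  have hdD : d ≤ max D 1 := by
    have := curveDist_le x hy₁
    have h2 := hD hx
    rw [Metric.mem_ball] at h2
    exact (this.trans h2.le).trans (le_max_left _ _)
  obtain ⟨y₀, hy₀, hdy⟩ := exists_curveDist_eq n x
  obtain ⟨e, he, h0, h1, h2⟩ := mem_kochCurve_iff.1 hy₀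
  have hne := ne_of_mem_kochSides he
  have hl := side_length_pos he
  have hll : l₀ ≤ dist e.1 e.2 := hmax e he
  set l := dist e.1 e.2 with hldef
  set s := tanCoord e y₀ with hs
  have hy : y₀ = AffineMap.lineMap e.1 e.2 s := eq_lineMap_of_norCoord_eq_zero hne h0
  -- Parameter length of a piece of the side around the nearest point `y₀` that stays within
  -- distance `d` of it. The cap `1/2` ensures that the piece fits on the side in at least one
  -- direction.
  set δ := min (1 / 2) (d / l) with hδ
  have hδ0 : 0 < δ := by positivity
  obtain ⟨a, ha0, ha1, has⟩ : ∃ a, 0 ≤ a ∧ a + δ ≤ 1 ∧ ∀ t ∈ Icc a (a + δ), |t - s| ≤ δ := by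
    have hδ2 : δ ≤ 1 / 2 := min_le_left _ _
    rcases le_total s (1 / 2) with h | h
    · exact ⟨s, h1, by linarith, fun t ht => by rw [abs_le]; constructor <;> linarith [ht.1, ht.2]⟩
    · exact ⟨s - δ, by linarith, by linarith,
        fun t ht => by rw [abs_le]; constructor <;> linarith [ht.1, ht.2]⟩
  have hpt : ∀ t ∈ Icc a (a + δ), ((2 * d) ^ 4)⁻¹ ≤ invFour x (AffineMap.lineMap e.1 e.2 t) := by
    intro t ht
    have htI : t ∈ Icc (0 : ℝ) 1 := ⟨ha0.trans ht.1, ht.2.trans ha1⟩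
    have b1 := curveDist_le x (side_mem_kochCurve he htI)
    have b2 : dist x (AffineMap.lineMap e.1 e.2 t) ≤ 2 * d := by
      refine (dist_triangle x y₀ _).trans ?_
      rw [← hdy, hy, dist_lineMap_lineMap, Real.dist_eq, abs_sub_comm]
      have := has t ht
      have b3 : |t - s| * l ≤ d := by
        calc |t - s| * l ≤ δ * l := by gcongr
          _ ≤ d / l * l := by gcongr; exact min_le_right _ _
          _ = d := by field_simp
      linarith
    unfold invFour
    have : 0 < dist x (AffineMap.lineMap e.1 e.2 t) := hd0.trans_le b1
    gcongr
  have hlow : ENNReal.ofReal (l * (δ * ((2 * d) ^ 4)⁻¹)) ≤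
      ∫⁻ y, ENNReal.ofReal (invFour x y) ∂arcLength n := by
    calc ENNReal.ofReal (l * (δ * ((2 * d) ^ 4)⁻¹))
        = ENNReal.ofReal l * ∫⁻ t in Icc a (a + δ), ENNReal.ofReal (((2 * d) ^ 4)⁻¹) := by
          rw [setLIntegral_const, Real.volume_Icc, add_sub_cancel_left,
            ← ENNReal.ofReal_mul (by positivity), ← ENNReal.ofReal_mul hl.le, mul_comm δ]
      _ ≤ ENNReal.ofReal l * ∫⁻ t in Icc a (a + δ),
            ENNReal.ofReal (invFour x (AffineMap.lineMap e.1 e.2 t)) := by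
          gcongr ENNReal.ofReal l * ?_
          exact setLIntegral_mono' measurableSet_Icc fun t ht => ENNReal.ofReal_le_ofReal (hpt t ht)
      _ ≤ ENNReal.ofReal l * ∫⁻ t in Icc (0 : ℝ) 1,
            ENNReal.ofReal (invFour x (AffineMap.lineMap e.1 e.2 t)) := by
          gcongr ENNReal.ofReal l * ?_
          exact lintegral_mono_set (Icc_subset_Icc ha0 ha1)
      _ = ∫⁻ y, ENNReal.ofReal (invFour x y) ∂sideMeasure e := 
          (lintegral_sideMeasure hne (fun y => ENNReal.ofReal (invFour x y))).symm
      _ ≤ _ := lintegral_mono' (sideMeasure_le_arcLength he) le_rfl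
  rw [← ofReal_integral_eq_lintegral_ofReal (integrable_invFour hxK)
    (.of_forall fun y => invFour_nonneg x y)] at hlow
  have hlow' := (ENNReal.ofReal_le_ofReal_iff
    (integral_nonneg fun y => invFour_nonneg x y)).1 hlow
  have hfin : min 1 (l₀ / (2 * (max D 1))) / 16 ≤ d ^ 3 * (l * (δ * ((2 * d) ^ 4)⁻¹)) := by
    have e1 : d ^ 3 * (l * (δ * ((2 * d) ^ 4)⁻¹)) = (l * δ / d) / 16 := by
      field_simp; norm_num
    rw [e1]
    gcongr
    rw [hδ]
    rcases min_choice (1 / 2) (d / l) with h | h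
    · rw [h]
      refine (min_le_right _ _).trans ?_
      rw [div_le_div_iff₀ (by positivity) hd0]
      nlinarith [mul_le_mul hll hdD hd0.le hl.le]
    · rw [h]
      refine (min_le_left _ _).trans (le_of_eq ?_)
      field_simp
  refine hfin.trans ?_
  gcongr
  exact hlow'

theorem kernelMass_pos {n : ℕ} {x : Plane} (hx : x ∈ kochDomain n) : 0 < kernelMass n x := by
  obtain ⟨c, hc, h⟩ := exists_le_kernelMass n
  have h1 := h x hx
  have h2 := curveDist_pos_of_mem hx
  by_contra h3
  have : curveDist n x ^ 3 * kernelMass n x ≤ 0 :=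
    mul_nonpos_of_nonneg_of_nonpos (by positivity) (not_lt.1 h3)
  linarith


/-- The extension of a function on the curve: its mean with respect to the normalized kernel. -/
def ext (n : ℕ) (g : Plane → ℝ) (x : Plane) : ℝ :=
  (∫ y, g y * invFour x y ∂arcLength n) / kernelMass n x

/-- The normalized kernel. -/
def wgt (n : ℕ) (x y : Plane) : ℝ≥0∞ := ENNReal.ofReal (invFour x y / kernelMass n x)

/-- The constant in the upper bound for the normalized kernel. -/
def wgtConst (n : ℕ) : ℝ := (exists_le_kernelMass n).choose⁻¹

theorem wgtConst_pos (n : ℕ) : 0 < wgtConst n := inv_pos.2 (exists_le_kernelMass n).choose_spec.1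

theorem inv_kernelMass_le {n : ℕ} {x : Plane} (hx : x ∈ kochDomain n) :
    (kernelMass n x)⁻¹ ≤ wgtConst n * curveDist n x ^ 3 := by
  have h := (exists_le_kernelMass n).choose_spec.2 x hx
  have h0 := (exists_le_kernelMass n).choose_spec.1
  have hk := kernelMass_pos hx
  rw [wgtConst, inv_eq_one_div, div_le_iff₀ hk]
  have h2 := mul_le_mul_of_nonneg_left h (inv_pos.2 h0).le
  rw [inv_mul_cancel₀ h0.ne'] at h2
  linarith

/-- Only the lower bound `c d^{-3}` for the kernel mass is used, with `d` the distance to the curve.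
-/
theorem wgt_le {n : ℕ} {x : Plane} (hx : x ∈ kochDomain n) (y : Plane) :
    wgt n x y ≤ ENNReal.ofReal (wgtConst n * (curveDist n x ^ 3 * invFour x y)) := by
  refine ENNReal.ofReal_le_ofReal ?_
  rw [div_eq_mul_inv, ← mul_assoc, mul_comm]
  exact mul_le_mul_of_nonneg_right (inv_kernelMass_le hx) (invFour_nonneg x y)

theorem measurable_kernelMass (n : ℕ) : Measurable (kernelMass n) :=
  (measurable_invFour.stronglyMeasurable.integral_prod_right'
    (ν := arcLength n)).measurable

theorem measurable_wgt_right (n : ℕ) (x : Plane) : Measurable (wgt n x) :=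
  ((measurable_invFour_right x).div_const (kernelMass n x)).ennreal_ofReal

theorem measurable_ext {n : ℕ} {g : Plane → ℝ} (hg : Measurable g) : Measurable (ext n g) := by
  have h : Measurable fun p : Plane × Plane => g p.2 * invFour p.1 p.2 :=
    (hg.comp measurable_snd).mul measurable_invFour
  exact (h.stronglyMeasurable.integral_prod_right' (ν := arcLength n)).measurable.div
    (measurable_kernelMass n)

theorem lintegral_wgt {n : ℕ} {x : Plane} (hx : x ∈ kochDomain n) :
    ∫⁻ y, wgt n x y ∂arcLength n = 1 := by
  have hxK : x ∉ kochCurve n := fun h => notMem_kochDomain_of_mem_kochCurve h hx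
  have hk := kernelMass_pos hx
  unfold wgt
  rw [← ofReal_integral_eq_lintegral_ofReal ((integrable_invFour hxK).div_const _)
    (.of_forall fun y => div_nonneg (invFour_nonneg x y) hk.le), integral_div]
  change ENNReal.ofReal (kernelMass n x / kernelMass n x) = 1
  rw [div_self hk.ne', ENNReal.ofReal_one]

/-- The normalised kernel is a probability density, so constants pass under the average. -/
theorem sub_ext_eq {n : ℕ} {g : Plane → ℝ} (hg : Integrable g (arcLength n)) {x : Plane}
    (hx : x ∈ kochDomain n) (c : ℝ) :
    c - ext n g x = ∫ y, (c - g y) * (invFour x y / kernelMass n x) ∂arcLength n := by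
  have hxK : x ∉ kochCurve n := fun h => notMem_kochDomain_of_mem_kochCurve h hx
  have hk := kernelMass_pos hx
  have e : (fun y => (c - g y) * (invFour x y / kernelMass n x)) =
      fun y => (c * invFour x y - g y * invFour x y) / kernelMass n x := by
    ext y; ring
  rw [e, integral_div, integral_sub ((integrable_invFour hxK).const_mul c)
    (integrable_mul_invFour hg hxK), integral_const_mul]
  change c - ext n g x = (c * kernelMass n x - _) / kernelMass n x
  rw [ext]
  field_simp

/-- Jensen's inequality for the extension. -/
theorem enorm_sub_ext_sq_le {n : ℕ} {g : Plane → ℝ} (hg : Integrable g (arcLength n)) {x : Plane}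
    (hx : x ∈ kochDomain n) (c : ℝ) :
    ‖c - ext n g x‖ₑ ^ 2 ≤ ∫⁻ y, ‖c - g y‖ₑ ^ 2 * wgt n x y ∂arcLength n := by
  have hk := kernelMass_pos hx
  have h1 : ‖c - ext n g x‖ₑ ≤ ∫⁻ y, ‖c - g y‖ₑ * wgt n x y ∂arcLength n := by
    rw [sub_ext_eq hg hx]
    refine (enorm_integral_le_lintegral_enorm _).trans (le_of_eq (lintegral_congr fun y => ?_))
    rw [enorm_mul, wgt, Real.enorm_eq_ofReal (div_nonneg (invFour_nonneg x y) hk.le)]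
  calc ‖c - ext n g x‖ₑ ^ 2 ≤ (∫⁻ y, ‖c - g y‖ₑ * wgt n x y ∂arcLength n) ^ 2 := by gcongr
    _ ≤ (∫⁻ y, wgt n x y ∂arcLength n) * ∫⁻ y, ‖c - g y‖ₑ ^ 2 * wgt n x y ∂arcLength n :=
        lintegral_mul_weight_sq_le (hg.1.aemeasurable.const_sub c).enorm
          (measurable_wgt_right n x).aemeasurable
    _ = _ := by rw [lintegral_wgt hx, one_mul]

/-! ### The derivative of the extension -/

/-- The derivative of the kernel. -/
def invFourDeriv (x y : Plane) : Plane →L[ℝ] ℝ := (-4 * (dist x y ^ 6)⁻¹) • innerSL ℝ (x - y)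

theorem hasFDerivAt_invFour {x y : Plane} (h : x ≠ y) :
    HasFDerivAt (fun x => invFour x y) (invFourDeriv x y) x := by
  have hd : 0 < dist x y := dist_pos.2 h
  have h1 : HasFDerivAt (fun x : Plane => dist x y ^ 2) ((2 : ℝ) • innerSL ℝ (x - y)) x := by
    have := ((hasFDerivAt_id x).sub_const y).norm_sq
    simp only [dist_eq_norm]
    refine this.congr_fderiv ?_
    ext v
    simp
  have h2 := (hasDerivAt_inv (x := (dist x y ^ 2) ^ 2) (by positivity)).comp_hasFDerivAt x (h1.pow 2)
  have e : (fun x => invFour x y) = fun x => ((dist x y ^ 2) ^ 2)⁻¹ := by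
    ext z; rw [invFour]; ring
  rw [e]
  refine h2.congr_fderiv ?_
  ext v
  simp only [invFourDeriv, smul_apply, smul_eq_mul, innerSL_apply_apply]
  field_simp
  ring

theorem norm_invFourDeriv (x y : Plane) : ‖invFourDeriv x y‖ ≤ 4 * (dist x y)⁻¹ * invFour x y := by
  rw [invFourDeriv, norm_smul, innerSL_apply_norm, ← dist_eq_norm, invFour, Real.norm_eq_abs,
    abs_mul, abs_of_neg (by norm_num : (-4 : ℝ) < 0), abs_of_nonneg (by positivity)]
  by_cases h : dist x y = 0
  · simp [h]
  · refine le_of_eq ?_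
    field_simp

theorem measurable_invFourDeriv_right (x : Plane) : Measurable (invFourDeriv x) := by
  unfold invFourDeriv
  have h : Measurable fun y : Plane => -4 * (dist x y ^ 6)⁻¹ := by fun_prop
  exact h.smul ((innerSL ℝ).continuous.comp (continuous_const.sub continuous_id)).measurable

/-- On the ball of half the distance to the curve the poles stay away uniformly, so differentiation
under the integral is dominated. -/
theorem hasFDerivAt_integral_invFour {n : ℕ} {g : Plane → ℝ} (hg : Integrable g (arcLength n))
    {x : Plane} (hx : x ∉ kochCurve n) :
    Integrable (fun y => g y • invFourDeriv x y) (arcLength n) ∧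
    HasFDerivAt (fun x => ∫ y, g y * invFour x y ∂arcLength n)
      (∫ y, g y • invFourDeriv x y ∂arcLength n) x := by
  have hd := curveDist_pos hx
  set d := curveDist n x
  have hball : ∀ z ∈ Metric.ball x (d / 2), ∀ y ∈ kochCurve n, d / 2 ≤ dist z y := by
    intro z hz y hy
    have h1 := curveDist_le x hy
    have h2 := dist_triangle x z y
    rw [Metric.mem_ball, dist_comm] at hz
    linarith
  have hnot : ∀ z ∈ Metric.ball x (d / 2), z ∉ kochCurve n := by
    intro z hz hK
    have := hball z hz z hK
    rw [dist_self] at this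
    linarith
  have hb : ∀ᵐ y ∂arcLength n, ∀ z ∈ Metric.ball x (d / 2),
      ‖g y • invFourDeriv z y‖ ≤ ‖g y‖ * (4 * (d / 2)⁻¹ * ((d / 2) ^ 4)⁻¹) := by
    filter_upwards [ae_mem_kochCurve n] with y hy z hz
    have h1 := hball z hz y hy
    rw [norm_smul]
    refine mul_le_mul_of_nonneg_left ((norm_invFourDeriv z y).trans ?_) (norm_nonneg _)
    unfold invFour
    gcongr
  have hm : AEStronglyMeasurable (fun y => g y • invFourDeriv x y) (arcLength n) :=
    hg.1.smul (measurable_invFourDeriv_right x).aestronglyMeasurable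
  refine ⟨?_, ?_⟩
  · refine (hg.norm.mul_const (4 * (d / 2)⁻¹ * ((d / 2) ^ 4)⁻¹)).mono' hm ?_
    filter_upwards [hb] with y hy
    exact hy x (Metric.mem_ball_self (by positivity))
  refine hasFDerivAt_integral_of_dominated_of_fderiv_le
    (F' := fun z y => g y • invFourDeriv z y) (Metric.ball_mem_nhds x (half_pos hd)) ?_
    (integrable_mul_invFour hg hx) hm hb (hg.norm.mul_const _) ?_
  · filter_upwards [Metric.ball_mem_nhds x (half_pos hd)] with z hz
    exact (integrable_mul_invFour hg (hnot z hz)).1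
  · filter_upwards [ae_mem_kochCurve n] with y hy z hz
    exact (hasFDerivAt_invFour fun h : z = y => hnot z hz (h.symm ▸ hy)).const_mul (g y)

/-- Quotient rule. The derivative of the normalisation contributes exactly the subtraction of `ext n
g x`, so the gradient is governed by the oscillation of `g` and not by its size. -/
theorem hasFDerivAt_ext {n : ℕ} {g : Plane → ℝ} (hg : Integrable g (arcLength n)) {x : Plane}
    (hx : x ∈ kochDomain n) :
    HasFDerivAt (ext n g)
      ((kernelMass n x)⁻¹ • ∫ y, (g y - ext n g x) • invFourDeriv x y ∂arcLength n) x := by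
  have hxK : x ∉ kochCurve n := fun h => notMem_kochDomain_of_mem_kochCurve h hx
  have hk := kernelMass_pos hx
  obtain ⟨i1, h1⟩ := hasFDerivAt_integral_invFour hg hxK
  obtain ⟨i2, h2⟩ := hasFDerivAt_integral_invFour (integrable_const (μ := arcLength n) (1 : ℝ)) hxK
  have h2' : HasFDerivAt (kernelMass n) (∫ y, (1 : ℝ) • invFourDeriv x y ∂arcLength n) x := by
    simp only [one_mul] at h2
    exact h2
  have h3 := h1.mul ((hasDerivAt_inv hk.ne').comp_hasFDerivAt x h2')
  have e : ext n g = (fun x => ∫ y, g y * invFour x y ∂arcLength n) * (Inv.inv ∘ kernelMass n) := by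
    ext z; rfl
  rw [e]
  refine h3.congr_fderiv ?_
  have e2 : (fun y => (g y - ext n g x) • invFourDeriv x y) =
      fun y => g y • invFourDeriv x y - ext n g x • ((1 : ℝ) • invFourDeriv x y) := by
    ext y v
    simp only [smul_apply, smul_eq_mul, sub_apply]
    ring
  have i3 : Integrable (fun y => ext n g x • ((1 : ℝ) • invFourDeriv x y)) (arcLength n) :=
    i2.smul (ext n g x)
  have e3 : ∫ y, ext n g x • ((1 : ℝ) • invFourDeriv x y) ∂arcLength n =
      ext n g x • ∫ y, (1 : ℝ) • invFourDeriv x y ∂arcLength n := integral_smul _ _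
  rw [← e, e2, integral_sub i1 i3, e3]
  ext v
  simp only [add_apply, smul_apply, smul_eq_mul, sub_apply, ext]
  simp only [Function.comp_apply]
  field_simp
  ring

/-- Differentiating the kernel costs a factor `4 / |x - y| ≤ 4 / d`; the rest is Cauchy-Schwarz for
the probability weight. -/
theorem enorm_fderiv_ext_sq_le {n : ℕ} {g : Plane → ℝ} (hg : Integrable g (arcLength n)) {x : Plane}
    (hx : x ∈ kochDomain n) :
    ‖fderiv ℝ (ext n g) x‖ₑ ^ 2 ≤ ENNReal.ofReal (16 * (curveDist n x ^ 2)⁻¹) *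
      ∫⁻ y, ‖g y - ext n g x‖ₑ ^ 2 * wgt n x y ∂arcLength n := by
  have hk := kernelMass_pos hx
  have hd := curveDist_pos_of_mem hx
  have h1 : ‖fderiv ℝ (ext n g) x‖ₑ ≤ ENNReal.ofReal (4 * (curveDist n x)⁻¹) *
      ∫⁻ y, ‖g y - ext n g x‖ₑ * wgt n x y ∂arcLength n := by
    rw [(hasFDerivAt_ext hg hx).fderiv, ← integral_smul,
      ← lintegral_const_mul' _ _ ENNReal.ofReal_ne_top]
    refine (enorm_integral_le_lintegral_enorm _).trans (lintegral_mono_ae ?_)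
    filter_upwards [ae_mem_kochCurve n] with y hy
    rw [enorm_smul, enorm_smul, Real.enorm_eq_ofReal (inv_pos.2 hk).le, wgt, mul_left_comm,
      mul_left_comm (ENNReal.ofReal _) (‖g y - ext n g x‖ₑ)]
    refine mul_le_mul_right ?_ _
    rw [← ofReal_norm, ← ENNReal.ofReal_mul (inv_pos.2 hk).le, ← ENNReal.ofReal_mul (by positivity)]
    refine ENNReal.ofReal_le_ofReal ?_
    have h4 := norm_invFourDeriv x y
    have h5 := curveDist_le x hy
    have h6 := invFour_nonneg x y
    calc (kernelMass n x)⁻¹ * ‖invFourDeriv x y‖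
        ≤ (kernelMass n x)⁻¹ * (4 * (dist x y)⁻¹ * invFour x y) := by gcongr
      _ ≤ (kernelMass n x)⁻¹ * (4 * (curveDist n x)⁻¹ * invFour x y) := by gcongr
      _ = _ := by ring
  calc ‖fderiv ℝ (ext n g) x‖ₑ ^ 2 ≤ (ENNReal.ofReal (4 * (curveDist n x)⁻¹) *
      ∫⁻ y, ‖g y - ext n g x‖ₑ * wgt n x y ∂arcLength n) ^ 2 := by gcongr
    _ = ENNReal.ofReal (16 * (curveDist n x ^ 2)⁻¹) *
        (∫⁻ y, ‖g y - ext n g x‖ₑ * wgt n x y ∂arcLength n) ^ 2 := by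
        rw [mul_pow, ← ENNReal.ofReal_pow (by positivity)]
        congr 2
        field_simp
        norm_num
    _ ≤ ENNReal.ofReal (16 * (curveDist n x ^ 2)⁻¹) * ((∫⁻ y, wgt n x y ∂arcLength n) *
        ∫⁻ y, ‖g y - ext n g x‖ₑ ^ 2 * wgt n x y ∂arcLength n) := by
        gcongr
        exact lintegral_mul_weight_sq_le (hg.1.aemeasurable.sub_const _).enorm
          (measurable_wgt_right n x).aemeasurable
    _ = _ := by rw [lintegral_wgt hx, one_mul]

/-! ### Boundedness of the extension from `H^{1/2}(K_n)` to `H¹(Ω)` -/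

/-- Jensen's inequality with the weight bounded by a multiple of `1 / |x - y|`, whose integral over
the domain is bounded uniformly in `y`; Tonelli concludes. -/
theorem lintegral_ext_sq_le (n : ℕ) : ∃ C : ℝ≥0∞, C ≠ ⊤ ∧ ∀ g : Plane → ℝ, Measurable g →
    Integrable g (arcLength n) →
    ∫⁻ x, ‖ext n g x‖ₑ ^ 2 ∂bulk n ≤ C * ∫⁻ y, ‖g y‖ₑ ^ 2 ∂arcLength n := by
  obtain ⟨R, hR⟩ := (isBounded_kochDomain n).subset_ball 0
  have hR0 : (0 : ℝ) < max R 1 := by positivity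
  have hC := wgtConst_pos n
  refine ⟨ENNReal.ofReal (wgtConst n) * (ENNReal.ofReal (max R 1) * ballConst),
    ENNReal.mul_ne_top ENNReal.ofReal_ne_top
      (ENNReal.mul_ne_top ENNReal.ofReal_ne_top ballConst_lt_top.ne), fun g hgm hg => ?_⟩
  have hm : Measurable fun p : Plane × Plane =>
      ‖g p.2‖ₑ ^ 2 * ENNReal.ofReal (wgtConst n * (dist p.1 p.2)⁻¹) := by fun_prop
  calc ∫⁻ x, ‖ext n g x‖ₑ ^ 2 ∂bulk n
      ≤ ∫⁻ x, ∫⁻ y, ‖g y‖ₑ ^ 2 * ENNReal.ofReal (wgtConst n * (dist x y)⁻¹) ∂arcLength n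
          ∂bulk n := by
        refine lintegral_mono_ae ?_
        filter_upwards [ae_bulk_mem n] with x hx
        have hd := curveDist_pos_of_mem hx
        have h := enorm_sub_ext_sq_le hg hx 0
        rw [zero_sub, enorm_neg] at h
        refine h.trans (lintegral_mono_ae ?_)
        filter_upwards [ae_mem_kochCurve n] with y hy
        rw [zero_sub, enorm_neg]
        refine mul_le_mul_right ((wgt_le hx y).trans (ENNReal.ofReal_le_ofReal ?_)) _
        have h2 := curveDist_le x hy
        have h3 : 0 < dist x y := hd.trans_le h2
        gcongr
        calc curveDist n x ^ 3 * invFour x y ≤ dist x y ^ 3 * invFour x y := by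
              have := invFour_nonneg x y
              gcongr
          _ = _ := by rw [invFour]; field_simp
    _ = ∫⁻ y, ∫⁻ x, ‖g y‖ₑ ^ 2 * ENNReal.ofReal (wgtConst n * (dist x y)⁻¹) ∂bulk n
          ∂arcLength n := lintegral_lintegral_swap hm.aemeasurable
    _ ≤ ∫⁻ y, ENNReal.ofReal (wgtConst n) * (ENNReal.ofReal (max R 1) * ballConst) * ‖g y‖ₑ ^ 2
          ∂arcLength n := by
        refine lintegral_mono fun y => ?_
        rw [lintegral_const_mul _ (by fun_prop), mul_comm]
        refine mul_le_mul_left ?_ _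
        simp_rw [ENNReal.ofReal_mul hC.le]
        rw [lintegral_const_mul _ (by fun_prop)]
        refine mul_le_mul_right ?_ _
        refine le_trans (lintegral_mono_set ?_) (lintegral_inv_dist_le hR0 0 y)
        exact hR.trans (Metric.ball_subset_ball (le_max_left _ _))
    _ = _ := lintegral_const_mul _ (by fun_prop)

/-- Each `x` has distance at least `|y - z| / 2` from one of the two poles, so the minimum is
bounded by two tails. The Gagliardo weight `|y - z|^{-2}` arises here. -/
theorem lintegral_min_invFour_le {y z : Plane} (h : y ≠ z) :
    ∫⁻ x, min (ENNReal.ofReal (invFour x y)) (ENNReal.ofReal (invFour x z)) ≤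
      8 * tailMass * ENNReal.ofReal ((dist y z ^ 2)⁻¹) := by
  have hd : 0 < dist y z := dist_pos.2 h
  set ρ := dist y z / 2 with hρ
  have hρ0 : 0 < ρ := by positivity
  have hmq : ∀ q : Plane, MeasurableSet {x : Plane | ρ ≤ dist x q} := fun q =>
    measurableSet_le measurable_const (measurable_id.dist measurable_const)
  have hm : ∀ q : Plane, Measurable fun x : Plane => ENNReal.ofReal (invFour x q) := fun q => by
    unfold invFour; fun_prop
  calc ∫⁻ x, min (ENNReal.ofReal (invFour x y)) (ENNReal.ofReal (invFour x z))
      ≤ ∫⁻ x, ({x : Plane | ρ ≤ dist x y}.indicator (fun x => ENNReal.ofReal (invFour x y)) x +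
          {x : Plane | ρ ≤ dist x z}.indicator (fun x => ENNReal.ofReal (invFour x z)) x) := by
        refine lintegral_mono fun x => ?_
        by_cases h1 : ρ ≤ dist x y
        · refine (min_le_left _ _).trans (le_trans (le_of_eq ?_) le_self_add)
          rw [indicator_of_mem (by exact h1)]
        · have h2 : ρ ≤ dist x z := by
            have := dist_triangle_left y z x
            linarith
          refine (min_le_right _ _).trans (le_trans (le_of_eq ?_) le_add_self)
          rw [indicator_of_mem (by exact h2)]
    _ = ENNReal.ofReal ((ρ ^ 2)⁻¹) * tailMass + ENNReal.ofReal ((ρ ^ 2)⁻¹) * tailMass := by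
        rw [lintegral_add_left ((hm y).indicator (hmq y)), lintegral_indicator (hmq y),
          lintegral_indicator (hmq z)]
        unfold invFour
        rw [lintegral_tail hρ0, lintegral_tail hρ0]
    _ = _ := by
        have e : ENNReal.ofReal ((ρ ^ 2)⁻¹) = 4 * ENNReal.ofReal ((dist y z ^ 2)⁻¹) := by
          rw [show (4 : ℝ≥0∞) = ENNReal.ofReal 4 by norm_num, ← ENNReal.ofReal_mul (by norm_num)]
          congr 1
          rw [hρ]
          field_simp
          norm_num
        rw [e]
        ring

theorem enorm_diffQuot_sq (g : Plane → ℝ) (y z : Plane) :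
    ‖diffQuot g (y, z)‖ₑ ^ 2 = ‖g y - g z‖ₑ ^ 2 * ENNReal.ofReal ((dist y z ^ 2)⁻¹) := by
  rw [diffQuot, div_eq_mul_inv, enorm_mul, mul_pow, Real.enorm_eq_ofReal (inv_nonneg.2 dist_nonneg),
    ← ENNReal.ofReal_pow (inv_nonneg.2 dist_nonneg), inv_pow]

/-- Jensen once more replaces `ext n g x` by `g z`, which produces `d^{-2}` times two weights. As
`d⁴ |x - q|^{-4} ≤ 1` on the curve, either weight may be absorbed, leaving the minimum of the two
kernels, symmetric in `y` and `z`. -/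
theorem enorm_fderiv_ext_sq_le' {n : ℕ} {g : Plane → ℝ}
    (hg : Integrable g (arcLength n)) {x : Plane} (hx : x ∈ kochDomain n) :
    ‖fderiv ℝ (ext n g) x‖ₑ ^ 2 ≤ ENNReal.ofReal (16 * wgtConst n ^ 2) *
      ∫⁻ y, ∫⁻ z, ‖g y - g z‖ₑ ^ 2 * min (ENNReal.ofReal (invFour x y))
        (ENNReal.ofReal (invFour x z)) ∂arcLength n ∂arcLength n := by
  have hd := curveDist_pos_of_mem hx
  have hC := wgtConst_pos n
  set d := curveDist n x
  calc ‖fderiv ℝ (ext n g) x‖ₑ ^ 2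
      ≤ ENNReal.ofReal (16 * (d ^ 2)⁻¹) *
        ∫⁻ y, ‖g y - ext n g x‖ₑ ^ 2 * wgt n x y ∂arcLength n := enorm_fderiv_ext_sq_le hg hx
    _ ≤ ENNReal.ofReal (16 * (d ^ 2)⁻¹) *
        ∫⁻ y, ∫⁻ z, ‖g y - g z‖ₑ ^ 2 * wgt n x z * wgt n x y ∂arcLength n ∂arcLength n := by
        refine mul_le_mul_right (lintegral_mono fun y => ?_) _
        rw [lintegral_mul_const' (wgt n x y) _ ENNReal.ofReal_ne_top]
        exact mul_le_mul_left (enorm_sub_ext_sq_le hg hx _) _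
    _ = ∫⁻ y, ∫⁻ z, ENNReal.ofReal (16 * (d ^ 2)⁻¹) * (‖g y - g z‖ₑ ^ 2 * wgt n x z * wgt n x y)
          ∂arcLength n ∂arcLength n := by
        rw [← lintegral_const_mul' _ _ ENNReal.ofReal_ne_top]
        exact lintegral_congr fun y => (lintegral_const_mul' _ _ ENNReal.ofReal_ne_top).symm
    _ ≤ ∫⁻ y, ∫⁻ z, ENNReal.ofReal (16 * wgtConst n ^ 2) *
          (‖g y - g z‖ₑ ^ 2 * min (ENNReal.ofReal (invFour x y)) (ENNReal.ofReal (invFour x z)))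
          ∂arcLength n ∂arcLength n := by
        refine lintegral_mono_ae ?_
        filter_upwards [ae_mem_kochCurve n] with y hy
        refine lintegral_mono_ae ?_
        filter_upwards [ae_mem_kochCurve n] with z hz
        have hy' := curveDist_le x hy
        have hz' := curveDist_le x hz
        have hky := invFour_nonneg x y
        have hkz := invFour_nonneg x z
        have key : 16 * (d ^ 2)⁻¹ * ((wgtConst n * (d ^ 3 * invFour x z)) *
            (wgtConst n * (d ^ 3 * invFour x y))) ≤
            16 * wgtConst n ^ 2 * min (invFour x y) (invFour x z) := by
          have e : 16 * (d ^ 2)⁻¹ * ((wgtConst n * (d ^ 3 * invFour x z)) *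
            (wgtConst n * (d ^ 3 * invFour x y))) =
            16 * wgtConst n ^ 2 * (d ^ 4 * (invFour x z * invFour x y)) := by
            field_simp
          rw [e]
          have b : ∀ q, d ≤ dist x q → d ^ 4 * invFour x q ≤ 1 := fun q hq => by
            have : 0 < dist x q := hd.trans_le hq
            rw [invFour, ← div_eq_mul_inv, div_le_one (by positivity)]
            gcongr
          refine mul_le_mul_of_nonneg_left (le_min ?_ ?_) (by positivity)
          · rw [← mul_assoc]; exact mul_le_of_le_one_left hky (b z hz')
          · rw [mul_comm (invFour x z), ← mul_assoc]; exact mul_le_of_le_one_left hkz (b y hy')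
        calc ENNReal.ofReal (16 * (d ^ 2)⁻¹) * (‖g y - g z‖ₑ ^ 2 * wgt n x z * wgt n x y)
            = ‖g y - g z‖ₑ ^ 2 * (ENNReal.ofReal (16 * (d ^ 2)⁻¹) * (wgt n x z * wgt n x y)) := by
              ring
          _ ≤ ‖g y - g z‖ₑ ^ 2 * (ENNReal.ofReal (16 * (d ^ 2)⁻¹) *
              (ENNReal.ofReal (wgtConst n * (d ^ 3 * invFour x z)) *
                ENNReal.ofReal (wgtConst n * (d ^ 3 * invFour x y)))) := by
              gcongr
              · exact wgt_le hx z
              · exact wgt_le hx y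
          _ ≤ ‖g y - g z‖ₑ ^ 2 * ENNReal.ofReal (16 * wgtConst n ^ 2 *
                min (invFour x y) (invFour x z)) := by
              rw [← ENNReal.ofReal_mul (by positivity), ← ENNReal.ofReal_mul (by positivity)]
              exact mul_le_mul_right (ENNReal.ofReal_le_ofReal key) _
          _ = _ := by
              rw [ENNReal.ofReal_mul (by positivity), ENNReal.ofReal_min]
              ring
    _ = _ := by
        rw [← lintegral_const_mul' _ _ ENNReal.ofReal_ne_top]
        exact lintegral_congr fun y => (lintegral_const_mul' _ _ ENNReal.ofReal_ne_top)

/-- By Tonelli the integration in `x` falls on the minimum of the two kernels and turns it into the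
Gagliardo weight. -/
theorem lintegral_fderiv_ext_sq_le (n : ℕ) : ∃ C : ℝ≥0∞, C ≠ ⊤ ∧ ∀ g : Plane → ℝ, Measurable g →
    Integrable g (arcLength n) →
    ∫⁻ x, ‖fderiv ℝ (ext n g) x‖ₑ ^ 2 ∂bulk n ≤
      C * ∫⁻ p, ‖diffQuot g p‖ₑ ^ 2 ∂(arcLength n).prod (arcLength n) := by
  refine ⟨ENNReal.ofReal (16 * wgtConst n ^ 2) * (8 * tailMass),
    ENNReal.mul_ne_top ENNReal.ofReal_ne_top
      (ENNReal.mul_ne_top (by norm_num) tailMass_lt_top.ne), fun g hgm hg => ?_⟩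
  have hk : Measurable fun q : Plane × Plane × Plane =>
      ‖g q.2.1 - g q.2.2‖ₑ ^ 2 * min (ENNReal.ofReal (invFour q.1 q.2.1))
        (ENNReal.ofReal (invFour q.1 q.2.2)) := by
    unfold invFour; fun_prop
  have hd : Measurable fun p : Plane × Plane => ‖diffQuot g p‖ₑ ^ 2 := by
    unfold diffQuot; fun_prop
  have hs : ∀ x : Plane, AEMeasurable (fun p : Plane × Plane =>
      ‖g p.1 - g p.2‖ₑ ^ 2 * min (ENNReal.ofReal (invFour x p.1))
        (ENNReal.ofReal (invFour x p.2))) ((arcLength n).prod (arcLength n)) := fun x =>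
    (hk.comp measurable_prodMk_left).aemeasurable
  calc ∫⁻ x, ‖fderiv ℝ (ext n g) x‖ₑ ^ 2 ∂bulk n
      ≤ ∫⁻ x, ENNReal.ofReal (16 * wgtConst n ^ 2) * ∫⁻ p : Plane × Plane,
          ‖g p.1 - g p.2‖ₑ ^ 2 * min (ENNReal.ofReal (invFour x p.1))
          (ENNReal.ofReal (invFour x p.2)) ∂(arcLength n).prod (arcLength n) ∂bulk n := by
        refine lintegral_mono_ae ?_
        filter_upwards [ae_bulk_mem n] with x hx
        rw [lintegral_prod _ (hs x)]
        exact enorm_fderiv_ext_sq_le' hg hx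
    _ = ENNReal.ofReal (16 * wgtConst n ^ 2) * ∫⁻ p : Plane × Plane, ∫⁻ x,
          ‖g p.1 - g p.2‖ₑ ^ 2 * min (ENNReal.ofReal (invFour x p.1))
          (ENNReal.ofReal (invFour x p.2)) ∂bulk n ∂(arcLength n).prod (arcLength n) := by
        rw [lintegral_const_mul' _ _ ENNReal.ofReal_ne_top, lintegral_lintegral_swap]
        exact hk.aemeasurable
    _ ≤ ENNReal.ofReal (16 * wgtConst n ^ 2) * ∫⁻ p : Plane × Plane,
          8 * tailMass * ‖diffQuot g p‖ₑ ^ 2 ∂(arcLength n).prod (arcLength n) := by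
        gcongr with p
        obtain ⟨y, z⟩ := p
        dsimp only
        have hm : Measurable fun x : Plane => min (ENNReal.ofReal (invFour x y))
            (ENNReal.ofReal (invFour x z)) := by unfold invFour; fun_prop
        rw [lintegral_const_mul _ hm, enorm_diffQuot_sq]
        rcases eq_or_ne y z with rfl | h
        · simp
        · rw [mul_left_comm]
          refine mul_le_mul_right ?_ _
          exact (setLIntegral_le_lintegral _ _).trans (lintegral_min_invFour_le h)
    _ = _ := by rw [lintegral_const_mul _ hd, ← mul_assoc]

/-! ### Membership of the extension in `H¹(Ω)` -/

/-- Classical derivatives are weak derivatives. -/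
theorem hasWeakGrad_gradient {n : ℕ} {u : Plane → ℝ} (hu : ∀ x ∈ kochDomain n, DifferentiableAt ℝ u x)
    (h2 : MemLp u 2 (bulk n)) (hG : MemLp (gradient u) 2 (bulk n)) :
    HasWeakGrad n u (gradient u) := by
  intro φ hφ y
  have e1 := memLp_fderiv_apply hφ.1 hφ.2.1 (μ := bulk n) y
  have e2 : MemLp φ 2 (bulk n) := hφ.memLp
  have i1 := integrable_mul_of_memLp h2 e1
  have i2 := integrable_mul_of_memLp (hG.inner_const (𝕜 := ℝ) y) e2
  have z1 : ∀ x ∉ kochDomain n, φ x = 0 := fun x hx =>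
    image_eq_zero_of_notMem_tsupport fun h => hx (hφ.2.2 h)
  have z2 : ∀ x ∉ kochDomain n, fderiv ℝ φ x = 0 := fun x hx => by
    by_contra h
    exact hx (hφ.2.2 (support_fderiv_subset ℝ h))
  have hder : ∀ x, HasFDerivAt (fun x => u x * φ x)
      (u x • fderiv ℝ φ x + φ x • fderiv ℝ u x) x := by
    intro x
    have hφx := (hφ.1.differentiable (by simp) x).hasFDerivAt
    by_cases hx : x ∈ kochDomain n
    · exact (hu x hx).hasFDerivAt.mul hφx
    · have h0 : (fun x => u x * φ x) =ᶠ[𝓝 x] fun _ => 0 := by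
        have hn : x ∉ tsupport φ := fun h => hx (hφ.2.2 h)
        filter_upwards [(isClosed_tsupport φ).isOpen_compl.mem_nhds hn] with z hz
        rw [image_eq_zero_of_notMem_tsupport hz, mul_zero]
      rw [z1 x hx, z2 x hx, smul_zero, zero_smul, add_zero]
      exact (hasFDerivAt_const (0 : ℝ) x).congr_of_eventuallyEq h0
  have key : ∫ x, (u x * fderiv ℝ φ x y + inner ℝ (gradient u x) y * φ x) = 0 := by
    have hz : ∀ x ∉ kochDomain n, u x * fderiv ℝ φ x y + inner ℝ (gradient u x) y * φ x = 0 :=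
      fun x hx => by rw [z1 x hx, z2 x hx]; simp
    have hI : Integrable (fun x => u x * fderiv ℝ φ x y + inner ℝ (gradient u x) y * φ x) volume :=
      (integrableOn_iff_integrable_of_support_subset
        (s := kochDomain n) (Function.support_subset_iff'.2 hz)).1 (i1.add i2)
    have hI2 : Integrable (fun x => u x * φ x) volume :=
      (integrableOn_iff_integrable_of_support_subset (s := kochDomain n)
        (Function.support_subset_iff'.2 fun x hx => by rw [z1 x hx, mul_zero])).1
        (integrable_mul_of_memLp h2 e2)
    -- Integration by parts against the constant `1`: the product `u φ` is differentiable in the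
    -- whole plane, since it vanishes near every point outside the domain, so its derivative
    -- integrates to zero.
    have h := integral_bilinear_hasLineDerivAt_right_eq_neg_left_of_integrable
      (μ := (volume : Measure Plane)) (f := fun _ => (1 : ℝ)) (f' := fun _ => 0)
      (g := fun x => u x * φ x)
      (g' := fun x => u x * fderiv ℝ φ x y + inner ℝ (gradient u x) y * φ x) (v := y)
      (B := ContinuousLinearMap.mul ℝ ℝ) (by simp) (by simpa using hI) (by simpa using hI2)
      (fun x _ => by simpa using (hasFDerivAt_const (1 : ℝ) x).hasLineDerivAt y) (fun x _ => by
        have := (hder x).hasLineDerivAt y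
        convert this using 1
        rw [add_apply, smul_apply, smul_apply, smul_eq_mul, smul_eq_mul]
        rw [gradient, InnerProductSpace.toDual_symm_apply]
        ring)
    simpa using h
  have i3 : Integrable (fun x => u x * fderiv ℝ φ x y) (bulk n) := i1
  have i4 : Integrable (fun x => inner ℝ (gradient u x) y * φ x) (bulk n) := i2
  rw [← add_eq_zero_iff_eq_neg, ← integral_add i3 i4, bulk,
    setIntegral_eq_integral_of_forall_compl_eq_zero, key]
  intro x hx
  rw [z1 x hx, z2 x hx]
  simp

theorem norm_gradient (u : Plane → ℝ) (x : Plane) : ‖gradient u x‖ = ‖fderiv ℝ u x‖ := by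
  rw [gradient, LinearIsometryEquiv.norm_map]

theorem measurable_gradient (u : Plane → ℝ) : Measurable (gradient u) :=
  (InnerProductSpace.toDual ℝ Plane).symm.continuous.measurable.comp (measurable_fderiv ℝ u)

theorem memLp_ext {n : ℕ} {g : Plane → ℝ} (hgm : Measurable g) (hg : MemLp g 2 (arcLength n)) :
    MemLp (ext n g) 2 (bulk n) := by
  obtain ⟨C, hC, h⟩ := lintegral_ext_sq_le n
  rw [memLp_two_iff_lintegral (measurable_ext hgm).aestronglyMeasurable]
  exact (h g hgm (hg.integrable (by norm_num))).trans_lt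
    (ENNReal.mul_lt_top hC.lt_top ((memLp_two_iff_lintegral hg.1).1 hg))

theorem memLp_gradient_ext {n : ℕ} {g : Plane → ℝ} (hgm : Measurable g)
    (hg : MemLp g 2 (arcLength n))
    (hq : MemLp (diffQuot g) 2 ((arcLength n).prod (arcLength n))) :
    MemLp (gradient (ext n g)) 2 (bulk n) := by
  obtain ⟨C, hC, h⟩ := lintegral_fderiv_ext_sq_le n
  rw [memLp_two_iff_lintegral (measurable_gradient _).aestronglyMeasurable]
  have e : ∀ x, ‖gradient (ext n g) x‖ₑ = ‖fderiv ℝ (ext n g) x‖ₑ := fun x => by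
    rw [← ofReal_norm, norm_gradient, ofReal_norm]
  simp_rw [e]
  exact (h g hgm (hg.integrable (by norm_num))).trans_lt
    (ENNReal.mul_lt_top hC.lt_top ((memLp_two_iff_lintegral hq.1).1 hq))

theorem hasWeakGrad_ext {n : ℕ} {g : Plane → ℝ} (hgm : Measurable g)
    (hg : MemLp g 2 (arcLength n))
    (hq : MemLp (diffQuot g) 2 ((arcLength n).prod (arcLength n))) :
    HasWeakGrad n (ext n g) (gradient (ext n g)) :=
  hasWeakGrad_gradient
    (fun _ hx => (hasFDerivAt_ext (hg.integrable (by norm_num)) hx).differentiableAt)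
    (memLp_ext hgm hg) (memLp_gradient_ext hgm hg hq)

theorem memH1_ext {n : ℕ} {g : Plane → ℝ} (hgm : Measurable g) (hg : MemLp g 2 (arcLength n))
    (hq : MemLp (diffQuot g) 2 ((arcLength n).prod (arcLength n))) : MemH1 n (ext n g) :=
  ⟨memLp_ext hgm hg, _, memLp_gradient_ext hgm hg hq, hasWeakGrad_ext hgm hg hq⟩

/-! ### The trace of the extension -/

/-- Near an interior point of a side the domain has positive density. -/
theorem exists_le_volume_ball_inter {n : ℕ} {e : Plane × Plane} (he : e ∈ kochSides n) {τ : ℝ}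
    (hτ : τ ∈ Ioo (0 : ℝ) 1) : ∃ c > 0, ∀ᶠ r in 𝓝[>] (0 : ℝ),
      c * r ^ 2 ≤ (volume (Metric.ball (AffineMap.lineMap e.1 e.2 τ) r ∩ kochDomain n)).toReal := by
  have hne := ne_of_mem_kochSides he
  have hl := side_length_pos he
  set x₀ : Plane := AffineMap.lineMap e.1 e.2 τ with hx₀
  obtain ⟨r₀, hr₀, hball⟩ := Metric.isOpen_iff.1 (isOpen_rhombus e) x₀ (side_mem_rhombus hne hτ)
  have hfin : volume (Metric.ball (0 : Plane) 1) ≠ ⊤ := measure_ball_lt_top.ne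
  have hpos : 0 < volume (Metric.ball (0 : Plane) 1) := Metric.measure_ball_pos _ _ one_pos
  refine ⟨(volume (Metric.ball (0 : Plane) 1)).toReal / 64,
    div_pos (ENNReal.toReal_pos hpos.ne' hfin) (by norm_num), ?_⟩
  filter_upwards [Ioo_mem_nhdsGT hr₀] with r hr
  have hr0 : 0 < r := hr.1
  set l := dist e.1 e.2 with hldef
  -- The point at distance `r / √3` from `x₀` along the inner normal. The ball of radius `r / 8`
  -- around it stays in the inner half, whence the constant `1 / 64`.
  obtain ⟨z, hz1, hz2⟩ := exists_coord hne τ (-(r / l))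
  have hdz : dist z x₀ ≤ 3 / 4 * r := by
    have h := dist_sq_coord hne z x₀
    rw [hz1, hz2, hx₀, tanCoord_side hne, norCoord_side, sqLen_eq] at h
    have h2 : dist z x₀ ^ 2 = r ^ 2 / 3 := by
      rw [hx₀, h, ← hldef]; field_simp; ring
    nlinarith [dist_nonneg (x := z) (y := x₀)]
  have hsub : Metric.ball z (r / 8) ⊆ Metric.ball x₀ r ∩ kochDomain n := by
    intro q hq
    rw [Metric.mem_ball] at hq
    have h1 : dist q x₀ < r := by
      have := dist_triangle q z x₀
      linarith
    refine ⟨h1, ?_⟩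
    have hqr : q ∈ rhombus e := hball (Metric.ball_subset_ball hr.2.le h1)
    rw [mem_kochDomain_iff he hqr]
    have h3 := abs_norCoord_sub_le hne q z
    rw [hz2] at h3
    have h4 := (abs_le.1 h3).2
    have h5 : 2 * dist q z / l ≤ r / l / 4 := by
      rw [div_div, div_le_div_iff₀ hl (by positivity)]
      nlinarith
    have h6 : 0 < r / l := by positivity
    linarith
  have hle := measure_mono (μ := volume) hsub
  rw [volume_ball_plane (by positivity)] at hle
  have hlt : volume (Metric.ball x₀ r ∩ kochDomain n) ≠ ⊤ :=
    ((measure_mono inter_subset_left).trans_lt measure_ball_lt_top).ne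
  have := ENNReal.toReal_mono hlt hle
  rw [ENNReal.toReal_mul, ENNReal.toReal_ofReal (by positivity)] at this
  refine le_trans (le_of_eq ?_) this
  ring

/-- Cauchy-Schwarz on `S`: the error of the average is controlled by the mean square deviation. -/
theorem sq_sub_average_mul_le {S : Set Plane} (hS : volume S ≠ 0) (hS' : volume S ≠ ⊤)
    {u : Plane → ℝ} (hu : IntegrableOn u S volume) (c : ℝ) {K : ℝ} (hK : 0 ≤ K)
    (h : ∫⁻ x in S, ‖c - u x‖ₑ ^ 2 ≤ ENNReal.ofReal K) :
    (c - ⨍ x in S, u x ∂volume) ^ 2 * (volume S).toReal ≤ K := by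
  have hV : 0 < (volume S).toReal := ENNReal.toReal_pos hS hS'
  have : IsFiniteMeasure (volume.restrict S) := isFiniteMeasure_restrict.2 hS'
  set V := (volume S).toReal
  set A := c - ⨍ x in S, u x ∂volume with hA
  have e : V * A = ∫ x in S, (c - u x) := by
    rw [integral_sub (integrable_const c) hu, setIntegral_const, hA, setAverage_eq, smul_eq_mul,
      smul_eq_mul]
    change V * (c - V⁻¹ * _) = V * c - _
    field_simp
  have h1 : ‖V * A‖ₑ ^ 2 ≤ ENNReal.ofReal (K * V) := by
    rw [e]
    calc ‖∫ x in S, (c - u x)‖ₑ ^ 2 ≤ (∫⁻ x in S, ‖c - u x‖ₑ * 1) ^ 2 := by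
          simp only [mul_one]
          gcongr
          exact enorm_integral_le_lintegral_enorm _
      _ ≤ (∫⁻ x in S, 1) * ∫⁻ x in S, ‖c - u x‖ₑ ^ 2 * 1 :=
          lintegral_mul_weight_sq_le (hu.1.aemeasurable.const_sub c).enorm aemeasurable_const
      _ ≤ ENNReal.ofReal (K * V) := by
          simp only [mul_one]
          rw [lintegral_one, Measure.restrict_apply_univ, mul_comm, ENNReal.ofReal_mul hK,
            ENNReal.ofReal_toReal hS']
          gcongr
  rw [Real.enorm_eq_ofReal_abs, ← ENNReal.ofReal_pow (abs_nonneg _), sq_abs,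
    ENNReal.ofReal_le_ofReal_iff (by positivity)] at h1
  nlinarith

/-- The mean oscillation of the extension around a point of the curve. -/
theorem setLIntegral_ext_sub_sq_le {n : ℕ} {g : Plane → ℝ} (hgm : Measurable g)
    (hg : Integrable g (arcLength n)) {x₀ : Plane} (hx₀ : x₀ ∈ kochCurve n) {r : ℝ} (hr : 0 < r) :
    ∫⁻ x in Metric.ball x₀ r ∩ kochDomain n, ‖g x₀ - ext n g x‖ₑ ^ 2 ≤
      ENNReal.ofReal (4 * wgtConst n) * ballConst *
        (∫⁻ y, ‖diffQuot g (x₀, y)‖ₑ ^ 2 ∂arcLength n) * ENNReal.ofReal (r ^ 3) := by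
  have hC := wgtConst_pos n
  set S := Metric.ball x₀ r ∩ kochDomain n
  have hS : MeasurableSet S := measurableSet_ball.inter (measurableSet_kochDomain n)
  have hd : Measurable fun p : Plane => ‖diffQuot g (x₀, p)‖ₑ ^ 2 := by
    unfold diffQuot; fun_prop
  have hm : Measurable fun p : Plane × Plane => ‖diffQuot g (x₀, p.2)‖ₑ ^ 2 *
      ENNReal.ofReal (4 * wgtConst n * r ^ 2 * (dist p.1 p.2)⁻¹) :=
    (hd.comp measurable_snd).mul (by fun_prop)
  calc ∫⁻ x in S, ‖g x₀ - ext n g x‖ₑ ^ 2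
      ≤ ∫⁻ x in S, ∫⁻ y, ‖diffQuot g (x₀, y)‖ₑ ^ 2 *
          ENNReal.ofReal (4 * wgtConst n * r ^ 2 * (dist x y)⁻¹) ∂arcLength n := by
        refine setLIntegral_mono' hS fun x hx => ?_
        have hd := curveDist_pos_of_mem hx.2
        refine (enorm_sub_ext_sq_le hg hx.2 (g x₀)).trans (lintegral_mono_ae ?_)
        filter_upwards [ae_mem_kochCurve n] with y hy
        rcases eq_or_ne x₀ y with rfl | hne
        · simp
        have h0 : 0 < dist x₀ y := dist_pos.2 hne
        rw [enorm_diffQuot_sq, mul_assoc]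
        refine mul_le_mul_right ?_ _
        refine (wgt_le hx.2 y).trans ?_
        rw [← ENNReal.ofReal_mul (by positivity)]
        refine ENNReal.ofReal_le_ofReal ?_
        have b1 := curveDist_le x hy
        have b2 : curveDist n x ≤ r := (curveDist_le x hx₀).trans (Metric.mem_ball.1 hx.1).le
        have b3 : dist x₀ y ≤ r + dist x y := by
          have := dist_triangle_left x₀ y x
          have := (Metric.mem_ball.1 hx.1).le
          linarith
        set d := curveDist n x
        set a := dist x y
        set D := dist x₀ y
        have ha : 0 < a := hd.trans_le b1
        -- Uses `D ≤ r + a` together with the two bounds `d ≤ a` and `d ≤ r`: one power of `d` is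
        -- traded for `a` and two for `r`.
        have e1 : d ^ 3 * invFour x y * D ^ 2 ≤ 4 * r ^ 2 * a⁻¹ := by
          rw [invFour]
          change d ^ 3 * (a ^ 4)⁻¹ * D ^ 2 ≤ _
          rw [← div_eq_mul_inv, ← div_eq_mul_inv, div_mul_eq_mul_div,
            div_le_div_iff₀ (by positivity) ha]
          have hD2 : D ^ 2 ≤ 2 * r ^ 2 + 2 * a ^ 2 := by
            have : D ^ 2 ≤ (r + a) ^ 2 := by gcongr
            nlinarith [sq_nonneg (r - a)]
          have c1 : d ^ 3 * r ^ 2 ≤ a ^ 3 * r ^ 2 := by gcongr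
          have c2 : d ^ 3 * a ^ 2 ≤ a ^ 3 * r ^ 2 := by
            calc d ^ 3 * a ^ 2 = d * d ^ 2 * a ^ 2 := by ring
              _ ≤ a * r ^ 2 * a ^ 2 := by gcongr
              _ = _ := by ring
          calc d ^ 3 * D ^ 2 * a ≤ d ^ 3 * (2 * r ^ 2 + 2 * a ^ 2) * a := by gcongr
            _ = (2 * (d ^ 3 * r ^ 2) + 2 * (d ^ 3 * a ^ 2)) * a := by ring
            _ ≤ (2 * (a ^ 3 * r ^ 2) + 2 * (a ^ 3 * r ^ 2)) * a := by gcongr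
            _ = _ := by ring
        rw [inv_mul_eq_div, le_div_iff₀ (by positivity)]
        calc wgtConst n * (d ^ 3 * invFour x y) * D ^ 2
            = wgtConst n * (d ^ 3 * invFour x y * D ^ 2) := by ring
          _ ≤ wgtConst n * (4 * r ^ 2 * a⁻¹) := by gcongr
          _ = _ := by ring
    _ = ∫⁻ y, (∫⁻ x in S, ‖diffQuot g (x₀, y)‖ₑ ^ 2 *
          ENNReal.ofReal (4 * wgtConst n * r ^ 2 * (dist x y)⁻¹)) ∂arcLength n :=
        lintegral_lintegral_swap hm.aemeasurable
    _ ≤ ∫⁻ y, ENNReal.ofReal (4 * wgtConst n * r ^ 2) * (ENNReal.ofReal r * ballConst) *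
          ‖diffQuot g (x₀, y)‖ₑ ^ 2 ∂arcLength n := by
        refine lintegral_mono fun y => ?_
        rw [lintegral_const_mul _ (by fun_prop), mul_comm]
        refine mul_le_mul_left ?_ _
        simp_rw [ENNReal.ofReal_mul (show 0 ≤ 4 * wgtConst n * r ^ 2 by positivity)]
        rw [lintegral_const_mul _ (by fun_prop)]
        refine mul_le_mul_right ?_ _
        exact (lintegral_mono_set inter_subset_left).trans (lintegral_inv_dist_le hr x₀ y)
    _ = _ := by
        rw [lintegral_const_mul _ hd, ENNReal.ofReal_mul (by positivity),
          ENNReal.ofReal_pow hr.le, ENNReal.ofReal_pow hr.le]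
        ring

theorem ae_interior_side (n : ℕ) : ∀ᵐ x ∂arcLength n, ∃ e ∈ kochSides n, ∃ τ ∈ Ioo (0 : ℝ) 1,
    x = AffineMap.lineMap e.1 e.2 τ := by
  rw [ae_arcLength_iff]
  intro e he
  rw [← restrict_Ioo_eq_restrict_Icc]
  filter_upwards [ae_restrict_mem measurableSet_Ioo] with τ hτ
  exact ⟨e, he, τ, hτ, rfl⟩

/-- At almost every `x₀` the inner Gagliardo integral is finite, and then the squared deviation of
the extension from `g x₀` integrates to `O(r³)` over the ball of radius `r`. The part of the ball in
the domain has area at least `c r²`, so the squared error of the average is `O(r)`. -/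
theorem hasTrace_ext {n : ℕ} {g : Plane → ℝ} (hgm : Measurable g) (hg : MemLp g 2 (arcLength n))
    (hq : MemLp (diffQuot g) 2 ((arcLength n).prod (arcLength n))) :
    HasTrace n (ext n g) g := by
  have hgi : Integrable g (arcLength n) := hg.integrable (by norm_num)
  have hd : Measurable fun p : Plane × Plane => ‖diffQuot g p‖ₑ ^ 2 := by
    unfold diffQuot; fun_prop
  have hfin := (memLp_two_iff_lintegral hq.1).1 hq
  rw [lintegral_prod _ hd.aemeasurable] at hfin
  have hae := ae_lt_top hd.lintegral_prod_right' hfin.ne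
  filter_upwards [hae, ae_interior_side n] with x₀ hx₀ hx₁
  obtain ⟨e, he, τ, hτ, rfl⟩ := hx₁
  obtain ⟨c, hc, hvol⟩ := exists_le_volume_ball_inter he hτ
  have hK := side_mem_kochCurve he (Ioo_subset_Icc_self hτ)
  set x₀ : Plane := AffineMap.lineMap e.1 e.2 τ
  set C : ℝ := (ENNReal.ofReal (4 * wgtConst n) * ballConst *
        (∫⁻ y, ‖diffQuot g (x₀, y)‖ₑ ^ 2 ∂arcLength n)).toReal with hCdef
  have hC0 : 0 ≤ C := ENNReal.toReal_nonneg
  have hCtop : ENNReal.ofReal (4 * wgtConst n) * ballConst *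
        (∫⁻ y, ‖diffQuot g (x₀, y)‖ₑ ^ 2 ∂arcLength n) ≠ ⊤ :=
    ENNReal.mul_ne_top (ENNReal.mul_ne_top ENNReal.ofReal_ne_top ballConst_lt_top.ne) hx₀.ne
  have hsq : Tendsto (fun r : ℝ => (g x₀ - ⨍ y in Metric.ball x₀ r ∩ kochDomain n,
      ext n g y ∂volume) ^ 2) (𝓝[>] 0) (𝓝 0) := by
    have hlim : Tendsto (fun r : ℝ => C / c * r) (𝓝[>] 0) (𝓝 0) := by
      have : Tendsto (fun r : ℝ => C / c * r) (𝓝 0) (𝓝 (C / c * 0)) :=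
        tendsto_id.const_mul _
      rw [mul_zero] at this
      exact this.mono_left nhdsWithin_le_nhds
    refine squeeze_zero' (.of_forall fun r => sq_nonneg _) ?_ hlim
    filter_upwards [hvol, self_mem_nhdsWithin] with r hv hr
    have hr : 0 < r := hr
    have hVpos : 0 < (volume (Metric.ball x₀ r ∩ kochDomain n)).toReal :=
      lt_of_lt_of_le (by positivity) hv
    have hV := ENNReal.toReal_pos_iff.1 hVpos
    have hint : IntegrableOn (ext n g) (Metric.ball x₀ r ∩ kochDomain n) volume := by
      have h : IntegrableOn (ext n g) (kochDomain n) volume :=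
        (memLp_ext hgm hg).integrable (by norm_num)
      exact h.mono_set inter_subset_right
    have h := sq_sub_average_mul_le hV.1.ne' hV.2.ne hint (g x₀) (K := C * r ^ 3) (by positivity) (by
      rw [ENNReal.ofReal_mul hC0, hCdef, ENNReal.ofReal_toReal hCtop]
      exact setLIntegral_ext_sub_sq_le hgm hgi hK hr)
    set A := (g x₀ - ⨍ y in Metric.ball x₀ r ∩ kochDomain n, ext n g y ∂volume) ^ 2
    have hA : 0 ≤ A := sq_nonneg _
    have h2 : A * (c * r ^ 2) ≤ C * r ^ 3 := (by gcongr : A * (c * r ^ 2) ≤ A * _).trans h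
    rw [div_mul_eq_mul_div, le_div_iff₀ hc]
    have hr2 : 0 < r ^ 2 := by positivity
    nlinarith
  have hs := (Real.continuous_sqrt.tendsto 0).comp hsq
  rw [Real.sqrt_zero] at hs
  have h3 : Tendsto (fun r : ℝ => dist (⨍ y in Metric.ball x₀ r ∩ kochDomain n,
      ext n g y ∂volume) (g x₀)) (𝓝[>] 0) (𝓝 0) := by
    refine hs.congr fun r => ?_
    simp only [Function.comp_apply]
    rw [Real.sqrt_sq_eq_abs, Real.dist_eq, abs_sub_comm]
  exact tendsto_iff_dist_tendsto_zero.2 h3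

/-! ### Extension by zero of functions with vanishing trace -/

/-- The defect in the integration by parts formula. -/
def defect (n : ℕ) (w : Plane → ℝ) (G : Plane → Plane) (y : Plane) (Φ : Plane → ℝ) : ℝ :=
  ∫ x, w x * fderiv ℝ Φ x y ∂bulk n + ∫ x, inner ℝ (G x) y * Φ x ∂bulk n

section defect

variable {n : ℕ} {w : Plane → ℝ} {G : Plane → Plane}

theorem memLp_of_smooth {Φ : Plane → ℝ} (h : ContDiff ℝ ∞ Φ) (hc : HasCompactSupport Φ) :
    MemLp Φ 2 (bulk n) := h.continuous.memLp_of_hasCompactSupport hc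

theorem defect_add (hw : MemLp w 2 (bulk n)) (hG : MemLp G 2 (bulk n)) (y : Plane)
    {Φ Ψ : Plane → ℝ} (h : ContDiff ℝ ∞ Φ) (hc : HasCompactSupport Φ) (h' : ContDiff ℝ ∞ Ψ)
    (hc' : HasCompactSupport Ψ) :
    defect n w G y (fun x => Φ x + Ψ x) = defect n w G y Φ + defect n w G y Ψ := by
  have i1 := integrable_mul_of_memLp hw (memLp_fderiv_apply h hc (μ := bulk n) y)
  have i2 := integrable_mul_of_memLp hw (memLp_fderiv_apply h' hc' (μ := bulk n) y)
  have i3 := integrable_mul_of_memLp (hG.inner_const (𝕜 := ℝ) y) (memLp_of_smooth (n := n) h hc)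
  have i4 := integrable_mul_of_memLp (hG.inner_const (𝕜 := ℝ) y) (memLp_of_smooth (n := n) h' hc')
  have e1 : ∀ x, w x * fderiv ℝ (fun x => Φ x + Ψ x) x y =
      w x * fderiv ℝ Φ x y + w x * fderiv ℝ Ψ x y := fun x => by
    rw [fderiv_fun_add (h.differentiable (by simp) x) (h'.differentiable (by simp) x), add_apply,
      mul_add]
  unfold defect
  simp_rw [e1, mul_add]
  rw [integral_add i1 i2, integral_add i3 i4]
  ring

theorem defect_zero (y : Plane) : defect n w G y (fun _ => 0) = 0 := by
  simp [defect]

theorem defect_sum (hw : MemLp w 2 (bulk n)) (hG : MemLp G 2 (bulk n)) (y : Plane) {ι : Type*}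
    (s : Finset ι) {Φ : ι → Plane → ℝ} (h : ∀ i, ContDiff ℝ ∞ (Φ i))
    (hc : ∀ i, HasCompactSupport (Φ i)) :
    (HasCompactSupport fun x => ∑ i ∈ s, Φ i x) ∧
      defect n w G y (fun x => ∑ i ∈ s, Φ i x) = ∑ i ∈ s, defect n w G y (Φ i) := by
  classical
  induction s using Finset.induction_on with
  | empty => simpa using ⟨HasCompactSupport.zero, defect_zero y⟩
  | insert i s his ih =>
    simp only [Finset.sum_insert his]
    refine ⟨(hc i).add ih.1, ?_⟩
    rw [defect_add hw hG y (h i) (hc i) (ContDiff.sum fun j _ => h j) ih.1, ih.2]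

/-- If the integration by parts formula holds near the sides, it holds off the vertices. -/
theorem defect_eq_zero_of_rhombus (hw : MemLp w 2 (bulk n)) (hG : MemLp G 2 (bulk n))
    (hwG : HasWeakGrad n w G) (y : Plane)
    (hloc : ∀ e ∈ kochSides n, ∀ Φ : Plane → ℝ, ContDiff ℝ ∞ Φ → HasCompactSupport Φ →
      tsupport Φ ⊆ rhombus e → defect n w G y Φ = 0)
    {Φ : Plane → ℝ} (h : ContDiff ℝ ∞ Φ) (hc : HasCompactSupport Φ)
    (hV : Disjoint (tsupport Φ) (vertices n)) : defect n w G y Φ = 0 := by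
  -- The cover by the domain, the exterior and the rhombi, with a subordinate partition of unity. In
  -- the domain the weak gradient applies, in the exterior the integrands vanish, and in the rhombi
  -- `hloc` applies.
  let ι := Option (Option {e // e ∈ kochSides n})
  have : Finite {e // e ∈ kochSides n} := (List.finite_toSet (kochSides n)).to_subtype
  let U : ι → Set Plane := fun i => match i with
    | none => kochDomain n
    | some none => (kochRegion n)ᶜ
    | some (some e) => rhombus e.1
  have hU : ∀ i, IsOpen (U i) := by
    rintro (_ | _ | e)
    · exact isOpen_kochDomain n
    · exact (isCompact_kochRegion n).isClosed.isOpen_compl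
    · exact isOpen_rhombus e.1
  have hcov : tsupport Φ ⊆ ⋃ i, U i := by
    intro x hx
    rw [mem_iUnion]
    rcases cover_plane (n := n) (fun h => hV.ne_of_mem hx h rfl) with ⟨e, he, hxe⟩ | hx | hx
    · exact ⟨some (some ⟨e, he⟩), hxe⟩
    · exact ⟨none, hx⟩
    · exact ⟨some none, hx⟩
  obtain ⟨f, hf⟩ := SmoothPartitionOfUnity.exists_isSubordinate (modelWithCornersSelf ℝ Plane)
    (isClosed_tsupport Φ) U hU hcov
  have : Fintype ι := Fintype.ofFinite ι
  have hsm : ∀ i, ContDiff ℝ ∞ fun x => f i x * Φ x := fun i => (f i).contMDiff.contDiff.mul h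
  have hcs : ∀ i, HasCompactSupport fun x => f i x * Φ x := fun i => hc.mul_left
  have hsum : Φ = fun x => ∑ i, f i x * Φ x := by
    ext x
    by_cases hx : x ∈ tsupport Φ
    · have := f.sum_eq_one hx
      rw [finsum_eq_sum_of_fintype] at this
      rw [← Finset.sum_mul, this, one_mul]
    · rw [image_eq_zero_of_notMem_tsupport hx]; simp
  rw [hsum, (defect_sum hw hG y Finset.univ hsm hcs).2]
  refine Finset.sum_eq_zero fun i _ => ?_
  have hsup : tsupport (fun x => f i x * Φ x) ⊆ U i := (tsupport_mul_subset_left).trans (hf i)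
  rcases i with _ | _ | e
  · have := hwG _ ⟨hsm none, hcs none, hsup⟩ y
    rw [defect, this]; ring
  · have hz : ∀ x ∈ kochDomain n, x ∉ tsupport (fun x => f (some none) x * Φ x) := fun x hx hx' =>
      hsup hx' (kochDomain_subset_kochRegion n hx)
    have e1 : ∫ x, w x * fderiv ℝ (fun x => f (some none) x * Φ x) x y ∂bulk n = 0 := by
      refine integral_eq_zero_of_ae ?_
      filter_upwards [ae_bulk_mem n] with x hx
      have : fderiv ℝ (fun x => f (some none) x * Φ x) x = 0 := by
        by_contra h0
        exact hz x hx (support_fderiv_subset ℝ h0)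
      rw [this]; simp
    have e2 : ∫ x, inner ℝ (G x) y * (f (some none) x * Φ x) ∂bulk n = 0 := by
      refine integral_eq_zero_of_ae ?_
      filter_upwards [ae_bulk_mem n] with x hx
      have : f (some none) x * Φ x = 0 :=
        image_eq_zero_of_notMem_tsupport (f := fun x => f (some none) x * Φ x) (hz x hx)
      rw [this]; simp
    rw [defect, e1, e2, add_zero]
  · exact hloc e.1 e.2 _ (hsm _) (hcs _) hsup

theorem tendsto_volume_ball (p : Plane) :
    Tendsto (fun ρ : ℝ => volume (Metric.ball p ρ)) (𝓝[>] 0) (𝓝 0) := by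
  have h1 : Tendsto (fun ρ : ℝ => ENNReal.ofReal (ρ ^ 2) * volume (Metric.ball (0 : Plane) 1))
      (𝓝[>] 0) (𝓝 0) := by
    have h2 : Tendsto (fun ρ : ℝ => ENNReal.ofReal (ρ ^ 2)) (𝓝[>] 0) (𝓝 0) := by
      have : Tendsto (fun ρ : ℝ => ENNReal.ofReal (ρ ^ 2)) (𝓝 0) (𝓝 (ENNReal.ofReal (0 ^ 2))) :=
        ENNReal.tendsto_ofReal ((continuous_pow 2).tendsto 0)
      rw [zero_pow (by norm_num), ENNReal.ofReal_zero] at this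
      exact this.mono_left nhdsWithin_le_nhds
    have := ENNReal.Tendsto.mul_const h2
      (Or.inr (measure_ball_lt_top (μ := volume) (x := (0 : Plane)) (r := 1)).ne)
    rwa [zero_mul] at this
  refine h1.congr' ?_
  filter_upwards [self_mem_nhdsWithin] with ρ hρ
  rw [volume_ball_plane (le_of_lt hρ)]

/-- The mass of an `L²` function on small balls is `o(ρ)`. -/
theorem tendsto_setIntegral_ball_div (hw : MemLp w 2 (bulk n)) (p : Plane) :
    Tendsto (fun ρ : ℝ => (∫ x in Metric.ball p ρ, |w x| ∂bulk n) / ρ) (𝓝[>] 0) (𝓝 0) := by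
  have hsq : Integrable (fun x => w x ^ 2) (bulk n) := hw.integrable_sq
  have hvol : Tendsto (fun ρ : ℝ => bulk n (Metric.ball p ρ)) (𝓝[>] 0) (𝓝 0) :=
    tendsto_of_tendsto_of_tendsto_of_le_of_le tendsto_const_nhds (tendsto_volume_ball p)
      (fun _ => zero_le) (fun ρ => Measure.restrict_apply_le _ _)
  have hlim := hsq.tendsto_setIntegral_nhds_zero (s := fun ρ : ℝ => Metric.ball p ρ) hvol
  set κ := (volume (Metric.ball (0 : Plane) 1)).toReal
  have hlim2 : Tendsto (fun ρ : ℝ => Real.sqrt (κ * ∫ x in Metric.ball p ρ, w x ^ 2 ∂bulk n))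
      (𝓝[>] 0) (𝓝 0) := by
    have := (Real.continuous_sqrt.tendsto _).comp (hlim.const_mul κ)
    rwa [mul_zero, Real.sqrt_zero] at this
  refine squeeze_zero' ?_ ?_ hlim2
  · filter_upwards [self_mem_nhdsWithin] with ρ hρ
    exact div_nonneg (integral_nonneg fun x => abs_nonneg _) (le_of_lt hρ)
  filter_upwards [self_mem_nhdsWithin] with ρ hρ
  have hρ : 0 < ρ := hρ
  refine Real.le_sqrt_of_sq_le ?_
  rw [div_pow, div_le_iff₀ (by positivity)]
  have hw' : MemLp w 2 ((bulk n).restrict (Metric.ball p ρ)) := hw.restrict _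
  have hi : Integrable (fun x => |w x|) ((bulk n).restrict (Metric.ball p ρ)) :=
    (hw'.integrable (by norm_num)).abs
  -- Cauchy-Schwarz gains the factor `|B_ρ|^{1/2} = O(ρ)`; the remaining `∫_{B_ρ} w²` tends to zero
  -- by absolute continuity.
  have h1 := lintegral_mul_weight_sq_le (μ := (bulk n).restrict (Metric.ball p ρ))
    (f := fun x => ‖w x‖ₑ) (k := fun _ => 1) hw'.1.enorm aemeasurable_const
  simp only [mul_one, lintegral_one, Measure.restrict_apply_univ] at h1
  have e1 : ∫⁻ x in Metric.ball p ρ, ‖w x‖ₑ ∂bulk n =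
      ENNReal.ofReal (∫ x in Metric.ball p ρ, |w x| ∂bulk n) := by
    rw [ofReal_integral_eq_lintegral_ofReal hi (.of_forall fun x => abs_nonneg _)]
    exact lintegral_congr fun x => Real.enorm_eq_ofReal_abs _
  have e2 : ∫⁻ x in Metric.ball p ρ, ‖w x‖ₑ ^ 2 ∂bulk n =
      ENNReal.ofReal (∫ x in Metric.ball p ρ, w x ^ 2 ∂bulk n) := by
    rw [ofReal_integral_eq_lintegral_ofReal hsq.restrict (.of_forall fun x => sq_nonneg _)]
    refine lintegral_congr fun x => ?_
    rw [Real.enorm_eq_ofReal_abs, ← ENNReal.ofReal_pow (abs_nonneg _), sq_abs]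
  have e3 : bulk n (Metric.ball p ρ) ≤ ENNReal.ofReal (κ * ρ ^ 2) := by
    refine (Measure.restrict_apply_le _ _).trans ?_
    rw [volume_ball_plane hρ.le, mul_comm, ENNReal.ofReal_mul ENNReal.toReal_nonneg,
      ENNReal.ofReal_toReal measure_ball_lt_top.ne]
  rw [e1, e2] at h1
  have h2 := h1.trans (mul_le_mul_left e3 _)
  have h0 : 0 ≤ ∫ x in Metric.ball p ρ, |w x| ∂bulk n := integral_nonneg fun x => abs_nonneg _
  have h0' : 0 ≤ ∫ x in Metric.ball p ρ, w x ^ 2 ∂bulk n := integral_nonneg fun x => sq_nonneg _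
  have hκ : 0 ≤ κ := ENNReal.toReal_nonneg
  rw [← ENNReal.ofReal_pow h0, ← ENNReal.ofReal_mul (by positivity),
    ENNReal.ofReal_le_ofReal_iff (by positivity)] at h2
  linarith

theorem integral_eq_setIntegral_of_zero {f : Plane → ℝ} {s : Set Plane}
    (hf : ∀ x ∉ s, f x = 0) : ∫ x, f x ∂bulk n = ∫ x in s, f x ∂bulk n :=
  (setIntegral_eq_integral_of_forall_compl_eq_zero hf).symm

/-- Points are removable for the integration by parts formula. -/
theorem defect_eq_zero_of_removable (hw : MemLp w 2 (bulk n)) (hG : MemLp G 2 (bulk n)) (y : Plane)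
    (c : Plane) {Φ : Plane → ℝ} (h : ContDiff ℝ ∞ Φ) (hc : HasCompactSupport Φ)
    (hloc : ∀ θ : Plane → ℝ, ContDiff ℝ ∞ θ → (∀ᶠ x in 𝓝 c, θ x = 0) →
      defect n w G y (fun x => θ x * Φ x) = 0) : defect n w G y Φ = 0 := by
  let b : ContDiffBump (0 : Plane) := ⟨1, 2, one_pos, one_lt_two⟩
  have hb : ContDiff ℝ ∞ (b : Plane → ℝ) := b.contDiff
  obtain ⟨M₁, hM₁⟩ := (hb.continuous_fderiv (by simp)).bounded_above_of_compact_support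
    (b.hasCompactSupport.fderiv ℝ)
  obtain ⟨M₂, hM₂⟩ := h.continuous.bounded_above_of_compact_support hc
  obtain ⟨M₃, hM₃⟩ := (h.continuous_fderiv (by simp)).bounded_above_of_compact_support
    (hc.fderiv ℝ)
  have hM₁0 : 0 ≤ M₁ := (norm_nonneg _).trans (hM₁ 0)
  have hM₂0 : 0 ≤ M₂ := (norm_nonneg _).trans (hM₂ 0)
  have hM₃0 : 0 ≤ M₃ := (norm_nonneg _).trans (hM₃ 0)
  have hGy : MemLp (fun x => inner ℝ (G x) y) 2 (bulk n) := hG.inner_const (𝕜 := ℝ) y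
  -- Only the part of `Φ` in the ball of radius `2ε` contributes. The bump has gradient `O(1/ε)`,
  -- and the `L¹` mass of `w` on that ball is `o(ε)`: points have zero capacity in the plane.
  have key : ∀ ε ∈ Ioo (0 : ℝ) 1, |defect n w G y Φ| ≤
      2 * (M₁ * M₂ + M₃) * ‖y‖ * ((∫ x in Metric.ball c (2 * ε), |w x| ∂bulk n) / (2 * ε)) +
      2 * M₂ * ((∫ x in Metric.ball c (2 * ε), |inner ℝ (G x) y| ∂bulk n) / (2 * ε)) := by
    intro ε ⟨hε, hε1⟩
    set β : Plane → ℝ := fun x => b (ε⁻¹ • (x - c)) with hβ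
    have haff : ∀ x, HasFDerivAt (fun x : Plane => ε⁻¹ • (x - c))
        (ε⁻¹ • ContinuousLinearMap.id ℝ Plane) x := fun x =>
      ((hasFDerivAt_id x).sub_const c).const_smul ε⁻¹
    have hβs : ContDiff ℝ ∞ β := 
      hb.comp ((contDiff_id.sub contDiff_const).const_smul ε⁻¹)
    have hβ0 : ∀ x ∉ Metric.ball c (2 * ε), β x = 0 := by
      intro x hx
      refine b.zero_of_le_dist ?_
      rw [dist_zero_right, norm_smul, Real.norm_of_nonneg (inv_pos.2 hε).le, ← dist_eq_norm]
      change 2 ≤ _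
      rw [Metric.mem_ball, not_lt] at hx
      rw [inv_mul_eq_div, le_div_iff₀ hε]
      exact hx
    have hβ1 : ∀ x, |β x| ≤ 1 := fun x => by
      rw [abs_of_nonneg b.nonneg]; exact b.le_one
    have hβd : ∀ x, ‖fderiv ℝ β x‖ ≤ M₁ / ε := by
      intro x
      have h1 : HasFDerivAt β ((fderiv ℝ b (ε⁻¹ • (x - c))).comp
          (ε⁻¹ • ContinuousLinearMap.id ℝ Plane)) x :=
        (hb.differentiable (by simp) _).hasFDerivAt.comp x (haff x)
      rw [h1.fderiv, ContinuousLinearMap.comp_smul, norm_smul, ContinuousLinearMap.comp_id,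
        Real.norm_of_nonneg (inv_pos.2 hε).le, inv_mul_eq_div]
      gcongr
      exact hM₁ _
    have hsplit : defect n w G y Φ = defect n w G y (fun x => (1 - β x) * Φ x) +
        defect n w G y (fun x => β x * Φ x) := by
      rw [← defect_add hw hG y ((contDiff_const.sub hβs).mul h) hc.mul_left (hβs.mul h)
        hc.mul_left]
      congr 1
      ext x; ring
    have hz : defect n w G y (fun x => (1 - β x) * Φ x) = 0 := by
      refine hloc (fun x => 1 - β x) (contDiff_const.sub hβs) ?_
      filter_upwards [Metric.ball_mem_nhds c hε] with x hx
      have : β x = 1 := by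
        refine b.one_of_mem_closedBall ?_
        rw [mem_closedBall_zero_iff, norm_smul, Real.norm_of_nonneg (inv_pos.2 hε).le,
          ← dist_eq_norm, inv_mul_eq_div, div_le_iff₀ hε]
        change _ ≤ 1 * ε
        rw [one_mul]
        exact (Metric.mem_ball.1 hx).le
      rw [this, sub_self]
    rw [hsplit, hz, zero_add, defect]
    have hd : ∀ x, fderiv ℝ (fun x => β x * Φ x) x = β x • fderiv ℝ Φ x + Φ x • fderiv ℝ β x :=
      fun x => ((hβs.differentiable (by simp) x).hasFDerivAt.mul
        (h.differentiable (by simp) x).hasFDerivAt).fderiv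
    have hd0 : ∀ x ∉ Metric.closedBall c (2 * ε), fderiv ℝ β x = 0 := by
      intro x hx
      have : β =ᶠ[𝓝 x] fun _ => 0 := by
        filter_upwards [Metric.isClosed_closedBall.isOpen_compl.mem_nhds hx] with z hz
        exact hβ0 z fun h => hz (Metric.ball_subset_closedBall h)
      rw [this.fderiv_eq]; simp
    -- On the bounding circle the derivative vanishes by continuity from outside, which makes the
    -- open ball sufficient.
    have hd1 : ∀ x ∉ Metric.ball c (2 * ε), fderiv ℝ β x = 0 := by
      have hcont := hβs.continuous_fderiv (by simp)
      have hcl : IsClosed {x | fderiv ℝ β x = 0} := isClosed_eq hcont continuous_const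
      intro x hx
      have hx' : x ∈ closure (Metric.closedBall c (2 * ε))ᶜ := by
        rw [closure_compl, interior_closedBall _ (by positivity)]; exact hx
      exact hcl.closure_subset_iff.2 (fun z hz => hd0 z hz) hx'
    have b1 : |∫ x, w x * fderiv ℝ (fun x => β x * Φ x) x y ∂bulk n| ≤
        (M₁ * M₂ + M₃) * ‖y‖ / ε * ∫ x in Metric.ball c (2 * ε), |w x| ∂bulk n := by
      rw [integral_eq_setIntegral_of_zero (s := Metric.ball c (2 * ε)) (fun x hx => by
        rw [hd, hβ0 x hx, hd1 x hx]; simp), ← integral_const_mul]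
      refine (abs_integral_le_integral_abs).trans (integral_mono_of_nonneg
        (.of_forall fun x => abs_nonneg _) (((hw.restrict _).integrable (by norm_num)).abs.const_mul _)
        (.of_forall fun x => ?_))
      dsimp only
      rw [abs_mul, mul_comm]
      refine mul_le_mul_of_nonneg_right ?_ (abs_nonneg _)
      refine ((fderiv ℝ (fun x => β x * Φ x) x).le_opNorm y).trans ?_
      rw [div_eq_mul_inv, mul_right_comm]
      refine mul_le_mul_of_nonneg_right ?_ (norm_nonneg _)
      rw [hd]
      refine (norm_add_le _ _).trans ?_
      rw [norm_smul, norm_smul, Real.norm_eq_abs, ← div_eq_mul_inv, le_div_iff₀ hε, add_mul]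
      have c1 : |β x| * ‖fderiv ℝ Φ x‖ * ε ≤ 1 * M₃ * 1 := by
        gcongr
        · exact hβ1 x
        · exact hM₃ x
      have c2 : ‖Φ x‖ * ‖fderiv ℝ β x‖ * ε ≤ M₂ * (M₁ / ε) * ε := by
        gcongr
        · exact hM₂ x
        · exact hβd x
      have c3 : M₂ * (M₁ / ε) * ε = M₂ * M₁ := by field_simp
      linarith
    have b2 : |∫ x, inner ℝ (G x) y * (β x * Φ x) ∂bulk n| ≤
        M₂ / ε * ∫ x in Metric.ball c (2 * ε), |inner ℝ (G x) y| ∂bulk n := by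
      rw [integral_eq_setIntegral_of_zero (s := Metric.ball c (2 * ε)) (fun x hx => by
        rw [hβ0 x hx]; simp), ← integral_const_mul]
      refine (abs_integral_le_integral_abs).trans (integral_mono_of_nonneg
        (.of_forall fun x => abs_nonneg _)
        (((hGy.restrict _).integrable (by norm_num)).abs.const_mul _)
        (.of_forall fun x => ?_))
      dsimp only
      rw [abs_mul, mul_comm]
      refine mul_le_mul_of_nonneg_right ?_ (abs_nonneg _)
      rw [abs_mul, le_div_iff₀ hε]
      calc |β x| * |Φ x| * ε ≤ 1 * M₂ * 1 := by
            gcongr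
            · exact hβ1 x
            · exact hM₂ x
        _ = M₂ := by ring
    refine (abs_add_le _ _).trans ((add_le_add b1 b2).trans (le_of_eq ?_))
    field_simp
  have hscale : Tendsto (fun ε : ℝ => 2 * ε) (𝓝[>] 0) (𝓝[>] 0) := by
    refine tendsto_nhdsWithin_iff.2 ⟨?_, ?_⟩
    · have : Tendsto (fun ε : ℝ => 2 * ε) (𝓝 0) (𝓝 (2 * 0)) := tendsto_id.const_mul 2
      rw [mul_zero] at this
      exact this.mono_left nhdsWithin_le_nhds
    · filter_upwards [self_mem_nhdsWithin] with ε hε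
      exact mul_pos two_pos (mem_Ioi.1 hε)
  have l1 := ((tendsto_setIntegral_ball_div hw c).comp hscale).const_mul
    (2 * (M₁ * M₂ + M₃) * ‖y‖)
  have l2 := ((tendsto_setIntegral_ball_div hGy c).comp hscale).const_mul (2 * M₂)
  have l3 := l1.add l2
  rw [mul_zero, mul_zero, add_zero] at l3
  have hfin : |defect n w G y Φ| ≤ 0 := by
    refine ge_of_tendsto l3 ?_
    filter_upwards [Ioo_mem_nhdsGT one_pos] with ε hε
    exact key ε hε
  exact abs_eq_zero.1 (le_antisymm hfin (abs_nonneg _))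

/-- Vertices are removed one at a time: the induction is on the set `S` of vertices that the support
of `Φ` is allowed to contain. -/
theorem defect_eq_zero_of_disjoint_vertices (hw : MemLp w 2 (bulk n)) (hG : MemLp G 2 (bulk n))
    (y : Plane) (hloc : ∀ Φ : Plane → ℝ, ContDiff ℝ ∞ Φ → HasCompactSupport Φ →
      Disjoint (tsupport Φ) (vertices n) → defect n w G y Φ = 0)
    {Φ : Plane → ℝ} (h : ContDiff ℝ ∞ Φ) (hc : HasCompactSupport Φ) : defect n w G y Φ = 0 := by
  have main : ∀ S : Set Plane, S.Finite → ∀ Φ : Plane → ℝ, ContDiff ℝ ∞ Φ → HasCompactSupport Φ →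
      Disjoint (tsupport Φ) (vertices n \ S) → defect n w G y Φ = 0 := by
    intro S hS
    induction S, hS using Set.Finite.induction_on with
    | empty => intro Φ h hc hd; rw [sdiff_empty] at hd; exact hloc Φ h hc hd
    | @insert c S _ _ ih =>
      intro Φ h hc hd
      refine defect_eq_zero_of_removable hw hG y c h hc fun θ hθ hθ0 => ?_
      refine ih _ (hθ.mul h) hc.mul_left ?_
      rw [Set.disjoint_left] at hd ⊢
      intro x hx hxV
      by_cases hxc : x = c
      · subst hxc
        exact (notMem_tsupport_iff_eventuallyEq.2 (by
          filter_upwards [hθ0] with z hz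
          simp [hz])) (tsupport_mul_subset_left hx)
      · refine hd (tsupport_mul_subset_right hx) ⟨hxV.1, ?_⟩
        rintro (h | h)
        · exact hxc h
        · exact hxV.2 h
  exact main (vertices n) (finite_vertices n) Φ h hc (by simp)

end defect

/-! ### Integration by parts near a side -/

/-- The direction of a side. -/
def sideDir (e : Plane × Plane) : Plane := e.2 - e.1

/-- The outward normal of a side, of the same length. -/
def sideNormal (e : Plane × Plane) : Plane := !₂[e.2 1 - e.1 1, -(e.2 0 - e.1 0)]

/-- The linear part of `tanCoord`. -/
def tanLin (e : Plane × Plane) : Plane →L[ℝ] ℝ := (sqLen e)⁻¹ • innerSL ℝ (sideDir e)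

/-- The linear part of `norCoord`. -/
def norLin (e : Plane × Plane) : Plane →L[ℝ] ℝ := (Real.sqrt 3 / sqLen e) • innerSL ℝ (sideNormal e)

theorem inner_plane (x y : Plane) : inner ℝ x y = x 0 * y 0 + x 1 * y 1 := by
  simp [PiLp.inner_apply, Fin.sum_univ_two, mul_comm]

theorem tanLin_apply (e : Plane × Plane) (y : Plane) :
    tanLin e y = (y 0 * (e.2 0 - e.1 0) + y 1 * (e.2 1 - e.1 1)) / sqLen e := by
  simp [tanLin, inner_plane, sideDir]; ring

theorem norLin_apply (e : Plane × Plane) (y : Plane) :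
    norLin e y = Real.sqrt 3 * (y 0 * (e.2 1 - e.1 1) - y 1 * (e.2 0 - e.1 0)) / sqLen e := by
  simp [norLin, inner_plane, sideNormal]; ring

theorem tanCoord_add (e : Plane × Plane) (x y : Plane) :
    tanCoord e (x + y) = tanCoord e x + tanLin e y := by
  rw [tanLin_apply, tanCoord, tanCoord]; simp; ring

theorem norCoord_add (e : Plane × Plane) (x y : Plane) :
    norCoord e (x + y) = norCoord e x + norLin e y := by
  rw [norLin_apply, norCoord, norCoord]; simp; ring

theorem hasFDerivAt_tanCoord (e : Plane × Plane) (x : Plane) :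
    HasFDerivAt (tanCoord e) (tanLin e) x := by
  have h : tanCoord e = fun z => tanCoord e 0 + tanLin e z := by
    ext z; rw [← tanCoord_add, zero_add]
  rw [h]
  exact (tanLin e).hasFDerivAt.const_add _

theorem hasFDerivAt_norCoord (e : Plane × Plane) (x : Plane) :
    HasFDerivAt (norCoord e) (norLin e) x := by
  have h : norCoord e = fun z => norCoord e 0 + norLin e z := by
    ext z; rw [← norCoord_add, zero_add]
  rw [h]
  exact (norLin e).hasFDerivAt.const_add _

theorem contDiff_tanCoord (e : Plane × Plane) : ContDiff ℝ ∞ (tanCoord e) := by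
  have h : tanCoord e = fun z => tanCoord e 0 + tanLin e z := by
    ext z; rw [← tanCoord_add, zero_add]
  rw [h]
  exact contDiff_const.add (tanLin e).contDiff

theorem contDiff_norCoord (e : Plane × Plane) : ContDiff ℝ ∞ (norCoord e) := by
  have h : norCoord e = fun z => norCoord e 0 + norLin e z := by
    ext z; rw [← norCoord_add, zero_add]
  rw [h]
  exact contDiff_const.add (norLin e).contDiff

theorem tanLin_sideDir {e : Plane × Plane} (he : e.1 ≠ e.2) : tanLin e (sideDir e) = 1 := by
  have h := sqLen_pos he
  rw [tanLin_apply, div_eq_one_iff_eq h.ne']; simp [sideDir, sqLen]; ring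

theorem norLin_sideDir (e : Plane × Plane) : norLin e (sideDir e) = 0 := by
  rw [norLin_apply]; simp [sideDir]; ring_nf; simp

theorem tanLin_sideNormal (e : Plane × Plane) : tanLin e (sideNormal e) = 0 := by
  rw [tanLin_apply]; simp [sideNormal]; ring_nf; simp

theorem norLin_sideNormal {e : Plane × Plane} (he : e.1 ≠ e.2) :
    norLin e (sideNormal e) = Real.sqrt 3 := by
  have h := sqLen_pos he
  rw [norLin_apply, div_eq_iff h.ne']; simp [sideNormal, sqLen]; ring

theorem eq_sideDir_add_sideNormal {e : Plane × Plane} (he : e.1 ≠ e.2) (y : Plane) :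
    y = tanLin e y • sideDir e + (norLin e y / Real.sqrt 3) • sideNormal e := by
  have h := sqLen_pos he
  have h3 : Real.sqrt 3 ≠ 0 := by positivity
  ext i
  fin_cases i
  · simp [tanLin_apply, norLin_apply, sideDir, sideNormal]; field_simp; rw [sqLen]; ring
  · simp [tanLin_apply, norLin_apply, sideDir, sideNormal]; field_simp; rw [sqLen]; ring

theorem exists_deriv_smoothTransition_le : ∃ M, ∀ t, |deriv Real.smoothTransition t| ≤ M := by
  have hs : ContDiff ℝ ∞ Real.smoothTransition := Real.smoothTransition.contDiff
  have hc := hs.continuous_deriv (by simp)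
  have hcs : HasCompactSupport (deriv Real.smoothTransition) := by
    refine HasCompactSupport.intro (isCompact_Icc (a := (0 : ℝ)) (b := 1)) fun t ht => ?_
    rw [mem_Icc, not_and_or, not_le, not_le] at ht
    rcases ht with h | h
    · have : Real.smoothTransition =ᶠ[𝓝 t] fun _ => 0 := by
        filter_upwards [Iio_mem_nhds h] with z hz
        exact Real.smoothTransition.zero_of_nonpos (le_of_lt hz)
      rw [this.deriv_eq, deriv_const]
    · have : Real.smoothTransition =ᶠ[𝓝 t] fun _ => 1 := by
        filter_upwards [Ioi_mem_nhds h] with z hz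
        exact Real.smoothTransition.one_of_one_le (le_of_lt hz)
      rw [this.deriv_eq, deriv_const]
  obtain ⟨M, hM⟩ := hc.bounded_above_of_compact_support hcs
  exact ⟨M, fun t => by simpa using hM t⟩

theorem deriv_smoothTransition_of_one_lt {t : ℝ} (h : 1 < t) : deriv Real.smoothTransition t = 0 := by
  have : Real.smoothTransition =ᶠ[𝓝 t] fun _ => 1 := by
    filter_upwards [Ioi_mem_nhds h] with z hz
    exact Real.smoothTransition.one_of_one_le (le_of_lt hz)
  rw [this.deriv_eq, deriv_const]

/-- Integration by parts near a side for vector fields which are tangential on the side. -/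
theorem defect_eq_zero_of_tangential {n : ℕ} {w : Plane → ℝ} {G : Plane → Plane}
    (hw : MemLp w 2 (bulk n)) (hG : MemLp G 2 (bulk n)) (hwG : HasWeakGrad n w G)
    {e : Plane × Plane} (he : e ∈ kochSides n) (y : Plane) {f : Plane → ℝ} (hf : ContDiff ℝ ∞ f)
    (hc : HasCompactSupport f) (hsup : tsupport f ⊆ rhombus e) {C : ℝ}
    (hC : ∀ x, |f x * norLin e y| ≤ C * |norCoord e x|) : defect n w G y f = 0 := by
  obtain ⟨M, hM⟩ := exists_deriv_smoothTransition_le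
  obtain ⟨M₁, hM₁⟩ := hf.continuous.bounded_above_of_compact_support hc
  obtain ⟨M₂, hM₂⟩ := (hf.continuous_fderiv (by simp)).bounded_above_of_compact_support
    (hc.fderiv ℝ)
  have hM0 : 0 ≤ M := (abs_nonneg _).trans (hM 0)
  -- A cut-off in the normal coordinate alone: it vanishes for `norCoord ≥ -1/(k+1)` and equals `1`
  -- for `norCoord ≤ -2/(k+1)`. So `η k * f` is a test function in the domain, and `η k → 1` on the
  -- part of the support inside the domain.
  set η : ℕ → Plane → ℝ := fun k x => Real.smoothTransition (-(k + 1) * norCoord e x - 1) with hη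
  have hηs : ∀ k, ContDiff ℝ ∞ (η k) := fun k =>
    Real.smoothTransition.contDiff.comp ((contDiff_const.mul (contDiff_norCoord e)).sub contDiff_const)
  have hη1 : ∀ k x, |η k x| ≤ 1 := fun k x => by
    rw [abs_of_nonneg (Real.smoothTransition.nonneg _)]; exact Real.smoothTransition.le_one _
  have hηd : ∀ k x, HasFDerivAt (η k) ((deriv Real.smoothTransition (-(k + 1) * norCoord e x - 1) *
      -((k : ℝ) + 1)) • norLin e) x := by
    intro k x
    have hs : ContDiff ℝ ∞ Real.smoothTransition := Real.smoothTransition.contDiff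
    have hst : DifferentiableAt ℝ Real.smoothTransition (-(k + 1) * norCoord e x - 1) :=
      hs.differentiable (by simp) _
    have := hst.hasDerivAt.comp_hasFDerivAt x
      (((hasFDerivAt_norCoord e x).const_mul (-((k : ℝ) + 1))).sub_const 1)
    rwa [smul_smul] at this
  have htest : ∀ k, IsTest n (fun x => η k x * f x) := by
    intro k
    refine ⟨(hηs k).mul hf, hc.mul_left, ?_⟩
    have hcl : IsClosed {x | norCoord e x ≤ -(1 / ((k : ℝ) + 1))} :=
      isClosed_le (continuous_norCoord e) continuous_const
    have h1 : tsupport (fun x => η k x * f x) ⊆ {x | norCoord e x ≤ -(1 / ((k : ℝ) + 1))} := by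
      refine closure_minimal (fun x hx => ?_) hcl
      by_contra h
      rw [mem_ofPred_eq, not_le] at h
      refine hx ?_
      have : η k x = 0 := by
        refine Real.smoothTransition.zero_of_nonpos ?_
        have h2 : -(1 / ((k : ℝ) + 1)) * (k + 1) < norCoord e x * (k + 1) := by gcongr
        have h3 : -(1 / ((k : ℝ) + 1)) * (k + 1) = -1 := by field_simp
        linarith
      simp [this]
    intro x hx
    have h2 : norCoord e x ≤ -(1 / ((k : ℝ) + 1)) := h1 hx
    have h3 : (0 : ℝ) < 1 / ((k : ℝ) + 1) := by positivity
    exact (mem_kochDomain_iff he (hsup (tsupport_mul_subset_right hx))).2 (by linarith)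
  have hnor : ∀ x ∈ kochDomain n, x ∈ tsupport f → norCoord e x < 0 := fun x hx hx' =>
    (mem_kochDomain_iff he (hsup hx')).1 hx
  have hlarge : ∀ x ∈ kochDomain n, x ∈ tsupport f →
      ∀ᶠ k : ℕ in atTop, 1 < -((k : ℝ) + 1) * norCoord e x - 1 := by
    intro x hx hx'
    have h := hnor x hx hx'
    obtain ⟨N, hN⟩ := exists_nat_gt (2 / -norCoord e x)
    filter_upwards [eventually_ge_atTop N] with k hk
    have hk' : (N : ℝ) ≤ k := by exact_mod_cast hk
    rw [div_lt_iff₀ (by linarith)] at hN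
    nlinarith
  have hder : ∀ k x, fderiv ℝ (fun x => η k x * f x) x y = η k x * fderiv ℝ f x y +
      deriv Real.smoothTransition (-(k + 1) * norCoord e x - 1) * (-((k : ℝ) + 1) *
        (f x * norLin e y)) := by
    intro k x
    have h : HasFDerivAt (fun x => η k x * f x) _ x :=
      (hηd k x).mul (hf.differentiable (by simp) x).hasFDerivAt
    rw [h.fderiv]
    simp only [add_apply, smul_apply, smul_eq_mul]
    ring
  have l1 : Tendsto (fun k => ∫ x, w x * fderiv ℝ (fun x => η k x * f x) x y ∂bulk n) atTop
      (𝓝 (∫ x, w x * fderiv ℝ f x y ∂bulk n)) := by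
    -- The derivative of `η k` is of order `k`, but it lives where `|norCoord| ≤ 2/(k+1)`. There
    -- `hC` gives a compensating factor, whence the uniform bound `M * (2 * C)`.
    refine tendsto_integral_of_dominated_convergence (fun x => |w x| * (M₂ * ‖y‖ + M * (2 * C))) 
      (fun k => (integrable_mul_of_memLp hw
        (memLp_fderiv_apply (htest k).1 (htest k).2.1 y)).1) 
      ((hw.integrable (by norm_num)).abs.mul_const _) (fun k => .of_forall fun x => ?_) ?_
    · rw [Real.norm_eq_abs, abs_mul]
      refine mul_le_mul_of_nonneg_left ?_ (abs_nonneg _)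
      rw [hder]
      refine (abs_add_le _ _).trans (add_le_add ?_ ?_)
      · rw [abs_mul]
        refine (mul_le_of_le_one_left (abs_nonneg _) (hη1 k x)).trans ?_
        exact ((fderiv ℝ f x).le_opNorm y).trans (by gcongr; exact hM₂ x)
      · have hC0 : 0 ≤ C * |norCoord e x| := (abs_nonneg _).trans (hC x)
        by_cases h0 : norCoord e x = 0
        · have h1 : f x * norLin e y = 0 := by
            have := hC x
            rw [h0, abs_zero, mul_zero] at this
            exact abs_eq_zero.1 (le_antisymm this (abs_nonneg _))
          have h2 : deriv Real.smoothTransition (-(k + 1) * norCoord e x - 1) *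
              (-((k : ℝ) + 1) * (f x * norLin e y)) = 0 := by rw [h1]; ring
          rw [h2, abs_zero]
          by_cases hCn : 0 ≤ C
          · positivity
          · exfalso
            obtain ⟨z, hz1, hz2⟩ := exists_coord (ne_of_mem_kochSides he) 0 1
            have := (abs_nonneg _).trans (hC z)
            rw [hz2] at this
            norm_num at this
            exact hCn this
        have hCn : 0 ≤ C := nonneg_of_mul_nonneg_left hC0 (abs_pos.2 h0)
        by_cases h1 : 1 < -((k : ℝ) + 1) * norCoord e x - 1
        · rw [deriv_smoothTransition_of_one_lt h1, zero_mul, abs_zero]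
          positivity
        by_cases h2 : -((k : ℝ) + 1) * norCoord e x - 1 < 0
        · have : Real.smoothTransition =ᶠ[𝓝 (-((k : ℝ) + 1) * norCoord e x - 1)] fun _ => 0 := by
            filter_upwards [Iio_mem_nhds h2] with z hz
            exact Real.smoothTransition.zero_of_nonpos (le_of_lt hz)
          rw [this.deriv_eq, deriv_const, zero_mul, abs_zero]
          positivity
        rw [not_lt] at h1 h2
        rw [abs_mul]
        refine mul_le_mul (hM _) ?_ (abs_nonneg _) hM0
        rw [abs_mul, abs_neg, abs_of_nonneg (by positivity : (0 : ℝ) ≤ (k : ℝ) + 1)]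
        have hneg : norCoord e x < 0 := by
          by_contra h
          rw [not_lt] at h
          have : 0 ≤ ((k : ℝ) + 1) * norCoord e x := by positivity
          linarith
        calc ((k : ℝ) + 1) * |f x * norLin e y| ≤ ((k : ℝ) + 1) * (C * |norCoord e x|) := by
              gcongr; exact hC x
          _ = C * (-((k : ℝ) + 1) * norCoord e x) := by rw [abs_of_neg hneg]; ring
          _ ≤ C * 2 := by gcongr; linarith
          _ = _ := by ring
    · filter_upwards [ae_bulk_mem n] with x hx
      by_cases hx' : x ∈ tsupport f
      · refine tendsto_const_nhds.congr' ?_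
        filter_upwards [hlarge x hx hx'] with k hk
        rw [hder, deriv_smoothTransition_of_one_lt hk]
        have : η k x = 1 := Real.smoothTransition.one_of_one_le hk.le
        rw [this]; ring
      · refine tendsto_const_nhds.congr fun k => ?_
        rw [hder, image_eq_zero_of_notMem_tsupport hx']
        have : fderiv ℝ f x = 0 := by
          by_contra h0
          exact hx' (support_fderiv_subset ℝ h0)
        rw [this]; simp
  have l2 : Tendsto (fun k => ∫ x, inner ℝ (G x) y * (η k x * f x) ∂bulk n) atTop
      (𝓝 (∫ x, inner ℝ (G x) y * f x ∂bulk n)) := by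
    have hGy : MemLp (fun x => inner ℝ (G x) y) 2 (bulk n) := hG.inner_const (𝕜 := ℝ) y
    refine tendsto_integral_of_dominated_convergence (fun x => |inner ℝ (G x) y| * M₁)
      (fun k => (integrable_mul_of_memLp hGy (htest k).memLp).1)
      ((hGy.integrable (by norm_num)).abs.mul_const _) (fun k => .of_forall fun x => ?_) ?_
    · rw [Real.norm_eq_abs, abs_mul]
      refine mul_le_mul_of_nonneg_left ?_ (abs_nonneg _)
      rw [abs_mul]
      exact (mul_le_of_le_one_left (abs_nonneg _) (hη1 k x)).trans (hM₁ x)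
    · filter_upwards [ae_bulk_mem n] with x hx
      by_cases hx' : x ∈ tsupport f
      · refine tendsto_const_nhds.congr' ?_
        filter_upwards [hlarge x hx hx'] with k hk
        have : η k x = 1 := Real.smoothTransition.one_of_one_le hk.le
        rw [this, one_mul]
      · refine tendsto_const_nhds.congr fun k => ?_
        rw [image_eq_zero_of_notMem_tsupport hx']; simp
  have l3 := l1.add l2
  have l4 : ∀ k, ∫ x, w x * fderiv ℝ (fun x => η k x * f x) x y ∂bulk n +
      ∫ x, inner ℝ (G x) y * (η k x * f x) ∂bulk n = 0 := fun k => by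
    rw [hwG _ (htest k) y]; ring
  simp only [l4] at l3
  exact (tendsto_nhds_unique l3 tendsto_const_nhds)

/-! ### A radial kernel -/

/-- The kernel `s² / (s² + |x|²)²` decreases in `|x|`, hence is a superposition of indicators of
discs with this derivative as density. -/
theorem hasDerivAt_kernel₁ {s : ℝ} (hs : 0 < s) (ρ : ℝ) :
    HasDerivAt (fun ρ => -(s ^ 2 / (s ^ 2 + ρ ^ 2) ^ 2)) (4 * s ^ 2 * ρ / (s ^ 2 + ρ ^ 2) ^ 3) ρ := by
  have hpos : 0 < s ^ 2 + ρ ^ 2 := by positivity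
  have h1 : HasDerivAt (fun ρ : ℝ => s ^ 2 + ρ ^ 2) (2 * ρ) ρ := by
    simpa using (hasDerivAt_pow 2 ρ).const_add (s ^ 2)
  have h2 : HasDerivAt (fun ρ => -(s ^ 2 / (s ^ 2 + ρ ^ 2) ^ 2)) _ ρ :=
    ((hasDerivAt_const ρ (s ^ 2)).div (h1.fun_pow 2) (pow_ne_zero 2 hpos.ne')).neg
  refine h2.congr_deriv ?_
  field_simp
  ring

/-- Primitive for the second moment of the density, which equals `1`: ball integrals divided by `ρ²`
are averaged with total weight one. -/
theorem hasDerivAt_kernel₂ {s : ℝ} (hs : 0 < s) (ρ : ℝ) :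
    HasDerivAt (fun ρ => s ^ 4 / (s ^ 2 + ρ ^ 2) ^ 2 - 2 * s ^ 2 / (s ^ 2 + ρ ^ 2))
      (4 * s ^ 2 * ρ / (s ^ 2 + ρ ^ 2) ^ 3 * ρ ^ 2) ρ := by
  have hpos : 0 < s ^ 2 + ρ ^ 2 := by positivity
  have h1 : HasDerivAt (fun ρ : ℝ => s ^ 2 + ρ ^ 2) (2 * ρ) ρ := by
    simpa using (hasDerivAt_pow 2 ρ).const_add (s ^ 2)
  have h2 : HasDerivAt (fun ρ => s ^ 4 / (s ^ 2 + ρ ^ 2) ^ 2 - 2 * s ^ 2 / (s ^ 2 + ρ ^ 2)) _ ρ :=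
    ((hasDerivAt_const ρ (s ^ 4)).div (h1.fun_pow 2) (pow_ne_zero 2 hpos.ne')).sub
    ((hasDerivAt_const ρ (2 * s ^ 2)).div h1 hpos.ne')
  refine h2.congr_deriv ?_
  field_simp
  ring

theorem tendsto_inv_add_sq {s : ℝ} : Tendsto (fun ρ : ℝ => (s ^ 2 + ρ ^ 2)⁻¹) atTop (𝓝 0) :=
  (tendsto_atTop_add_const_left _ _ (tendsto_pow_atTop (by norm_num))).inv_tendsto_atTop

theorem integral_kernel₁ {s : ℝ} (hs : 0 < s) {a : ℝ} (ha : 0 ≤ a) :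
    IntegrableOn (fun ρ => 4 * s ^ 2 * ρ / (s ^ 2 + ρ ^ 2) ^ 3) (Ioi a) ∧
    ∫ ρ in Ioi a, 4 * s ^ 2 * ρ / (s ^ 2 + ρ ^ 2) ^ 3 = s ^ 2 / (s ^ 2 + a ^ 2) ^ 2 := by
  have hlim : Tendsto (fun ρ : ℝ => -(s ^ 2 / (s ^ 2 + ρ ^ 2) ^ 2)) atTop (𝓝 0) := by
    have := ((tendsto_inv_add_sq (s := s)).pow 2).const_mul (-s ^ 2)
    simp only [ne_eq, OfNat.ofNat_ne_zero, not_false_eq_true, zero_pow, mul_zero] at this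
    refine this.congr fun ρ => ?_
    rw [inv_pow]; ring
  have hpos : ∀ ρ ∈ Ioi a, 0 ≤ 4 * s ^ 2 * ρ / (s ^ 2 + ρ ^ 2) ^ 3 := fun ρ hρ => by
    have : 0 < ρ := ha.trans_lt hρ
    positivity
  refine ⟨integrableOn_Ioi_deriv_of_nonneg' (fun ρ _ => hasDerivAt_kernel₁ hs ρ) hpos hlim, ?_⟩
  rw [integral_Ioi_of_hasDerivAt_of_nonneg' (fun ρ _ => hasDerivAt_kernel₁ hs ρ) hpos hlim]
  ring

theorem integral_kernel₂ {s : ℝ} (hs : 0 < s) :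
    IntegrableOn (fun ρ => 4 * s ^ 2 * ρ / (s ^ 2 + ρ ^ 2) ^ 3 * ρ ^ 2) (Ioi 0) ∧
    ∫ ρ in Ioi (0 : ℝ), 4 * s ^ 2 * ρ / (s ^ 2 + ρ ^ 2) ^ 3 * ρ ^ 2 = 1 := by
  have hlim : Tendsto (fun ρ : ℝ => s ^ 4 / (s ^ 2 + ρ ^ 2) ^ 2 - 2 * s ^ 2 / (s ^ 2 + ρ ^ 2)) atTop
      (𝓝 0) := by
    have := (((tendsto_inv_add_sq (s := s)).pow 2).const_mul (s ^ 4)).sub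
      ((tendsto_inv_add_sq (s := s)).const_mul (2 * s ^ 2))
    simp only [ne_eq, OfNat.ofNat_ne_zero, not_false_eq_true, zero_pow, mul_zero, sub_zero] at this
    refine this.congr fun ρ => ?_
    rw [inv_pow]; ring
  have hpos : ∀ ρ ∈ Ioi (0 : ℝ), 0 ≤ 4 * s ^ 2 * ρ / (s ^ 2 + ρ ^ 2) ^ 3 * ρ ^ 2 := fun ρ hρ => by
    have : 0 < ρ := hρ
    positivity
  refine ⟨integrableOn_Ioi_deriv_of_nonneg' (fun ρ _ => hasDerivAt_kernel₂ hs ρ) hpos hlim, ?_⟩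
  rw [integral_Ioi_of_hasDerivAt_of_nonneg' (fun ρ _ => hasDerivAt_kernel₂ hs ρ) hpos hlim]
  field_simp
  ring

/-- Layer-cake formula: the kernel at `x` is the integral of the density over `ρ > dist x p`, and
Fubini turns it into integrals over balls. -/
theorem integral_mul_kernel_eq {μ : Measure Plane} [SFinite μ] {f : Plane → ℝ} (hf : Integrable f μ)
    (p : Plane) {s : ℝ} (hs : 0 < s) :
    ∫ x, f x * (s ^ 2 / (s ^ 2 + dist x p ^ 2) ^ 2) ∂μ =
      ∫ ρ in Ioi (0 : ℝ), 4 * s ^ 2 * ρ / (s ^ 2 + ρ ^ 2) ^ 3 * ∫ x in Metric.ball p ρ, f x ∂μ := by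
  set h : ℝ → ℝ := fun ρ => 4 * s ^ 2 * ρ / (s ^ 2 + ρ ^ 2) ^ 3 with hh
  have hS : MeasurableSet {q : Plane × ℝ | dist q.1 p < q.2} :=
    measurableSet_lt (measurable_fst.dist measurable_const) measurable_snd
  have hI : Integrable ({q : Plane × ℝ | dist q.1 p < q.2}.indicator fun q => f q.1 * h q.2)
      (μ.prod (volume.restrict (Ioi (0 : ℝ)))) :=
    (hf.mul_prod (integral_kernel₁ hs le_rfl).1).indicator hS
  have e1 : ∀ x, ∫ ρ in Ioi (0 : ℝ), {q : Plane × ℝ | dist q.1 p < q.2}.indicator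
      (fun q => f q.1 * h q.2) (x, ρ) = f x * (s ^ 2 / (s ^ 2 + dist x p ^ 2) ^ 2) := by
    intro x
    rw [← (integral_kernel₁ hs (dist_nonneg (x := x) (y := p))).2, ← integral_const_mul,
      ← integral_indicator measurableSet_Ioi, ← integral_indicator measurableSet_Ioi]
    refine integral_congr_ae (.of_forall fun ρ => ?_)
    simp only [indicator, mem_Ioi, mem_ofPred_eq]
    by_cases h1 : dist x p < ρ
    · rw [if_pos (dist_nonneg.trans_lt h1), if_pos h1]
    · simp [h1]
  have e2 : ∀ ρ, ∫ x, {q : Plane × ℝ | dist q.1 p < q.2}.indicator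
      (fun q => f q.1 * h q.2) (x, ρ) ∂μ = h ρ * ∫ x in Metric.ball p ρ, f x ∂μ := by
    intro ρ
    rw [← integral_const_mul, ← integral_indicator measurableSet_ball]
    refine integral_congr_ae (.of_forall fun x => ?_)
    simp only [indicator, Metric.mem_ball, mem_ofPred_eq, mul_comm]
  have := integral_integral_swap (f := fun x ρ => {q : Plane × ℝ | dist q.1 p < q.2}.indicator
      (fun q => f q.1 * h q.2) (x, ρ)) hI
  simp only [e1, e2] at this
  exact this

/-- For radii below `δ` the ball integrals are at most `(ε/2) ρ²` and the second moment is one.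
Radii above `δ` carry total density at most `s² / δ⁴`. No absolute values enter the ball integrals,
so convergence of signed averages is enough. -/
theorem tendsto_integral_mul_kernel {μ : Measure Plane} [SFinite μ] {f : Plane → ℝ}
    (hf : Integrable f μ) (p : Plane)
    (hM : Tendsto (fun ρ : ℝ => (∫ x in Metric.ball p ρ, f x ∂μ) / ρ ^ 2) (𝓝[>] 0) (𝓝 0)) :
    Tendsto (fun s : ℝ => ∫ x, f x * (s ^ 2 / (s ^ 2 + dist x p ^ 2) ^ 2) ∂μ) (𝓝[>] 0) (𝓝 0) := by
  rw [Metric.tendsto_nhds]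
  intro ε hε
  have h1 := (Metric.tendsto_nhds.1 hM) (ε / 2) (half_pos hε)
  obtain ⟨δ, hδ, hδ2⟩ := (mem_nhdsGT_iff_exists_Ioo_subset).1 h1
  have hδ : 0 < δ := hδ
  set B := ∫ x, |f x| ∂μ
  have hB : 0 ≤ B := integral_nonneg fun x => abs_nonneg _
  have hMB : ∀ ρ, |∫ x in Metric.ball p ρ, f x ∂μ| ≤ B := fun ρ =>
    abs_integral_le_integral_abs.trans
      (setIntegral_le_integral hf.abs (.of_forall fun x => abs_nonneg _))
  have hlim : Tendsto (fun s : ℝ => ε / 2 + B / δ ^ 4 * s ^ 2) (𝓝[>] 0) (𝓝 (ε / 2)) := by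
    have : Tendsto (fun s : ℝ => ε / 2 + B / δ ^ 4 * s ^ 2) (𝓝 0) (𝓝 (ε / 2 + B / δ ^ 4 * 0 ^ 2)) :=
      (Continuous.tendsto (by fun_prop) 0)
    simp only [ne_eq, OfNat.ofNat_ne_zero, not_false_eq_true, zero_pow, mul_zero, add_zero] at this
    exact this.mono_left nhdsWithin_le_nhds
  filter_upwards [hlim.eventually_lt_const (half_lt_self hε), self_mem_nhdsWithin] with s hs1 hs
  have hs : 0 < s := hs
  rw [Real.dist_eq, sub_zero, integral_mul_kernel_eq hf p hs]
  refine lt_of_le_of_lt ?_ hs1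
  set h : ℝ → ℝ := fun ρ => 4 * s ^ 2 * ρ / (s ^ 2 + ρ ^ 2) ^ 3 with hh
  have hh0 : ∀ ρ ∈ Ioi (0 : ℝ), 0 ≤ h ρ := fun ρ hρ => by
    have : 0 < ρ := hρ
    positivity
  have i2 : IntegrableOn (fun ρ => ε / 2 * (h ρ * ρ ^ 2)) (Ioi 0) :=
    (integral_kernel₂ hs).1.const_mul _
  have hset : Ioi (0 : ℝ) ∩ Ici δ = Ici δ := inter_eq_right.2 fun x hx => lt_of_lt_of_le hδ hx
  calc |∫ ρ in Ioi (0 : ℝ), h ρ * ∫ x in Metric.ball p ρ, f x ∂μ|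
      ≤ ∫ ρ in Ioi (0 : ℝ), |h ρ * ∫ x in Metric.ball p ρ, f x ∂μ| := abs_integral_le_integral_abs
    _ ≤ ∫ ρ in Ioi (0 : ℝ), (ε / 2 * (h ρ * ρ ^ 2) + (Ici δ).indicator (fun ρ => B * h ρ) ρ) := by
        refine integral_mono_of_nonneg (.of_forall fun ρ => abs_nonneg _) 
          (i2.add (((integral_kernel₁ hs le_rfl).1.const_mul B).indicator measurableSet_Ici)) ?_
        filter_upwards [ae_restrict_mem measurableSet_Ioi] with ρ hρ
        have hρ0 : 0 < ρ := hρ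
        rw [abs_mul, abs_of_nonneg (hh0 ρ hρ)]
        by_cases hρδ : δ ≤ ρ
        · rw [indicator_of_mem (by exact hρδ)]
          have b1 := mul_le_mul_of_nonneg_left (hMB ρ) (hh0 ρ hρ)
          have b2 : 0 ≤ ε / 2 * (h ρ * ρ ^ 2) := by
            have := hh0 ρ hρ
            positivity
          linarith
        · rw [indicator_of_notMem (by exact hρδ), add_zero]
          have b1 := hδ2 ⟨hρ0, not_le.1 hρδ⟩
          rw [mem_ofPred_eq, Real.dist_eq, sub_zero, abs_div, abs_of_pos (by positivity : 0 < ρ ^ 2),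
            div_lt_iff₀ (by positivity)] at b1
          have b2 := mul_le_mul_of_nonneg_left b1.le (hh0 ρ hρ)
          linarith
    _ = ε / 2 + B * (s ^ 2 / (s ^ 2 + δ ^ 2) ^ 2) := by
        rw [integral_add i2 (((integral_kernel₁ hs le_rfl).1.const_mul B).indicator
          measurableSet_Ici), integral_const_mul, (integral_kernel₂ hs).2, mul_one,
          setIntegral_indicator measurableSet_Ici, hset, integral_Ici_eq_integral_Ioi, integral_const_mul,
          (integral_kernel₁ hs hδ.le).2]
    _ ≤ _ := by
        have : s ^ 2 / (s ^ 2 + δ ^ 2) ^ 2 ≤ s ^ 2 / δ ^ 4 := by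
          gcongr
          nlinarith [sq_nonneg s, sq_nonneg (s * δ)]
        have := mul_le_mul_of_nonneg_left this hB
        calc _ ≤ ε / 2 + B * (s ^ 2 / δ ^ 4) := by linarith
          _ = _ := by ring

theorem setIntegral_ball_bulk (n : ℕ) (f : Plane → ℝ) (p : Plane) (ρ : ℝ) :
    ∫ x in Metric.ball p ρ, f x ∂bulk n = ∫ x in Metric.ball p ρ ∩ kochDomain n, f x := by
  rw [bulk, Measure.restrict_restrict measurableSet_ball]

theorem lipschitz_of_smooth {Φ : Plane → ℝ} (h : ContDiff ℝ ∞ Φ) (hc : HasCompactSupport Φ) :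
    ∃ L, 0 ≤ L ∧ ∀ x y, |Φ x - Φ y| ≤ L * dist x y := by
  obtain ⟨L, hL⟩ := (h.continuous_fderiv (by simp)).bounded_above_of_compact_support
    (hc.fderiv ℝ)
  refine ⟨L, (norm_nonneg _).trans (hL 0), fun x y => ?_⟩
  have := Convex.norm_image_sub_le_of_norm_fderiv_le (𝕜 := ℝ) (f := Φ) (s := univ) (C := L)
    (fun z _ => h.differentiable (by simp) z) (fun z _ => hL z) convex_univ (mem_univ y) (mem_univ x)
  rwa [Real.norm_eq_abs, ← dist_eq_norm] at this

/-- Vanishing averages are not affected by smooth factors. -/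
theorem tendsto_setIntegral_mul_div_sq {n : ℕ} {w : Plane → ℝ} (hw : MemLp w 2 (bulk n)) {p : Plane}
    (hp : Tendsto (fun r : ℝ => ⨍ y in Metric.ball p r ∩ kochDomain n, w y ∂volume) (𝓝[>] 0) (𝓝 0))
    {Φ : Plane → ℝ} (h : ContDiff ℝ ∞ Φ) (hc : HasCompactSupport Φ) :
    Tendsto (fun ρ : ℝ => (∫ x in Metric.ball p ρ, w x * Φ x ∂bulk n) / ρ ^ 2) (𝓝[>] 0) (𝓝 0) := by
  obtain ⟨L, hL0, hL⟩ := lipschitz_of_smooth h hc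
  set κ := (volume (Metric.ball (0 : Plane) 1)).toReal
  have hκ0 : 0 ≤ κ := ENNReal.toReal_nonneg
  have l1 := (hp.abs.const_mul (κ * |Φ p|)).add ((tendsto_setIntegral_ball_div hw p).const_mul L)
  simp only [abs_zero, mul_zero, add_zero] at l1
  rw [tendsto_zero_iff_abs_tendsto_zero]
  refine squeeze_zero' (.of_forall fun ρ => abs_nonneg _) ?_ l1
  filter_upwards [self_mem_nhdsWithin] with ρ hρ
  have hρ : 0 < ρ := hρ
  have hwi : Integrable w ((bulk n).restrict (Metric.ball p ρ)) :=
    (hw.restrict _).integrable (by norm_num)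
  have hwΦ : Integrable (fun x => w x * Φ x) ((bulk n).restrict (Metric.ball p ρ)) :=
    (integrable_mul_of_memLp hw (memLp_of_smooth (n := n) h hc)).restrict
  have i1 : Integrable (fun x => Φ p * w x) ((bulk n).restrict (Metric.ball p ρ)) :=
    hwi.const_mul _
  have i2 : Integrable (fun x => w x * Φ x - Φ p * w x) ((bulk n).restrict (Metric.ball p ρ)) :=
    hwΦ.sub i1
  -- Freezing `Φ` at `p` leaves the average of `w`, which tends to zero. The error is at most `L ρ`
  -- times the `L¹` mass of `w`, and that mass is `o(ρ)`.
  have e : ∫ x in Metric.ball p ρ, w x * Φ x ∂bulk n = Φ p * ∫ x in Metric.ball p ρ, w x ∂bulk n +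
      ∫ x in Metric.ball p ρ, (w x * Φ x - Φ p * w x) ∂bulk n := by
    rw [integral_sub hwΦ i1, integral_const_mul]; ring
  have b1 : |∫ x in Metric.ball p ρ, w x ∂bulk n| ≤
      κ * ρ ^ 2 * |⨍ y in Metric.ball p ρ ∩ kochDomain n, w y ∂volume| := by
    rw [setIntegral_ball_bulk]
    set S := Metric.ball p ρ ∩ kochDomain n
    have hS : volume S ≤ volume (Metric.ball p ρ) := measure_mono inter_subset_left
    have hSt : volume S ≠ ⊤ := (hS.trans_lt measure_ball_lt_top).ne
    have hVle : (volume S).toReal ≤ κ * ρ ^ 2 := by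
      have := ENNReal.toReal_mono measure_ball_lt_top.ne hS
      rw [volume_ball_plane hρ.le, ENNReal.toReal_mul, ENNReal.toReal_ofReal (by positivity)] at this
      linarith
    by_cases h0 : volume S = 0
    · rw [Measure.restrict_eq_zero.2 h0]
      simp
    have hV : 0 < (volume S).toReal := ENNReal.toReal_pos h0 hSt
    have : ∫ x in S, w x = (volume S).toReal * ⨍ y in S, w y ∂volume := by
      rw [setAverage_eq, smul_eq_mul]
      change _ = (volume S).toReal * ((volume S).toReal⁻¹ * _)
      field_simp
    rw [this, abs_mul, abs_of_pos hV]
    gcongr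
  have b2 : |∫ x in Metric.ball p ρ, (w x * Φ x - Φ p * w x) ∂bulk n| ≤
      L * ρ * ∫ x in Metric.ball p ρ, |w x| ∂bulk n := by
    rw [← integral_const_mul]
    refine abs_integral_le_integral_abs.trans (setIntegral_mono_on i2.abs (hwi.abs.const_mul _)
      measurableSet_ball fun x hx => ?_)
    have : w x * Φ x - Φ p * w x = w x * (Φ x - Φ p) := by ring
    rw [this, abs_mul, mul_comm]
    refine mul_le_mul_of_nonneg_right ((hL x p).trans ?_) (abs_nonneg _)
    have := (Metric.mem_ball.1 hx).le
    gcongr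
  rw [Function.comp_apply, e, abs_div, abs_of_pos (by positivity : 0 < ρ ^ 2), div_le_iff₀ (by positivity)]
  refine (abs_add_le _ _).trans ?_
  rw [abs_mul]
  calc |Φ p| * |∫ x in Metric.ball p ρ, w x ∂bulk n| +
        |∫ x in Metric.ball p ρ, (w x * Φ x - Φ p * w x) ∂bulk n|
      ≤ |Φ p| * (κ * ρ ^ 2 * |⨍ y in Metric.ball p ρ ∩ kochDomain n, w y ∂volume|) +
        L * ρ * ∫ x in Metric.ball p ρ, |w x| ∂bulk n := by gcongr
    _ = _ := by field_simp

/-- Stated on the whole line through the side, because the later integration runs over all of it: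
beyond the side `Φ` vanishes near the point. -/
theorem ae_tendsto_setIntegral_mul_div_sq {n : ℕ} {w : Plane → ℝ} (hw : MemLp w 2 (bulk n))
    (ht : HasTrace n w fun _ => 0) {e : Plane × Plane} (he : e ∈ kochSides n) {Φ : Plane → ℝ}
    (h : ContDiff ℝ ∞ Φ) (hc : HasCompactSupport Φ) (hsup : tsupport Φ ⊆ rhombus e) :
    ∀ᵐ l : ℝ, Tendsto (fun ρ : ℝ => (∫ x in Metric.ball (AffineMap.lineMap e.1 e.2 l : Plane) ρ,
      w x * Φ x ∂bulk n) / ρ ^ 2) (𝓝[>] 0) (𝓝 0) := by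
  have h1 := (ae_restrict_iff' measurableSet_Icc).1 (ae_arcLength_iff.1 ht e he)
  filter_upwards [h1] with l hl
  by_cases hl' : l ∈ Icc (0 : ℝ) 1
  · exact tendsto_setIntegral_mul_div_sq hw (hl hl') h hc
  set p : Plane := AffineMap.lineMap e.1 e.2 l
  have hp : p ∉ tsupport Φ := by
    intro hp
    have := hsup hp
    have h2 := this.1
    have h3 := this.2
    rw [norCoord_side, tanCoord_side (ne_of_mem_kochSides he), abs_zero] at h2 h3
    exact hl' ⟨h2.le, by linarith⟩
  obtain ⟨δ, hδ, hball⟩ := Metric.isOpen_iff.1 (isClosed_tsupport Φ).isOpen_compl p hp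
  refine tendsto_const_nhds.congr' ?_
  filter_upwards [Ioo_mem_nhdsGT hδ] with ρ hρ
  rw [setIntegral_eq_zero_of_forall_eq_zero, zero_div]
  intro x hx
  rw [image_eq_zero_of_notMem_tsupport (hball (Metric.ball_subset_ball hρ.2.le hx)), mul_zero]

theorem measurable_lineMap (e : Plane × Plane) :
    Measurable fun l : ℝ => (AffineMap.lineMap e.1 e.2 l : Plane) :=
  (AffineMap.lineMap_continuous : Continuous fun l : ℝ => (AffineMap.lineMap e.1 e.2 l : Plane)).measurable

/-- With `D` the distance, `|A| D^{-1} ≤ |A|² D^{-1/2} + D^{-3/2}`. The first term is integrable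
along the line because `D` dominates the tangential distance, the second over the domain because
`3/2 < 2`. This justifies Fubini for the singular kernel with `A` merely square integrable. -/
theorem integrable_mul_inv_dist {n : ℕ} {A : Plane → ℝ} (hA : MemLp A 2 (bulk n))
    {e : Plane × Plane} (he : e.1 ≠ e.2) (R : ℝ) :
    Integrable (fun q : Plane × ℝ => A q.1 * (dist q.1 (AffineMap.lineMap e.1 e.2 q.2))⁻¹)
      ((bulk n).prod (volume.restrict (Icc (-R) R))) := by
  have hl := dist_pos.2 he
  set l := dist e.1 e.2 with hldef
  have hD : Measurable fun q : Plane × ℝ => dist q.1 (AffineMap.lineMap e.1 e.2 q.2) :=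
    measurable_fst.dist ((measurable_lineMap e).comp measurable_snd)
  have hAm : AEStronglyMeasurable (fun q : Plane × ℝ => A q.1)
      ((bulk n).prod (volume.restrict (Icc (-R) R))) := hA.1.comp_fst
  have hmeas : AEStronglyMeasurable
      (fun q : Plane × ℝ => A q.1 * (dist q.1 (AffineMap.lineMap e.1 e.2 q.2))⁻¹)
      ((bulk n).prod (volume.restrict (Icc (-R) R))) := hAm.mul hD.inv.aestronglyMeasurable
  refine ⟨hmeas, ?_⟩
  obtain ⟨R₁, hR₁⟩ := (isBounded_kochDomain n).subset_ball e.1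
  set M := R₁ / l
  have htan : ∀ x ∈ kochDomain n, |tanCoord e x| ≤ M := fun x hx => by
    have h := abs_tanCoord_sub_le he x e.1
    rw [tanCoord_fst, sub_zero] at h
    exact h.trans (by change _ / l ≤ R₁ / l; gcongr; exact (Metric.mem_ball.1 (hR₁ hx)).le)
  set R₂ := R₁ + |R| * l
  have hball : ∀ r ∈ Icc (-R) R, kochDomain n ⊆ Metric.ball (AffineMap.lineMap e.1 e.2 r : Plane) R₂ := by
    intro r hr x hx
    have h1 := Metric.mem_ball.1 (hR₁ hx)
    have h2 := dist_triangle x e.1 (AffineMap.lineMap e.1 e.2 r)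
    rw [dist_left_lineMap, Real.norm_eq_abs] at h2
    have h3 : |r| ≤ |R| := (abs_le.2 hr).trans (le_abs_self R)
    have h4 : |r| * dist e.1 e.2 ≤ |R| * l := by gcongr
    rw [Metric.mem_ball]
    linarith
  set K : ℝ≥0∞ := ENNReal.ofReal (l ^ (-(1 / 2) : ℝ))
  have hm3 : Measurable fun q : Plane × ℝ =>
      ENNReal.ofReal (dist q.1 (AffineMap.lineMap e.1 e.2 q.2) ^ (-(3 / 2) : ℝ)) :=
    (hD.pow_const _).ennreal_ofReal
  have hpt : ∀ x : Plane, ∀ r : ℝ, r ≠ tanCoord e x →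
      ‖A x * (dist x (AffineMap.lineMap e.1 e.2 r))⁻¹‖ₑ ≤
        ‖A x‖ₑ ^ 2 * K * invSqrt (r - tanCoord e x) +
          ENNReal.ofReal (dist x (AffineMap.lineMap e.1 e.2 r) ^ (-(3 / 2) : ℝ)) := by
    intro x r hr
    set D := dist x (AffineMap.lineMap e.1 e.2 r) with hDdef
    have h1 : l * |r - tanCoord e x| ≤ D := by
      have := abs_tanCoord_sub_le he x (AffineMap.lineMap e.1 e.2 r)
      rw [tanCoord_side he, le_div_iff₀ hl, abs_sub_comm] at this
      linarith
    have h2 : 0 < |r - tanCoord e x| := abs_pos.2 (sub_ne_zero.2 hr)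
    have hD0 : 0 < D := lt_of_lt_of_le (by positivity) h1
    set s := D ^ (-(1 / 2) : ℝ) with hs
    have hs0 : 0 < s := by positivity
    have e2 : D⁻¹ = s ^ 2 := by
      rw [hs, ← Real.rpow_natCast, ← Real.rpow_mul hD0.le, ← Real.rpow_neg_one]; norm_num
    have e3 : D ^ (-(3 / 2) : ℝ) = s ^ 3 := by
      rw [hs, ← Real.rpow_natCast, ← Real.rpow_mul hD0.le]; norm_num
    have hs1 : s ≤ l ^ (-(1 / 2) : ℝ) * |r - tanCoord e x| ^ (-(1 / 2) : ℝ) := by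
      rw [← Real.mul_rpow hl.le h2.le]
      exact Real.rpow_le_rpow_of_nonpos (by positivity) h1 (by norm_num)
    -- With `s = D^{-1/2}` this is `s (|A|² - |A| s + s²) ≥ 0`.
    have hreal : |A x| * s ^ 2 ≤ |A x| ^ 2 * (l ^ (-(1 / 2) : ℝ) *
        |r - tanCoord e x| ^ (-(1 / 2) : ℝ)) + s ^ 3 := by
      have : |A x| ^ 2 * s ≤ |A x| ^ 2 * (l ^ (-(1 / 2) : ℝ) *
        |r - tanCoord e x| ^ (-(1 / 2) : ℝ)) := by gcongr
      have h3 : 0 ≤ s * (|A x| ^ 2 - |A x| * s + s ^ 2) := by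
        refine mul_nonneg hs0.le ?_
        nlinarith [sq_nonneg (|A x| - s), abs_nonneg (A x)]
      linarith
    rw [enorm_mul, Real.enorm_eq_ofReal_abs (A x), Real.enorm_eq_ofReal (inv_pos.2 hD0).le, e2, e3,
      ← ENNReal.ofReal_mul (abs_nonneg _), invSqrt, ← ENNReal.ofReal_pow (abs_nonneg _),
      ← ENNReal.ofReal_mul (by positivity), ← ENNReal.ofReal_mul (by positivity),
      ← ENNReal.ofReal_add (by positivity) (by positivity)]
    refine ENNReal.ofReal_le_ofReal (hreal.trans (le_of_eq ?_))
    ring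
  have hinv : ∀ x ∈ kochDomain n, ∫⁻ r in Icc (-R) R, invSqrt (r - tanCoord e x) ≤
      ∫⁻ r in Icc (-(|R| + M)) (|R| + M), invSqrt r := by
    intro x hx
    rw [← lintegral_indicator measurableSet_Icc, ← lintegral_indicator measurableSet_Icc,
      ← lintegral_sub_right_eq_self ((Icc (-(|R| + M)) (|R| + M)).indicator invSqrt) (tanCoord e x)]
    refine lintegral_mono fun r => ?_
    by_cases hr : r ∈ Icc (-R) R
    · have h1 := abs_le.1 (htan x hx)
      have h2 := abs_le.1 ((abs_le.2 hr).trans (le_abs_self R))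
      rw [indicator_of_mem hr, indicator_of_mem]
      exact ⟨by linarith, by linarith⟩
    · rw [indicator_of_notMem hr]; exact zero_le
  set I₁ := ∫⁻ r in Icc (-(|R| + M)) (|R| + M), invSqrt r
  have hI₁ : I₁ < ⊤ := lintegral_invSqrt_lt_top _
  set I₂ := ∫⁻ z in Metric.ball (0 : Plane) R₂, ENNReal.ofReal (‖z‖ ^ (-(3 / 2) : ℝ))
  have hI₂ : I₂ < ⊤ := (integrableOn_norm_rpow_ball (α := 3 / 2) (by norm_num) R₂).lintegral_lt_top
  have hx3 : ∀ r ∈ Icc (-R) R, ∫⁻ x, ENNReal.ofReal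
      (dist x (AffineMap.lineMap e.1 e.2 r) ^ (-(3 / 2) : ℝ)) ∂bulk n ≤ I₂ := by
    intro r hr
    refine (lintegral_mono_set (hball r hr)).trans (le_of_eq ?_)
    change _ = ∫⁻ z in Metric.ball (0 : Plane) R₂, ENNReal.ofReal (‖z‖ ^ (-(3 / 2) : ℝ))
    rw [← lintegral_indicator measurableSet_ball, ← lintegral_indicator measurableSet_ball,
      ← lintegral_sub_right_eq_self ((Metric.ball (0 : Plane) R₂).indicator
        fun z => ENNReal.ofReal (‖z‖ ^ (-(3 / 2) : ℝ))) (AffineMap.lineMap e.1 e.2 r)]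
    refine lintegral_congr fun x => ?_
    simp only [indicator, Metric.mem_ball, dist_eq_norm, sub_zero]
  have hA2 := (memLp_two_iff_lintegral hA.1).1 hA
  rw [HasFiniteIntegral, lintegral_prod _ hmeas.enorm]
  have hmr : ∀ x, Measurable fun r : ℝ => invSqrt (r - tanCoord e x) := fun x =>
    measurable_invSqrt.comp (measurable_id.sub measurable_const)
  calc ∫⁻ x, (∫⁻ r in Icc (-R) R, ‖A x * (dist x (AffineMap.lineMap e.1 e.2 r))⁻¹‖ₑ) ∂bulk n
      ≤ ∫⁻ x, (‖A x‖ₑ ^ 2 * (K * I₁) + ∫⁻ r in Icc (-R) R, ENNReal.ofReal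
          (dist x (AffineMap.lineMap e.1 e.2 r) ^ (-(3 / 2) : ℝ))) ∂bulk n := by
        refine lintegral_mono_ae ?_
        filter_upwards [ae_bulk_mem n] with x hx
        calc ∫⁻ r in Icc (-R) R, ‖A x * (dist x (AffineMap.lineMap e.1 e.2 r))⁻¹‖ₑ
            ≤ ∫⁻ r in Icc (-R) R, (‖A x‖ₑ ^ 2 * K * invSqrt (r - tanCoord e x) +
              ENNReal.ofReal (dist x (AffineMap.lineMap e.1 e.2 r) ^ (-(3 / 2) : ℝ))) := by
              refine lintegral_mono_ae ?_
              have : ∀ᵐ r : ℝ, r ≠ tanCoord e x := by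
                simp [ae_iff]
              filter_upwards [ae_restrict_of_ae this] with r hr
              exact hpt x r hr
          _ = ‖A x‖ₑ ^ 2 * K * (∫⁻ r in Icc (-R) R, invSqrt (r - tanCoord e x)) +
              ∫⁻ r in Icc (-R) R, ENNReal.ofReal
                (dist x (AffineMap.lineMap e.1 e.2 r) ^ (-(3 / 2) : ℝ)) := by
              rw [lintegral_add_left ((hmr x).const_mul _), lintegral_const_mul _ (hmr x)]
          _ ≤ _ := by
              rw [← mul_assoc]
              gcongr
              exact hinv x hx
    _ = (∫⁻ x, ‖A x‖ₑ ^ 2 ∂bulk n) * (K * I₁) + ∫⁻ r in Icc (-R) R, (∫⁻ x, ENNReal.ofReal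
          (dist x (AffineMap.lineMap e.1 e.2 r) ^ (-(3 / 2) : ℝ)) ∂bulk n) := by
        rw [lintegral_add_right _ hm3.lintegral_prod_right', lintegral_mul_const' _ _
          (ENNReal.mul_ne_top ENNReal.ofReal_ne_top hI₁.ne), lintegral_lintegral_swap hm3.aemeasurable]
    _ ≤ (∫⁻ x, ‖A x‖ₑ ^ 2 ∂bulk n) * (K * I₁) + ∫⁻ r in Icc (-R) R, I₂ := by
        exact add_le_add le_rfl (setLIntegral_mono' measurableSet_Icc hx3)
    _ < ⊤ := by
        rw [setLIntegral_const]
        refine ENNReal.add_lt_top.2 ⟨ENNReal.mul_lt_top hA2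
          (ENNReal.mul_lt_top ENNReal.ofReal_lt_top hI₁), ENNReal.mul_lt_top hI₂ ?_⟩
        exact measure_Icc_lt_top

/-! ### The regularised radial field centred on the line through a side -/

theorem hasFDerivAt_div_two_mul {f q : Plane → ℝ} {f' q' : Plane →L[ℝ] ℝ} {x : Plane}
    (hf : HasFDerivAt f f' x) (hq : HasFDerivAt q q' x) (h0 : q x ≠ 0) :
    HasFDerivAt (fun x => f x / (2 * q x)) ((2 * q x)⁻¹ • f' - (f x / (2 * q x ^ 2)) • q') x := by
  have h1 := hf.mul ((hasDerivAt_inv (x := 2 * q x) (by simpa using h0)).comp_hasFDerivAt x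
    (hq.const_mul 2))
  refine h1.congr_fderiv ?_
  ext v
  simp only [add_apply, sub_apply, smul_apply, smul_eq_mul, Function.comp_apply]
  field_simp
  ring

/-- The square of the regularized distance to a point on the line through a side. -/
def regDist (e : Plane × Plane) (l s : ℝ) (x : Plane) : ℝ :=
  s ^ 2 + sqLen e * ((tanCoord e x - l) ^ 2 + norCoord e x ^ 2 / 3)

theorem regDist_eq {e : Plane × Plane} (he : e.1 ≠ e.2) (l s : ℝ) (x : Plane) :
    regDist e l s x = s ^ 2 + dist x (AffineMap.lineMap e.1 e.2 l) ^ 2 := by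
  rw [regDist, dist_sq_coord he, tanCoord_side he, norCoord_side, sub_zero]

theorem regDist_pos {e : Plane × Plane} (he : e.1 ≠ e.2) (l : ℝ) {s : ℝ} (hs : 0 < s) (x : Plane) :
    0 < regDist e l s x := by
  rw [regDist_eq he]; positivity

theorem hasFDerivAt_regDist (e : Plane × Plane) (l s : ℝ) (x : Plane) :
    HasFDerivAt (regDist e l s) (sqLen e • ((2 * (tanCoord e x - l)) • tanLin e +
      (2 * norCoord e x / 3) • norLin e)) x := by
  have h1 := ((hasFDerivAt_tanCoord e x).sub_const l).pow 2
  have h2 := ((hasFDerivAt_norCoord e x).pow 2).mul_const (3⁻¹ : ℝ)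
  have h3 : HasFDerivAt (regDist e l s) _ x := ((h1.add h2).const_mul (sqLen e)).const_add (s ^ 2)
  refine h3.congr_fderiv ?_
  ext v
  simp only [add_apply, smul_apply, smul_eq_mul, nsmul_eq_mul]
  push_cast
  ring

theorem contDiff_regDist (e : Plane × Plane) (l s : ℝ) : ContDiff ℝ ∞ (regDist e l s) :=
  contDiff_const.add (contDiff_const.mul ((((contDiff_tanCoord e).sub contDiff_const).pow 2).add
    (((contDiff_norCoord e).pow 2).div_const 3)))

section side

variable {n : ℕ} {w : Plane → ℝ} {G : Plane → Plane}

/-- The derivative of `w Φ` in direction `y`, for a function `w` with gradient `G`. -/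
def prodDeriv (w : Plane → ℝ) (G : Plane → Plane) (Φ : Plane → ℝ) (y : Plane) (x : Plane) : ℝ :=
  w x * fderiv ℝ Φ x y + inner ℝ (G x) y * Φ x

theorem memLp_mul_bounded {f g : Plane → ℝ} (hf : MemLp f 2 (bulk n)) (hg : Continuous g)
    (hc : HasCompactSupport g) : MemLp (fun x => f x * g x) 2 (bulk n) := by
  obtain ⟨C, hC⟩ := hg.bounded_above_of_compact_support hc
  refine MemLp.of_le_mul (c := C) hf (hf.1.mul hg.aestronglyMeasurable) (.of_forall fun x => ?_)
  rw [norm_mul, mul_comm]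
  exact mul_le_mul_of_nonneg_right (hC x) (norm_nonneg _)

theorem memLp_prodDeriv (hw : MemLp w 2 (bulk n)) (hG : MemLp G 2 (bulk n)) {Φ : Plane → ℝ}
    (h : ContDiff ℝ ∞ Φ) (hc : HasCompactSupport Φ) (y : Plane) :
    MemLp (prodDeriv w G Φ y) 2 (bulk n) :=
  (memLp_mul_bounded hw ((h.continuous_fderiv (by simp)).clm_apply continuous_const)
    (hc.fderiv_apply ℝ y)).add (memLp_mul_bounded (hG.inner_const (𝕜 := ℝ) y) h.continuous hc)

theorem defect_eq_integral_prodDeriv (hw : MemLp w 2 (bulk n)) (hG : MemLp G 2 (bulk n))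
    {Φ : Plane → ℝ} (h : ContDiff ℝ ∞ Φ) (hc : HasCompactSupport Φ) (y : Plane) :
    defect n w G y Φ = ∫ x, prodDeriv w G Φ y x ∂bulk n := by
  have i1 := integrable_mul_of_memLp hw (memLp_fderiv_apply h hc (μ := bulk n) y)
  have i3 := integrable_mul_of_memLp (hG.inner_const (𝕜 := ℝ) y) (memLp_of_smooth (n := n) h hc)
  unfold defect prodDeriv
  rw [integral_add i1 i3]

theorem defect_mul (hw : MemLp w 2 (bulk n)) (hG : MemLp G 2 (bulk n))
    {Φ : Plane → ℝ} (h : ContDiff ℝ ∞ Φ) (hc : HasCompactSupport Φ) (y : Plane) {a : Plane → ℝ}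
    (ha : ContDiff ℝ ∞ a) :
    Integrable (fun x => prodDeriv w G Φ y x * a x + w x * Φ x * fderiv ℝ a x y) (bulk n) ∧
    defect n w G y (fun x => Φ x * a x) =
      ∫ x, (prodDeriv w G Φ y x * a x + w x * Φ x * fderiv ℝ a x y) ∂bulk n := by
  have hca : HasCompactSupport (fun x => Φ x * a x) := hc.mul_right
  have e : prodDeriv w G (fun x => Φ x * a x) y =
      fun x => prodDeriv w G Φ y x * a x + w x * Φ x * fderiv ℝ a x y := by
    ext x
    have hd : HasFDerivAt (fun x => Φ x * a x) _ x :=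
      (h.differentiable (by simp) x).hasFDerivAt.mul (ha.differentiable (by simp) x).hasFDerivAt
    rw [prodDeriv, prodDeriv, hd.fderiv]
    simp only [add_apply, smul_apply, smul_eq_mul]
    ring
  rw [defect_eq_integral_prodDeriv hw hG (h.mul ha) hca, ← e]
  exact ⟨(memLp_prodDeriv hw hG (h.mul ha) hca y).integrable (by norm_num), rfl⟩

/-- The fundamental identity for the field `z / (2 (s² + |z|²))`. -/
theorem integral_regDist_identity (hw : MemLp w 2 (bulk n)) (hG : MemLp G 2 (bulk n))
    (hwG : HasWeakGrad n w G) {e : Plane × Plane} (he : e ∈ kochSides n) {Φ : Plane → ℝ}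
    (h : ContDiff ℝ ∞ Φ) (hc : HasCompactSupport Φ) (hsup : tsupport Φ ⊆ rhombus e) (l : ℝ) {s : ℝ}
    (hs : 0 < s) :
    ∫ x, w x * Φ x * (s ^ 2 / (s ^ 2 + dist x (AffineMap.lineMap e.1 e.2 l) ^ 2) ^ 2) ∂bulk n =
      -∫ x, (prodDeriv w G Φ (sideDir e) x * ((tanCoord e x - l) / (2 * regDist e l s x)) +
        prodDeriv w G Φ (sideNormal e) x * (norCoord e x / Real.sqrt 3 / (2 * regDist e l s x)))
        ∂bulk n := by
  have hne := ne_of_mem_kochSides he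
  have h3 : Real.sqrt 3 ≠ 0 := by positivity
  have h33 : Real.sqrt 3 ^ 2 = 3 := Real.sq_sqrt (by norm_num)
  -- `a` and `c` are the components of `z / (2(s² + |z|²))` in the frame `sideDir`, `sideNormal`,
  -- where `z` is the position relative to the centre on the line.
  set a : Plane → ℝ := fun x => (tanCoord e x - l) / (2 * regDist e l s x) with ha
  set c : Plane → ℝ := fun x => norCoord e x / Real.sqrt 3 / (2 * regDist e l s x) with hcdef
  have hq : ∀ x, 2 * regDist e l s x ≠ 0 := fun x => by
    have := regDist_pos hne l hs x
    positivity
  have has : ContDiff ℝ ∞ a := ((contDiff_tanCoord e).sub contDiff_const).div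
    (contDiff_const.mul (contDiff_regDist e l s)) hq
  have hcs : ContDiff ℝ ∞ c := ((contDiff_norCoord e).div_const _).div
    (contDiff_const.mul (contDiff_regDist e l s)) hq
  have da : ∀ x, fderiv ℝ a x (sideDir e) = (2 * regDist e l s x)⁻¹ -
      (tanCoord e x - l) / (2 * regDist e l s x ^ 2) * (sqLen e * (2 * (tanCoord e x - l))) := by
    intro x
    rw [(hasFDerivAt_div_two_mul ((hasFDerivAt_tanCoord e x).sub_const l)
      (hasFDerivAt_regDist e l s x) (regDist_pos hne l hs x).ne').fderiv]
    simp only [add_apply, sub_apply, smul_apply, smul_eq_mul, tanLin_sideDir hne, norLin_sideDir]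
    ring
  have dc : ∀ x, fderiv ℝ c x (sideNormal e) = (2 * regDist e l s x)⁻¹ -
      norCoord e x / (2 * regDist e l s x ^ 2) * (sqLen e * (2 * norCoord e x / 3)) := by
    intro x
    have hn : HasFDerivAt (fun x => norCoord e x / Real.sqrt 3) ((Real.sqrt 3)⁻¹ • norLin e) x := by
      simpa only [div_eq_mul_inv] using (hasFDerivAt_norCoord e x).mul_const (Real.sqrt 3)⁻¹
    rw [(hasFDerivAt_div_two_mul hn
      (hasFDerivAt_regDist e l s x) (regDist_pos hne l hs x).ne').fderiv]
    simp only [add_apply, sub_apply, smul_apply, smul_eq_mul, tanLin_sideNormal,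
      norLin_sideNormal hne]
    field_simp
    ring
  have d1 := defect_eq_zero_of_tangential hw hG hwG he (sideDir e) (h.mul has)
    (hc.mul_right) (tsupport_mul_subset_left.trans hsup) (C := 0) (fun x => by
      rw [norLin_sideDir]; simp)
  obtain ⟨M, hM⟩ := h.continuous.bounded_above_of_compact_support hc
  -- The normal component carries the factor `norCoord`, so it vanishes linearly on the side. The
  -- constant uses that the denominator is at least `2 s²`.
  have d2 := defect_eq_zero_of_tangential hw hG hwG he (sideNormal e) (h.mul hcs)
    (hc.mul_right) (tsupport_mul_subset_left.trans hsup) (C := M / (2 * s ^ 2)) (fun x => by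
      have hqs : s ^ 2 ≤ regDist e l s x := by
        rw [regDist_eq hne]; nlinarith [sq_nonneg (dist x (AffineMap.lineMap e.1 e.2 l : Plane))]
      have hM' : |Φ x| ≤ M := hM x
      have hM0 : 0 ≤ M := (abs_nonneg _).trans hM'
      have e1 : Φ x * c x * norLin e (sideNormal e) =
          Φ x * (norCoord e x / (2 * regDist e l s x)) := by
        rw [norLin_sideNormal hne, hcdef]
        field_simp
      have hqpos := regDist_pos hne l hs x
      rw [e1, abs_mul, abs_div, abs_of_pos (by positivity : 0 < 2 * regDist e l s x),
        div_mul_eq_mul_div, mul_div_assoc]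
      gcongr)
  obtain ⟨i1, e1⟩ := defect_mul hw hG h hc (sideDir e) has
  obtain ⟨i2, e2⟩ := defect_mul hw hG h hc (sideNormal e) hcs
  have d1' : defect n w G (sideDir e) (fun x => Φ x * a x) = 0 := d1
  have d2' : defect n w G (sideNormal e) (fun x => Φ x * c x) = 0 := d2
  rw [e1] at d1'
  rw [e2] at d2'
  have hsum := integral_add i1 i2
  rw [d1', d2', add_zero] at hsum
  have bk : ∀ x, |s ^ 2 / (s ^ 2 + dist x (AffineMap.lineMap e.1 e.2 l : Plane) ^ 2) ^ 2| ≤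
      (s ^ 2)⁻¹ := by
    intro x
    rw [abs_of_nonneg (by positivity), div_le_iff₀ (by positivity)]
    set D := dist x (AffineMap.lineMap e.1 e.2 l : Plane)
    have : s ^ 2 * s ^ 2 ≤ (s ^ 2 + D ^ 2) ^ 2 := by
      nlinarith [mul_nonneg (sq_nonneg s) (sq_nonneg D), sq_nonneg (D ^ 2)]
    rw [inv_mul_eq_div, le_div_iff₀ (by positivity)]
    exact this
  have ik : Integrable (fun x => w x * Φ x *
      (s ^ 2 / (s ^ 2 + dist x (AffineMap.lineMap e.1 e.2 l : Plane) ^ 2) ^ 2)) (bulk n) := by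
    refine (integrable_mul_of_memLp hw (memLp_of_smooth (n := n) h hc)).mul_bdd (c := (s ^ 2)⁻¹)
      ?_ (.of_forall bk)
    exact (Measurable.aestronglyMeasurable (by fun_prop))
  have ept : ∀ x, (prodDeriv w G Φ (sideDir e) x * a x + w x * Φ x * fderiv ℝ a x (sideDir e)) +
      (prodDeriv w G Φ (sideNormal e) x * c x + w x * Φ x * fderiv ℝ c x (sideNormal e)) =
      (prodDeriv w G Φ (sideDir e) x * a x + prodDeriv w G Φ (sideNormal e) x * c x) +
      w x * Φ x * (s ^ 2 / (s ^ 2 + dist x (AffineMap.lineMap e.1 e.2 l : Plane) ^ 2) ^ 2) := by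
    intro x
    have hqpos := regDist_pos hne l hs x
    -- The divergence: with `q = s² + |z|²` it is `1/q - |z|²/q² = s²/q²`. The first term is `2 ·
    -- 1/(2q)` because the dimension is two.
    have : fderiv ℝ a x (sideDir e) + fderiv ℝ c x (sideNormal e) =
        s ^ 2 / (s ^ 2 + dist x (AffineMap.lineMap e.1 e.2 l : Plane) ^ 2) ^ 2 := by
      rw [da, dc, ← regDist_eq hne]
      have hq2 : s ^ 2 = regDist e l s x -
        sqLen e * ((tanCoord e x - l) ^ 2 + norCoord e x ^ 2 / 3) := by rw [regDist]; ring
      rw [hq2]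
      field_simp
      ring
    rw [← this]
    ring
  have ia : Integrable (fun x => prodDeriv w G Φ (sideDir e) x * a x +
      prodDeriv w G Φ (sideNormal e) x * c x) (bulk n) := by
    refine ((i1.add i2).sub ik).congr (.of_forall fun x => ?_)
    simp only [Pi.add_apply, Pi.sub_apply]
    rw [ept]; ring
  simp only [ept] at hsum
  rw [integral_add ia ik] at hsum
  linarith

end side

/-! ### Integration along the line through a side -/

theorem integral_odd_kernel {σ t : ℝ} (ht : t ≠ 0) (R : ℝ) :
    ∫ l in (-R)..R, (σ - l) / ((σ - l) ^ 2 + t ^ 2) =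
      (Real.log ((σ + R) ^ 2 + t ^ 2) - Real.log ((σ - R) ^ 2 + t ^ 2)) / 2 := by
  have hpos : ∀ l : ℝ, 0 < (σ - l) ^ 2 + t ^ 2 := fun l => by positivity
  have hder : ∀ l : ℝ, HasDerivAt (fun l => -(Real.log ((σ - l) ^ 2 + t ^ 2) / 2))
      ((σ - l) / ((σ - l) ^ 2 + t ^ 2)) l := by
    intro l
    have h1 : HasDerivAt (fun l : ℝ => (σ - l) ^ 2 + t ^ 2) (2 * (σ - l) * -1) l := by
      simpa using (((hasDerivAt_id l).const_sub σ).fun_pow 2).add_const (t ^ 2)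
    refine ((h1.log (hpos l).ne').div_const 2).neg.congr_deriv ?_
    have := (hpos l).ne'
    field_simp
  rw [intervalIntegral.integral_eq_sub_of_hasDerivAt (fun l _ => hder l)]
  · rw [sub_neg_eq_add]; ring_nf
  · exact (Continuous.div (by fun_prop) (by fun_prop) fun l => (hpos l).ne').intervalIntegrable _ _

/-- The integral is half the logarithm of a quotient whose numerator and denominator are at least
`R²/4` and differ by at most `4 M R`, so it is `O(M / R)`. -/
theorem abs_integral_odd_kernel_le {σ t M R : ℝ} (ht : t ≠ 0) (hσ : |σ| ≤ M) (hR : 0 < R)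
    (hM : 2 * M ≤ R) : |∫ l in (-R)..R, (σ - l) / ((σ - l) ^ 2 + t ^ 2)| ≤ 8 * M / R := by
  have hM0 : 0 ≤ M := (abs_nonneg _).trans hσ
  obtain ⟨h1, h2⟩ := abs_le.1 hσ
  have key : ∀ u v : ℝ, 0 < v → R ^ 2 / 4 ≤ v → 0 < u → u - v ≤ 4 * M * R →
      Real.log u - Real.log v ≤ 16 * M / R := by
    intro u v hv hv2 hu huv
    rw [← Real.log_div hu.ne' hv.ne']
    refine (Real.log_le_sub_one_of_pos (by positivity)).trans ?_
    rw [div_sub_one hv.ne', div_le_div_iff₀ hv hR]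
    calc (u - v) * R ≤ 4 * M * R * R := by gcongr
      _ = 16 * M * (R ^ 2 / 4) := by ring
      _ ≤ 16 * M * v := by gcongr
  have p1 : 0 < (σ + R) ^ 2 + t ^ 2 := by positivity
  have p2 : 0 < (σ - R) ^ 2 + t ^ 2 := by positivity
  have q1 : R ^ 2 / 4 ≤ (σ + R) ^ 2 + t ^ 2 := by nlinarith [sq_nonneg t, sq_nonneg (σ + R / 2)]
  have q2 : R ^ 2 / 4 ≤ (σ - R) ^ 2 + t ^ 2 := by nlinarith [sq_nonneg t, sq_nonneg (R / 2 - σ)]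
  have k1 := key _ _ p2 q2 p1 (by nlinarith)
  have k2 := key _ _ p1 q1 p2 (by nlinarith)
  rw [integral_odd_kernel ht, abs_le]
  have e : 8 * M / R = 16 * M / R / 2 := by ring
  rw [e]
  constructor <;> linarith

theorem integral_even_kernel {σ t : ℝ} (ht : t ≠ 0) (R : ℝ) :
    ∫ l in (-R)..R, t / ((σ - l) ^ 2 + t ^ 2) =
      Real.arctan ((R - σ) / t) + Real.arctan ((R + σ) / t) := by
  have hpos : ∀ l : ℝ, 0 < (σ - l) ^ 2 + t ^ 2 := fun l => by positivity
  have hder : ∀ l : ℝ, HasDerivAt (fun l => Real.arctan ((l - σ) / t))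
      (t / ((σ - l) ^ 2 + t ^ 2)) l := by
    intro l
    have h1 : HasDerivAt (fun l : ℝ => (l - σ) / t) (1 / t) l :=
      ((hasDerivAt_id l).sub_const σ).div_const t
    refine h1.arctan.congr_deriv ?_
    have h2 := (hpos l).ne'
    have h3 : (l - σ) ^ 2 + t ^ 2 ≠ 0 := by positivity
    have h4 : 1 + ((l - σ) / t) ^ 2 ≠ 0 := by positivity
    field_simp
    ring
  rw [intervalIntegral.integral_eq_sub_of_hasDerivAt (fun l _ => hder l)]
  · have : (-R - σ) / t = -((R + σ) / t) := by ring
    rw [this, Real.arctan_neg, sub_neg_eq_add]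
  · exact (Continuous.div (by fun_prop) (by fun_prop) fun l => (hpos l).ne').intervalIntegrable _ _

theorem abs_integral_even_kernel_le {σ t : ℝ} (ht : t ≠ 0) (R : ℝ) :
    |∫ l in (-R)..R, t / ((σ - l) ^ 2 + t ^ 2)| ≤ Real.pi := by
  rw [integral_even_kernel ht, abs_le]
  have h1 := Real.neg_pi_div_two_lt_arctan ((R - σ) / t)
  have h2 := Real.neg_pi_div_two_lt_arctan ((R + σ) / t)
  have h3 := Real.arctan_lt_pi_div_two ((R - σ) / t)
  have h4 := Real.arctan_lt_pi_div_two ((R + σ) / t)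
  constructor <;> linarith

/-- Up to sign the integral is the angle under which the segment is seen from the point. It tends to
a straight angle, negative because the point is on the inner side. -/
theorem tendsto_integral_even_kernel {σ t : ℝ} (ht : t < 0) :
    Tendsto (fun R : ℝ => ∫ l in (-R)..R, t / ((σ - l) ^ 2 + t ^ 2)) atTop (𝓝 (-Real.pi)) := by
  simp_rw [integral_even_kernel ht.ne]
  have hb : Tendsto Real.arctan atBot (𝓝 (-(Real.pi / 2))) :=
    Real.tendsto_arctan_atBot.mono_right nhdsWithin_le_nhds
  have h1 : Tendsto (fun R : ℝ => (R - σ) / t) atTop atBot :=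
    (tendsto_atTop_add_const_right _ _ tendsto_id).atTop_div_const_of_neg ht
  have h2 : Tendsto (fun R : ℝ => (R + σ) / t) atTop atBot :=
    (tendsto_atTop_add_const_right _ _ tendsto_id).atTop_div_const_of_neg ht
  have e : -Real.pi = -(Real.pi / 2) + -(Real.pi / 2) := by ring
  rw [e]
  exact (hb.comp h1).add (hb.comp h2)

section side

variable {n : ℕ} {w : Plane → ℝ} {G : Plane → Plane}

/-- Both components of `z / |z|²` are bounded by a multiple of `1 / |z|`, the kernel of
`integrable_mul_inv_dist`; the normal one is treated next. -/
theorem abs_tan_sub_mul_le {e : Plane × Plane} (he : e.1 ≠ e.2) (x : Plane) (l : ℝ) :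
    |tanCoord e x - l| / dist x (AffineMap.lineMap e.1 e.2 l : Plane) ^ 2 ≤
      (dist e.1 e.2)⁻¹ * (dist x (AffineMap.lineMap e.1 e.2 l : Plane))⁻¹ := by
  have hl := dist_pos.2 he
  have h := abs_tanCoord_sub_le he x (AffineMap.lineMap e.1 e.2 l)
  rw [tanCoord_side he] at h
  rcases (dist_nonneg (x := x) (y := (AffineMap.lineMap e.1 e.2 l : Plane))).eq_or_lt with h0 | h0
  · rw [← h0]; simp
  · rw [div_le_iff₀ (by positivity)]
    refine h.trans (le_of_eq ?_)
    field_simp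

theorem abs_nor_mul_le {e : Plane × Plane} (he : e.1 ≠ e.2) (x : Plane) (l : ℝ) :
    |norCoord e x / Real.sqrt 3| / dist x (AffineMap.lineMap e.1 e.2 l : Plane) ^ 2 ≤
      2 * (dist e.1 e.2)⁻¹ * (dist x (AffineMap.lineMap e.1 e.2 l : Plane))⁻¹ := by
  have hl := dist_pos.2 he
  have h := abs_norCoord_sub_le he x (AffineMap.lineMap e.1 e.2 l)
  rw [norCoord_side, sub_zero] at h
  have h3 : 1 ≤ Real.sqrt 3 := Real.one_le_sqrt.2 (by norm_num)
  have h4 : |norCoord e x / Real.sqrt 3| ≤ |norCoord e x| := by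
    rw [abs_div, abs_of_pos (by positivity : 0 < Real.sqrt 3)]
    exact div_le_self (abs_nonneg _) h3
  rcases (dist_nonneg (x := x) (y := (AffineMap.lineMap e.1 e.2 l : Plane))).eq_or_lt with h0 | h0
  · rw [← h0]; simp
  · rw [div_le_iff₀ (by positivity)]
    refine (h4.trans h).trans (le_of_eq ?_)
    field_simp

/-- The regularized kernels are dominated by their limit. -/
theorem abs_div_regDist_le {e : Plane × Plane} (he : e.1 ≠ e.2) (x : Plane) (l s c K : ℝ)
    (hc : |c| / dist x (AffineMap.lineMap e.1 e.2 l : Plane) ^ 2 ≤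
      K * (dist x (AffineMap.lineMap e.1 e.2 l : Plane))⁻¹)
    (h0 : dist x (AffineMap.lineMap e.1 e.2 l : Plane) = 0 → c = 0) :
    |c / (2 * regDist e l s x)| ≤ K * (dist x (AffineMap.lineMap e.1 e.2 l : Plane))⁻¹ := by
  rcases (dist_nonneg (x := x) (y := (AffineMap.lineMap e.1 e.2 l : Plane))).eq_or_lt with h | h
  · rw [h0 h.symm, ← h]; simp
  · refine le_trans ?_ hc
    have hq : dist x (AffineMap.lineMap e.1 e.2 l : Plane) ^ 2 ≤ 2 * regDist e l s x := by
      rw [regDist_eq he]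
      nlinarith [sq_nonneg s, sq_nonneg (dist x (AffineMap.lineMap e.1 e.2 l : Plane))]
    have hq0 : 0 < 2 * regDist e l s x := lt_of_lt_of_le (by positivity) hq
    rw [abs_div, abs_of_pos hq0]
    gcongr

theorem tendsto_div_regDist {e : Plane × Plane} (he : e.1 ≠ e.2) (x : Plane) (l c : ℝ)
    (h0 : dist x (AffineMap.lineMap e.1 e.2 l : Plane) = 0 → c = 0) :
    Tendsto (fun s : ℝ => c / (2 * regDist e l s x)) (𝓝[>] 0)
      (𝓝 (c / (2 * dist x (AffineMap.lineMap e.1 e.2 l : Plane) ^ 2))) := by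
  by_cases h : dist x (AffineMap.lineMap e.1 e.2 l : Plane) = 0
  · rw [h0 h]; simp
  · simp_rw [regDist_eq he]
    set D := dist x (AffineMap.lineMap e.1 e.2 l : Plane)
    have hc : ContinuousAt (fun s : ℝ => c / (2 * (s ^ 2 + D ^ 2))) 0 := by
      refine ContinuousAt.div (by fun_prop) (by fun_prop) ?_
      simp [h]
    have := hc.tendsto
    simp only [ne_eq, OfNat.ofNat_ne_zero, not_false_eq_true, zero_pow, zero_add] at this
    exact this.mono_left nhdsWithin_le_nhds

theorem coords_of_dist_eq_zero {e : Plane × Plane} (he : e.1 ≠ e.2) {x : Plane} {l : ℝ}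
    (h : dist x (AffineMap.lineMap e.1 e.2 l : Plane) = 0) :
    tanCoord e x - l = 0 ∧ norCoord e x / Real.sqrt 3 = 0 := by
  rw [dist_eq_zero] at h
  rw [h, tanCoord_side he, norCoord_side]
  simp

/-- Limit `s → 0` in `integral_regDist_identity`. The approximate delta tends to zero at almost
every point of the line because the trace vanishes. The other side converges dominatedly to the
singular kernel `z / |z|²`, up to the factor `2`. -/
theorem ae_integral_kernel_eq_zero (hw : MemLp w 2 (bulk n)) (hG : MemLp G 2 (bulk n))
    (hwG : HasWeakGrad n w G) (ht : HasTrace n w fun _ => 0) {e : Plane × Plane}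
    (he : e ∈ kochSides n) {Φ : Plane → ℝ} (h : ContDiff ℝ ∞ Φ) (hc : HasCompactSupport Φ)
    (hsup : tsupport Φ ⊆ rhombus e) (R : ℝ) :
    ∀ᵐ l : ℝ ∂volume.restrict (Icc (-R) R),
      ∫ x, (prodDeriv w G Φ (sideDir e) x * ((tanCoord e x - l) /
          dist x (AffineMap.lineMap e.1 e.2 l : Plane) ^ 2) +
        prodDeriv w G Φ (sideNormal e) x * (norCoord e x / Real.sqrt 3 /
          dist x (AffineMap.lineMap e.1 e.2 l : Plane) ^ 2)) ∂bulk n = 0 := by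
  have hne := ne_of_mem_kochSides he
  set A := prodDeriv w G Φ (sideDir e)
  set B := prodDeriv w G Φ (sideNormal e)
  have hA : MemLp A 2 (bulk n) := memLp_prodDeriv hw hG h hc _
  have hB : MemLp B 2 (bulk n) := memLp_prodDeriv hw hG h hc _
  filter_upwards [ae_restrict_of_ae (ae_tendsto_setIntegral_mul_div_sq hw ht he h hc hsup),
    (integrable_mul_inv_dist hA hne R).prod_left_ae,
    (integrable_mul_inv_dist hB hne R).prod_left_ae] with l hl hAl hBl
  set p : Plane := AffineMap.lineMap e.1 e.2 l
  have hwΦ : Integrable (fun x => w x * Φ x) (bulk n) :=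
    integrable_mul_of_memLp hw (memLp_of_smooth (n := n) h hc)
  have l1 := tendsto_integral_mul_kernel hwΦ p hl
  have hmq : ∀ s, Measurable (regDist e l s) := fun s => (contDiff_regDist e l s).continuous.measurable
  have hmt : Measurable (tanCoord e) := (continuous_tanCoord e).measurable
  have hmn : Measurable (norCoord e) := (continuous_norCoord e).measurable
  have l2 : Tendsto (fun s : ℝ => ∫ x, (A x * ((tanCoord e x - l) / (2 * regDist e l s x)) +
      B x * (norCoord e x / Real.sqrt 3 / (2 * regDist e l s x))) ∂bulk n) (𝓝[>] 0)
      (𝓝 (∫ x, (A x * ((tanCoord e x - l) / (2 * dist x p ^ 2)) +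
        B x * (norCoord e x / Real.sqrt 3 / (2 * dist x p ^ 2))) ∂bulk n)) := by
    refine tendsto_integral_filter_of_dominated_convergence
      (fun x => (dist e.1 e.2)⁻¹ * |A x * (dist x p)⁻¹| + 2 * (dist e.1 e.2)⁻¹ * |B x * (dist x p)⁻¹|)
      (.of_forall fun s => ?_) (.of_forall fun s => .of_forall fun x => ?_)
      ((hAl.abs.const_mul _).add (hBl.abs.const_mul _)) (.of_forall fun x => ?_)
    · have m1 : Measurable fun x => (tanCoord e x - l) / (2 * regDist e l s x) :=
        (hmt.sub_const l).div ((hmq s).const_mul 2)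
      have m2 : Measurable fun x => norCoord e x / Real.sqrt 3 / (2 * regDist e l s x) :=
        (hmn.div_const _).div ((hmq s).const_mul 2)
      exact (hA.1.mul m1.aestronglyMeasurable).add (hB.1.mul m2.aestronglyMeasurable)
    · rw [Real.norm_eq_abs]
      refine (abs_add_le _ _).trans (add_le_add ?_ ?_)
      · rw [abs_mul, abs_mul, mul_left_comm, abs_of_nonneg (inv_nonneg.2 (dist_nonneg (x := x)))]
        exact mul_le_mul_of_nonneg_left (abs_div_regDist_le hne x l s _ _
          (abs_tan_sub_mul_le hne x l) fun h => (coords_of_dist_eq_zero hne h).1) (abs_nonneg _)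
      · rw [abs_mul, abs_mul, mul_left_comm, abs_of_nonneg (inv_nonneg.2 (dist_nonneg (x := x)))]
        exact mul_le_mul_of_nonneg_left (abs_div_regDist_le hne x l s _ _
          (abs_nor_mul_le hne x l) fun h => (coords_of_dist_eq_zero hne h).2) (abs_nonneg _)
    · exact ((tendsto_div_regDist hne x l _ fun h => (coords_of_dist_eq_zero hne h).1).const_mul _).add
        ((tendsto_div_regDist hne x l _ fun h => (coords_of_dist_eq_zero hne h).2).const_mul _)
  have l3 : Tendsto (fun s : ℝ => ∫ x, w x * Φ x * (s ^ 2 / (s ^ 2 + dist x p ^ 2) ^ 2) ∂bulk n)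
      (𝓝[>] 0) (𝓝 (-∫ x, (A x * ((tanCoord e x - l) / (2 * dist x p ^ 2)) +
        B x * (norCoord e x / Real.sqrt 3 / (2 * dist x p ^ 2))) ∂bulk n)) := by
    refine l2.neg.congr' ?_
    filter_upwards [self_mem_nhdsWithin] with s hs
    exact (integral_regDist_identity hw hG hwG he h hc hsup l hs).symm
  have h5 := tendsto_nhds_unique l3 l1
  have e6 : ∀ x, A x * ((tanCoord e x - l) / dist x p ^ 2) +
      B x * (norCoord e x / Real.sqrt 3 / dist x p ^ 2) =
      2 * (A x * ((tanCoord e x - l) / (2 * dist x p ^ 2)) +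
        B x * (norCoord e x / Real.sqrt 3 / (2 * dist x p ^ 2))) := by
    intro x
    rw [mul_comm (2 : ℝ) (dist x p ^ 2), ← div_div, ← div_div]
    ring
  simp_rw [e6]
  rw [integral_const_mul]
  linarith

theorem prodDeriv_eq_zero {Φ : Plane → ℝ} {x : Plane} (hx : x ∉ tsupport Φ) (y : Plane) :
    prodDeriv w G Φ y x = 0 := by
  have : fderiv ℝ Φ x = 0 := by
    by_contra h0
    exact hx (support_fderiv_subset ℝ h0)
  rw [prodDeriv, this, image_eq_zero_of_notMem_tsupport hx]
  simp

/-- The integration by parts formula in the normal direction near a side. -/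
theorem defect_sideNormal_eq_zero (hw : MemLp w 2 (bulk n)) (hG : MemLp G 2 (bulk n))
    (hwG : HasWeakGrad n w G) (ht : HasTrace n w fun _ => 0) {e : Plane × Plane}
    (he : e ∈ kochSides n) {Φ : Plane → ℝ} (h : ContDiff ℝ ∞ Φ) (hc : HasCompactSupport Φ)
    (hsup : tsupport Φ ⊆ rhombus e) : defect n w G (sideNormal e) Φ = 0 := by
  have hne := ne_of_mem_kochSides he
  have hq := sqLen_pos hne
  have hl := dist_pos.2 hne
  set A := prodDeriv w G Φ (sideDir e) with hAdef
  set B := prodDeriv w G Φ (sideNormal e) with hBdef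
  have hA : MemLp A 2 (bulk n) := memLp_prodDeriv hw hG h hc _
  have hB : MemLp B 2 (bulk n) := memLp_prodDeriv hw hG h hc _
  have hAi := hA.integrable (by norm_num)
  have hBi := hB.integrable (by norm_num)
  rw [defect_eq_integral_prodDeriv hw hG h hc]
  set t : Plane → ℝ := fun x => norCoord e x / Real.sqrt 3 with htdef
  set P : ℝ → Plane → ℝ := fun R x => ∫ l in (-R)..R, (tanCoord e x - l) /
    ((tanCoord e x - l) ^ 2 + t x ^ 2) with hP
  set Q : ℝ → Plane → ℝ := fun R x => ∫ l in (-R)..R, t x /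
    ((tanCoord e x - l) ^ 2 + t x ^ 2) with hQ
  have hD : ∀ x l, dist x (AffineMap.lineMap e.1 e.2 l : Plane) ^ 2 =
      sqLen e * ((tanCoord e x - l) ^ 2 + t x ^ 2) := by
    intro x l
    rw [dist_sq_coord hne, tanCoord_side hne, norCoord_side, sub_zero, htdef]
    simp only [div_pow]
    rw [Real.sq_sqrt (by norm_num)]
  have hneg : ∀ x ∈ kochDomain n, x ∈ tsupport Φ → t x < 0 := fun x hx hx' =>
    div_neg_of_neg_of_pos ((mem_kochDomain_iff he (hsup hx')).1 hx) (by positivity)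
  -- measurability of the kernels
  have hDm : Measurable fun q : Plane × ℝ => dist q.1 (AffineMap.lineMap e.1 e.2 q.2 : Plane) :=
    measurable_fst.dist ((measurable_lineMap e).comp measurable_snd)
  have mk1 : Measurable fun q : Plane × ℝ => (tanCoord e q.1 - q.2) /
      dist q.1 (AffineMap.lineMap e.1 e.2 q.2 : Plane) ^ 2 :=
    (((continuous_tanCoord e).measurable.comp measurable_fst).sub measurable_snd).div (hDm.pow_const 2)
  have mk2 : Measurable fun q : Plane × ℝ => t q.1 /
      dist q.1 (AffineMap.lineMap e.1 e.2 q.2 : Plane) ^ 2 :=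
    (((continuous_norCoord e).measurable.comp measurable_fst).div_const _).div (hDm.pow_const 2)
  -- Integrating the vanishing identity over centres `l ∈ [-R, R]` and exchanging the order replaces
  -- the two singular kernels by their integrals `P R` and `Q R` along the line.
  have hkey : ∀ R : ℝ, 0 < R → Integrable (fun x => A x * P R x) (bulk n) ∧
      Integrable (fun x => B x * Q R x) (bulk n) ∧
      ∫ x, A x * P R x ∂bulk n + ∫ x, B x * Q R x ∂bulk n = 0 := by
    intro R hR
    have iA : Integrable (fun q : Plane × ℝ => A q.1 * ((tanCoord e q.1 - q.2) /
        dist q.1 (AffineMap.lineMap e.1 e.2 q.2 : Plane) ^ 2))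
        ((bulk n).prod (volume.restrict (Icc (-R) R))) := by
      refine ((integrable_mul_inv_dist hA hne R).const_mul (dist e.1 e.2)⁻¹).mono
        (hA.1.comp_fst.mul mk1.aestronglyMeasurable) (.of_forall fun q => ?_)
      rw [norm_mul, norm_mul, norm_mul, mul_left_comm, norm_inv, norm_inv, Real.norm_eq_abs (dist _ _),
        abs_of_pos hl, norm_div, norm_pow, Real.norm_eq_abs (dist q.1 _), abs_of_nonneg dist_nonneg]
      exact mul_le_mul_of_nonneg_left (abs_tan_sub_mul_le hne q.1 q.2) (norm_nonneg _)
    have iB : Integrable (fun q : Plane × ℝ => B q.1 * (t q.1 /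
        dist q.1 (AffineMap.lineMap e.1 e.2 q.2 : Plane) ^ 2))
        ((bulk n).prod (volume.restrict (Icc (-R) R))) := by
      refine ((integrable_mul_inv_dist hB hne R).const_mul (2 * (dist e.1 e.2)⁻¹)).mono
        (hB.1.comp_fst.mul mk2.aestronglyMeasurable) (.of_forall fun q => ?_)
      rw [norm_mul, norm_mul (2 * (dist e.1 e.2)⁻¹), norm_mul (B q.1) (dist _ _)⁻¹, mul_left_comm,
        Real.norm_of_nonneg (by positivity : 0 ≤ 2 * (dist e.1 e.2)⁻¹), norm_inv, norm_div, norm_pow, Real.norm_eq_abs (dist q.1 _), abs_of_nonneg dist_nonneg]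
      exact mul_le_mul_of_nonneg_left (abs_nor_mul_le hne q.1 q.2) (norm_nonneg _)
    have hsw := integral_integral_swap (μ := bulk n)
      (ν := volume.restrict (Icc (-R) R)) (f := fun x l => A x * ((tanCoord e x - l) /
        dist x (AffineMap.lineMap e.1 e.2 l : Plane) ^ 2) +
      B x * (t x / dist x (AffineMap.lineMap e.1 e.2 l : Plane) ^ 2))
      ((iA.add iB).congr (.of_forall fun _ => rfl))
    have hz : ∫ l in Icc (-R) R, ∫ x, (A x * ((tanCoord e x - l) /
        dist x (AffineMap.lineMap e.1 e.2 l : Plane) ^ 2) +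
      B x * (t x / dist x (AffineMap.lineMap e.1 e.2 l : Plane) ^ 2)) ∂bulk n = 0 :=
      integral_eq_zero_of_ae (ae_integral_kernel_eq_zero hw hG hwG ht he h hc hsup R)
    rw [hz] at hsw
    have eA : ∀ x, ∫ l in Icc (-R) R, A x * ((tanCoord e x - l) /
        dist x (AffineMap.lineMap e.1 e.2 l : Plane) ^ 2) = (sqLen e)⁻¹ * (A x * P R x) := by
      intro x
      rw [integral_Icc_eq_integral_Ioc, ← intervalIntegral.integral_of_le (by linarith),
        intervalIntegral.integral_const_mul, hP]
      simp only [hD, mul_comm (sqLen e), ← div_div]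
      rw [intervalIntegral.integral_div]
      ring
    have eB : ∀ x, ∫ l in Icc (-R) R, B x * (t x /
        dist x (AffineMap.lineMap e.1 e.2 l : Plane) ^ 2) = (sqLen e)⁻¹ * (B x * Q R x) := by
      intro x
      rw [integral_Icc_eq_integral_Ioc, ← intervalIntegral.integral_of_le (by linarith),
        intervalIntegral.integral_const_mul, hQ]
      simp only [hD, mul_comm (sqLen e), ← div_div]
      rw [intervalIntegral.integral_div]
      ring
    have jA : Integrable (fun x => (sqLen e)⁻¹ * (A x * P R x)) (bulk n) :=
      iA.integral_prod_left.congr (.of_forall eA)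
    have jB : Integrable (fun x => (sqLen e)⁻¹ * (B x * Q R x)) (bulk n) :=
      iB.integral_prod_left.congr (.of_forall eB)
    have hsplit : ∫ x, (∫ l in Icc (-R) R, (A x * ((tanCoord e x - l) /
        dist x (AffineMap.lineMap e.1 e.2 l : Plane) ^ 2) +
      B x * (t x / dist x (AffineMap.lineMap e.1 e.2 l : Plane) ^ 2))) ∂bulk n =
      ∫ x, ((sqLen e)⁻¹ * (A x * P R x) + (sqLen e)⁻¹ * (B x * Q R x)) ∂bulk n := by
      refine integral_congr_ae ?_
      filter_upwards [iA.prod_right_ae, iB.prod_right_ae] with x h1 h2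
      rw [integral_add h1 h2, eA, eB]
    rw [hsplit, integral_add jA jB, integral_const_mul, integral_const_mul, ← mul_add] at hsw
    have hinv : (sqLen e)⁻¹ ≠ 0 := inv_ne_zero hq.ne'
    refine ⟨(integrable_const_mul_iff (isUnit_iff_ne_zero.2 hinv) _).1 jA,
      (integrable_const_mul_iff (isUnit_iff_ne_zero.2 hinv) _).1 jB,
      (mul_eq_zero.1 hsw).resolve_left hinv⟩
  obtain ⟨R₁, hR₁⟩ := (isBounded_kochDomain n).subset_ball e.1
  set M := |R₁| / dist e.1 e.2 with hMdef
  have hM0 : 0 ≤ M := by positivity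
  have htan : ∀ x ∈ kochDomain n, |tanCoord e x| ≤ M := fun x hx => by
    have h := abs_tanCoord_sub_le hne x e.1
    rw [tanCoord_fst, sub_zero] at h
    refine h.trans ?_
    rw [hMdef]
    gcongr
    exact (Metric.mem_ball.1 (hR₁ hx)).le.trans (le_abs_self _)
  -- The tangential kernel is odd in `l` about `tanCoord e x`, so the window `[-R, R]` leaves only a
  -- boundary effect of order `1 / R`.
  have lA : Tendsto (fun R : ℝ => ∫ x, A x * P R x ∂bulk n) atTop (𝓝 0) := by
    have hlim : Tendsto (fun R : ℝ => 8 * M / R * ∫ x, |A x| ∂bulk n) atTop (𝓝 0) := by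
      have := (tendsto_const_nhds (x := 8 * M)).div_atTop (tendsto_id (α := ℝ))
      simpa using this.mul_const (∫ x, |A x| ∂bulk n)
    rw [tendsto_zero_iff_abs_tendsto_zero]
    refine squeeze_zero' (.of_forall fun R => abs_nonneg _) ?_ hlim
    filter_upwards [eventually_gt_atTop 0, eventually_ge_atTop (2 * M)] with R hR0 hR
    rw [Function.comp_apply, ← integral_const_mul]
    refine abs_integral_le_integral_abs.trans (integral_mono_ae (hkey R hR0).1.abs
      (hAi.abs.const_mul _) ?_)
    filter_upwards [ae_bulk_mem n] with x hx
    rw [abs_mul, mul_comm]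
    by_cases hx' : x ∈ tsupport Φ
    · exact mul_le_mul_of_nonneg_right (abs_integral_odd_kernel_le (hneg x hx hx').ne (htan x hx) hR0 hR)
        (abs_nonneg _)
    · rw [hAdef, prodDeriv_eq_zero hx']; simp
  -- The normal kernel integrates to `-π` at every point of the support in the domain, independently
  -- of the point: the limit is `-π` times the defect.
  have lB : Tendsto (fun R : ℝ => ∫ x, B x * Q R x ∂bulk n) atTop
      (𝓝 (∫ x, B x * -Real.pi ∂bulk n)) := by
    refine tendsto_integral_filter_of_dominated_convergence (fun x => |B x| * Real.pi) ?_ ?_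
      (hBi.abs.mul_const _) ?_
    · filter_upwards [eventually_gt_atTop 0] with R hR
      exact (hkey R hR).2.1.1
    · refine .of_forall fun R => ?_
      filter_upwards [ae_bulk_mem n] with x hx
      by_cases hx' : x ∈ tsupport Φ
      · rw [norm_mul]
        exact mul_le_mul_of_nonneg_left (abs_integral_even_kernel_le (hneg x hx hx').ne R)
          (norm_nonneg _)
      · rw [hBdef, prodDeriv_eq_zero hx']; simp
    · filter_upwards [ae_bulk_mem n] with x hx
      by_cases hx' : x ∈ tsupport Φ
      · exact (tendsto_integral_even_kernel (hneg x hx hx')).const_mul _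
      · rw [hBdef, prodDeriv_eq_zero hx']; simp
  have lsum := lA.add lB
  have hev : (fun R : ℝ => ∫ x, A x * P R x ∂bulk n + ∫ x, B x * Q R x ∂bulk n) =ᶠ[atTop]
      fun _ => 0 := by
    filter_upwards [eventually_gt_atTop 0] with R hR
    exact (hkey R hR).2.2
  have hfin := tendsto_nhds_unique (lsum.congr' hev) tendsto_const_nhds
  rw [zero_add, integral_mul_const] at hfin
  exact (mul_eq_zero.1 hfin).resolve_right (neg_ne_zero.2 Real.pi_ne_zero)

theorem defect_add_smul (hw : MemLp w 2 (bulk n)) (hG : MemLp G 2 (bulk n)) {Φ : Plane → ℝ}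
    (h : ContDiff ℝ ∞ Φ) (hc : HasCompactSupport Φ) (a b : ℝ) (y z : Plane) :
    defect n w G (a • y + b • z) Φ = a * defect n w G y Φ + b * defect n w G z Φ := by
  rw [defect_eq_integral_prodDeriv hw hG h hc, defect_eq_integral_prodDeriv hw hG h hc,
    defect_eq_integral_prodDeriv hw hG h hc, ← integral_const_mul, ← integral_const_mul,
    ← integral_add (((memLp_prodDeriv hw hG h hc y).integrable (by norm_num)).const_mul a)
      (((memLp_prodDeriv hw hG h hc z).integrable (by norm_num)).const_mul b)]
  refine integral_congr_ae (.of_forall fun x => ?_)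
  simp only [prodDeriv, map_add, map_smul, inner_add_right, inner_smul_right, smul_eq_mul]
  ring

/-- A function with vanishing trace can be extended by zero: the integration by parts formula holds
for arbitrary test functions. -/
theorem defect_eq_zero_of_trace (hw : MemLp w 2 (bulk n)) (hG : MemLp G 2 (bulk n))
    (hwG : HasWeakGrad n w G) (ht : HasTrace n w fun _ => 0) (y : Plane) {Φ : Plane → ℝ}
    (h : ContDiff ℝ ∞ Φ) (hc : HasCompactSupport Φ) : defect n w G y Φ = 0 := by
  refine defect_eq_zero_of_disjoint_vertices hw hG y (fun Φ h hc hV =>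
    defect_eq_zero_of_rhombus hw hG hwG y (fun e he Φ h hc hsup => ?_) h hc hV) h hc
  rw [eq_sideDir_add_sideNormal (ne_of_mem_kochSides he) y, defect_add_smul hw hG h hc,
    defect_sideNormal_eq_zero hw hG hwG ht he h hc hsup,
    defect_eq_zero_of_tangential hw hG hwG he (sideDir e) h hc hsup (C := 0)
      (fun x => by rw [norLin_sideDir]; simp)]
  simp

end side

/-! ### Weak gradients in the whole plane -/

/-- `H` is the weak gradient of `W` in the plane. -/
def HasPlaneGrad (W : Plane → ℝ) (H : Plane → Plane) : Prop :=
  ∀ (y : Plane) (Φ : Plane → ℝ), ContDiff ℝ ∞ Φ → HasCompactSupport Φ →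
    ∫ x, W x * fderiv ℝ Φ x y = -∫ x, inner ℝ (H x) y * Φ x

theorem hasCompactSupport_comp_sub {Φ : Plane → ℝ} (hc : HasCompactSupport Φ) (h : Plane) :
    HasCompactSupport fun x => Φ (x - h) := by
  simpa [sub_eq_add_neg, Function.comp_def] using hc.comp_homeomorph (Homeomorph.addRight (-h))

theorem fderiv_comp_sub {Φ : Plane → ℝ} (h x : Plane) :
    fderiv ℝ (fun x => Φ (x - h)) x = fderiv ℝ Φ (x - h) := by
  rw [_root_.fderiv_comp_sub]

theorem eLpNorm_comp_sub {E : Type*} [NormedAddCommGroup E] {f : Plane → E}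
    (hf : AEStronglyMeasurable f volume) (h : Plane) :
    eLpNorm (fun x => f (x - h)) 2 volume = eLpNorm f 2 volume :=
  eLpNorm_comp_measurePreserving hf (measurePreserving_sub_right volume h)

theorem memLp_comp_sub {E : Type*} [NormedAddCommGroup E] {f : Plane → E}
    (hf : MemLp f 2 volume) (h : Plane) : MemLp (fun x => f (x - h)) 2 volume :=
  hf.comp_measurePreserving (measurePreserving_sub_right volume h)

theorem memLp_comp_add {E : Type*} [NormedAddCommGroup E] {f : Plane → E}
    (hf : MemLp f 2 volume) (h : Plane) : MemLp (fun x => f (x + h)) 2 volume :=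
  hf.comp_measurePreserving (measurePreserving_add_right volume h)

section planeGrad

variable {W : Plane → ℝ} {H : Plane → Plane}

/-- Mean value inequality in `t` for `∫ W φ(x - t h)`: by the weak gradient its derivative is `∫ ⟨H,
h⟩ φ(x - t h)`, and the norm of a translate of `φ` does not depend on `t`. -/
theorem abs_integral_translate_sub_le (hW : Integrable W) (hH : MemLp H 2 volume)
    (hWH : HasPlaneGrad W H) (h : Plane) {φ : Plane → ℝ} (hφ : ContDiff ℝ ∞ φ)
    (hc : HasCompactSupport φ) :
    |(∫ x, W x * φ (x - h)) - ∫ x, W x * φ x| ≤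
      ‖h‖ * (eLpNorm H 2 volume).toReal * (eLpNorm φ 2 volume).toReal := by
  obtain ⟨K, hK⟩ := hφ.continuous.bounded_above_of_compact_support hc
  obtain ⟨L, hL⟩ := (hφ.continuous_fderiv (by simp)).bounded_above_of_compact_support (hc.fderiv ℝ)
  have hφ2 : MemLp φ 2 volume := hφ.continuous.memLp_of_hasCompactSupport hc
  have hsm : ∀ v : Plane, ContDiff ℝ ∞ fun x => φ (x - v) := fun v =>
    hφ.comp (contDiff_id.sub contDiff_const)
  have hder : ∀ t : ℝ, HasDerivAt (fun t : ℝ => ∫ x, W x * φ (x - t • h))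
      (∫ x, W x * -fderiv ℝ φ (x - t • h) h) t := by
    intro t
    refine (hasDerivAt_integral_of_dominated_loc_of_deriv_le (s := univ)
      (F := fun t x => W x * φ (x - t • h)) (F' := fun t x => W x * -fderiv ℝ φ (x - t • h) h)
      (bound := fun x => |W x| * (L * ‖h‖)) univ_mem (.of_forall fun t => ?_) ?_ ?_ ?_ ?_ ?_).2
    · exact hW.1.mul (hsm _).continuous.aestronglyMeasurable
    · exact hW.mul_bdd (hsm _).continuous.aestronglyMeasurable (.of_forall fun x => hK _)
    · refine hW.1.mul (Continuous.aestronglyMeasurable ?_)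
      exact ((((hφ.continuous_fderiv (by simp)).comp (continuous_id.sub continuous_const))).clm_apply
        continuous_const).neg
    · refine .of_forall fun x t _ => ?_
      rw [norm_mul, norm_neg, Real.norm_eq_abs]
      exact mul_le_mul_of_nonneg_left (((fderiv ℝ φ (x - t • h)).le_opNorm h).trans
        (mul_le_mul_of_nonneg_right (hL _) (norm_nonneg _))) (abs_nonneg _)
    · exact hW.abs.mul_const _
    · refine .of_forall fun x t _ => ?_
      have h1 : HasDerivAt (fun t : ℝ => x - t • h) (-h) t := by
        simpa using ((hasDerivAt_id t).smul_const h).const_sub x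
      have h2 : HasDerivAt (fun t : ℝ => φ (x - t • h)) (fderiv ℝ φ (x - t • h) (-h)) t :=
        ((hφ.differentiable (by simp)) (x - t • h)).hasFDerivAt.comp_hasDerivAt t h1
      exact (h2.const_mul (W x)).congr_deriv (by rw [map_neg])
  have hbd : ∀ t : ℝ, ‖∫ x, W x * -fderiv ℝ φ (x - t • h) h‖ ≤
      ‖h‖ * (eLpNorm H 2 volume).toReal * (eLpNorm φ 2 volume).toReal := by
    intro t
    have e1 : ∫ x, W x * -fderiv ℝ φ (x - t • h) h = ∫ x, inner ℝ (H x) h * φ (x - t • h) := by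
      have := hWH h _ (hsm (t • h)) (hasCompactSupport_comp_sub hc _)
      simp only [fderiv_comp_sub] at this
      simp only [mul_neg, integral_neg, this, neg_neg]
    have hHn : MemLp (fun x => ‖h‖ * ‖H x‖) 2 volume := hH.norm.const_mul _
    rw [e1, Real.norm_eq_abs]
    refine (abs_integral_le_eLpNorm_mul hHn (memLp_comp_sub hφ2 (t • h))
      (.of_forall fun x => ?_)).trans (le_of_eq ?_)
    · rw [abs_mul, abs_of_nonneg (by positivity : 0 ≤ ‖h‖ * ‖H x‖), mul_comm ‖h‖]
      exact mul_le_mul_of_nonneg_right (abs_real_inner_le_norm _ _) (abs_nonneg _)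
    · rw [eLpNorm_comp_sub hφ2.1]
      have : eLpNorm (fun x => ‖h‖ * ‖H x‖) 2 volume = ‖(‖h‖)‖ₑ * eLpNorm H 2 volume := by
        rw [← eLpNorm_norm H]
        exact eLpNorm_const_smul (‖h‖) (fun x => ‖H x‖) 2 volume
      rw [this, ENNReal.toReal_mul, enorm_norm, toReal_enorm]
  have := norm_image_sub_le_of_norm_deriv_le_segment_01' (fun t _ => (hder t).hasDerivWithinAt)
    (fun t _ => hbd t)
  simpa using this

/-- If `k ∈ L²` and `|∫ k φ| ≤ M ‖φ‖` for all test functions `φ`, then `‖k‖ ≤ M`. -/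
theorem eLpNorm_le_of_forall_smooth {k : Plane → ℝ} (hk : MemLp k 2 volume) {M : ℝ}
    (hM0 : 0 ≤ M) (hM : ∀ φ : Plane → ℝ, ContDiff ℝ ∞ φ → HasCompactSupport φ →
      |∫ x, k x * φ x| ≤ M * (eLpNorm φ 2 volume).toReal) :
    (eLpNorm k 2 volume).toReal ≤ M := by
  have hall : ∀ g : Lp ℝ 2 (volume : Measure Plane), |inner ℝ (hk.toLp k) g| ≤ M * ‖g‖ := by
    intro g
    refine (Lp.dense_hasCompactSupport_contDiff (E := Plane) (F := ℝ) (μ := volume)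
      (p := 2) (by norm_num)).induction ?_ (isClosed_le (by fun_prop) (by fun_prop)) g
    rintro g ⟨φ, hφ, hc, hs⟩
    rw [L2.inner_def, Lp.norm_def, eLpNorm_congr_ae hφ]
    refine le_trans (le_of_eq ?_) (hM φ hs hc)
    congr 1
    refine integral_congr_ae ?_
    filter_upwards [hk.coeFn_toLp, hφ] with x h1 h2
    rw [h1, h2]; simp [mul_comm]
  have h := hall (hk.toLp k)
  rw [real_inner_self_eq_norm_sq, abs_of_nonneg (by positivity), sq, Lp.norm_toLp] at h
  rcases ENNReal.toReal_nonneg (a := eLpNorm k 2 volume) |>.eq_or_lt' with h0 | h0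
  · rwa [h0]
  · exact le_of_mul_le_mul_right h h0

/-- Translation estimate for functions with square integrable weak gradient. -/
theorem eLpNorm_translate_sub_le (hW : Integrable W) (hW2 : MemLp W 2 volume)
    (hH : MemLp H 2 volume) (hWH : HasPlaneGrad W H) (h : Plane) :
    (eLpNorm (fun x => W (x + h) - W x) 2 volume).toReal ≤
      ‖h‖ * (eLpNorm H 2 volume).toReal := by
  refine eLpNorm_le_of_forall_smooth ((memLp_comp_add hW2 h).sub hW2)
    (by positivity) fun φ hφ hc => ?_
  refine le_trans (le_of_eq ?_) (abs_integral_translate_sub_le hW hH hWH h hφ hc)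
  have hφ2 : MemLp φ 2 volume := hφ.continuous.memLp_of_hasCompactSupport hc
  have e1 : ∫ x, W x * φ (x - h) = ∫ x, W (x + h) * φ x := by
    rw [← integral_add_right_eq_self (fun x => W x * φ (x - h)) h]
    simp
  change |∫ x, (W (x + h) - W x) * φ x| = _
  rw [e1, ← integral_sub (integrable_mul_of_memLp (memLp_comp_add hW2 h) hφ2)
    (integrable_mul_of_memLp hW2 hφ2)]
  simp only [sub_mul]

end planeGrad

/-! ### Mollification -/

section mollify

variable {E : Type*} [NormedAddCommGroup E] [InnerProductSpace ℝ E]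

/-- Translations act continuously on `L²`. -/
theorem continuous_integral_inner_translate {F g : Plane → E} (hF : MemLp F 2 volume)
    (hg : MemLp g 2 volume) : Continuous fun h : Plane => ∫ x, inner ℝ (F x) (g (x - h)) := by
  have : Fact ((2 : ℝ≥0∞) ≠ ⊤) := ⟨ENNReal.ofNat_ne_top⟩
  have h1 : Continuous fun h : Plane =>
      (DomAddAct.mk (-h) +ᵥ hg.toLp g : Lp E 2 (volume : Measure Plane)) := by
    exact ((DomAddAct.continuous_mk (M := Plane)).comp continuous_neg).vadd continuous_const
  have h2 : Continuous fun h : Plane => inner ℝ (hF.toLp F)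
      (DomAddAct.mk (-h) +ᵥ hg.toLp g : Lp E 2 (volume : Measure Plane)) :=
    continuous_const.inner h1
  refine h2.congr fun h => ?_
  rw [L2.inner_def]
  refine integral_congr_ae ?_
  filter_upwards [hF.coeFn_toLp, DomAddAct.vadd_Lp_ae_eq (DomAddAct.mk (-h)) (hg.toLp g),
    (measurePreserving_sub_right volume h).quasiMeasurePreserving.ae hg.coeFn_toLp] with x h1 h2 h3
  rw [h1, h2]
  rw [Equiv.symm_apply_apply, vadd_eq_add, neg_add_eq_sub, h3]

theorem integral_inner_mollify {F g : Plane → E} (hF : MemLp F 2 volume)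
    (hg : MemLp g 2 volume) {ρ : Plane → ℝ} (hρ : Continuous ρ) (hc : HasCompactSupport ρ) :
    ∫ x, ∫ t, ρ t * inner ℝ (F x) (g (x - t)) = ∫ t, ρ t * ∫ x, inner ℝ (F x) (g (x - t)) := by
  rw [integral_integral_swap]
  · simp only [integral_const_mul]
  have hmg : AEStronglyMeasurable (fun q : Plane × Plane => g (q.1 - q.2)) (volume.prod volume) :=
    hg.1.comp_quasiMeasurePreserving (quasiMeasurePreserving_sub_of_right_invariant volume volume)
  have hm : AEStronglyMeasurable
      (Function.uncurry fun x t => ρ t * inner ℝ (F x) (g (x - t)))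
      ((volume : Measure Plane).prod volume) :=
    (hρ.comp continuous_snd).aestronglyMeasurable.mul (hF.1.comp_fst.inner hmg)
  rw [integrable_prod_iff' hm]
  have hi : ∀ t, Integrable (fun x => inner ℝ (F x) (g (x - t))) := fun t =>
    (hF.norm.integrable_mul (memLp_comp_sub hg t).norm).mono (hF.1.inner (memLp_comp_sub hg t).1)
      (.of_forall fun x => by simpa using norm_inner_le_norm (𝕜 := ℝ) (F x) (g (x - t)))
  refine ⟨.of_forall fun t => (hi t).const_mul (ρ t), ?_⟩
  have hρi : Integrable ρ := hρ.integrable_of_hasCompactSupport hc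
  refine (hρi.norm.mul_const ((eLpNorm F 2 volume).toReal * (eLpNorm g 2 volume).toReal)).mono
    hm.prod_swap.norm.integral_prod_right' (.of_forall fun t => ?_)
  have h1 : ∫ x, ‖Function.uncurry (fun x t => ρ t * inner ℝ (F x) (g (x - t))) (x, t)‖ =
      ‖ρ t‖ * ∫ x, |inner ℝ (F x) (g (x - t))| := by
    rw [← integral_const_mul]
    exact integral_congr_ae (.of_forall fun x => by
      simp only [Function.uncurry, norm_mul, Real.norm_eq_abs])
  rw [h1, norm_mul, norm_mul, norm_norm]
  refine mul_le_mul_of_nonneg_left ?_ (norm_nonneg _)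
  rw [Real.norm_eq_abs]
  refine (abs_integral_le_eLpNorm_mul hF.norm (memLp_comp_sub hg t).norm
    (.of_forall fun x => ?_)).trans ?_
  · simpa using abs_real_inner_le_norm (F x) (g (x - t))
  · rw [eLpNorm_norm, eLpNorm_norm, eLpNorm_comp_sub hg.1]
    exact le_abs_self _

end mollify

theorem contDiff_mollify {W : Plane → ℝ} (hW : Integrable W) {ρ : Plane → ℝ}
    (hρ : ContDiff ℝ ∞ ρ) (hc : HasCompactSupport ρ) :
    ContDiff ℝ ∞ fun x => ∫ t, ρ t * W (x - t) :=
  hc.contDiff_convolution_left (ContinuousLinearMap.mul ℝ ℝ) hρ hW.locallyIntegrable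

/-- The derivative falls on `ρ`; the weak gradient is then tested with the reflected translate `z ↦
ρ (x - z)`. -/
theorem fderiv_mollify {W : Plane → ℝ} {H : Plane → Plane} (hW : Integrable W)
    (hWH : HasPlaneGrad W H) {ρ : Plane → ℝ}
    (hρ : ContDiff ℝ ∞ ρ) (hc : HasCompactSupport ρ) (x y : Plane) :
    fderiv ℝ (fun x => ∫ t, ρ t * W (x - t)) x y = ∫ t, ρ t * inner ℝ y (H (x - t)) := by
  have h1 : HasFDerivAt (fun x => ∫ t, ρ t * W (x - t)) _ x :=
    hc.hasFDerivAt_convolution_left (ContinuousLinearMap.mul ℝ ℝ)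
      (hρ.of_le (by exact_mod_cast le_top)) hW.locallyIntegrable x
  have hci : Integrable (fun t => (ContinuousLinearMap.precompL Plane (ContinuousLinearMap.mul ℝ ℝ))
      (fderiv ℝ ρ t) (W (x - t))) :=
    (hc.fderiv ℝ).convolutionExists_left _ (hρ.continuous_fderiv (by simp)) hW.locallyIntegrable x
  rw [h1.fderiv, convolution_def, ContinuousLinearMap.integral_apply hci]
  have h2 : ContDiff ℝ ∞ fun z => ρ (x - z) := hρ.comp (contDiff_const.sub contDiff_id)
  have h3 : HasCompactSupport fun z => ρ (x - z) := by
    simpa [Function.comp_def] using hc.comp_homeomorph (Homeomorph.subLeft x)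
  have h4 : ∀ z, fderiv ℝ (fun z => ρ (x - z)) z y = -fderiv ℝ ρ (x - z) y := fun z => by
    have h5 : HasFDerivAt (fun z => x - z) (-ContinuousLinearMap.id ℝ Plane) z :=
      (hasFDerivAt_id z).const_sub x
    have h6 : HasFDerivAt (fun z => ρ (x - z)) _ z :=
      ((hρ.differentiable (by simp)) (x - z)).hasFDerivAt.comp z h5
    rw [h6.fderiv]; simp
  have h := hWH y _ h2 h3
  simp only [h4, mul_neg, integral_neg, neg_inj] at h
  have e1 : ∫ t, fderiv ℝ ρ t y * W (x - t) = ∫ z, W z * fderiv ℝ ρ (x - z) y := by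
    rw [← integral_sub_left_eq_self _ volume x]
    simp [mul_comm]
  have e2 : ∫ t, ρ t * inner ℝ y (H (x - t)) = ∫ z, inner ℝ (H z) y * ρ (x - z) := by
    rw [← integral_sub_left_eq_self _ volume x]
    simp [mul_comm, real_inner_comm]
  rw [e2, ← h, ← e1]
  exact integral_congr_ae (.of_forall fun t => by
    simp [ContinuousLinearMap.precompL_apply])

/-- An identity `∫ ⟨F, ∇Ψ⟩ + ∫ f Ψ = 0` for smooth functions `Ψ` extends to functions with square
integrable weak gradient. -/
theorem integral_inner_add_eq_zero_of_smooth {W f : Plane → ℝ} {H F : Plane → Plane}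
    (hW : Integrable W) (hW2 : MemLp W 2 volume) (hH : MemLp H 2 volume) (hWH : HasPlaneGrad W H)
    (hf : MemLp f 2 volume) (hF : MemLp F 2 volume)
    (hz : ∀ Ψ : Plane → ℝ, ContDiff ℝ ∞ Ψ → (∫ x, fderiv ℝ Ψ x (F x)) + ∫ x, f x * Ψ x = 0) :
    (∫ x, inner ℝ (F x) (H x)) + ∫ x, f x * W x = 0 := by
  have hc1 := continuous_integral_inner_translate hF hH
  have hc0 := continuous_integral_inner_translate hf hW2
  -- The pairing with the translate of `W` by `t`. Applying `hz` to the mollification of `W` by an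
  -- arbitrary `ρ` shows that this function of `t` is orthogonal to all test functions. It is
  -- continuous, so it vanishes at `t = 0`, and no limit of mollifiers is needed.
  have key : (fun t : Plane => (∫ x, inner ℝ (F x) (H (x - t))) + ∫ x, inner ℝ (f x) (W (x - t)))
      =ᵐ[volume] fun _ => 0 := by
    refine ae_eq_zero_of_integral_contDiff_smul_eq_zero (hc1.add hc0).locallyIntegrable
      fun ρ hρ hc => ?_
    have h := hz _ (contDiff_mollify hW hρ hc)
    simp only [fderiv_mollify hW hWH hρ hc] at h
    have h' := integral_inner_mollify hf hW2 hρ.continuous hc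
    have e : ∀ x, f x * ∫ t, ρ t * W (x - t) = ∫ t, ρ t * inner ℝ (f x) (W (x - t)) := fun x => by
      rw [← integral_const_mul]
      exact integral_congr_ae (.of_forall fun t => by simp; ring)
    simp only [e, h', integral_inner_mollify hF hH hρ.continuous hc] at h
    have i1 : Integrable fun t => ρ t * ∫ x, inner ℝ (F x) (H (x - t)) :=
      (hρ.continuous.mul hc1).integrable_of_hasCompactSupport hc.mul_right
    have i0 : Integrable fun t => ρ t * ∫ x, inner ℝ (f x) (W (x - t)) :=
      (hρ.continuous.mul hc0).integrable_of_hasCompactSupport hc.mul_right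
    rw [← integral_add i1 i0] at h
    simpa only [smul_eq_mul, mul_add] using h
  have : (∫ x, inner ℝ (F x) (H (x - 0))) + ∫ x, inner ℝ (f x) (W (x - 0)) = 0 :=
    congrFun ((Continuous.ae_eq_iff_eq volume (hc1.add hc0) continuous_const).1 key) 0
  simp only [sub_zero] at this
  refine Eq.trans ?_ this
  congr 1
  exact integral_congr_ae (.of_forall fun x => by simp [mul_comm])

/-! ### Cut-off functions near the curve -/

/-- Smooth functions with values in `[0, 1]` and Lipschitz constant `K`. -/
structure IsCutoff (K : ℝ) (f : Plane → ℝ) : Prop where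
  contDiff : ContDiff ℝ ∞ f
  nonneg : ∀ x, 0 ≤ f x
  le_one : ∀ x, f x ≤ 1
  lipschitz : ∀ x y, |f x - f y| ≤ K * dist x y

theorem IsCutoff.mul {K K' : ℝ} {f g : Plane → ℝ} (hf : IsCutoff K f) (hg : IsCutoff K' g) :
    IsCutoff (K + K') fun x => f x * g x where
  contDiff := hf.contDiff.mul hg.contDiff
  nonneg x := mul_nonneg (hf.nonneg x) (hg.nonneg x)
  le_one x := mul_le_one₀ (hf.le_one x) (hg.nonneg x) (hg.le_one x)
  lipschitz x y := by
    have h1 : |f x * (g x - g y)| ≤ K' * dist x y := by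
      rw [abs_mul, abs_of_nonneg (hf.nonneg x)]
      exact (mul_le_of_le_one_left (abs_nonneg _) (hf.le_one x)).trans (hg.lipschitz x y)
    have h2 : |(f x - f y) * g y| ≤ K * dist x y := by
      rw [abs_mul, abs_of_nonneg (hg.nonneg y)]
      exact (mul_le_of_le_one_right (abs_nonneg _) (hg.le_one y)).trans (hf.lipschitz x y)
    calc |f x * g x - f y * g y| = |f x * (g x - g y) + (f x - f y) * g y| := by ring_nf
      _ ≤ _ := abs_add_le _ _
      _ ≤ (K + K') * dist x y := by linarith

theorem IsCutoff.one_sub {K : ℝ} {f : Plane → ℝ} (hf : IsCutoff K f) :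
    IsCutoff K fun x => 1 - f x where
  contDiff := contDiff_const.sub hf.contDiff
  nonneg x := sub_nonneg.2 (hf.le_one x)
  le_one x := sub_le_self _ (hf.nonneg x)
  lipschitz x y := by
    rw [sub_sub_sub_cancel_left, abs_sub_comm]
    exact hf.lipschitz x y

theorem exists_lipschitz_smoothTransition :
    ∃ K : ℝ, 0 ≤ K ∧ ∀ s t, |Real.smoothTransition s - Real.smoothTransition t| ≤ K * |s - t| := by
  have hs : ContDiff ℝ ∞ Real.smoothTransition := Real.smoothTransition.contDiff
  obtain ⟨K, hK⟩ := isCompact_Icc.exists_bound_of_continuousOn (s := Icc (0 : ℝ) 1)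
    (hs.continuous_deriv (by simp)).continuousOn
  have hK0 : 0 ≤ K := (norm_nonneg _).trans (hK 0 (by simp))
  refine ⟨K, hK0, fun s t => ?_⟩
  rw [← Real.smoothTransition.projIcc (x := s), ← Real.smoothTransition.projIcc (x := t)]
  refine ((convex_Icc (0 : ℝ) 1).norm_image_sub_le_of_norm_deriv_le
    (fun x _ => (hs.differentiable (by simp)) x) hK (projIcc (0 : ℝ) 1 zero_le_one t).2
    (projIcc (0 : ℝ) 1 zero_le_one s).2).trans ?_
  refine mul_le_mul_of_nonneg_left ?_ hK0
  rw [Real.norm_eq_abs]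
  exact abs_projIcc_sub_projIcc zero_le_one

theorem isCutoff_smoothTransition {K : ℝ} (hK0 : 0 ≤ K)
    (hK : ∀ s t, |Real.smoothTransition s - Real.smoothTransition t| ≤ K * |s - t|)
    {f : Plane → ℝ} (hf : ContDiff ℝ ∞ f) {M : ℝ} (hM : ∀ x y, |f x - f y| ≤ M * dist x y) :
    IsCutoff (K * M) fun x => Real.smoothTransition (f x) where
  contDiff := by
    have hs : ContDiff ℝ ∞ Real.smoothTransition := Real.smoothTransition.contDiff
    exact hs.comp hf
  nonneg x := Real.smoothTransition.nonneg _
  le_one x := Real.smoothTransition.le_one _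
  lipschitz x y := by
    refine (hK _ _).trans ?_
    rw [mul_assoc]
    exact mul_le_mul_of_nonneg_left (hM x y) hK0

/-- A cut-off function vanishing near the side `e`. -/
def sideCutoff (δ : ℝ) (e : Plane × Plane) (x : Plane) : ℝ :=
  1 - Real.smoothTransition (2 + tanCoord e x / δ) *
    Real.smoothTransition (2 + (1 - tanCoord e x) / δ) *
    (Real.smoothTransition (2 + norCoord e x / δ) * Real.smoothTransition (2 - norCoord e x / δ))

/-- A strip around the side `e`. -/
def sideStrip (δ : ℝ) (e : Plane × Plane) : Set Plane :=
  {x | -(2 * δ) < tanCoord e x ∧ tanCoord e x < 1 + 2 * δ ∧ |norCoord e x| < 2 * δ}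

theorem isOpen_sideStrip (δ : ℝ) (e : Plane × Plane) : IsOpen (sideStrip δ e) :=
  (isOpen_lt continuous_const (continuous_tanCoord e)).inter
    ((isOpen_lt (continuous_tanCoord e) continuous_const).inter
      (isOpen_lt (continuous_norCoord e).abs continuous_const))

theorem sideCutoff_eq_one {δ : ℝ} (hδ : 0 < δ) {e : Plane × Plane} {x : Plane}
    (hx : x ∉ sideStrip δ e) : sideCutoff δ e x = 1 := by
  have hdiv : ∀ {t : ℝ}, t ≤ -(2 * δ) → 2 + t / δ ≤ 0 := fun {t} h => by
    have : t / δ ≤ -2 := by rw [div_le_iff₀ hδ]; linarith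
    linarith
  rw [sideCutoff]
  by_cases h1 : -(2 * δ) < tanCoord e x
  · by_cases h2 : tanCoord e x < 1 + 2 * δ
    · have h3 : 2 * δ ≤ |norCoord e x| := not_lt.1 fun h3 => hx ⟨h1, h2, h3⟩
      rcases le_abs.1 h3 with h | h
      · rw [sub_eq_add_neg 2, ← neg_div, Real.smoothTransition.zero_of_nonpos (x := 2 + -_ / δ)
          (hdiv (by linarith))]
        simp
      · rw [Real.smoothTransition.zero_of_nonpos (x := 2 + norCoord e x / δ)
          (hdiv (by linarith))]
        simp
    · rw [Real.smoothTransition.zero_of_nonpos (x := 2 + (1 - _) / δ)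
          (hdiv (by linarith))]
      simp
  · rw [Real.smoothTransition.zero_of_nonpos (x := 2 + tanCoord e x / δ) (hdiv (by linarith))]
    simp

theorem sideCutoff_eq_zero {δ : ℝ} (hδ : 0 < δ) {e : Plane × Plane} {x : Plane}
    (h1 : -δ < tanCoord e x) (h2 : tanCoord e x < 1 + δ) (h3 : |norCoord e x| < δ) :
    sideCutoff δ e x = 0 := by
  have hdiv : ∀ {t : ℝ}, -δ ≤ t → 1 ≤ 2 + t / δ := fun {t} h => by
    have : -1 ≤ t / δ := by rw [le_div_iff₀ hδ]; linarith
    linarith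
  obtain ⟨h4, h5⟩ := abs_lt.1 h3
  rw [sideCutoff, sub_eq_add_neg 2 (_ / δ), ← neg_div,
    Real.smoothTransition.one_of_one_le (hdiv h1.le),
    Real.smoothTransition.one_of_one_le (hdiv h4.le),
    Real.smoothTransition.one_of_one_le (hdiv (by linarith : -δ ≤ 1 - tanCoord e x)),
    Real.smoothTransition.one_of_one_le (hdiv (by linarith : -δ ≤ -norCoord e x))]
  simp

/-- Each factor is a fixed profile evaluated at a coordinate divided by `δ`; the factors have values
in `[0, 1]`, so their Lipschitz constants add. -/
theorem exists_isCutoff_sideCutoff {e : Plane × Plane} (he : e.1 ≠ e.2) :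
    ∃ C, 0 ≤ C ∧ ∀ δ > 0, IsCutoff (C / δ) (sideCutoff δ e) := by
  obtain ⟨K, hK0, hK⟩ := exists_lipschitz_smoothTransition
  have hl := dist_pos.2 he
  refine ⟨K * (2 / dist e.1 e.2) + K * (2 / dist e.1 e.2) +
    (K * (2 / dist e.1 e.2) + K * (2 / dist e.1 e.2)), by positivity, fun δ hδ => ?_⟩
  have ht : ∀ x y, |tanCoord e x - tanCoord e y| ≤ 2 / dist e.1 e.2 * dist x y := fun x y => by
    refine (abs_tanCoord_sub_le he x y).trans ?_
    rw [div_mul_eq_mul_div]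
    gcongr
    linarith [dist_nonneg (x := x) (y := y)]
  have hn : ∀ x y, |norCoord e x - norCoord e y| ≤ 2 / dist e.1 e.2 * dist x y := fun x y => by
    rw [div_mul_eq_mul_div]
    exact abs_norCoord_sub_le he x y
  have hsm := contDiff_tanCoord e
  have hsn := contDiff_norCoord e
  have hd : ∀ {a b : ℝ} {x y : Plane}, |a - b| ≤ 2 / dist e.1 e.2 * dist x y →
      |a / δ - b / δ| ≤ 2 / dist e.1 e.2 / δ * dist x y := fun {a b x y} h => by
    rw [← sub_div, abs_div, abs_of_pos hδ, div_mul_eq_mul_div]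
    gcongr
  have := ((isCutoff_smoothTransition hK0 hK (f := fun x => 2 + tanCoord e x / δ)
      (contDiff_const.add (hsm.div_const δ)) (M := 2 / dist e.1 e.2 / δ) fun x y => by
        rw [add_sub_add_left_eq_sub]; exact hd (ht x y)).mul
    (isCutoff_smoothTransition hK0 hK (f := fun x => 2 + (1 - tanCoord e x) / δ)
      (contDiff_const.add ((contDiff_const.sub hsm).div_const δ)) (M := 2 / dist e.1 e.2 / δ)
      fun x y => by
        rw [add_sub_add_left_eq_sub]
        refine hd ?_
        rw [sub_sub_sub_cancel_left, abs_sub_comm]; exact ht x y)).mul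
    ((isCutoff_smoothTransition hK0 hK (f := fun x => 2 + norCoord e x / δ)
      (contDiff_const.add (hsn.div_const δ)) (M := 2 / dist e.1 e.2 / δ) fun x y => by
        rw [add_sub_add_left_eq_sub]; exact hd (hn x y)).mul
    (isCutoff_smoothTransition hK0 hK (f := fun x => 2 - norCoord e x / δ)
      (contDiff_const.sub (hsn.div_const δ)) (M := 2 / dist e.1 e.2 / δ) fun x y => by
        rw [sub_sub_sub_cancel_left, abs_sub_comm]; exact hd (hn x y)))
  refine (congrArg (fun c => IsCutoff c (sideCutoff δ e)) ?_).mp this.one_sub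
  simp only [add_div, mul_div_assoc]

/-- A cut-off function vanishing near the curve. -/
def curveCutoff (n : ℕ) (δ : ℝ) (x : Plane) : ℝ := ((kochSides n).map (sideCutoff δ · x)).prod

theorem exists_isCutoff_curveCutoff (n : ℕ) :
    ∃ C, 0 ≤ C ∧ ∀ δ > 0, IsCutoff (C / δ) (curveCutoff n δ) := by
  unfold curveCutoff
  have hne : ∀ e ∈ kochSides n, e.1 ≠ e.2 := fun e he => ne_of_mem_kochSides he
  generalize kochSides n = l at hne ⊢
  induction l with
  | nil =>
    refine ⟨0, le_rfl, fun δ _ => ⟨?_, ?_, ?_, ?_⟩⟩ <;> simp [contDiff_const]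
  | cons e l ih =>
    obtain ⟨C, hC0, hC⟩ := ih fun e he => hne e (List.mem_cons_of_mem _ he)
    obtain ⟨D, hD0, hD⟩ := exists_isCutoff_sideCutoff (hne e List.mem_cons_self)
    refine ⟨D + C, by positivity, fun δ hδ => ?_⟩
    simp only [List.map_cons, List.prod_cons]
    rw [add_div]
    exact (hD δ hδ).mul (hC δ hδ)

theorem curveCutoff_eq_one {n : ℕ} {δ : ℝ} (hδ : 0 < δ) {x : Plane}
    (hx : ∀ e ∈ kochSides n, x ∉ sideStrip δ e) : curveCutoff n δ x = 1 :=
  List.prod_eq_one fun a ha => by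
    obtain ⟨e, he, rfl⟩ := List.mem_map.1 ha
    exact sideCutoff_eq_one hδ (hx e he)

theorem eventually_curveCutoff_eq_zero {n : ℕ} {δ : ℝ} (hδ : 0 < δ) {x : Plane}
    (hx : x ∈ kochCurve n) : ∀ᶠ y in 𝓝 x, curveCutoff n δ y = 0 := by
  obtain ⟨e, he, h0, h1, h2⟩ := mem_kochCurve_iff.1 hx
  have ht := (continuous_tanCoord e).continuousAt (x := x)
  have hn := (continuous_norCoord e).abs.continuousAt (x := x)
  filter_upwards [ht.eventually (lt_mem_nhds (by linarith : -δ < tanCoord e x)),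
    ht.eventually (gt_mem_nhds (by linarith : tanCoord e x < 1 + δ)),
    hn.eventually (gt_mem_nhds (by simpa [h0] using hδ))] with y h3 h4 h5
  exact List.prod_eq_zero (List.mem_map.2 ⟨e, he, sideCutoff_eq_zero hδ h3 h4 h5⟩)

/-- Where the cut-off equals `1` it attains its maximum. The argument needs no neighbourhood and so
covers the boundary of the strips. -/
theorem fderiv_curveCutoff_eq_zero {n : ℕ} {δ : ℝ} (hδ : 0 < δ) {x : Plane}
    (hx : ∀ e ∈ kochSides n, x ∉ sideStrip δ e) : fderiv ℝ (curveCutoff n δ) x = 0 := by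
  obtain ⟨C, -, hC⟩ := exists_isCutoff_curveCutoff n
  refine IsLocalMax.fderiv_eq_zero (.of_forall fun y => ?_)
  rw [curveCutoff_eq_one hδ hx]
  exact (hC δ hδ).le_one y

theorem IsCutoff.norm_fderiv_le {K : ℝ} {f : Plane → ℝ} (hK : 0 ≤ K) (hf : IsCutoff K f)
    (x : Plane) : ‖fderiv ℝ f x‖ ≤ K := by
  have h : LipschitzWith K.toNNReal f := LipschitzWith.of_dist_le_mul fun x y => by
    rw [Real.dist_eq, Real.coe_toNNReal _ hK]
    exact hf.lipschitz x y
  simpa [hK] using norm_fderiv_le_of_lipschitz ℝ (x₀ := x) h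

/-- A strip is moved out of the domain by two translations of length proportional to its width. -/
theorem exists_translate_notMem {n : ℕ} {e : Plane × Plane} (he : e ∈ kochSides n) :
    ∃ k₁ k₂ : Plane, ∀ δ : ℝ, 0 < δ → δ < 1 / 32 → ∀ x ∈ sideStrip δ e,
      x + δ • k₁ ∉ kochDomain n ∨ x + δ • k₂ ∉ kochDomain n := by
  have hne := ne_of_mem_kochSides he
  have h3 : Real.sqrt 3 ≠ 0 := by positivity
  -- The normal shift `4δ` brings `norCoord` from `(-2δ, 2δ)` into `(2δ, 6δ)`, the outer side. The
  -- tangential shift `10δ` towards the middle keeps the point in the rhombus: `-2δ + 10δ > 6δ` at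
  -- the near end, and at the far end `1/2 - 10δ > 6δ`, which is `δ < 1/32`. The half of the side
  -- decides the sign.
  refine ⟨(10 : ℝ) • sideDir e + (4 / Real.sqrt 3) • sideNormal e,
    (-10 : ℝ) • sideDir e + (4 / Real.sqrt 3) • sideNormal e, fun δ hδ hδ' x hx => ?_⟩
  obtain ⟨h1, h2, hn⟩ := hx
  obtain ⟨h4, h5⟩ := abs_lt.1 hn
  have key : ∀ c : ℝ, tanCoord e (x + δ • (c • sideDir e + (4 / Real.sqrt 3) • sideNormal e)) =
      tanCoord e x + c * δ ∧
      norCoord e (x + δ • (c • sideDir e + (4 / Real.sqrt 3) • sideNormal e)) =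
      norCoord e x + 4 * δ := fun c => by
    rw [tanCoord_add, norCoord_add]
    simp only [map_add, map_smul, smul_eq_mul, tanLin_sideDir hne, norLin_sideDir,
      tanLin_sideNormal, norLin_sideNormal hne]
    constructor
    · ring
    · field_simp; ring
  have hout : ∀ c : ℝ, norCoord e x + 4 * δ < tanCoord e x + c * δ →
      norCoord e x + 4 * δ < 1 - (tanCoord e x + c * δ) →
      x + δ • (c • sideDir e + (4 / Real.sqrt 3) • sideNormal e) ∉ kochDomain n := by
    intro c h6 h7 hmem
    obtain ⟨k1, k2⟩ := key c
    have hpos : 0 < norCoord e x + 4 * δ := by linarith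
    have := (mem_kochDomain_iff he (by
      rw [rhombus]
      simp only [Set.mem_ofPred_eq]
      rw [k1, k2, abs_of_pos hpos]
      exact ⟨h6, h7⟩)).1 hmem
    linarith
  rcases le_total (tanCoord e x) (1 / 2) with h | h
  · exact .inl (hout 10 (by linarith) (by linarith))
  · exact .inr (hout (-10) (by linarith) (by linarith))

/-! ### Integration by parts against functions with zero trace -/

section zeroTrace

variable {n : ℕ}

/-- Points of the closure outside the domain lie on the curve, near which `χ` vanishes, so
truncation to the domain creates no discontinuity. -/
theorem isTest_indicator_mul {χ Ψ : Plane → ℝ} (hχ : ContDiff ℝ ∞ χ) (hΨ : ContDiff ℝ ∞ Ψ)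
    (h0 : ∀ x ∈ kochCurve n, ∀ᶠ y in 𝓝 x, χ y = 0) :
    IsTest n ((kochDomain n).indicator fun x => χ x * Ψ x) := by
  have hloc : ∀ x, x ∉ kochDomain n → (kochDomain n).indicator (fun x => χ x * Ψ x) =ᶠ[𝓝 x] 0 := by
    intro x hx
    by_cases hx' : x ∈ closure (kochDomain n)
    · filter_upwards [h0 x (frontier_kochDomain_subset hx' hx)] with y hy
      by_cases h : y ∈ kochDomain n <;> simp [h, hy]
    · filter_upwards [isClosed_closure.isOpen_compl.mem_nhds hx'] with y hy
      exact indicator_of_notMem (fun h => hy (subset_closure h)) _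
  refine ⟨contDiff_iff_contDiffAt.2 fun x => ?_, ?_, fun x hx => ?_⟩
  · by_cases hx : x ∈ kochDomain n
    · refine (hχ.mul hΨ).contDiffAt.congr_of_eventuallyEq ?_
      filter_upwards [(isOpen_kochDomain n).mem_nhds hx] with y hy
      exact indicator_of_mem hy _
    · exact (contDiff_const (c := (0 : ℝ))).contDiffAt.congr_of_eventuallyEq (hloc x hx)
  · exact HasCompactSupport.of_support_subset_isCompact
      (isBounded_kochDomain n).isCompact_closure
      (support_indicator_subset.trans subset_closure)
  · by_contra h
    exact notMem_tsupport_iff_eventuallyEq.2 (hloc x h) hx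

theorem aestronglyMeasurable_clm_apply {μ : Measure Plane} {D : Plane → Plane →L[ℝ] ℝ}
    {Y : Plane → Plane} (hD : Continuous D) (hY : AEStronglyMeasurable Y μ) :
    AEStronglyMeasurable (fun x => D x (Y x)) μ :=
  (isBoundedBilinearMap_apply (𝕜 := ℝ) (E := Plane) (F := ℝ)).continuous.comp_aestronglyMeasurable
    (hD.aestronglyMeasurable.prodMk hY)

theorem memLp_indicator {E : Type*} [NormedAddCommGroup E] {f : Plane → E}
    (hf : MemLp f 2 (bulk n)) : MemLp ((kochDomain n).indicator f) 2 volume :=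
  (memLp_indicator_iff_restrict (measurableSet_kochDomain n)).2 hf

/-- The vanishing defect, read as a statement on the whole plane: the zero extension of `w` has as
weak gradient the zero extension of `G`. -/
theorem hasPlaneGrad_indicator {w : Plane → ℝ} {G : Plane → Plane}
    (hz : ∀ (y : Plane) (Φ : Plane → ℝ), ContDiff ℝ ∞ Φ → HasCompactSupport Φ →
      defect n w G y Φ = 0) :
    HasPlaneGrad ((kochDomain n).indicator w) ((kochDomain n).indicator G) := by
  intro y Φ hΦ hc
  have h := eq_neg_of_add_eq_zero_left (hz y Φ hΦ hc)
  rw [bulk, ← integral_indicator (measurableSet_kochDomain n),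
    ← integral_indicator (measurableSet_kochDomain n)] at h
  refine Eq.trans (integral_congr_ae (.of_forall fun x => ?_)) (h.trans
    (congrArg Neg.neg (integral_congr_ae (.of_forall fun x => ?_))))
  all_goals by_cases hx : x ∈ kochDomain n <;> simp [hx]

variable {X G : Plane → Plane} {L w : Plane → ℝ}

/-- For smooth `Ψ` the truncation of `χ Ψ` is a test function in the domain. Hence `χ X`, extended
by zero, has divergence `∇χ·X + χ L` in the whole plane, and mollification allows it to be tested
with the zero extension of `w`. -/
theorem integral_cutoff_add_eq_zero (hX : MemLp X 2 (bulk n)) (hL : MemLp L 2 (bulk n))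
    (hXL : ∀ φ, IsTest n φ → ∫ x, fderiv ℝ φ x (X x) ∂bulk n = -∫ x, L x * φ x ∂bulk n)
    (hw : MemLp w 2 (bulk n)) (hG : MemLp G 2 (bulk n))
    (hz : ∀ (y : Plane) (Φ : Plane → ℝ), ContDiff ℝ ∞ Φ → HasCompactSupport Φ →
      defect n w G y Φ = 0)
    {K : ℝ} (hK : 0 ≤ K) {χ : Plane → ℝ} (hχ : IsCutoff K χ)
    (h0 : ∀ x ∈ kochCurve n, ∀ᶠ y in 𝓝 x, χ y = 0) :
    ∫ x, χ x * inner ℝ (X x) (G x) ∂bulk n + (∫ x, fderiv ℝ χ x (X x) * w x ∂bulk n +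
      ∫ x, χ x * (L x * w x) ∂bulk n) = 0 := by
  have hms := measurableSet_kochDomain n
  have hcd := hχ.contDiff.continuous_fderiv (by simp)
  have hF : MemLp (fun x => χ x • X x) 2 (bulk n) :=
    hX.of_le (hχ.contDiff.continuous.aestronglyMeasurable.smul hX.1) (.of_forall fun x => by
      rw [norm_smul, Real.norm_of_nonneg (hχ.nonneg x)]
      exact mul_le_of_le_one_left (norm_nonneg _) (hχ.le_one x))
  have hf1 : MemLp (fun x => fderiv ℝ χ x (X x)) 2 (bulk n) :=
    hX.of_le_mul (c := K) (aestronglyMeasurable_clm_apply hcd hX.1) (.of_forall fun x =>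
      ((fderiv ℝ χ x).le_opNorm _).trans
        (mul_le_mul_of_nonneg_right (hχ.norm_fderiv_le hK x) (norm_nonneg _)))
  have hf2 : MemLp (fun x => χ x * L x) 2 (bulk n) :=
    hL.of_le (hχ.contDiff.continuous.aestronglyMeasurable.mul hL.1) (.of_forall fun x => by
      rw [norm_mul, Real.norm_of_nonneg (hχ.nonneg x)]
      exact mul_le_of_le_one_left (norm_nonneg _) (hχ.le_one x))
  have hf : MemLp (fun x => fderiv ℝ χ x (X x) + χ x * L x) 2 (bulk n) := hf1.add hf2
  have key := integral_inner_add_eq_zero_of_smooth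
    (W := (kochDomain n).indicator w) (H := (kochDomain n).indicator G)
    (f := (kochDomain n).indicator fun x => fderiv ℝ χ x (X x) + χ x * L x)
    (F := (kochDomain n).indicator fun x => χ x • X x)
    ((integrable_indicator_iff hms).2 (hw.integrable (by norm_num))) (memLp_indicator hw)
    (memLp_indicator hG) (hasPlaneGrad_indicator hz) (memLp_indicator hf) (memLp_indicator hF) ?_
  · have e1 : ∫ x, inner ℝ ((kochDomain n).indicator (fun x => χ x • X x) x)
        ((kochDomain n).indicator G x) = ∫ x, χ x * inner ℝ (X x) (G x) ∂bulk n := by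
      rw [bulk, ← integral_indicator hms]
      refine integral_congr_ae (.of_forall fun x => ?_)
      by_cases hx : x ∈ kochDomain n <;> simp [hx, inner_smul_left]
    have e2 : ∫ x, (kochDomain n).indicator (fun x => fderiv ℝ χ x (X x) + χ x * L x) x *
        (kochDomain n).indicator w x =
        ∫ x, (fderiv ℝ χ x (X x) * w x + χ x * (L x * w x)) ∂bulk n := by
      rw [bulk, ← integral_indicator hms]
      refine integral_congr_ae (.of_forall fun x => ?_)
      by_cases hx : x ∈ kochDomain n <;> simp [hx, add_mul, mul_assoc]
    have i2 : Integrable (fun x => χ x * (L x * w x)) (bulk n) := by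
      simpa only [mul_assoc] using integrable_mul_of_memLp hf2 hw
    rw [e1, e2, integral_add (integrable_mul_of_memLp hf1 hw) i2] at key
    exact key
  · intro Ψ hΨ
    have ht := isTest_indicator_mul hχ.contDiff hΨ h0
    have h := hXL _ ht
    have hd : ∀ x ∈ kochDomain n, fderiv ℝ ((kochDomain n).indicator fun x => χ x * Ψ x) x (X x) =
        fderiv ℝ Ψ x (χ x • X x) + fderiv ℝ χ x (X x) * Ψ x := by
      intro x hx
      have : (kochDomain n).indicator (fun x => χ x * Ψ x) =ᶠ[𝓝 x] fun x => χ x * Ψ x := by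
        filter_upwards [(isOpen_kochDomain n).mem_nhds hx] with y hy
        exact indicator_of_mem hy _
      rw [this.fderiv_eq, fderiv_fun_mul ((hχ.contDiff.differentiable (by simp)) x)
        ((hΨ.differentiable (by simp)) x), add_apply, smul_apply, smul_apply, map_smul]
      simp only [smul_eq_mul]; ring
    obtain ⟨B, hB⟩ := (isBounded_kochDomain n).isCompact_closure.exists_bound_of_continuousOn
      (f := Ψ) hΨ.continuous.continuousOn
    obtain ⟨B', hB'⟩ := (isBounded_kochDomain n).isCompact_closure.exists_bound_of_continuousOn
      (f := fderiv ℝ Ψ) (hΨ.continuous_fderiv (by simp)).continuousOn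
    have i1 : Integrable (fun x => fderiv ℝ Ψ x (χ x • X x)) (bulk n) := by
      refine MemLp.integrable (q := 2) (by norm_num) (hF.of_le_mul (c := B')
        (aestronglyMeasurable_clm_apply (hΨ.continuous_fderiv (by simp)) hF.1) ?_)
      filter_upwards [ae_bulk_mem n] with x hx
      exact ((fderiv ℝ Ψ x).le_opNorm _).trans
        (mul_le_mul_of_nonneg_right (hB' x (subset_closure hx)) (norm_nonneg _))
    have hbΨ : ∀ᵐ x ∂bulk n, ‖Ψ x‖ ≤ B := by
      filter_upwards [ae_bulk_mem n] with x hx using hB x (subset_closure hx)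
    have i2 : Integrable (fun x => fderiv ℝ χ x (X x) * Ψ x) (bulk n) :=
      (hf1.integrable (by norm_num)).mul_bdd hΨ.continuous.aestronglyMeasurable hbΨ
    have i3 : Integrable (fun x => χ x * L x * Ψ x) (bulk n) :=
      (hf2.integrable (by norm_num)).mul_bdd hΨ.continuous.aestronglyMeasurable hbΨ
    have e1 : ∫ x, fderiv ℝ ((kochDomain n).indicator fun x => χ x * Ψ x) x (X x) ∂bulk n =
        ∫ x, fderiv ℝ Ψ x (χ x • X x) ∂bulk n + ∫ x, fderiv ℝ χ x (X x) * Ψ x ∂bulk n := by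
      rw [← integral_add i1 i2]
      refine integral_congr_ae ?_
      filter_upwards [ae_bulk_mem n] with x hx using hd x hx
    have e2 : ∫ x, L x * (kochDomain n).indicator (fun x => χ x * Ψ x) x ∂bulk n =
        ∫ x, χ x * L x * Ψ x ∂bulk n := by
      refine integral_congr_ae ?_
      filter_upwards [ae_bulk_mem n] with x hx
      rw [indicator_of_mem hx]; ring
    have e3 : ∫ x, fderiv ℝ Ψ x ((kochDomain n).indicator (fun x => χ x • X x) x) =
        ∫ x, fderiv ℝ Ψ x (χ x • X x) ∂bulk n := by
      rw [bulk, ← integral_indicator hms]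
      refine integral_congr_ae (.of_forall fun x => ?_)
      by_cases hx : x ∈ kochDomain n <;> simp [hx]
    have e4 : ∫ x, (kochDomain n).indicator (fun x => fderiv ℝ χ x (X x) + χ x * L x) x * Ψ x =
        ∫ x, fderiv ℝ χ x (X x) * Ψ x ∂bulk n + ∫ x, χ x * L x * Ψ x ∂bulk n := by
      rw [← integral_add i2 i3, bulk, ← integral_indicator hms]
      refine integral_congr_ae (.of_forall fun x => ?_)
      by_cases hx : x ∈ kochDomain n <;> simp [hx, add_mul]
    rw [e3, e4]
    rw [e1, e2] at h
    linarith

/-- The union of the strips around the sides. -/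
def curveStrip (n : ℕ) (δ : ℝ) : Set Plane := ⋃ e ∈ kochSides n, sideStrip δ e

theorem measurableSet_curveStrip (δ : ℝ) : MeasurableSet (curveStrip n δ) :=
  (isOpen_biUnion fun _ _ => isOpen_sideStrip δ _).measurableSet

theorem eventually_notMem_curveStrip {x : Plane} (hx : x ∉ kochCurve n) :
    ∀ᶠ δ in 𝓝[>] (0 : ℝ), x ∉ curveStrip n δ := by
  have : ∀ᶠ δ in 𝓝[>] (0 : ℝ), ∀ e ∈ {e | e ∈ kochSides n}, x ∉ sideStrip δ e := by
    rw [Filter.eventually_all_finite (List.finite_toSet _)]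
    intro e he
    have hlim : ∀ a : ℝ, 0 < a → ∀ᶠ δ in 𝓝[>] (0 : ℝ), 2 * δ < a := fun a ha => by
      have : Tendsto (fun δ : ℝ => 2 * δ) (𝓝[>] 0) (𝓝 (2 * 0)) :=
        (continuous_const.mul continuous_id).continuousWithinAt
      exact this.eventually (gt_mem_nhds (by simpa using ha))
    by_cases h0 : norCoord e x = 0
    · by_cases h1 : 0 ≤ tanCoord e x
      · have h2 : 1 < tanCoord e x := not_le.1 fun h2 => hx (mem_kochCurve_iff.2 ⟨e, he, h0, h1, h2⟩)
        filter_upwards [hlim (tanCoord e x - 1) (by linarith)] with δ hδ hm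
        linarith [hm.2.1]
      · filter_upwards [hlim (-tanCoord e x) (by linarith)] with δ hδ hm
        linarith [hm.1]
    · filter_upwards [hlim |norCoord e x| (abs_pos.2 h0)] with δ hδ hm
      linarith [hm.2.2]
  filter_upwards [this] with δ hδ hm
  obtain ⟨e, he, h⟩ := mem_iUnion₂.1 hm
  exact hδ e he h

/-- A Hardy-type bound. On the strip one of two translates of the zero extension `W` vanishes, so
there `|w|` is at most a sum of two differences of `W`, and shifts of length `O(δ)` change `W` by
`O(δ)` in `L²`. -/
theorem exists_eLpNorm_indicator_curveStrip_le (hw : MemLp w 2 (bulk n)) (hG : MemLp G 2 (bulk n))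
    (hz : ∀ (y : Plane) (Φ : Plane → ℝ), ContDiff ℝ ∞ Φ → HasCompactSupport Φ →
      defect n w G y Φ = 0) :
    ∃ M, 0 ≤ M ∧ ∀ δ : ℝ, 0 < δ → δ < 1 / 32 →
      eLpNorm ((curveStrip n δ).indicator w) 2 (bulk n) ≤ ENNReal.ofReal (M * δ) := by
  have hms := measurableSet_kochDomain n
  have hside : ∀ e ∈ kochSides n, ∃ M, 0 ≤ M ∧ ∀ δ : ℝ, 0 < δ → δ < 1 / 32 →
      eLpNorm ((sideStrip δ e).indicator w) 2 (bulk n) ≤ ENNReal.ofReal (M * δ) := by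
    intro e he
    obtain ⟨k₁, k₂, hk⟩ := exists_translate_notMem he
    set W := (kochDomain n).indicator w with hW
    set N := (eLpNorm ((kochDomain n).indicator G) 2 volume).toReal with hN
    have hW2 : MemLp W 2 volume := memLp_indicator hw
    have htr : ∀ h : Plane, eLpNorm (fun x => W (x + h) - W x) 2 volume ≤
        ENNReal.ofReal (‖h‖ * N) := fun h =>
      (ENNReal.le_ofReal_iff_toReal_le (((memLp_comp_add hW2 h).sub hW2).2.ne) (by positivity)).2
        (eLpNorm_translate_sub_le ((integrable_indicator_iff hms).2 (hw.integrable (by norm_num)))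
          hW2 (memLp_indicator hG) (hasPlaneGrad_indicator hz) h)
    refine ⟨(‖k₁‖ + ‖k₂‖) * N, by positivity, fun δ hδ hδ' => ?_⟩
    have hle : ∀ᵐ x ∂bulk n, ‖(sideStrip δ e).indicator w x‖ ≤
        ‖‖W (x + δ • k₁) - W x‖ + ‖W (x + δ • k₂) - W x‖‖ := by
      filter_upwards [ae_bulk_mem n] with x hx
      rw [Real.norm_of_nonneg (r := _ + _) (by positivity)]
      by_cases hs : x ∈ sideStrip δ e
      · have hWx : W x = w x := indicator_of_mem hx _
        rw [indicator_of_mem hs]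
        rcases hk δ hδ hδ' x hs with h | h
        · have : W (x + δ • k₁) = 0 := indicator_of_notMem h _
          rw [this, zero_sub, norm_neg, hWx]
          exact le_add_of_nonneg_right (norm_nonneg _)
        · have : W (x + δ • k₂) = 0 := indicator_of_notMem h _
          rw [this, zero_sub, norm_neg, hWx]
          exact le_add_of_nonneg_left (norm_nonneg _)
      · rw [indicator_of_notMem hs, norm_zero]; positivity
    calc eLpNorm ((sideStrip δ e).indicator w) 2 (bulk n)
        ≤ eLpNorm (fun x => ‖W (x + δ • k₁) - W x‖ + ‖W (x + δ • k₂) - W x‖) 2 (bulk n) :=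
          eLpNorm_mono_ae hle
      _ ≤ eLpNorm (fun x => ‖W (x + δ • k₁) - W x‖ + ‖W (x + δ • k₂) - W x‖) 2 volume :=
          eLpNorm_mono_measure _ Measure.restrict_le_self
      _ ≤ eLpNorm (fun x => ‖W (x + δ • k₁) - W x‖) 2 volume +
          eLpNorm (fun x => ‖W (x + δ • k₂) - W x‖) 2 volume :=
          eLpNorm_add_le ((memLp_comp_add hW2 _).sub hW2).1.norm
            ((memLp_comp_add hW2 _).sub hW2).1.norm (by norm_num)
      _ ≤ ENNReal.ofReal (‖δ • k₁‖ * N) + ENNReal.ofReal (‖δ • k₂‖ * N) := by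
          rw [eLpNorm_norm, eLpNorm_norm]
          exact add_le_add (htr _) (htr _)
      _ = ENNReal.ofReal ((‖k₁‖ + ‖k₂‖) * N * δ) := by
          rw [← ENNReal.ofReal_add (by positivity) (by positivity), norm_smul, norm_smul,
            Real.norm_of_nonneg hδ.le]
          ring_nf
  unfold curveStrip
  generalize kochSides n = l at hside ⊢
  induction l with
  | nil => exact ⟨0, le_rfl, fun δ _ _ => by simp⟩
  | cons e l ih =>
    obtain ⟨M, hM0, hM⟩ := ih fun e he => hside e (List.mem_cons_of_mem _ he)
    obtain ⟨M', hM0', hM'⟩ := hside e List.mem_cons_self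
    refine ⟨M' + M, by positivity, fun δ hδ hδ' => ?_⟩
    set S := ⋃ e ∈ l, sideStrip δ e with hS
    have hSm : MeasurableSet S := (isOpen_biUnion fun _ _ => isOpen_sideStrip δ _).measurableSet
    have heq : (⋃ e' ∈ e :: l, sideStrip δ e') = sideStrip δ e ∪ S := by
      ext x; simp [hS]
    rw [heq, add_mul, ENNReal.ofReal_add (by positivity) (by positivity)]
    refine le_trans ?_ (add_le_add (hM' δ hδ hδ') (hM δ hδ hδ'))
    have h1 : MemLp ((sideStrip δ e).indicator w) 2 (bulk n) :=
      hw.indicator (isOpen_sideStrip δ e).measurableSet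
    have h2 : MemLp (S.indicator w) 2 (bulk n) := hw.indicator hSm
    have h3 := eLpNorm_add_le (p := 2) h1.1.norm h2.1.norm (by norm_num)
    rw [eLpNorm_norm, eLpNorm_norm] at h3
    refine le_trans (eLpNorm_mono fun x => ?_) h3
    change _ ≤ ‖‖(sideStrip δ e).indicator w x‖ + ‖S.indicator w x‖‖
    rw [Real.norm_of_nonneg (r := _ + _) (add_nonneg (norm_nonneg _) (norm_nonneg _))]
    by_cases ha : x ∈ sideStrip δ e
    · rw [indicator_of_mem (mem_union_left S ha), indicator_of_mem ha]
      exact le_add_of_nonneg_right (norm_nonneg _)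
    · by_cases hb : x ∈ S
      · rw [indicator_of_mem (mem_union_right _ hb), indicator_of_mem hb]
        exact le_add_of_nonneg_left (norm_nonneg _)
      · rw [indicator_of_notMem (fun h => h.elim ha hb), norm_zero]
        exact add_nonneg (norm_nonneg _) (norm_nonneg _)


/-- Dominated convergence: each point of the domain is off the curve and leaves the strip for small
`δ`. -/
theorem tendsto_eLpNorm_indicator_curveStrip {E : Type*} [NormedAddCommGroup E] {Y : Plane → E}
    (hY : MemLp Y 2 (bulk n)) :
    Tendsto (fun δ => (eLpNorm ((curveStrip n δ).indicator Y) 2 (bulk n)).toReal) (𝓝[>] 0)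
      (𝓝 0) := by
  have hb : ∫⁻ x, ‖Y x‖ₑ ^ 2 ∂bulk n ≠ ⊤ := by
    rw [← eLpNorm_two_sq]; exact ENNReal.pow_ne_top hY.2.ne
  have h1 : Tendsto (fun δ => ∫⁻ x, ‖(curveStrip n δ).indicator Y x‖ₑ ^ 2 ∂bulk n) (𝓝[>] 0)
      (𝓝 (∫⁻ _, 0 ∂bulk n)) := by
    refine tendsto_lintegral_filter_of_dominated_convergence' (fun x => ‖Y x‖ₑ ^ 2)
      (.of_forall fun δ => ?_) (.of_forall fun δ => .of_forall fun x => ?_) hb ?_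
    · exact ((hY.1.indicator (measurableSet_curveStrip δ)).enorm).pow_const 2
    · gcongr
      by_cases hx : x ∈ curveStrip n δ <;> simp [hx]
    · filter_upwards [ae_bulk_mem n] with x hx
      refine tendsto_const_nhds.congr' ?_
      filter_upwards [eventually_notMem_curveStrip fun h =>
        notMem_kochDomain_of_mem_kochCurve h hx] with δ hδ
      simp [hδ]
  rw [lintegral_zero] at h1
  have h2 := (ENNReal.continuous_rpow_const (y := (1 / 2 : ℝ))).continuousAt.tendsto.comp h1
  rw [ENNReal.zero_rpow_of_pos (by norm_num)] at h2
  have h3 := (ENNReal.tendsto_toReal ENNReal.zero_ne_top).comp h2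
  rw [ENNReal.toReal_zero] at h3
  refine h3.congr fun δ => ?_
  simp only [Function.comp_apply]
  rw [← eLpNorm_two_sq, ← ENNReal.rpow_natCast, ← ENNReal.rpow_mul]
  norm_num

/-- Integration by parts of a square integrable vector field with divergence `L` against a function
in `H¹(Ω)` with zero trace. -/
theorem integral_inner_add_eq_zero_of_trace (hX : MemLp X 2 (bulk n)) (hL : MemLp L 2 (bulk n))
    (hXL : ∀ φ, IsTest n φ → ∫ x, fderiv ℝ φ x (X x) ∂bulk n = -∫ x, L x * φ x ∂bulk n)
    (hw : MemLp w 2 (bulk n)) (hG : MemLp G 2 (bulk n)) (hwG : HasWeakGrad n w G)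
    (ht : HasTrace n w fun _ => 0) :
    ∫ x, inner ℝ (X x) (G x) ∂bulk n + ∫ x, L x * w x ∂bulk n = 0 := by
  have hz := fun y Φ => defect_eq_zero_of_trace hw hG hwG ht y (Φ := Φ)
  obtain ⟨C, hC0, hC⟩ := exists_isCutoff_curveCutoff n
  obtain ⟨M, hM0, hM⟩ := exists_eLpNorm_indicator_curveStrip_le hw hG hz
  have hid : ∀ᶠ δ in 𝓝[>] (0 : ℝ), ∫ x, curveCutoff n δ x * inner ℝ (X x) (G x) ∂bulk n +
      (∫ x, fderiv ℝ (curveCutoff n δ) x (X x) * w x ∂bulk n +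
        ∫ x, curveCutoff n δ x * (L x * w x) ∂bulk n) = 0 := by
    filter_upwards [self_mem_nhdsWithin] with δ hδ
    exact integral_cutoff_add_eq_zero hX hL hXL hw hG hz (div_nonneg hC0 (le_of_lt hδ)) (hC δ hδ)
      fun x hx => eventually_curveCutoff_eq_zero hδ hx
  have hlim : ∀ {k : Plane → ℝ}, Integrable k (bulk n) →
      Tendsto (fun δ => ∫ x, curveCutoff n δ x * k x ∂bulk n) (𝓝[>] 0) (𝓝 (∫ x, k x ∂bulk n)) := by
    intro k hk
    refine tendsto_integral_filter_of_dominated_convergence (fun x => ‖k x‖) ?_ ?_ hk.norm ?_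
    · filter_upwards [self_mem_nhdsWithin] with δ hδ
      exact (hC δ hδ).contDiff.continuous.aestronglyMeasurable.mul hk.1
    · filter_upwards [self_mem_nhdsWithin] with δ hδ
      refine .of_forall fun x => ?_
      rw [norm_mul, Real.norm_of_nonneg ((hC δ hδ).nonneg x)]
      exact mul_le_of_le_one_left (norm_nonneg _) ((hC δ hδ).le_one x)
    · filter_upwards [ae_bulk_mem n] with x hx
      refine tendsto_const_nhds.congr' ?_
      filter_upwards [self_mem_nhdsWithin, eventually_notMem_curveStrip fun h =>
        notMem_kochDomain_of_mem_kochCurve h hx] with δ hδ hδ'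
      rw [curveCutoff_eq_one hδ fun e he h => hδ' (mem_iUnion₂.2 ⟨e, he, h⟩), one_mul]
  -- The gradient of the cut-off is `O(1/δ)` and supported in the strip, where `w` has norm `O(δ)`.
  -- What remains is the norm of `X` on the strip, which tends to zero.
  have h2 : Tendsto (fun δ => ∫ x, fderiv ℝ (curveCutoff n δ) x (X x) * w x ∂bulk n) (𝓝[>] 0)
      (𝓝 0) := by
    have hlim2 := (tendsto_eLpNorm_indicator_curveStrip hX).const_mul (C * M)
    rw [mul_zero] at hlim2
    refine squeeze_zero_norm' ?_ hlim2
    filter_upwards [self_mem_nhdsWithin,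
      nhdsWithin_le_nhds (gt_mem_nhds (by norm_num : (0 : ℝ) < 1 / 32))] with δ hδ hδ'
    have hδ0 : 0 < δ := hδ
    have hms := measurableSet_curveStrip (n := n) δ
    have hw' : MemLp (fun x => C / δ * (curveStrip n δ).indicator w x) 2 (bulk n) :=
      (hw.indicator hms).const_mul _
    have hX' := (hX.indicator hms).norm
    refine (abs_integral_le_eLpNorm_mul hw' hX' (.of_forall fun x => ?_)).trans ?_
    · by_cases hx : x ∈ curveStrip n δ
      · rw [indicator_of_mem hx, indicator_of_mem hx, abs_norm, abs_mul, abs_mul,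
          abs_of_nonneg (by positivity : 0 ≤ C / δ), mul_right_comm]
        exact mul_le_mul_of_nonneg_right (((fderiv ℝ (curveCutoff n δ) x).le_opNorm _).trans
          (mul_le_mul_of_nonneg_right ((hC δ hδ).norm_fderiv_le (by positivity) x)
            (norm_nonneg _))) (abs_nonneg _)
      · rw [fderiv_curveCutoff_eq_zero hδ fun e he h => hx (mem_iUnion₂.2 ⟨e, he, h⟩)]
        simp [hx]
    · rw [eLpNorm_norm]
      refine mul_le_mul_of_nonneg_right ?_ ENNReal.toReal_nonneg
      have e : eLpNorm (fun x => C / δ * (curveStrip n δ).indicator w x) 2 (bulk n) =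
          ‖C / δ‖ₑ * eLpNorm ((curveStrip n δ).indicator w) 2 (bulk n) :=
        eLpNorm_const_smul (C / δ) _ 2 _
      rw [e, ENNReal.toReal_mul, toReal_enorm, Real.norm_of_nonneg (by positivity)]
      have h5 : (eLpNorm ((curveStrip n δ).indicator w) 2 (bulk n)).toReal ≤ M * δ :=
        ENNReal.toReal_le_of_le_ofReal (by positivity) (hM δ hδ0 hδ')
      refine (mul_le_mul_of_nonneg_left h5 (by positivity)).trans (le_of_eq ?_)
      field_simp
  have hfin := (hlim (integrable_inner_of_memLp hX hG)).add
    (h2.add (hlim (integrable_mul_of_memLp hL hw)))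
  have h0 := tendsto_nhds_unique (hfin.congr' hid) tendsto_const_nhds
  simpa using h0

end zeroTrace

/-! ### The Green formula -/

theorem MemH1.weakGrad_ae_eq {n : ℕ} {u : Plane → ℝ} {G : Plane → Plane} (hu : MemLp u 2 (bulk n))
    (hG : MemLp G 2 (bulk n)) (h : HasWeakGrad n u G) : weakGrad n u =ᵐ[bulk n] G := by
  have h1 := hasWeakGrad_weakGrad (n := n) (u := u) ⟨hu, G, hG, h⟩
  exact h1.2.unique h h1.1 hG

theorem HasWeakGrad.add_const_mul {n : ℕ} {u u' : Plane → ℝ} {G G' : Plane → Plane}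
    (h : HasWeakGrad n u G) (h' : HasWeakGrad n u' G') (hu : MemLp u 2 (bulk n))
    (hu' : MemLp u' 2 (bulk n)) (hG : MemLp G 2 (bulk n)) (hG' : MemLp G' 2 (bulk n)) (c : ℝ) :
    HasWeakGrad n (fun x => u x + c * u' x) (fun x => G x + c • G' x) := by
  intro φ hφ y
  have e1 := memLp_fderiv_apply hφ.1 hφ.2.1 (μ := bulk n) y
  have e2 : MemLp φ 2 (bulk n) := hφ.memLp
  have m1 : MemLp (fun x => inner ℝ (G x) y) 2 (bulk n) := hG.inner_const y
  have m2 : MemLp (fun x => inner ℝ (G' x) y) 2 (bulk n) := hG'.inner_const y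
  simp only [add_mul, inner_add_left, inner_smul_left, conj_trivial, mul_assoc]
  rw [integral_add (integrable_mul_of_memLp hu e1) ((integrable_mul_of_memLp hu' e1).const_mul c),
    integral_add (integrable_mul_of_memLp m1 e2) ((integrable_mul_of_memLp m2 e2).const_mul c),
    integral_const_mul, integral_const_mul, h φ hφ y, h' φ hφ y]
  ring

theorem HasTrace.congr {n : ℕ} {u u' g g' : Plane → ℝ} (h : HasTrace n u g)
    (hu : u =ᵐ[bulk n] u') (hg : g =ᵐ[arcLength n] g') : HasTrace n u' g' := by
  filter_upwards [h, hg] with x hx hgx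
  rw [← hgx]
  refine hx.congr fun r => ?_
  refine setAverage_congr_fun (Metric.isOpen_ball.inter (isOpen_kochDomain n)).measurableSet ?_
  filter_upwards [(ae_restrict_iff' (measurableSet_kochDomain n)).1 hu] with y hy hyr
  exact hy hyr.2

theorem HasTrace.add_const_mul {n : ℕ} {u u' g g' : Plane → ℝ} (h : HasTrace n u g)
    (h' : HasTrace n u' g') (hu : MemLp u 2 (bulk n)) (hu' : MemLp u' 2 (bulk n)) (c : ℝ) :
    HasTrace n (fun x => u x + c * u' x) (fun x => g x + c * g' x) := by
  filter_upwards [h, h'] with x hx hx'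
  refine (hx.add (hx'.const_mul c)).congr fun r => ?_
  have hi : ∀ {v : Plane → ℝ}, MemLp v 2 (bulk n) →
      IntegrableOn v (Metric.ball x r ∩ kochDomain n) := fun {v} hv =>
    IntegrableOn.mono_set (hv.integrable (by norm_num)) inter_subset_right
  rw [setAverage_eq, setAverage_eq, setAverage_eq,
    integral_add (hi hu) ((hi hu').const_mul c), integral_const_mul]
  simp only [smul_eq_mul]
  ring

/-- The functional `w ↦ ∫ ⟨X, ∇w⟩ + ∫ L w` on `H¹(Ω)`. -/
def greenForm (n : ℕ) (X : Plane → Plane) (L w : Plane → ℝ) : ℝ :=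
  ∫ x, inner ℝ (X x) (weakGrad n w x) ∂bulk n + ∫ x, L x * w x ∂bulk n

/-- The vector field `X` has the divergence `L` in `Ω`. -/
def HasWeakDiv (n : ℕ) (X : Plane → Plane) (L : Plane → ℝ) : Prop :=
  ∀ φ, IsTest n φ → ∫ x, fderiv ℝ φ x (X x) ∂bulk n = -∫ x, L x * φ x ∂bulk n

section green

variable {n : ℕ} {X : Plane → Plane} {L : Plane → ℝ}

theorem greenForm_eq {w : Plane → ℝ} {G : Plane → Plane} (hw : MemLp w 2 (bulk n))
    (hG : MemLp G 2 (bulk n)) (hwG : HasWeakGrad n w G) :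
    greenForm n X L w = ∫ x, inner ℝ (X x) (G x) ∂bulk n + ∫ x, L x * w x ∂bulk n := by
  rw [greenForm]
  congr 1
  refine integral_congr_ae ?_
  filter_upwards [MemH1.weakGrad_ae_eq hw hG hwG] with x hx
  rw [hx]

theorem MemH1.add_const_mul {w w' : Plane → ℝ} (hw : MemH1 n w) (hw' : MemH1 n w') (c : ℝ) :
    MemH1 n fun x => w x + c * w' x := by
  obtain ⟨h1, h2⟩ := hasWeakGrad_weakGrad hw
  obtain ⟨h1', h2'⟩ := hasWeakGrad_weakGrad hw'
  exact ⟨hw.1.add (hw'.1.const_mul c), _, h1.add (h1'.const_smul c),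
    h2.add_const_mul h2' hw.1 hw'.1 h1 h1' c⟩

theorem greenForm_add_const_mul (hX : MemLp X 2 (bulk n)) (hL : MemLp L 2 (bulk n))
    {w w' : Plane → ℝ} (hw : MemH1 n w) (hw' : MemH1 n w') (c : ℝ) :
    greenForm n X L (fun x => w x + c * w' x) = greenForm n X L w + c * greenForm n X L w' := by
  obtain ⟨h1, h2⟩ := hasWeakGrad_weakGrad hw
  obtain ⟨h1', h2'⟩ := hasWeakGrad_weakGrad hw'
  have m1 : MemLp (fun x => w x + c * w' x) 2 (bulk n) := hw.1.add (hw'.1.const_mul c)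
  have m2 : MemLp (fun x => weakGrad n w x + c • weakGrad n w' x) 2 (bulk n) :=
    h1.add (h1'.const_smul c)
  rw [greenForm_eq m1 m2 (h2.add_const_mul h2' hw.1 hw'.1 h1 h1' c), greenForm, greenForm]
  simp only [inner_add_right, inner_smul_right, mul_add, mul_left_comm _ c]
  rw [integral_add (integrable_inner_of_memLp hX h1)
      ((integrable_inner_of_memLp hX h1').const_mul c),
    integral_add (integrable_mul_of_memLp hL hw.1) ((integrable_mul_of_memLp hL hw'.1).const_mul c),
    integral_const_mul, integral_const_mul]
  ring

/-- The Green functional depends only on the trace. -/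
theorem greenForm_eq_of_trace (hX : MemLp X 2 (bulk n)) (hL : MemLp L 2 (bulk n))
    (hXL : HasWeakDiv n X L) {w w' g g' : Plane → ℝ} (hw : MemH1 n w) (hw' : MemH1 n w')
    (ht : HasTrace n w g) (ht' : HasTrace n w' g') (hg : g =ᵐ[arcLength n] g') :
    greenForm n X L w = greenForm n X L w' := by
  have hm := hw.add_const_mul hw' (-1)
  obtain ⟨h1, h2⟩ := hasWeakGrad_weakGrad hm
  have h0 : HasTrace n (fun x => w x + -1 * w' x) fun _ => 0 :=
    (ht.add_const_mul ht' hw.1 hw'.1 (-1)).congr ae_eq_rfl (by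
      filter_upwards [hg] with x hx
      rw [hx]; ring)
  have h := integral_inner_add_eq_zero_of_trace hX hL hXL hm.1 h1 h2 h0
  have h' := greenForm_add_const_mul hX hL hw hw' (-1)
  rw [greenForm] at h'
  linarith

theorem HHalf.measurable (g : HHalf n) : Measurable (g : Plane → ℝ) :=
  (Lp.stronglyMeasurable _).measurable

theorem HHalf.memLp (g : HHalf n) : MemLp (g : Plane → ℝ) 2 (arcLength n) := Lp.memLp _

theorem HHalf.memLp_diffQuot (g : HHalf n) :
    MemLp (diffQuot (g : Plane → ℝ)) 2 ((arcLength n).prod (arcLength n)) :=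
  mem_hHalfSubmodule.1 (HHalf.toSub n g).2

theorem HHalf.norm_toSub_le (g : HHalf n) : ‖(HHalf.toSub n g : Lp ℝ 2 (arcLength n))‖ ≤ ‖g‖ := by
  have h : ‖g‖ ^ 2 = ‖(HHalf.toSub n g : Lp ℝ 2 (arcLength n))‖ ^ 2 + ‖HHalf.quot n g‖ ^ 2 :=
    WithLp.prod_norm_sq_eq_of_L2 (HHalf.embed n g)
  exact le_of_sq_le_sq (by nlinarith [sq_nonneg ‖HHalf.quot n g‖]) (norm_nonneg g)

theorem HHalf.eLpNorm_le (g : HHalf n) :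
    eLpNorm (g : Plane → ℝ) 2 (arcLength n) ≤ ENNReal.ofReal ‖g‖ := by
  refine (ENNReal.le_ofReal_iff_toReal_le g.memLp.2.ne (norm_nonneg _)).2 ?_
  have := HHalf.norm_toSub_le g
  rwa [Lp.norm_def] at this

theorem HHalf.eLpNorm_diffQuot_le (g : HHalf n) :
    eLpNorm (diffQuot (g : Plane → ℝ)) 2 ((arcLength n).prod (arcLength n)) ≤
      ENNReal.ofReal ‖g‖ := by
  refine (ENNReal.le_ofReal_iff_toReal_le g.memLp_diffQuot.2.ne (norm_nonneg _)).2 ?_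
  have := HHalf.norm_quot_le n g
  rwa [Lp.norm_def, eLpNorm_congr_ae (HHalf.coeFn_quot n g)] at this

theorem HHalf.memH1_ext (g : HHalf n) : MemH1 n (ext n g) :=
  KochVenttsel.memH1_ext g.measurable g.memLp g.memLp_diffQuot

theorem HHalf.hasTrace_ext (g : HHalf n) : HasTrace n (ext n g) g :=
  KochVenttsel.hasTrace_ext g.measurable g.memLp g.memLp_diffQuot

theorem HHalf.coeFn_add (g h : HHalf n) :
    ((g + h : HHalf n) : Plane → ℝ) =ᵐ[arcLength n] fun x => g x + h x :=
  Lp.coeFn_add (HHalf.toSub n g : Lp ℝ 2 (arcLength n)) (HHalf.toSub n h)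

theorem HHalf.coeFn_smul (c : ℝ) (g : HHalf n) :
    ((c • g : HHalf n) : Plane → ℝ) =ᵐ[arcLength n] fun x => c * g x :=
  Lp.coeFn_smul c (HHalf.toSub n g : Lp ℝ 2 (arcLength n))

theorem toReal_eLpNorm_le_of_sq_le {α β E F : Type*} [MeasurableSpace α] [MeasurableSpace β]
    [NormedAddCommGroup E] [NormedAddCommGroup F] {μ : Measure α} {ν : Measure β} {f : α → E}
    {g : β → F} {C : ℝ≥0∞} (hC : C ≠ ⊤) {a : ℝ} (ha : 0 ≤ a)
    (h : ∫⁻ x, ‖f x‖ₑ ^ 2 ∂μ ≤ C * ∫⁻ y, ‖g y‖ₑ ^ 2 ∂ν) (hg : eLpNorm g 2 ν ≤ ENNReal.ofReal a) :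
    (eLpNorm f 2 μ).toReal ≤ √C.toReal * a := by
  have h1 : eLpNorm f 2 μ ^ 2 ≤ C * ENNReal.ofReal a ^ 2 := by
    rw [eLpNorm_two_sq]
    refine h.trans ?_
    rw [← eLpNorm_two_sq]
    gcongr
  have h2 := ENNReal.toReal_mono
    (ENNReal.mul_ne_top hC (ENNReal.pow_ne_top ENNReal.ofReal_ne_top)) h1
  rw [ENNReal.toReal_pow, ENNReal.toReal_mul, ENNReal.toReal_pow, ENNReal.toReal_ofReal ha] at h2
  refine le_of_sq_le_sq ?_ (by positivity)
  rwa [mul_pow, Real.sq_sqrt ENNReal.toReal_nonneg]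

/-- Cauchy-Schwarz and the two bounds for the extension; `ext` is used only to prove existence and
continuity of the functional. -/
theorem exists_greenForm_ext_le (hX : MemLp X 2 (bulk n)) (hL : MemLp L 2 (bulk n)) :
    ∃ C, ∀ g : HHalf n, |greenForm n X L (ext n g)| ≤ C * ‖g‖ := by
  obtain ⟨C₁, hC₁, h₁⟩ := lintegral_ext_sq_le n
  obtain ⟨C₂, hC₂, h₂⟩ := lintegral_fderiv_ext_sq_le n
  refine ⟨(eLpNorm X 2 (bulk n)).toReal * √C₂.toReal + (eLpNorm L 2 (bulk n)).toReal * √C₁.toReal,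
    fun g => ?_⟩
  have hm1 := memLp_ext g.measurable g.memLp
  have hm2 := memLp_gradient_ext g.measurable g.memLp g.memLp_diffQuot
  rw [greenForm_eq hm1 hm2 (hasWeakGrad_ext g.measurable g.memLp g.memLp_diffQuot), add_mul,
    mul_assoc, mul_assoc]
  have hgi : Integrable (g : Plane → ℝ) (arcLength n) := g.memLp.integrable (by norm_num)
  have b1 := toReal_eLpNorm_le_of_sq_le hC₁ (norm_nonneg g) (h₁ g g.measurable hgi) g.eLpNorm_le
  have b2 : (eLpNorm (gradient (ext n g)) 2 (bulk n)).toReal ≤ √C₂.toReal * ‖g‖ := by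
    refine toReal_eLpNorm_le_of_sq_le hC₂ (norm_nonneg g) ?_ g.eLpNorm_diffQuot_le
    refine le_trans (le_of_eq (lintegral_congr fun x => ?_)) (h₂ g g.measurable hgi)
    rw [← ofReal_norm, norm_gradient, ofReal_norm]
  refine (abs_add_le _ _).trans (add_le_add ?_ ?_)
  · refine (abs_integral_le_eLpNorm_mul hX.norm hm2.norm (.of_forall fun x => ?_)).trans ?_
    · simpa using abs_real_inner_le_norm (X x) (gradient (ext n g) x)
    · rw [eLpNorm_norm, eLpNorm_norm]
      exact mul_le_mul_of_nonneg_left b2 ENNReal.toReal_nonneg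
  · refine (abs_integral_le_eLpNorm_mul hL hm1 (.of_forall fun x => (abs_mul _ _).le)).trans ?_
    exact mul_le_mul_of_nonneg_left b1 ENNReal.toReal_nonneg

/-- The normal trace of a square integrable vector field with square integrable divergence. -/
theorem exists_normalTrace (hX : MemLp X 2 (bulk n)) (hL : MemLp L 2 (bulk n))
    (hXL : HasWeakDiv n X L) :
    ∃ N : HNegHalf n, ∀ (w : Plane → ℝ) (g : HHalf n), MemH1 n w → HasTrace n w g →
      N g = greenForm n X L w := by
  obtain ⟨C, hC⟩ := exists_greenForm_ext_le hX hL
  have key : ∀ (w : Plane → ℝ) (g : HHalf n), MemH1 n w → HasTrace n w g →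
      greenForm n X L (ext n g) = greenForm n X L w := fun w g hw ht =>
    greenForm_eq_of_trace hX hL hXL g.memH1_ext hw g.hasTrace_ext ht ae_eq_rfl
  -- Representatives of a sum agree with the sum only almost everywhere. Linearity is therefore
  -- deduced from dependence on the trace alone, not from a pointwise identity for `ext`.
  have hlin : ∀ (g h : HHalf n) (c : ℝ), greenForm n X L (ext n (g + c • h : HHalf n)) =
      greenForm n X L (ext n g) + c * greenForm n X L (ext n h) := fun g h c => by
    rw [← greenForm_add_const_mul hX hL g.memH1_ext h.memH1_ext c]
    refine key _ _ (g.memH1_ext.add_const_mul h.memH1_ext c)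
      ((g.hasTrace_ext.add_const_mul h.hasTrace_ext g.memH1_ext.1 h.memH1_ext.1 c).congr ae_eq_rfl ?_)
    filter_upwards [HHalf.coeFn_add g (c • h), HHalf.coeFn_smul c h] with x h1 h2
    rw [h1, h2]
  refine ⟨LinearMap.mkContinuous
    { toFun := fun g => greenForm n X L (ext n g)
      map_add' := fun g h => by simpa using hlin g h 1
      map_smul' := fun c g => ?_ } C hC, fun w g hw ht => key w g hw ht⟩
  have h0 : greenForm n X L (ext n (0 : HHalf n)) = 0 := by simpa using hlin 0 0 1
  have := hlin 0 g c
  rwa [zero_add, h0, zero_add] at this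

/-- Functions in `L²(K_n)` as elements of `H^{-1/2}(K_n)`. -/
theorem exists_dual_eq_integral {k : Plane → ℝ} (hk : MemLp k 2 (arcLength n)) :
    ∃ Λ : HNegHalf n, ∀ g : HHalf n, Λ g = ∫ x, k x * g x ∂arcLength n := by
  refine ⟨LinearMap.mkContinuous ((innerSL ℝ (hk.toLp k)).toLinearMap ∘ₗ
    ((hHalfSubmodule n).subtype ∘ₗ (HHalf.toSub n).toLinearMap)) ‖hk.toLp k‖ fun g => ?_,
    fun g => ?_⟩
  · exact (norm_inner_le_norm (hk.toLp k) (HHalf.toSub n g : Lp ℝ 2 (arcLength n))).trans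
      (mul_le_mul_of_nonneg_left g.norm_toSub_le (norm_nonneg _))
  · change inner ℝ (hk.toLp k) (HHalf.toSub n g : Lp ℝ 2 (arcLength n)) = _
    rw [L2.inner_def]
    refine integral_congr_ae ?_
    filter_upwards [hk.coeFn_toLp] with x hx
    rw [hx]; simp [mul_comm]

end green

/-! ### Testing the energy form -/

theorem memLp_add_measure {μ ν : Measure Plane} {v : Plane → ℝ} (h : MemLp v 2 μ)
    (h' : MemLp v 2 ν) : MemLp v 2 (μ + ν) := by
  have hm : AEStronglyMeasurable v (μ + ν) := h.1.add_measure h'.1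
  rw [memLp_two_iff_lintegral hm, lintegral_add_measure]
  exact ENNReal.add_lt_top.2
    ⟨(memLp_two_iff_lintegral h.1).1 h, (memLp_two_iff_lintegral h'.1).1 h'⟩

/-- A function in `H¹(Ω)` with trace in `H¹(K_n)` gives an element of `V(Ω, K_n)`. -/
theorem exists_memV {n : ℕ} {v g : Plane → ℝ} (hv : MemH1 n v) (ht : HasTrace n v g)
    (hg : MemH1K n g) :
    ∃ z : L2m n, MemV n z ∧ (z : Plane → ℝ) =ᵐ[bulk n] v ∧ (z : Plane → ℝ) =ᵐ[arcLength n] g := by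
  -- The curve is disjoint from the open domain, so values can be prescribed independently: `v` for
  -- `dx` and `g` for `ds`.
  set y : Plane → ℝ := (kochDomain n).indicator v + (kochDomain n)ᶜ.indicator g with hy
  have e1 : v =ᵐ[bulk n] y := by
    filter_upwards [ae_bulk_mem n] with x hx
    simp [hy, hx]
  have e2 : g =ᵐ[arcLength n] y := by
    filter_upwards [ae_mem_kochCurve n] with x hx
    simp [hy, notMem_kochDomain_of_mem_kochCurve hx]
  have hm : MemLp y 2 (mMeasure n) := memLp_add_measure ((memLp_congr_ae e1).1 hv.1)
    ((memLp_congr_ae e2).1 (memLp_arcLength_of_memH1K hg))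
  obtain ⟨h1, h2⟩ := ae_mMeasure.1 hm.coeFn_toLp
  have h1' : v =ᵐ[bulk n] hm.toLp y := e1.trans (EventuallyEq.symm h1)
  have h2' : g =ᵐ[arcLength n] hm.toLp y := e2.trans (EventuallyEq.symm h2)
  exact ⟨hm.toLp y, ⟨hv.congr h1', (ht.congr h1' h2'), hg.congr h2'⟩, h1'.symm, h2'.symm⟩

theorem MemH1.weakGrad_congr {n : ℕ} {u v : Plane → ℝ} (hv : MemH1 n v) (h : u =ᵐ[bulk n] v) :
    weakGrad n u =ᵐ[bulk n] weakGrad n v := by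
  obtain ⟨h1, h2⟩ := hasWeakGrad_weakGrad hv
  exact MemH1.weakGrad_ae_eq ((memLp_congr_ae h).2 hv.1) h1 (h2.congr h.symm)

theorem MemH1K.tangentialDeriv_congr {n : ℕ} {u v : Plane → ℝ} (hv : MemH1K n v)
    (h : u =ᵐ[arcLength n] v) : tangentialDeriv n u =ᵐ[arcLength n] tangentialDeriv n v := by
  obtain ⟨h1, h2⟩ := hasTangentialDeriv_tangentialDeriv hv
  obtain ⟨h1', h2'⟩ := hasTangentialDeriv_tangentialDeriv (hv.congr h.symm)
  exact h2'.unique (h2.congr h.symm) h1' h1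

theorem nonlocalForm_congr {n : ℕ} {u u' v v' : Plane → ℝ} (hu : u =ᵐ[arcLength n] u')
    (hv : v =ᵐ[arcLength n] v') : nonlocalForm n u v = nonlocalForm n u' v' := by
  refine integral_congr_ae ?_
  filter_upwards [Measure.quasiMeasurePreserving_fst.ae hu,
    Measure.quasiMeasurePreserving_snd.ae hu, Measure.quasiMeasurePreserving_fst.ae hv,
    Measure.quasiMeasurePreserving_snd.ae hv] with p h1 h2 h3 h4
  rw [h1, h2, h3, h4]

theorem inner_neg_L2m {n : ℕ} (a z : L2m n) : inner ℝ (-a) z =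
    -(∫ x, a x * z x ∂bulk n + ∫ x, a x * z x ∂arcLength n) := by
  rw [inner_neg_left, L2.inner_def]
  have h : Integrable (fun x => a x * z x) (mMeasure n) :=
    integrable_mul_of_memLp (Lp.memLp a) (Lp.memLp z)
  rw [← integral_add_measure (h.mono_measure (bulk_le n)) (h.mono_measure (arcLength_le n))]
  refine congrArg Neg.neg (integral_congr_ae (.of_forall fun x => ?_))
  simp [mul_comm]

/-- The equation `A u = a`, tested with a function in `H¹(Ω)` with trace in `H¹(K_n)`. -/
theorem energy_test {n : ℕ} {b : Plane → ℝ} {U a : L2m n}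
    (hE : ∀ z : L2m n, MemV n z → energy n b U z = inner ℝ (-a) z) {v g : Plane → ℝ}
    (hv : MemH1 n v) (ht : HasTrace n v g) (hg : MemH1K n g) :
    ∫ x, inner ℝ (weakGrad n U x) (weakGrad n v x) ∂bulk n
      + ∫ x, tangentialDeriv n U x * tangentialDeriv n g x ∂arcLength n
      + ∫ x, b x * U x * g x ∂arcLength n + nonlocalForm n U g =
    -(∫ x, a x * v x ∂bulk n + ∫ x, a x * g x ∂arcLength n) := by
  obtain ⟨z, hz, h1, h2⟩ := exists_memV hv ht hg
  have h := hE z hz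
  rw [inner_neg_L2m, energy] at h
  convert h using 2
  · congr 1
    · congr 1
      · refine integral_congr_ae ?_
        filter_upwards [hv.weakGrad_congr h1] with x hx
        rw [hx]
      · refine integral_congr_ae ?_
        filter_upwards [hg.tangentialDeriv_congr h2] with x hx
        rw [hx]
    · refine integral_congr_ae ?_
      filter_upwards [h2] with x hx
      rw [hx]
  · exact nonlocalForm_congr ae_eq_rfl h2.symm
  · congr 1
    · refine integral_congr_ae ?_
      filter_upwards [h1] with x hx
      rw [hx]
    · refine integral_congr_ae ?_
      filter_upwards [h2] with x hx
      rw [hx]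

/-! ### The equation in the interior -/

section test

variable {n : ℕ} {φ : Plane → ℝ}

theorem IsTest.memLp_gradient (h : IsTest n φ) : MemLp (gradient φ) 2 (bulk n) := by
  have h1 : Continuous (gradient φ) := (InnerProductSpace.toDual ℝ Plane).symm.continuous.comp
    (h.1.continuous_fderiv (by simp))
  refine h1.memLp_of_hasCompactSupport ?_
  exact (h.2.1.fderiv ℝ).comp_left (map_zero (InnerProductSpace.toDual ℝ Plane).symm)

theorem IsTest.hasWeakGrad (h : IsTest n φ) : HasWeakGrad n φ (gradient φ) :=
  hasWeakGrad_gradient (fun x _ => (h.1.differentiable (by simp)) x) h.memLp h.memLp_gradient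

theorem IsTest.memH1 (h : IsTest n φ) : MemH1 n φ := ⟨h.memLp, _, h.memLp_gradient, h.hasWeakGrad⟩

theorem IsTest.hasTrace (h : IsTest n φ) : HasTrace n φ fun _ => 0 := by
  filter_upwards [ae_mem_kochCurve n] with x hx
  have hx' : x ∉ tsupport φ := fun h' => notMem_kochDomain_of_mem_kochCurve hx (h.2.2 h')
  obtain ⟨ε, hε, hball⟩ := Metric.mem_nhds_iff.1 ((isClosed_tsupport φ).isOpen_compl.mem_nhds hx')
  refine tendsto_const_nhds.congr' ?_
  filter_upwards [Ioo_mem_nhdsGT hε] with r hr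
  rw [setAverage_eq, setIntegral_eq_zero_of_forall_eq_zero, smul_zero]
  intro y hy
  exact image_eq_zero_of_notMem_tsupport (hball (Metric.ball_subset_ball hr.2.le hy.1))

theorem memH1K_zero (n : ℕ) : MemH1K n fun _ => 0 :=
  ⟨⟨_, continuousOn_const, ae_eq_rfl⟩, fun _ => 0, MemLp.zero, fun e _ φ _ _ _ => by simp⟩

theorem IsTest.fderiv_apply (h : IsTest n φ) (y : Plane) : IsTest n fun x => fderiv ℝ φ x y :=
  ⟨(h.1.fderiv_right (by simp)).clm_apply contDiff_const, h.2.1.fderiv_apply ℝ y,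
    (tsupport_fderiv_apply_subset ℝ y).trans h.2.2⟩

/-- A test function has zero trace, so every term on the curve drops out of the energy identity. -/
theorem hasWeakDiv_of_energy {b : Plane → ℝ} {U a : L2m n}
    (hE : ∀ z : L2m n, MemV n z → energy n b U z = inner ℝ (-a) z) :
    HasWeakDiv n (weakGrad n U) a := by
  intro φ hφ
  have h := energy_test hE hφ.memH1 hφ.hasTrace (memH1K_zero n)
  have h0 : tangentialDeriv n (fun _ => 0) =ᵐ[arcLength n] fun _ => 0 := by
    obtain ⟨h1, h2⟩ := hasTangentialDeriv_tangentialDeriv (memH1K_zero n)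
    exact h2.unique (fun e _ φ _ _ _ => by simp) h1 MemLp.zero
  have e1 : ∫ x, tangentialDeriv n U x * tangentialDeriv n (fun _ => 0) x ∂arcLength n = 0 := by
    refine integral_eq_zero_of_ae ?_
    filter_upwards [h0] with x hx
    rw [hx]; simp
  have e2 : nonlocalForm n U (fun _ => 0) = 0 := by simp [nonlocalForm]
  have e3 : ∫ x, inner ℝ (weakGrad n U x) (weakGrad n φ x) ∂bulk n =
      ∫ x, fderiv ℝ φ x (weakGrad n U x) ∂bulk n := by
    refine integral_congr_ae ?_
    filter_upwards [MemH1.weakGrad_ae_eq hφ.memLp hφ.memLp_gradient hφ.hasWeakGrad] with x hx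
    rw [hx, real_inner_comm, gradient, InnerProductSpace.toDual_symm_apply]
  rw [e1, e2, e3] at h
  simpa using h

/-- The partial derivatives of a test function are test functions; applying the weak gradient to
each of them and summing moves one derivative onto `u`. -/
theorem hasWeakLaplacian_of_hasWeakDiv {u L : Plane → ℝ} (hu : MemH1 n u)
    (h : HasWeakDiv n (weakGrad n u) L) : HasWeakLaplacian n u L := by
  intro φ hφ
  obtain ⟨hm, hw⟩ := hasWeakGrad_weakGrad hu
  set B := EuclideanSpace.basisFun (Fin 2) ℝ with hB
  have hlap : ∀ x, Laplacian.laplacian φ x =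
      ∑ i, fderiv ℝ (fun x => fderiv ℝ φ x (B i)) x (B i) := fun x => by
    rw [InnerProductSpace.laplacian_eq_iteratedFDeriv_orthonormalBasis φ B]
    refine Finset.sum_congr rfl fun i _ => ?_
    rw [iteratedFDeriv_two_apply]
    have hd : DifferentiableAt ℝ (fderiv ℝ φ) x :=
      ((hφ.1.fderiv_right (m := ∞) (by simp)).differentiable (by simp)) x
    rw [fderiv_clm_apply hd (differentiableAt_const _)]
    simp
  have hi : ∀ i, ∫ x, u x * fderiv ℝ (fun x => fderiv ℝ φ x (B i)) x (B i) ∂bulk n =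
      -∫ x, inner ℝ (weakGrad n u x) (B i) * fderiv ℝ φ x (B i) ∂bulk n := fun i =>
    hw _ (hφ.fderiv_apply (B i)) (B i)
  simp only [hlap, Finset.mul_sum]
  rw [integral_finsetSum _ fun i _ => integrable_mul_of_memLp hu.1
    (memLp_fderiv_apply (hφ.fderiv_apply (B i)).1 (hφ.fderiv_apply (B i)).2.1 (B i))]
  simp only [hi]
  rw [Finset.sum_neg_distrib, ← integral_finsetSum _ fun i _ => integrable_mul_of_memLp
    (hm.inner_const (𝕜 := ℝ) (B i)) (memLp_fderiv_apply hφ.1 hφ.2.1 (B i)),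
    ← neg_eq_iff_eq_neg.2 (h φ hφ)]
  refine congrArg Neg.neg (integral_congr_ae (.of_forall fun x => ?_))
  have hx : weakGrad n u x = ∑ i, inner ℝ (weakGrad n u x) (B i) • B i := by
    conv_lhs => rw [← B.sum_repr (weakGrad n u x)]
    simp only [B.repr_apply_apply, real_inner_comm]
  change _ = fderiv ℝ φ x (weakGrad n u x)
  conv_rhs => rw [hx, map_sum]
  simp only [map_smul, smul_eq_mul]

end test

/-! ### The Venttsel' boundary condition -/

/-- The curve is a compact subset of the closure of the domain, so `b` is bounded on it. -/
theorem memLp_mul_of_continuousOn {n : ℕ} {b k : Plane → ℝ}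
    (hb : ContinuousOn b (closure (kochDomain n))) (hk : MemLp k 2 (arcLength n)) :
    MemLp (fun x => b x * k x) 2 (arcLength n) := by
  have hb' := hb.mono (kochCurve_subset_closure n)
  obtain ⟨S, hS⟩ := (isCompact_kochCurve n).exists_bound_of_continuousOn hb'
  have hres : arcLength n = (arcLength n).restrict (kochCurve n) :=
    (Measure.restrict_eq_self_of_ae_mem (ae_mem_kochCurve n)).symm
  have hm : AEStronglyMeasurable b (arcLength n) := by
    rw [hres]
    exact hb'.aestronglyMeasurable (isCompact_kochCurve n).measurableSet
  refine hk.of_le_mul (c := S) (hm.mul hk.1) ?_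
  filter_upwards [ae_mem_kochCurve n] with x hx
  rw [norm_mul]
  exact mul_le_mul_of_nonneg_right (hS x hx) (norm_nonneg _)

theorem exists_hHalf_of_memH1K {n : ℕ} {u : Plane → ℝ} (hu : MemH1K n u) :
    ∃ g : HHalf n, (g : Plane → ℝ) =ᵐ[arcLength n] u := by
  have hm := memLp_arcLength_of_memH1K hu
  exact ⟨(HHalf.toSub n).symm ⟨hm.toLp u, (memLp_congr_ae (diffQuot_congr hm.coeFn_toLp)).2
    (memLp_diffQuot_of_memH1K hu)⟩, hm.coeFn_toLp⟩

/-- The boundary value problem solved by the elements of `D(A)`. -/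
theorem exists_normalDeriv_curveLaplacian {n : ℕ} {b : Plane → ℝ}
    (hb : ContinuousOn b (closure (kochDomain n))) {U a : L2m n} (hU : MemV n U)
    (hE : ∀ z : L2m n, MemV n z → energy n b U z = inner ℝ (-a) z) :
    HasWeakLaplacian n U a ∧ ∃ (g : HHalf n) (N D : HNegHalf n),
      (∀ᵐ x ∂arcLength n, g x = U x) ∧ HasTrace n U g ∧ IsNormalDeriv n U N ∧
      IsCurveLaplacian n g D ∧ ∀ v : HHalf n, ∫ x, a x * v x ∂arcLength n =
        -N v + D v - ∫ x, b x * g x * v x ∂arcLength n - theta₂ n g v := by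
  obtain ⟨hU1, hUt, hUK⟩ := hU
  have hdiv := hasWeakDiv_of_energy hE
  have hlap := hasWeakLaplacian_of_hasWeakDiv hU1 hdiv
  have ha : MemLp a 2 (bulk n) := (Lp.memLp a).mono_measure (bulk_le n)
  have ha' : MemLp a 2 (arcLength n) := (Lp.memLp a).mono_measure (arcLength_le n)
  obtain ⟨N, hN⟩ := exists_normalTrace (hasWeakGrad_weakGrad hU1).1 ha hdiv
  obtain ⟨g, hg⟩ := exists_hHalf_of_memH1K hUK
  have hgK : MemH1K n g := hUK.congr hg.symm
  obtain ⟨Λa, hΛa⟩ := exists_dual_eq_integral ha'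
  obtain ⟨Λb, hΛb⟩ := exists_dual_eq_integral (memLp_mul_of_continuousOn hb g.memLp)
  -- The candidate for the curve Laplacian is the boundary equation solved for it. It is bounded on
  -- `H^{1/2}(K_n)` by construction, so only its values on `H¹(K_n)` have to be identified.
  refine ⟨hlap, g, N, Λa + N + Λb + theta₂ n g, hg, hUt.congr ae_eq_rfl hg.symm,
    ⟨hU1, a, ha, hlap, hN⟩, ⟨hgK, fun w hw => ?_⟩, fun v => ?_⟩
  -- Testing with the extension of `w`: the two integrals over the domain combine to `N w`, and what
  -- is left on the curve is the asserted formula.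
  · have h := energy_test hE w.memH1_ext w.hasTrace_ext hw
    have e1 : ∫ x, tangentialDeriv n U x * tangentialDeriv n w x ∂arcLength n =
        ∫ x, tangentialDeriv n g x * tangentialDeriv n w x ∂arcLength n := by
      refine integral_congr_ae ?_
      filter_upwards [hUK.tangentialDeriv_congr hg] with x hx
      rw [hx]
    have e2 : ∫ x, b x * U x * w x ∂arcLength n = ∫ x, b x * g x * w x ∂arcLength n := by
      refine integral_congr_ae ?_
      filter_upwards [hg] with x hx
      rw [hx]
    rw [e1, e2, nonlocalForm_congr hg.symm ae_eq_rfl] at h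
    simp only [add_apply, hΛa, hΛb, hN _ w w.memH1_ext w.hasTrace_ext, greenForm, theta₂_apply]
    linarith
  · simp only [add_apply, hΛa, hΛb]
    ring

theorem opA_spec {n : ℕ} {b : Plane → ℝ} {U : L2m n} (hU : MemDomA n b U) (z : L2m n)
    (hz : MemV n z) : energy n b U z = inner ℝ (-opA n b U) z := by
  have h := hU.2
  rw [opA, dif_pos h]
  exact h.choose_spec z hz

end KochVenttsel

end

/-! ### The evolution problem at a fixed time -/

theorem mainTheorem9 (n : ℕ) (b : KochVenttsel.Plane → ℝ)
    (hb : ContinuousOn b (closure (KochVenttsel.kochDomain n)))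
    (hb_pos : ∀ x ∈ closure (KochVenttsel.kochDomain n), 0 < b x)
    (T : ℝ) (hT : 0 < T) (α : ℝ≥0) (hα₀ : 0 < α) (hα₁ : α < 1)
    (f : ℝ → KochVenttsel.L2m n) (hf : ∃ C : ℝ≥0, HolderOnWith C α f (Set.Icc 0 T))
    (u₀ : KochVenttsel.L2m n) (hu₀ : KochVenttsel.MemDomA n b u₀)
    (u : ℝ → KochVenttsel.L2m n) (hu : KochVenttsel.IsStrictSolution n b T f u₀ u) :
    (∀ t ∈ Set.Icc 0 T,
      -- the heat equation, almost everywhere in the domain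
      (∃ L : KochVenttsel.Plane → ℝ, MemLp L 2 (KochVenttsel.bulk n) ∧
        KochVenttsel.HasWeakLaplacian n (u t) L ∧
        ∀ᵐ x ∂KochVenttsel.bulk n, derivWithin u (Set.Icc 0 T) t x = L x + f t x) ∧
      -- the dynamical boundary condition, as an identity of functionals on `H^{1/2}(K_n)`
      (∃ (g : KochVenttsel.HHalf n) (N D : KochVenttsel.HNegHalf n),
        (∀ᵐ x ∂KochVenttsel.arcLength n, g x = u t x) ∧
        KochVenttsel.HasTrace n (u t) g ∧
        KochVenttsel.IsNormalDeriv n (u t) N ∧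
        KochVenttsel.IsCurveLaplacian n g D ∧
        ∀ v : KochVenttsel.HHalf n,
          ∫ x, derivWithin u (Set.Icc 0 T) t x * v x ∂KochVenttsel.arcLength n =
            -N v + D v - ∫ x, b x * g x * v x ∂KochVenttsel.arcLength n
              - KochVenttsel.theta₂ n g v + ∫ x, f t x * v x ∂KochVenttsel.arcLength n)) ∧
    -- the initial condition
    (∀ᵐ x ∂KochVenttsel.mMeasure n, u 0 x = u₀ x) := by
  refine ⟨fun t ht => ?_, by rw [hu.initial]; exact .of_forall fun _ => rfl⟩
  have hdom := hu.mem_domA t ht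
  set U' := derivWithin u (Set.Icc 0 T) t with hU'
  -- The equation in `L²(Ω, m)`. The stationary result with `a = opA n b (u t)` is applied at this
  -- `t`, endpoints included since the derivative is taken within the interval.
  have heq : U' = KochVenttsel.opA n b (u t) + f t := hu.equation t ht
  obtain ⟨hlap, g, N, D, hg, htr, hN, hD, hid⟩ :=
    KochVenttsel.exists_normalDeriv_curveLaplacian hb hdom.1 (KochVenttsel.opA_spec hdom)
  -- One identity `m`-almost everywhere contains both equations: its restriction to `dx` is the heat
  -- equation, its restriction to `ds` the boundary condition.
  have hsum : ∀ᵐ x ∂KochVenttsel.mMeasure n,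
      U' x = KochVenttsel.opA n b (u t) x + f t x := by
    rw [heq]; exact Lp.coeFn_add _ _
  obtain ⟨h1, h2⟩ := KochVenttsel.ae_mMeasure.1 hsum
  refine ⟨⟨KochVenttsel.opA n b (u t),
    (Lp.memLp _).mono_measure (KochVenttsel.bulk_le n), hlap, h1⟩,
    g, N, D, hg, htr, hN, hD, fun v => ?_⟩
  have e : ∫ x, U' x * v x ∂KochVenttsel.arcLength n =
      ∫ x, KochVenttsel.opA n b (u t) x * v x ∂KochVenttsel.arcLength n +
        ∫ x, f t x * v x ∂KochVenttsel.arcLength n := by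
    rw [← integral_add
      (KochVenttsel.integrable_mul_of_memLp
        ((Lp.memLp _).mono_measure (KochVenttsel.arcLength_le n)) v.memLp)
      (KochVenttsel.integrable_mul_of_memLp
        ((Lp.memLp _).mono_measure (KochVenttsel.arcLength_le n)) v.memLp)]
    refine integral_congr_ae ?_
    filter_upwards [h2] with x hx
    rw [hx, add_mul]
  rw [e, hid v]
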